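/- Fix $\kappa\in(0,\infty)$. For a pair $\mathbf u=(u,v)$ of complex-valued functions on $\mathbb R\times\mathbb R^6$ put $A\mathbf u=(\Delta u,\kappa\Delta v)$ and $\mathbf f(\mathbf u)=(v\bar u,u^2)$, let $S(t)=\mathrm{diag}(e^{it\Delta},e^{i\kappa t\Delta})$, and let $\dot{\mathrm H}^1=\dot H^1(\mathbb R^6)\times\dot H^1(\mathbb R^6)$, $\mathrm L^p=L^p(\mathbb R^6)\times L^p(\mathbb R^6)$. For $s\in\{0,1\}$ let $\Lambda_s$ be the set of pairs $(q,r)$ of exponents in $[1,\infty]$ with $q\ge 2$ and $\frac2q=6\left(\frac12-\frac1r\right)-s$. Define, over the whole time axis, $$\|\mathbf u\|_{\mathcal S(\dot{\mathrm H}^1)}=\max\Big\{\sup_{(q,r)\in\Lambda_1}\|\mathbf u\|_{L^q_t\mathrm L^r_x},\ \sup_{(q,r)\in\Lambda_0}\|\nabla\mathbf u\|_{L^q_t\mathrm L^r_x}\Big\},\qquad \|\mathbf g\|_{\mathcal S'(\mathrm L^2)}=\inf_{(q,r)\in\Lambda_0}\|\mathbf g\|_{L^{q'}_t\mathrm L^{r'}_x},$$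 where $q',r'$ are the Hölder conjugate exponents. **Proposition 2.1 (Long time perturbation theory).** For each $M\ge 0$ there exist $\varepsilon=\varepsilon(\kappa,M)\in(0,1)$ and $L=L(\kappa,M)\in(1,\infty)$ such that the following holds. Let $t_0\in\mathbb R$. Let $\mathbf u\in C(\mathbb R;\dot{\mathrm H}^1)$, with $\mathbf u\in L^4(I\times\mathbb R^6)$ for every bounded interval $I$, solve $i\mathbf u_t+A\mathbf u+\mathbf f(\mathbf u)=0$ on $\mathbb R$ in the sense of the Duhamel formula $$\mathbf u(t)=S(t)\mathbf u(0)+i\int_0^tS(t-\tau)\mathbf f(\mathbf u(\tau))\,d\tau,\qquad t\in\mathbb R.$$ Let $\tilde{\mathbf u}\in C(\mathbb R;\dot{\mathrm H}^1)$, and define $\mathbf e:=i\tilde{\mathbf u}_t+A\tilde{\mathbf u}+\mathbf f(\tilde{\mathbf u})$ as a distribution on $\mathbb R\times\mathbb R^6$. If $$\|\tilde{\mathbf u}\|_{\mathcal S(\dot{\mathrm H}^1)}\le M,\qquad \|\nabla\mathbf e\|_{\mathcal S'(\mathrm L^2)}\le\varepsilon,\qquad \|S(t-t_0)(\mathbf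 u(t_0)-\tilde{\mathbf u}(t_0))\|_{\mathcal S(\dot{\mathrm H}^1)}\le\varepsilon,$$ then $$\|\mathbf u\|_{\mathcal S(\dot{\mathrm H}^1)}\le L.$$ -/

import Mathlib

open MeasureTheory Filter Topology
open scoped ENNReal NNReal SchwartzMap LineDeriv Laplacian ContDiff

noncomputable section

namespace QuadNLS

/-- The physical space `ℝ⁶`. -/
abbrev R6 : Type := EuclideanSpace ℝ (Fin 6)

instance factOneLeThree : Fact ((1 : ℝ≥0∞) ≤ 3) := ⟨by norm_num⟩

instance factOneLeThreeHalves : Fact ((1 : ℝ≥0∞) ≤ 3 / 2) :=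
  ⟨by
    rw [ENNReal.le_div_iff_mul_le (Or.inl (by norm_num)) (Or.inl (by norm_num))]
    norm_num⟩

/-! ### The linear flow -/

/-- The coefficients of the two Laplacians: `A = diag (Δ, κ Δ)`. -/
def coeff (κ : ℝ) : Fin 2 → ℝ := ![1, κ]

/-- The Fourier symbol of `e^{i a t Δ}`, for the Fourier transform with kernel
`e^{-2 π i x · ξ}` (so that `Δ` has symbol `-4 π² |ξ|²`). -/
def schrodingerSymbol (a t : ℝ) (ξ : R6) : ℂ :=
  Complex.exp (((-(4 * Real.pi ^ 2 * a * t) * ‖ξ‖ ^ 2 : ℝ) : ℂ) * Complex.I)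

/-- The symbol is a smooth function of temperate growth, so that multiplication by it acts on
tempered distributions (Mathlib's multiplication operator is zero for other symbols). -/
theorem schrodingerSymbol_hasTemperateGrowth (a t : ℝ) :
    (schrodingerSymbol a t).HasTemperateGrowth := by
  have h1 : (fun y : ℝ => Complex.exp (Complex.I * (y : ℂ))).HasTemperateGrowth := by
    have hd : ∀ n : ℕ, iteratedDeriv n (fun y : ℝ => Complex.exp (Complex.I * (y : ℂ))) =
        fun y : ℝ => Complex.I ^ n * Complex.exp (Complex.I * (y : ℂ)) := by
      intro n
      induction n with
      | zero => simp
      | succ n ih =>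
        rw [iteratedDeriv_succ, ih]
        funext y
        have h : HasDerivAt (fun y : ℝ => Complex.exp (Complex.I * (y : ℂ)))
            (Complex.exp (Complex.I * (y : ℂ)) * (Complex.I * 1)) y :=
          ((hasDerivAt_id y).ofReal_comp.const_mul Complex.I).cexp
        rw [(h.const_mul (Complex.I ^ n)).deriv]
        ring
    refine ⟨?_, fun n => ⟨0, 1, fun x => ?_⟩⟩
    · exact Complex.contDiff_exp.comp (contDiff_const.mul Complex.ofRealCLM.contDiff)
    · rw [norm_iteratedFDeriv_eq_norm_iteratedDeriv, hd]
      simp [Complex.norm_exp]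
  have h2 : (fun ξ : R6 => -(4 * Real.pi ^ 2 * a * t) * ‖ξ‖ ^ 2).HasTemperateGrowth :=
    (Function.HasTemperateGrowth.const _).mul (Function.hasTemperateGrowth_norm_sq R6)
  have h3 := h1.comp h2
  have h4 : schrodingerSymbol a t =
      (fun y : ℝ => Complex.exp (Complex.I * (y : ℂ))) ∘
        (fun ξ : R6 => -(4 * Real.pi ^ 2 * a * t) * ‖ξ‖ ^ 2) := by
    funext ξ
    simp only [schrodingerSymbol, Function.comp_apply]
    rw [mul_comm]
  rw [h4]
  exact h3

/-- The Schrödinger group `S(t) = diag (e^{i t Δ}, e^{i κ t Δ})`, acting on pairs of tempered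
distributions on `ℝ⁶`. -/
def flow (κ t : ℝ) (T : Fin 2 → 𝓢'(R6, ℂ)) : Fin 2 → 𝓢'(R6, ℂ) := fun j =>
  TemperedDistribution.fourierMultiplierCLM ℂ (schrodingerSymbol (coeff κ j) t) (T j)

/-! ### Norms of (pairs of) tempered distributions -/

/-- The `L^p` norm of a tempered distribution; it is `∞` if the distribution is not given by an
`L^p` function. (The representing function is unique almost everywhere, so the infimum is
over at most one value.) -/
def scalarLpNorm (p : ℝ≥0∞) (T : 𝓢'(R6, ℂ)) : ℝ≥0∞ :=
  ⨅ (g : R6 → ℂ) (_ : MemLp g p volume) (_ : ∀ φ : 𝓢(R6, ℂ), T φ = ∫ x, φ x * g x),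
    eLpNorm g p volume

/-- The norm of `L^p × L^p`. -/
def lpNorm (p : ℝ≥0∞) (T : Fin 2 → 𝓢'(R6, ℂ)) : ℝ≥0∞ := ∑ j, scalarLpNorm p (T j)

/-- The `k`-th unit vector of `ℝ⁶`. -/
def unitVec (k : Fin 6) : R6 := EuclideanSpace.single k 1

/-- The `L^p` norm of the (distributional) gradient of a pair. -/
def gradLpNorm (p : ℝ≥0∞) (T : Fin 2 → 𝓢'(R6, ℂ)) : ℝ≥0∞ :=
  ∑ k, lpNorm p (fun j => ∂_{unitVec k} (T j))

/-! ### Strichartz norms -/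

/-- `(q, r) ∈ Λ_s`, i.e. `q ≥ 2` and `2 / q = 6 (1 / 2 - 1 / r) - s`; here `q` and `r` may be
infinite, with `1 / ∞ = 0`. -/
def Admissible (s : ℝ) (q r : ℝ≥0∞) : Prop :=
  2 ≤ q ∧ 2 * (q⁻¹).toReal = 6 * (1 / 2 - (r⁻¹).toReal) - s

/-- The Hölder conjugate exponent. -/
def conjExp (q : ℝ≥0∞) : ℝ≥0∞ := (1 - q⁻¹)⁻¹

/-- The Strichartz norm `S(Ḣ¹)` on `ℝ × ℝ⁶`: the larger of the supremum of
`‖u‖_{L^q_t L^r_x}` over `Λ_1` and the supremum of `‖∇u‖_{L^q_t L^r_x}` over `Λ_0`. -/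
def strichartzNorm (U : ℝ → Fin 2 → 𝓢'(R6, ℂ)) : ℝ≥0∞ :=
  max (⨆ (q : ℝ≥0∞) (r : ℝ≥0∞) (_ : Admissible 1 q r),
        eLpNorm (fun t => lpNorm r (U t)) q volume)
      (⨆ (q : ℝ≥0∞) (r : ℝ≥0∞) (_ : Admissible 0 q r),
        eLpNorm (fun t => gradLpNorm r (U t)) q volume)

/-! ### The state space -/

/-- Pairs of functions in `L³(ℝ⁶)`. By the Sobolev embedding `Ḣ¹(ℝ⁶)` is the space of those
functions in `L³(ℝ⁶)` whose distributional gradient is in `L²(ℝ⁶)`. -/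
abbrev State : Type := Fin 2 → Lp ℂ 3 (volume : Measure R6)

/-- A state as a pair of tempered distributions. -/
def State.toDist (w : State) : Fin 2 → 𝓢'(R6, ℂ) := fun j => (w j : 𝓢'(R6, ℂ))

/-- Continuity in time with values in `Ḣ¹ × Ḣ¹`. -/
def ContinuousHdot1 (u : ℝ → State) : Prop :=
  (∀ t, gradLpNorm 2 (State.toDist (u t)) < ⊤) ∧
    ∀ s, Tendsto (fun t => gradLpNorm 2 (State.toDist (u t - u s))) (𝓝 s) (𝓝 0)

/-! ### The nonlinearity and the equation -/

/-- The pointwise nonlinearity `f(u, v) = (v ū, u²)`. -/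
def nonlin (z : Fin 2 → ℂ) : Fin 2 → ℂ := ![z 1 * (starRingEnd ℂ) (z 0), z 0 ^ 2]

/-- By Hölder's inequality the nonlinearity maps `L³` to `L^{3/2}`. -/
theorem memLp_nonlin (w : State) (j : Fin 2) :
    MemLp (fun x => nonlin (fun i => w i x) j) (3 / 2) volume := by
  have hT : ENNReal.HolderTriple 3 3 (3 / 2) := ⟨by
    rw [ENNReal.inv_div (by norm_num) (by norm_num), ← two_mul, ENNReal.div_eq_inv_mul, mul_comm]⟩
  have h0 := Lp.memLp (w 0)
  have h1 := Lp.memLp (w 1)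
  have h0' : MemLp (fun x => (starRingEnd ℂ) (w 0 x)) 3 volume := h0.star
  fin_cases j
  · exact h0'.mul h1
  · have := h0.mul h0 (r := 3 / 2)
    refine this.ae_eq (Eventually.of_forall fun x => ?_)
    simp [nonlin, pow_two]

/-- The nonlinearity `f(w)`, as a pair of elements of `L^{3/2}(ℝ⁶)`. -/
def nonlinLp (w : State) : Fin 2 → Lp ℂ (3 / 2) (volume : Measure R6) := fun j =>
  (memLp_nonlin w j).toLp _

/-- `u` is a solution of `i u_t + A u + f(u) = 0` on `ℝ`: it is in `C(ℝ; Ḣ¹)`, it is in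
`L⁴_{t,x}` on bounded time intervals, and it satisfies the Duhamel formula
`u(t) = S(t) u(0) + i ∫₀ᵗ S(t - τ) f(u(τ)) dτ`, where the integral is that of a function with
values in the tempered distributions. -/
def IsSolution (κ : ℝ) (u : ℝ → State) : Prop :=
  ContinuousHdot1 u ∧
  (∀ a b : ℝ,
    eLpNorm (fun t => lpNorm 4 (State.toDist (u t))) 4 (volume.restrict (Set.Icc a b)) < ⊤) ∧
  ∀ (t : ℝ) (j : Fin 2) (φ : 𝓢(R6, ℂ)),
    State.toDist (u t) j φ = flow κ t (State.toDist (u 0)) j φ +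
      Complex.I * ∫ τ in (0 : ℝ)..t,
        flow κ (t - τ) (fun i => (nonlinLp (u τ) i : 𝓢'(R6, ℂ))) j φ

/-- The `j`-th component of the space-time distribution `e = i u_t + A u + f(u)`, applied to a
test function `φ` on `ℝ × ℝ⁶`. -/
def errorDist (κ : ℝ) (u : ℝ → State) (j : Fin 2) (φ : ℝ × R6 → ℂ) : ℂ :=
  ∫ t : ℝ, ∫ x : R6,
    ((-Complex.I * deriv (fun s => φ (s, x)) t
        + (coeff κ j : ℂ) * (Δ (fun y => φ (t, y))) x) * u t j x
      + φ (t, x) * nonlinLp (u t) j x)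

/-- The space-time function `G` is the spatial gradient of the distribution
`e = i u_t + A u + f(u)`; `G k j` is the `k`-th partial derivative of the `j`-th component. -/
def IsErrorGradient (κ : ℝ) (u : ℝ → State) (G : Fin 6 → Fin 2 → ℝ × R6 → ℂ) : Prop :=
  ∀ (k : Fin 6) (j : Fin 2), LocallyIntegrable (G k j) volume ∧
    ∀ φ : ℝ × R6 → ℂ, ContDiff ℝ ∞ φ → HasCompactSupport φ →
      ∫ p, φ p * G k j p = - errorDist κ u j (fun p => fderiv ℝ φ p (0, unitVec k))

/-- The norm `‖∇e‖_{S'(L²)}` of `e = i u_t + A u + f(u)`: the infimum of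
`‖∇e‖_{L^{q'}_t L^{r'}_x}` over `(q, r) ∈ Λ_0`. It is `∞` if `∇e` is in none of these spaces. -/
def gradErrorNorm (κ : ℝ) (u : ℝ → State) : ℝ≥0∞ :=
  ⨅ (q : ℝ≥0∞) (r : ℝ≥0∞) (_ : Admissible 0 q r)
    (G : Fin 6 → Fin 2 → ℝ × R6 → ℂ) (_ : IsErrorGradient κ u G),
    eLpNorm (fun t => ∑ k, ∑ j, eLpNorm (fun x => G k j (t, x)) (conjExp r) volume)
      (conjExp q) volume

end QuadNLS

end

/-! ### The Schrödinger propagator on Schwartz functions and its dispersive decay. -/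

noncomputable section
namespace QuadNLS
open FourierTransform

/-! Let w = u - ũ. Its gradient solves a linear Schrödinger system forced by the gradients of f(u) -
f(ũ) and of the error. Strichartz estimates bound the energy norm of w, sup_t ‖∇w‖_{L²}, and its
endpoint norm, ‖∇w‖_{L²_t L³_x}, by the data at one time, the error and the nonlinear term. In
dimension six a quadratic nonlinearity is critical for Ḣ¹: the gradient of a product lies in L²_t
L^{3/2}_x when one factor is measured in the energy norm and the other in the endpoint norm, by
Hölder and the Sobolev embeddings into L³ and L⁶. Since every product in f(u) - f(ũ) contains a
factor w, the nonlinear term is at most the energy norm of w times the sum of the endpoint norms of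
ũ and w (`perturbation_estimate`).

Time is then divided according to the endpoint norm of ũ. The number of portions depends only on κ
and M, and on each of them the nonlinear term is absorbed by a continuity argument while w grows by
at most a fixed factor (`BootstrapBound.step`, `BootstrapBound.iterate`). If ε is small compared
with the inverse of the accumulated factor, w stays small for all times. Adding ũ controls the
energy and endpoint norms of u, and interpolation with Sobolev embedding gives all the others
(`strichartzNorm_le`).

The linear estimates include the endpoint q = 2, so complex interpolation of the dispersive bound is
not enough. A function in L^{3/2} is cut into atoms at dyadic heights (`exists_atoms`). Two atoms of
scales α and β interact, under the retarded time ordering, with a gain min(α/β, β/α)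
(`enorm_retarded_atoms_le`), and the sum over scales is geometric (`enorm_retarded_schPath_le`).
Measurable selection of test functions from a countable norming family turns this bilinear bound
into linear estimates. For a forcing in a general dual space, the forcing is regarded as a
functional bounded by interpolated L² and L³ norms and applied to the advanced integral of a test
path, both of whose norms are under control (`InterpBounded.enorm_integral_kernel_le`). No separate
argument is needed to pass from untruncated to retarded time integrals.

Two matters of regularity come before the perturbation argument. The solution u is only known to be
locally in L⁴_{t,x}; that its gradient is locally in the endpoint space is proved with difference
quotients (`IsSolution.lintegral_gradLpNorm_three_lt_top`). For ũ only an equation in the sense of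
distributions is available; testing it with products and then with propagated test functions gives a
Duhamel formula for its gradient (`exists_duhamelEq_weakGrad`). -/

/-- The Schrödinger propagator `e^{i c t Δ}` on Schwartz functions. -/
def sch (c t : ℝ) : 𝓢(R6, ℂ) →L[ℂ] 𝓢(R6, ℂ) :=
  SchwartzMap.fourierMultiplierCLM ℂ (schrodingerSymbol c t)

theorem norm_schrodingerSymbol (c t : ℝ) (ξ : R6) : ‖schrodingerSymbol c t ξ‖ = 1 := by
  rw [schrodingerSymbol, Complex.norm_exp_ofReal_mul_I]

theorem schrodingerSymbol_add (c s t : ℝ) :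
    schrodingerSymbol c s * schrodingerSymbol c t = schrodingerSymbol c (s + t) := by
  funext ξ
  simp only [schrodingerSymbol, Pi.mul_apply, ← Complex.exp_add]
  congr 1
  push_cast
  ring

theorem schrodingerSymbol_zero (c : ℝ) : schrodingerSymbol c 0 = fun _ => 1 := by
  funext ξ
  simp [schrodingerSymbol]

theorem schrodingerSymbol_neg_coeff (c t : ℝ) :
    schrodingerSymbol (-c) t = schrodingerSymbol c (-t) := by
  funext ξ
  simp only [schrodingerSymbol]
  congr 3
  ring

theorem sch_neg_coeff (c t : ℝ) : sch (-c) t = sch c (-t) := by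
  simp [sch, schrodingerSymbol_neg_coeff]

theorem sch_sch (c s t : ℝ) (φ : 𝓢(R6, ℂ)) : sch c s (sch c t φ) = sch c (s + t) φ := by
  rw [sch, sch, SchwartzMap.fourierMultiplierCLM_fourierMultiplierCLM_apply
    (schrodingerSymbol_hasTemperateGrowth c s) (schrodingerSymbol_hasTemperateGrowth c t),
    schrodingerSymbol_add, sch]

@[simp] theorem sch_zero (c : ℝ) (φ : 𝓢(R6, ℂ)) : sch c 0 φ = φ := by
  rw [sch, schrodingerSymbol_zero, SchwartzMap.fourierMultiplierCLM_const]
  simp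

theorem fourier_sch (c t : ℝ) (φ : 𝓢(R6, ℂ)) (ξ : R6) :
    𝓕 (sch c t φ) ξ = schrodingerSymbol c t ξ * 𝓕 φ ξ := by
  rw [sch, SchwartzMap.fourierMultiplierCLM_apply, FourierTransform.fourier_fourierInv_eq,
    SchwartzMap.smulLeftCLM_apply_apply (schrodingerSymbol_hasTemperateGrowth c t), smul_eq_mul]

/-- The symbol is even in ξ, so the reflection relating 𝓕 and 𝓕⁻ commutes with multiplication by it.
Hence the transpose of the propagator for the bilinear pairing is the propagator itself, with the
same sign of time; `flow_apply` and `integral_sch_mul` rest on this. -/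
theorem fourier_smulLeft_fourierInv (c t : ℝ) (φ : 𝓢(R6, ℂ)) :
    𝓕 (SchwartzMap.smulLeftCLM ℂ (schrodingerSymbol c t) (𝓕⁻ φ)) = sch c t φ := by
  have hg := schrodingerSymbol_hasTemperateGrowth c t
  have key : SchwartzMap.smulLeftCLM ℂ (schrodingerSymbol c t) (𝓕⁻ φ) =
      SchwartzMap.compCLMOfContinuousLinearEquiv ℂ (LinearIsometryEquiv.neg ℝ (E := R6))
        (SchwartzMap.smulLeftCLM ℂ (schrodingerSymbol c t) (𝓕 φ)) := by
    ext x
    simp [SchwartzMap.smulLeftCLM_apply_apply hg, SchwartzMap.fourierInv_apply_eq,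
      schrodingerSymbol]
  rw [key, sch, SchwartzMap.fourierMultiplierCLM_apply]
  ext x
  rw [SchwartzMap.fourier_coe, SchwartzMap.fourierInv_coe]
  rw [Real.fourierInv_eq_fourier_comp_neg]
  congr 1

theorem flow_apply (κ t : ℝ) (T : Fin 2 → 𝓢'(R6, ℂ)) (j : Fin 2) (φ : 𝓢(R6, ℂ)) :
    flow κ t T j φ = T j (sch (coeff κ j) t φ) := by
  rw [flow, TemperedDistribution.fourierMultiplierCLM_apply_apply, fourier_smulLeft_fourierInv]

theorem integral_sch_mul (c t : ℝ) (φ ψ : 𝓢(R6, ℂ)) :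
    ∫ x, sch c t φ x * ψ x = ∫ x, φ x * sch c t ψ x := by
  have hg := schrodingerSymbol_hasTemperateGrowth c t
  conv_lhs => rw [← fourier_smulLeft_fourierInv]
  rw [SchwartzMap.integral_fourier_mul_eq]
  simp_rw [SchwartzMap.smulLeftCLM_apply_apply hg, smul_eq_mul]
  have h1 : ∀ x, schrodingerSymbol c t x * 𝓕⁻ φ x * 𝓕 ψ x =
      𝓕⁻ φ x * SchwartzMap.smulLeftCLM ℂ (schrodingerSymbol c t) (𝓕 ψ) x := by
    intro x
    rw [SchwartzMap.smulLeftCLM_apply_apply hg, smul_eq_mul]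
    ring
  simp_rw [h1]
  rw [SchwartzMap.integral_fourierInv_mul_eq]
  rfl

theorem norm_toLp_le_of_le {p : ℝ≥0∞} {f g : 𝓢(R6, ℂ)} (h : ∀ x, ‖f x‖ ≤ ‖g x‖) :
    ‖f.toLp p volume‖ ≤ ‖g.toLp p volume‖ := by
  rw [SchwartzMap.norm_toLp, SchwartzMap.norm_toLp]
  have h1 : eLpNorm (g : R6 → ℂ) p volume ≠ ⊤ := (g.memLp p volume).2.ne
  exact ENNReal.toReal_mono h1 (eLpNorm_mono h)

theorem norm_sch_toLp_two (c t : ℝ) (φ : 𝓢(R6, ℂ)) : ‖(sch c t φ).toLp 2‖ = ‖φ.toLp 2‖ := by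
  rw [← SchwartzMap.norm_fourier_toL2_eq (sch c t φ), ← SchwartzMap.norm_fourier_toL2_eq φ]
  have h : ∀ x, ‖𝓕 (sch c t φ) x‖ = ‖𝓕 φ x‖ := fun x => by
    rw [fourier_sch, norm_mul, norm_schrodingerSymbol, one_mul]
  exact le_antisymm (norm_toLp_le_of_le fun x => (h x).le) (norm_toLp_le_of_le fun x => (h x).ge)

/-- With derivatives as complex-valued multipliers, commutation with the propagator is commutativity
of the product of symbols. -/
theorem lineDeriv_eq_complex_multiplier (v : R6) (ψ : 𝓢(R6, ℂ)) :
    ∂_{v} ψ = (2 * Real.pi * Complex.I) •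
      SchwartzMap.fourierMultiplierCLM ℂ (fun x : R6 => ((inner ℝ x v : ℝ) : ℂ)) ψ := by
  rw [SchwartzMap.lineDeriv_eq_fourierMultiplierCLM]
  congr 1
  exact (SchwartzMap.fourierMultiplierCLM_ofReal ℂ (by fun_prop) ψ).symm

theorem multiplier_comm_lineDeriv {g : R6 → ℂ} (hg : g.HasTemperateGrowth) (v : R6)
    (φ : 𝓢(R6, ℂ)) : SchwartzMap.fourierMultiplierCLM ℂ g (∂_{v} φ) =
      ∂_{v} (SchwartzMap.fourierMultiplierCLM ℂ g φ) := by
  have h1 : (fun x : R6 => ((inner ℝ x v : ℝ) : ℂ)).HasTemperateGrowth := by fun_prop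
  rw [lineDeriv_eq_complex_multiplier, lineDeriv_eq_complex_multiplier, map_smul,
    SchwartzMap.fourierMultiplierCLM_fourierMultiplierCLM_apply hg h1,
    SchwartzMap.fourierMultiplierCLM_fourierMultiplierCLM_apply h1 hg, mul_comm g]

theorem sch_lineDeriv (c t : ℝ) (v : R6) (φ : 𝓢(R6, ℂ)) : sch c t (∂_{v} φ) = ∂_{v} (sch c t φ) :=
  multiplier_comm_lineDeriv (schrodingerSymbol_hasTemperateGrowth c t) v φ

theorem laplacian_schwartz_eq (ψ : 𝓢(R6, ℂ)) : Δ ψ = ∑ k, ∂_{unitVec k} (∂_{unitVec k} ψ) := by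
  rw [SchwartzMap.laplacian_eq_sum (EuclideanSpace.basisFun (Fin 6) ℝ)]
  simp [unitVec]

theorem sch_laplacian (c t : ℝ) (φ : 𝓢(R6, ℂ)) : sch c t (Δ φ) = Δ (sch c t φ) := by
  simp [laplacian_schwartz_eq, sch_lineDeriv]

theorem laplacian_lineDeriv (v : R6) (φ : 𝓢(R6, ℂ)) :
    Δ (∂_{v} φ : 𝓢(R6, ℂ)) = ∂_{v} (Δ φ : 𝓢(R6, ℂ)) := by
  have h (w : R6) (φ : 𝓢(R6, ℂ)) : ∂_{w} (∂_{v} φ) = ∂_{v} (∂_{w} φ) := by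
    have h1 : (fun x : R6 => ((inner ℝ x w : ℝ) : ℂ)).HasTemperateGrowth := by fun_prop
    rw [lineDeriv_eq_complex_multiplier w, lineDeriv_eq_complex_multiplier w,
      multiplier_comm_lineDeriv h1, LineDeriv.lineDerivOp_smul]
  have h2 : ∂_{v} (Δ φ : 𝓢(R6, ℂ)) = ∑ k, ∂_{v} (∂_{unitVec k} (∂_{unitVec k} φ)) := by
    rw [laplacian_schwartz_eq]
    exact map_sum (LineDeriv.lineDerivOpCLM ℂ 𝓢(R6, ℂ) v) _ _
  rw [h2, laplacian_schwartz_eq]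
  simp_rw [h]

theorem fourier_laplacian (φ : 𝓢(R6, ℂ)) (ξ : R6) :
    𝓕 (Δ φ : 𝓢(R6, ℂ)) ξ = -(4 * Real.pi ^ 2 * ‖ξ‖ ^ 2 : ℝ) * 𝓕 φ ξ := by
  rw [SchwartzMap.laplacian_eq_fourierMultiplierCLM, SchwartzMap.fourierMultiplierCLM_apply]
  rw [FourierTransform.fourier_smul, FourierTransform.fourier_fourierInv_eq]
  rw [smul_apply, SchwartzMap.smulLeftCLM_apply_apply (by fun_prop)]
  simp
  ring

theorem norm_schrodingerSymbol_sub_le (c s t : ℝ) (ξ : R6) :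
    ‖schrodingerSymbol c t ξ - schrodingerSymbol c s ξ‖ ≤
      |c * (t - s)| * (4 * Real.pi ^ 2 * ‖ξ‖ ^ 2) := by
  have h : schrodingerSymbol c t ξ = schrodingerSymbol c s ξ * schrodingerSymbol c (t - s) ξ := by
    rw [← Pi.mul_apply, schrodingerSymbol_add]
    congr 1
    ring
  have h2 : schrodingerSymbol c (t - s) ξ =
      Complex.exp (Complex.I * ((-(4 * Real.pi ^ 2 * c * (t - s)) * ‖ξ‖ ^ 2 : ℝ) : ℂ)) := by
    rw [schrodingerSymbol, mul_comm]
  have h3 : schrodingerSymbol c t ξ - schrodingerSymbol c s ξ =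
      schrodingerSymbol c s ξ * (schrodingerSymbol c (t - s) ξ - 1) := by
    rw [h]; ring
  rw [h3, norm_mul, norm_schrodingerSymbol, one_mul, h2]
  refine (Real.norm_exp_I_mul_ofReal_sub_one_le).trans (le_of_eq ?_)
  rw [Real.norm_eq_abs, abs_mul, abs_neg, abs_of_nonneg (sq_nonneg ‖ξ‖),
    show 4 * Real.pi ^ 2 * c * (t - s) = (c * (t - s)) * (4 * Real.pi ^ 2) by ring, abs_mul,
    abs_of_nonneg (by positivity : (0:ℝ) ≤ 4 * Real.pi ^ 2)]
  ring

/-- For |y| ≤ 1 this is Taylor's formula; for |y| > 1 the trivial bound 2 + |y| is already below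
3y². A bound valid for all y is needed because y ranges over multiples of |ξ|². -/
theorem norm_exp_I_sub_le (y : ℝ) :
    ‖Complex.exp (y * Complex.I) - 1 - y * Complex.I‖ ≤ 3 * y ^ 2 := by
  by_cases hy : |y| ≤ 1
  · refine (Complex.norm_exp_sub_one_sub_id_le (x := y * Complex.I) ?_).trans ?_
    · simpa using hy
    · simp only [norm_mul, Complex.norm_real, Complex.norm_I, mul_one, Real.norm_eq_abs, sq_abs]
      nlinarith [sq_nonneg y]
  · push Not at hy
    have h1 : ‖Complex.exp (y * Complex.I) - 1 - y * Complex.I‖ ≤ 1 + 1 + |y| := by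
      refine (norm_sub_le _ _).trans (add_le_add ((norm_sub_le _ _).trans ?_) ?_)
      · rw [Complex.norm_exp_ofReal_mul_I]; simp
      · simp
    have : |y| ^ 2 = y ^ 2 := sq_abs y
    nlinarith

theorem norm_toLp_two_le_of_fourier {f g : 𝓢(R6, ℂ)} {C : ℝ} (hC : 0 ≤ C)
    (h : ∀ ξ, ‖𝓕 f ξ‖ ≤ C * ‖𝓕 g ξ‖) : ‖f.toLp 2 volume‖ ≤ C * ‖g.toLp 2 volume‖ := by
  rw [← SchwartzMap.norm_fourier_toL2_eq f, ← SchwartzMap.norm_fourier_toL2_eq g]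
  have h1 : ‖(𝓕 f).toLp 2 volume‖ ≤ ‖((C : ℂ) • 𝓕 g).toLp 2 volume‖ :=
    norm_toLp_le_of_le fun x => by
      rw [smul_apply, norm_smul, Complex.norm_real, Real.norm_eq_abs, abs_of_nonneg hC]
      exact h x
  refine h1.trans (le_of_eq ?_)
  rw [← SchwartzMap.toLpCLM_apply (𝕜 := ℂ), map_smul, norm_smul]
  simp [abs_of_nonneg hC]

theorem norm_apply_le_fourier_toLp_one (f : 𝓢(R6, ℂ)) (x : R6) :
    ‖f x‖ ≤ ‖(𝓕 f).toLp 1 volume‖ := by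
  have h : f x = 𝓕 (𝓕 f) (-x) := by
    have h1 : f = 𝓕⁻ (𝓕 f) := (FourierTransform.fourierInv_fourier_eq f).symm
    have h2 := congrArg (fun g : 𝓢(R6, ℂ) => g x) h1
    rw [SchwartzMap.fourierInv_apply_eq] at h2
    exact h2
  rw [h]
  exact SchwartzMap.norm_fourier_apply_le_toLp_one _ _

theorem norm_apply_le_of_fourier {f g : 𝓢(R6, ℂ)} {C : ℝ} (hC : 0 ≤ C)
    (h : ∀ ξ, ‖𝓕 f ξ‖ ≤ C * ‖𝓕 g ξ‖) (x : R6) : ‖f x‖ ≤ C * ‖(𝓕 g).toLp 1 volume‖ := by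
  refine (norm_apply_le_fourier_toLp_one f x).trans ?_
  have h1 : ‖(𝓕 f).toLp 1 volume‖ ≤ ‖((C : ℂ) • 𝓕 g).toLp 1 volume‖ :=
    norm_toLp_le_of_le fun x => by
      rw [smul_apply, norm_smul, Complex.norm_real, Real.norm_eq_abs, abs_of_nonneg hC]
      exact h x
  refine h1.trans (le_of_eq ?_)
  rw [← SchwartzMap.toLpCLM_apply (𝕜 := ℂ), map_smul, norm_smul]
  simp [abs_of_nonneg hC]

theorem fourier_schwartz_sub (f g : 𝓢(R6, ℂ)) : 𝓕 (f - g) = 𝓕 f - 𝓕 g :=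
  map_sub (FourierTransform.fourierCLM ℂ 𝓢(R6, ℂ)) f g

theorem toLp_schwartz_sub (p : ℝ≥0∞) [Fact (1 ≤ p)] (f g : 𝓢(R6, ℂ)) :
    (f - g).toLp p volume = f.toLp p volume - g.toLp p volume :=
  map_sub (SchwartzMap.toLpCLM ℂ ℂ p volume) f g

theorem toLp_schwartz_smul (p : ℝ≥0∞) [Fact (1 ≤ p)] (a : ℂ) (f : 𝓢(R6, ℂ)) :
    (a • f).toLp p volume = a • f.toLp p volume :=
  map_smul (SchwartzMap.toLpCLM ℂ ℂ p volume) a f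

/-- The factor 4π²|ξ|² that comes from |e^{iy} - 1| ≤ |y| is the symbol of -Δ. The comparison is
pointwise on the Fourier side, so it yields continuity in time both in L² and in the sup norm. -/
theorem norm_fourier_sch_sub_le (c s t : ℝ) (φ : 𝓢(R6, ℂ)) (ξ : R6) :
    ‖𝓕 (sch c t φ - sch c s φ) ξ‖ ≤ |c * (t - s)| * ‖𝓕 (Δ φ : 𝓢(R6, ℂ)) ξ‖ := by
  rw [fourier_schwartz_sub, sub_apply, fourier_sch, fourier_sch, ← sub_mul, norm_mul,
    fourier_laplacian, norm_mul, ← mul_assoc]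
  gcongr
  refine (norm_schrodingerSymbol_sub_le c s t ξ).trans (le_of_eq ?_)
  rw [norm_neg, Complex.norm_real, Real.norm_eq_abs,
    abs_of_nonneg (a := 4 * Real.pi ^ 2 * ‖ξ‖ ^ 2) (by positivity)]

/-- Plancherel says nothing about L³; continuity there comes from |f|³ ≤ B|f|², with smallness in L²
and in the sup norm. -/
theorem norm_toLp_three_pow_le (f : 𝓢(R6, ℂ)) {B : ℝ} (hB : ∀ x, ‖f x‖ ≤ B) :
    ‖f.toLp 3 volume‖ ^ 3 ≤ B * ‖f.toLp 2 volume‖ ^ 2 := by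
  have i3 : Integrable (fun x => ‖f x‖ ^ 3) volume := by
    simpa using! (f.memLp 3 volume).integrable_norm_pow (by norm_num)
  have i2 : Integrable (fun x => ‖f x‖ ^ 2) volume := by
    simpa using! (f.memLp 2 volume).integrable_norm_pow (by norm_num)
  have e3 : ‖f.toLp 3 volume‖ ^ 3 = ∫ x, ‖f x‖ ^ 3 := by
    rw [SchwartzMap.norm_toLp' (by norm_num) (by norm_num)]
    have : (0:ℝ) ≤ ∫ x, ‖f x‖ ^ 3 := integral_nonneg fun x => by positivity
    simp only [ENNReal.toReal_ofNat]
    norm_cast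
    rw [← Real.rpow_natCast, ← Real.rpow_mul this]
    norm_num
  have e2 : ‖f.toLp 2 volume‖ ^ 2 = ∫ x, ‖f x‖ ^ 2 := by
    rw [SchwartzMap.norm_toLp' (by norm_num) (by norm_num)]
    have : (0:ℝ) ≤ ∫ x, ‖f x‖ ^ 2 := integral_nonneg fun x => by positivity
    simp only [ENNReal.toReal_ofNat]
    norm_cast
    rw [← Real.rpow_natCast, ← Real.rpow_mul this]
    norm_num
  rw [e3, e2, ← integral_const_mul]
  refine integral_mono i3 (i2.const_mul B) fun x => ?_
  have := hB x
  show ‖f x‖ ^ 3 ≤ B * ‖f x‖ ^ 2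
  nlinarith [sq_nonneg ‖f x‖, norm_nonneg (f x)]

theorem norm_sch_sub_toLp_two_le (c s t : ℝ) (φ : 𝓢(R6, ℂ)) :
    ‖(sch c t φ).toLp 2 volume - (sch c s φ).toLp 2 volume‖ ≤
      |c * (t - s)| * ‖(Δ φ : 𝓢(R6, ℂ)).toLp 2 volume‖ := by
  rw [← toLp_schwartz_sub]
  exact norm_toLp_two_le_of_fourier (abs_nonneg _) (norm_fourier_sch_sub_le c s t φ)

theorem continuous_sch_toLp_two (c : ℝ) (φ : 𝓢(R6, ℂ)) :
    Continuous fun t => (sch c t φ).toLp 2 volume := by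
  rw [continuous_iff_continuousAt]
  intro s
  refine tendsto_iff_norm_sub_tendsto_zero.2 (squeeze_zero (fun _ => norm_nonneg _)
    (fun t => norm_sch_sub_toLp_two_le c s t φ) ?_)
  have : Continuous fun t => |c * (t - s)| * ‖(Δ φ : 𝓢(R6, ℂ)).toLp 2 volume‖ := by fun_prop
  simpa using this.tendsto s

theorem continuous_sch_toLp_three (c : ℝ) (φ : 𝓢(R6, ℂ)) :
    Continuous fun t => (sch c t φ).toLp 3 volume := by
  rw [continuous_iff_continuousAt]
  intro s
  refine tendsto_iff_norm_sub_tendsto_zero.2 ?_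
  have h1 : ∀ t, ‖(sch c t φ).toLp 3 volume - (sch c s φ).toLp 3 volume‖ ^ 3 ≤
      (|c * (t - s)| * ‖(𝓕 (Δ φ : 𝓢(R6, ℂ))).toLp 1 volume‖) *
        (|c * (t - s)| * ‖(Δ φ : 𝓢(R6, ℂ)).toLp 2 volume‖) ^ 2 := fun t => by
    rw [← toLp_schwartz_sub]
    refine (norm_toLp_three_pow_le (sch c t φ - sch c s φ)
      (norm_apply_le_of_fourier (abs_nonneg _) (norm_fourier_sch_sub_le c s t φ))).trans ?_
    rw [toLp_schwartz_sub]
    gcongr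
    exact norm_sch_sub_toLp_two_le c s t φ
  have h2 : Tendsto (fun t => ‖(sch c t φ).toLp 3 volume - (sch c s φ).toLp 3 volume‖ ^ 3)
      (𝓝 s) (𝓝 0) := by
    refine squeeze_zero (fun _ => by positivity) h1 ?_
    have : Continuous fun t => (|c * (t - s)| * ‖(𝓕 (Δ φ : 𝓢(R6, ℂ))).toLp 1 volume‖) *
        (|c * (t - s)| * ‖(Δ φ : 𝓢(R6, ℂ)).toLp 2 volume‖) ^ 2 := by fun_prop
    simpa using this.tendsto s
  have h3 := h2.rpow_const (p := 1 / 3) (Or.inr (by norm_num))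
  rw [Real.zero_rpow (by norm_num)] at h3
  refine h3.congr fun t => ?_
  rw [← Real.rpow_natCast, ← Real.rpow_mul (norm_nonneg _)]
  norm_num

theorem hasDerivAt_sch_toLp_two (c t : ℝ) (φ : 𝓢(R6, ℂ)) :
    HasDerivAt (fun t => (sch c t φ).toLp 2 volume)
      ((Complex.I * c) • (Δ (sch c t φ) : 𝓢(R6, ℂ)).toLp 2 volume) t := by
  rw [hasDerivAt_iff_isLittleO_nhds_zero]
  -- The symbol of the remainder is e^{iy} - 1 - iy with y proportional to h|ξ|², and y² is the
  -- symbol of (ch)²Δ², so the remainder is O(h²).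
  have hb : ∀ h : ℝ, ‖(sch c (t + h) φ).toLp 2 volume - (sch c t φ).toLp 2 volume -
      h • ((Complex.I * c) • (Δ (sch c t φ) : 𝓢(R6, ℂ)).toLp 2 volume)‖ ≤
      (3 * (c * h) ^ 2) * ‖(Δ (Δ φ : 𝓢(R6, ℂ)) : 𝓢(R6, ℂ)).toLp 2 volume‖ := by
    intro h
    have e : (sch c (t + h) φ).toLp 2 volume - (sch c t φ).toLp 2 volume -
        h • ((Complex.I * c) • (Δ (sch c t φ) : 𝓢(R6, ℂ)).toLp 2 volume) =
        (sch c (t + h) φ - sch c t φ -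
          ((h : ℂ) * (Complex.I * c)) • (Δ (sch c t φ) : 𝓢(R6, ℂ))).toLp 2 volume := by
      rw [toLp_schwartz_sub, toLp_schwartz_sub, toLp_schwartz_smul, ← smul_smul (h : ℂ)]
      rfl
    rw [e]
    refine norm_toLp_two_le_of_fourier (by positivity) fun ξ => ?_
    rw [fourier_schwartz_sub, fourier_schwartz_sub, FourierTransform.fourier_smul]
    simp only [sub_apply, smul_apply, fourier_laplacian, fourier_sch, smul_eq_mul]
    set y : ℝ := -(4 * Real.pi ^ 2 * c * h) * ‖ξ‖ ^ 2 with hy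
    have e1 : schrodingerSymbol c (t + h) ξ = schrodingerSymbol c t ξ *
        Complex.exp (y * Complex.I) := by
      rw [← schrodingerSymbol_add]
      rfl
    have e2 : schrodingerSymbol c (t + h) ξ * 𝓕 φ ξ - schrodingerSymbol c t ξ * 𝓕 φ ξ -
        (h : ℂ) * (Complex.I * c) * (-((4 * Real.pi ^ 2 * ‖ξ‖ ^ 2 : ℝ) : ℂ) *
          (schrodingerSymbol c t ξ * 𝓕 φ ξ)) =
        schrodingerSymbol c t ξ * (Complex.exp (y * Complex.I) - 1 - y * Complex.I) *
          𝓕 φ ξ := by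
      rw [e1, hy]
      push_cast
      ring
    rw [e2, norm_mul, norm_mul, norm_schrodingerSymbol, one_mul, norm_mul, norm_mul]
    refine (mul_le_mul_of_nonneg_right (norm_exp_I_sub_le y) (norm_nonneg _)).trans (le_of_eq ?_)
    rw [norm_neg, Complex.norm_real, Real.norm_eq_abs, abs_of_nonneg (by positivity), hy]
    ring
  refine Asymptotics.IsBigO.trans_isLittleO (g := fun h : ℝ => h ^ 2) ?_ ?_
  · refine Asymptotics.IsBigO.of_bound
      (3 * c ^ 2 * ‖(Δ (Δ φ : 𝓢(R6, ℂ)) : 𝓢(R6, ℂ)).toLp 2 volume‖) (Eventually.of_forall fun h => ?_)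
    refine (hb h).trans (le_of_eq ?_)
    rw [Real.norm_eq_abs, abs_of_nonneg (sq_nonneg h)]
    ring
  · simpa using Asymptotics.isLittleO_pow_id (𝕜 := ℝ) (n := 2) (by norm_num)

/-- The dispersive estimate. -/
theorem norm_sch_apply_le (c t : ℝ) (hct : c * t ≠ 0) (φ : 𝓢(R6, ℂ)) (x : R6) :
    ‖sch c t φ x‖ ≤ (|c * t|⁻¹) ^ 3 * ‖φ.toLp 1 volume‖ := by
  set b₀ : ℝ := 4 * Real.pi ^ 2 * c * t with hb₀
  have hb₀' : |b₀| = 4 * Real.pi ^ 2 * |c * t| := by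
    rw [hb₀, mul_assoc, abs_mul, abs_of_nonneg (by positivity)]
  -- Gaussian regularization: for ε > 0 the multiplier is a true Gaussian with an explicit Fourier
  -- transform, and ε → 0 returns the oscillatory one.
  let b : ℝ → ℂ := fun ε => ε + b₀ * Complex.I
  let g : ℝ → R6 → ℂ := fun ε v =>
    Complex.exp (-b ε * ‖v‖ ^ 2 + 2 * Real.pi * Complex.I * (inner ℝ x v : ℝ))
  have hbre : ∀ ε, (b ε).re = ε := fun ε => by simp [b]
  have hgcont : ∀ ε, Continuous (g ε) := fun ε => by fun_prop
  have hgn : ∀ ε v, ‖g ε v‖ = Real.exp (-ε * ‖v‖ ^ 2) := fun ε v => by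
    rw [Complex.norm_exp]
    congr 1
    have : (-b ε * (‖v‖ : ℂ) ^ 2 + 2 * Real.pi * Complex.I * (inner ℝ x v : ℝ)) =
      ((-ε * ‖v‖ ^ 2 : ℝ) : ℂ) +
        ((-b₀ * ‖v‖ ^ 2 + 2 * Real.pi * (inner ℝ x v : ℝ) : ℝ) : ℂ) * Complex.I := by
      simp only [b]; push_cast; ring
    rw [this, Complex.add_re, Complex.re_ofReal_mul, Complex.ofReal_re]
    simp
  have hlim : Tendsto (fun ε => ∫ v, g ε v * 𝓕 φ v) (𝓝[>] 0) (𝓝 (sch c t φ x)) := by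
    have e : sch c t φ x = ∫ v, g 0 v * 𝓕 φ v := by
      rw [sch, SchwartzMap.fourierMultiplierCLM_apply, SchwartzMap.fourierInv_coe,
        Real.fourierInv_eq']
      refine integral_congr_ae (Eventually.of_forall fun v => ?_)
      simp only [smul_eq_mul]
      rw [SchwartzMap.smulLeftCLM_apply_apply (schrodingerSymbol_hasTemperateGrowth c t),
        smul_eq_mul, ← mul_assoc]
      congr 1
      simp only [schrodingerSymbol, g, b, ← Complex.exp_add, real_inner_comm x v]
      congr 1
      rw [hb₀]
      push_cast
      ring
    rw [e]
    refine tendsto_integral_filter_of_dominated_convergence (fun v => ‖𝓕 φ v‖)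
      (Eventually.of_forall fun ε => ((hgcont ε).mul (𝓕 φ).continuous).aestronglyMeasurable) ?_
      (𝓕 φ).integrable.norm ?_
    · filter_upwards [self_mem_nhdsWithin] with ε hε
      refine Eventually.of_forall fun v => ?_
      rw [norm_mul, hgn]
      have : Real.exp (-ε * ‖v‖ ^ 2) ≤ 1 := Real.exp_le_one_iff.2 (by
        have : 0 < ε := hε
        nlinarith [sq_nonneg ‖v‖])
      nlinarith [norm_nonneg (𝓕 φ v)]
    · refine Eventually.of_forall fun v => ?_
      have : Continuous fun ε => g ε v * 𝓕 φ v := by fun_prop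
      exact (this.tendsto 0).mono_left nhdsWithin_le_nhds
  refine le_of_tendsto hlim.norm ?_
  filter_upwards [self_mem_nhdsWithin] with ε hε
  have hε' : 0 < (b ε).re := by rw [hbre]; exact hε
  have hgi : Integrable (g ε) volume := by
    have := (GaussianFourier.integrable_cexp_neg_mul_sq_norm_add hε' (2 * Real.pi * Complex.I) x)
    simpa [g] using this
  have hsw : ∫ v, g ε v * 𝓕 φ v = ∫ v, 𝓕 (g ε) v * φ v := by
    have := VectorFourier.integral_fourierIntegral_smul_eq_flip (L := innerₗ R6) (μ := volume)
      (ν := volume) (e := Real.fourierChar) Real.continuous_fourierChar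
      (by simpa using! continuous_inner) hgi φ.integrable
    simpa using! this.symm
  rw [hsw]
  have hF : ∀ v, ‖𝓕 (g ε) v‖ ≤ (|c * t|⁻¹) ^ 3 := by
    intro v
    have hbne : b ε ≠ 0 := fun h => by rw [h] at hε'; simp at hε'
    rw [fourier_gaussian_innerProductSpace' hε' x v]
    -- Half the dimension is the power of π/b in the Gaussian integral, hence the decay exponent 3.
    have e3 : ((Module.finrank ℝ R6 : ℂ) / 2) = ((3 : ℕ) : ℂ) := by
      simp; norm_num
    rw [e3, Complex.cpow_natCast, norm_mul, norm_pow, norm_div]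
    have h1 : ‖Complex.exp (-(Real.pi : ℂ) ^ 2 * (‖x - v‖ : ℂ) ^ 2 / b ε)‖ ≤ 1 := by
      rw [Complex.norm_exp, Real.exp_le_one_iff]
      have : (-(Real.pi : ℂ) ^ 2 * (‖x - v‖ : ℂ) ^ 2 / b ε) =
          ((-(Real.pi ^ 2 * ‖x - v‖ ^ 2) : ℝ) : ℂ) * (b ε)⁻¹ := by
        push_cast; ring
      rw [this, Complex.re_ofReal_mul, Complex.inv_re]
      have : 0 ≤ (b ε).re / Complex.normSq (b ε) := div_nonneg hε'.le (Complex.normSq_nonneg _)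
      nlinarith [mul_nonneg (sq_nonneg Real.pi) (sq_nonneg ‖x - v‖)]
    -- Since |b| ≥ |b₀| = 4π²|ct|, the quotient is at most 1/(4π|ct|); the gain 4π is discarded.
    have h2 : ‖(Real.pi : ℂ)‖ / ‖b ε‖ ≤ |c * t|⁻¹ := by
      have hbn : |b₀| ≤ ‖b ε‖ := by
        have := Complex.abs_im_le_norm (b ε)
        simpa [b] using this
      have hpos : 0 < |c * t| := abs_pos.2 hct
      rw [hb₀'] at hbn
      have hpi : ‖(Real.pi : ℂ)‖ = Real.pi := by
        rw [Complex.norm_real, Real.norm_eq_abs, abs_of_pos Real.pi_pos]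
      rw [hpi, div_le_iff₀ (lt_of_lt_of_le (by positivity) hbn), inv_mul_eq_div,
        le_div_iff₀ hpos]
      refine le_trans ?_ hbn
      have := Real.pi_gt_three
      nlinarith [mul_pos Real.pi_pos hpos]
    calc _ ≤ (|c * t|⁻¹) ^ 3 * 1 := by gcongr
      _ = _ := mul_one _
  calc ‖∫ v, 𝓕 (g ε) v * φ v‖ ≤ ∫ v, (|c * t|⁻¹) ^ 3 * ‖φ v‖ := by
        refine norm_integral_le_of_norm_le (φ.integrable.norm.const_mul _)
          (Eventually.of_forall fun v => ?_)
        rw [norm_mul]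
        exact mul_le_mul_of_nonneg_right (hF v) (norm_nonneg _)
    _ = _ := by rw [integral_const_mul, SchwartzMap.norm_toLp_one]

end QuadNLS
end

/-! ### Interaction of atoms: the endpoint argument in a Hilbert space. -/

noncomputable section
namespace QuadNLS

theorem ENNReal_mul_le_sq_add_sq (a b : ℝ≥0∞) : a * b ≤ a ^ 2 + b ^ 2 := by
  rcases le_total a b with h | h
  · calc a * b ≤ b * b := by gcongr
      _ = b ^ 2 := (sq b).symm
      _ ≤ _ := le_add_self
  · calc a * b ≤ a * a := by gcongr
      _ = a ^ 2 := (sq a).symm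
      _ ≤ _ := le_self_add

theorem lintegral_lintegral_sub_mul {K f : ℝ → ℝ≥0∞} (hK : Measurable K) (hf : Measurable f) :
    ∫⁻ t, ∫⁻ s, K (t - s) * f s = (∫⁻ t, K t) * ∫⁻ s, f s := by
  rw [lintegral_lintegral_swap]
  · have : ∀ s, ∫⁻ t, K (t - s) * f s = (∫⁻ t, K t) * f s := fun s => by
      rw [lintegral_mul_const _ (by fun_prop), lintegral_sub_right_eq_self K s]
    simp_rw [this]
    rw [lintegral_const_mul _ hf]
  · fun_prop

theorem lintegral_inv_cube_tail {r : ℝ} (hr : 0 < r) :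
    ∫⁻ τ in Set.Ici r, ENNReal.ofReal ((τ⁻¹) ^ 3) ≤ ENNReal.ofReal ((r⁻¹) ^ 2) := by
  rw [setLIntegral_congr Ioi_ae_eq_Ici.symm]
  have h1 : ∀ τ ∈ Set.Ioi r, ENNReal.ofReal ((τ⁻¹) ^ 3) = ENNReal.ofReal (τ ^ (-3 : ℝ)) := by
    intro τ hτ
    have : 0 < τ := lt_trans hr hτ
    rw [Real.rpow_neg this.le, inv_pow]
    norm_cast
  rw [setLIntegral_congr_fun measurableSet_Ioi h1, ← ofReal_integral_eq_lintegral_ofReal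
    (integrableOn_Ioi_rpow_of_lt (by norm_num) hr)]
  · rw [integral_Ioi_rpow_of_lt (by norm_num) hr]
    apply ENNReal.ofReal_le_ofReal
    have : r ^ ((-3 : ℝ) + 1) = (r⁻¹) ^ 2 := by
      rw [show (-3 : ℝ) + 1 = -((2 : ℕ) : ℝ) by norm_num, Real.rpow_neg hr.le, Real.rpow_natCast,
        inv_pow]
    rw [this]
    have : 0 ≤ (r⁻¹) ^ 2 := by positivity
    norm_num
    positivity
  · filter_upwards [ae_restrict_mem measurableSet_Ioi] with τ hτ
    exact Real.rpow_nonneg (lt_trans hr hτ).le _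

variable {H : Type*} [NormedAddCommGroup H] [InnerProductSpace ℂ H]

/-- A path in a Hilbert space that behaves like the free evolution of a function of height
`α ^ (-16)` supported on a set of measure `α ^ 24`: it has small norm and its correlations decay. -/
structure AtomPath (C α : ℝ) (f : ℝ → ℝ≥0∞) (x : ℝ → H) : Prop where
  integrable : Integrable x
  measurable : Measurable f
  -- A function of height α^{-16} on a set of measure α^{24} has size 1 in L^{3/2}, α^{-4} in L² and
  -- α⁸ in L¹. The L² size gives the first bound and the dispersive estimate with the L¹ sizes gives
  -- the second; f carries the amplitude in time.
  norm_le : ∀ s, ‖x s‖ₑ ≤ ENNReal.ofReal ((α⁻¹) ^ 4) * f s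
  inner_le : ∀ s s', s ≠ s' → ‖inner ℂ (x s) (x s')‖ₑ ≤
    ENNReal.ofReal (C * α ^ 16 * (|s - s'|⁻¹) ^ 3) * (f s * f s')

theorem AtomPath.comp_neg {C α : ℝ} {f : ℝ → ℝ≥0∞} {x : ℝ → H} (h : AtomPath C α f x) :
    AtomPath C α (fun s => f (-s)) (fun s => x (-s)) where
  integrable := h.integrable.comp_neg
  measurable := h.measurable.comp measurable_neg
  norm_le s := h.norm_le (-s)
  inner_le s s' hs := by
    have := h.inner_le (-s) (-s') (by simpa using hs)
    rwa [show |-s - -s'| = |s - s'| by rw [← abs_neg]; congr 1; ring] at this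

/-- A kernel bounding the correlations of an `AtomPath`. -/
def atomKernel (C α τ : ℝ) : ℝ≥0∞ :=
  Set.indicator (Set.Icc (-α ^ 8) (α ^ 8)) (fun _ => ENNReal.ofReal ((α⁻¹) ^ 8)) τ +
  ENNReal.ofReal (C * α ^ 16) *
    (Set.indicator (Set.Ici (α ^ 8)) (fun τ => ENNReal.ofReal ((τ⁻¹) ^ 3)) τ +
    Set.indicator (Set.Ici (α ^ 8)) (fun τ => ENNReal.ofReal ((τ⁻¹) ^ 3)) (-τ))

theorem measurable_atomKernel (C α : ℝ) : Measurable (atomKernel C α) := by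
  unfold atomKernel
  have h : Measurable (Set.indicator (Set.Ici (α ^ 8))
      (fun τ : ℝ => ENNReal.ofReal ((τ⁻¹) ^ 3))) :=
    Measurable.indicator (by fun_prop) measurableSet_Ici
  have h2 : Measurable (Set.indicator (Set.Icc (-α ^ 8) (α ^ 8))
      (fun _ : ℝ => ENNReal.ofReal ((α⁻¹) ^ 8))) :=
    Measurable.indicator (by fun_prop) measurableSet_Icc
  exact h2.add ((h.add (h.comp measurable_neg)).const_mul _)

/-- At the crossover |τ| = α⁸ the bounds α^{-8} and α^{16}|τ|^{-3} coincide, so that both regimes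
contribute O(1), whatever the scale. -/
theorem lintegral_atomKernel_le {C α : ℝ} (hC : 0 ≤ C) (hα : 0 < α) :
    ∫⁻ τ, atomKernel C α τ ≤ ENNReal.ofReal (2 + 2 * C) := by
  unfold atomKernel
  have h : Measurable (Set.indicator (Set.Ici (α ^ 8))
      (fun τ : ℝ => ENNReal.ofReal ((τ⁻¹) ^ 3))) :=
    Measurable.indicator (by fun_prop) measurableSet_Ici
  rw [lintegral_add_left (Measurable.indicator (by fun_prop) measurableSet_Icc),
    lintegral_const_mul _ (by fun_prop), lintegral_add_left h,
    lintegral_neg_eq_self (fun τ => Set.indicator (Set.Ici (α ^ 8))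
      (fun τ => ENNReal.ofReal ((τ⁻¹) ^ 3)) τ),
    lintegral_indicator measurableSet_Icc, lintegral_indicator measurableSet_Ici]
  have h1 := lintegral_inv_cube_tail (r := α ^ 8) (by positivity)
  simp only [lintegral_const, MeasurableSet.univ, Measure.restrict_apply, Set.univ_inter,
    Real.volume_Icc]
  rw [ENNReal.ofReal_add (by norm_num) (by positivity)]
  gcongr ?_ + ?_
  · rw [← ENNReal.ofReal_mul (by positivity)]
    apply ENNReal.ofReal_le_ofReal
    rw [inv_pow]; field_simp; norm_num
  · calc _ ≤ ENNReal.ofReal (C * α ^ 16) * (ENNReal.ofReal (((α ^ 8)⁻¹) ^ 2) +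
        ENNReal.ofReal (((α ^ 8)⁻¹) ^ 2)) := by gcongr
      _ ≤ _ := by
        rw [← ENNReal.ofReal_add (by positivity) (by positivity), ← ENNReal.ofReal_mul
          (by positivity)]
        apply ENNReal.ofReal_le_ofReal
        apply le_of_eq
        field_simp
        norm_num

theorem AtomPath.inner_le_kernel {C α : ℝ} (hC : 0 ≤ C) (hα : 0 < α) {f : ℝ → ℝ≥0∞} {x : ℝ → H}
    (h : AtomPath C α f x) (s s' : ℝ) :
    ‖inner ℂ (x s) (x s')‖ₑ ≤ atomKernel C α (s - s') * (f s * f s') := by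
  by_cases hs : s - s' ∈ Set.Icc (-α ^ 8) (α ^ 8)
  · have h1 : ENNReal.ofReal ((α⁻¹) ^ 8) ≤ atomKernel C α (s - s') := by
      unfold atomKernel
      rw [Set.indicator_of_mem hs]
      exact le_self_add
    refine le_trans ?_ (mul_le_mul_left h1 _)
    have h2 : ‖inner ℂ (x s) (x s')‖ₑ ≤ ‖x s‖ₑ * ‖x s'‖ₑ := by
      simp only [← ofReal_norm]
      rw [← ENNReal.ofReal_mul (norm_nonneg _)]
      exact ENNReal.ofReal_le_ofReal (norm_inner_le_norm _ _)
    refine h2.trans ((mul_le_mul' (h.norm_le s) (h.norm_le s')).trans (le_of_eq ?_))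
    rw [show (α⁻¹) ^ 8 = (α⁻¹) ^ 4 * (α⁻¹) ^ 4 by ring, ENNReal.ofReal_mul (by positivity)]
    ring
  · have hne : s ≠ s' := by
      rintro rfl
      apply hs
      simp only [sub_self, Set.mem_Icc]
      constructor
      · have : 0 < α ^ 8 := by positivity
        linarith
      · positivity
    refine (h.inner_le s s' hne).trans (mul_le_mul_left ?_ _)
    rw [ENNReal.ofReal_mul (by positivity)]
    unfold atomKernel
    refine le_trans ?_ le_add_self
    gcongr
    have hα8 : 0 < α ^ 8 := by positivity
    rcases le_or_gt 0 (s - s') with h0 | h0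
    · have h1 : s - s' ∈ Set.Ici (α ^ 8) := by
        simp only [Set.mem_Icc, not_and_or, not_le, Set.mem_Ici] at hs ⊢
        rcases hs with hs | hs <;> linarith
      rw [Set.indicator_of_mem h1, abs_of_nonneg h0]
      exact le_self_add
    · have h1 : -(s - s') ∈ Set.Ici (α ^ 8) := by
        simp only [Set.mem_Icc, not_and_or, not_le, Set.mem_Ici] at hs ⊢
        rcases hs with hs | hs <;> linarith
      rw [Set.indicator_of_mem h1, abs_of_neg h0]
      exact le_add_self

variable [CompleteSpace H]

/-- The squared norm is the inner product of the integral with itself, and moving it under both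
integrals leaves only correlations: the TT* step. -/
theorem enorm_integral_sq_le (x : ℝ → H) {J : Set ℝ} (hx : IntegrableOn x J) :
    ‖∫ s in J, x s‖ₑ ^ 2 ≤ ∫⁻ s in J, ∫⁻ s' in J, ‖inner ℂ (x s') (x s)‖ₑ := by
  set I := ∫ s in J, x s with hI
  have h1 : ‖I‖ₑ ^ 2 = ‖inner ℂ I I‖ₑ := by
    rw [inner_self_eq_norm_sq_to_K, enorm_pow]
    simp [← ofReal_norm]
  have h2 : inner ℂ I I = ∫ s in J, inner ℂ I (x s) := by
    conv_lhs => rw [hI]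
    exact (integral_inner hx I).symm
  rw [h1, h2]
  refine (enorm_integral_le_lintegral_enorm _).trans (lintegral_mono fun s => ?_)
  have h3 : inner ℂ I (x s) = ∫ s' in J, inner ℂ (x s') (x s) := by
    rw [← inner_conj_symm, hI, ← integral_inner hx (x s), ← integral_conj]
    simp
  rw [h3]
  exact enorm_integral_le_lintegral_enorm _

/-- Time localized Strichartz estimate for atoms. -/
theorem AtomPath.enorm_integral_sq_le {C α : ℝ} (hC : 0 ≤ C) (hα : 0 < α) {f : ℝ → ℝ≥0∞}
    {x : ℝ → H} (h : AtomPath C α f x) {J : Set ℝ} (hJ : MeasurableSet J) :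
    ‖∫ s in J, x s‖ₑ ^ 2 ≤ ENNReal.ofReal (4 + 4 * C) * ∫⁻ s in J, f s ^ 2 := by
  refine (QuadNLS.enorm_integral_sq_le x h.integrable.integrableOn).trans ?_
  have hK := measurable_atomKernel C α
  have hf := h.measurable
  set F : ℝ → ℝ≥0∞ := J.indicator (fun s => f s ^ 2) with hF
  have hFm : Measurable F := (hf.pow_const 2).indicator hJ
  have hFi : ∫⁻ s, F s = ∫⁻ s in J, f s ^ 2 := lintegral_indicator hJ _
  -- Schur's test: the product of the two amplitudes is bounded by the sum of their squares, and
  -- each square is then integrated against the kernel in the variable on which it does not depend.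
  have h1 : ∫⁻ s in J, ∫⁻ s' in J, ‖inner ℂ (x s') (x s)‖ₑ ≤
      ∫⁻ s, ((∫⁻ s', atomKernel C α (s' - s) * F s') +
        ∫⁻ s', atomKernel C α (s' - s) * F s) := by
    rw [← lintegral_indicator hJ]
    refine lintegral_mono fun s => ?_
    by_cases hs : s ∈ J
    · rw [Set.indicator_of_mem hs, ← lintegral_add_left (by fun_prop), ← lintegral_indicator hJ]
      refine lintegral_mono fun s' => ?_
      by_cases hs' : s' ∈ J
      · rw [Set.indicator_of_mem hs']
        refine (h.inner_le_kernel hC hα s' s).trans ?_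
        rw [← mul_add]
        gcongr
        rw [hF, Set.indicator_of_mem hs, Set.indicator_of_mem hs']
        exact ENNReal_mul_le_sq_add_sq _ _
      · rw [Set.indicator_of_notMem hs']
        exact zero_le
    · rw [Set.indicator_of_notMem hs]
      exact zero_le
  refine h1.trans ?_
  have h2 : ∀ s, ∫⁻ s', atomKernel C α (s' - s) * F s = (∫⁻ τ, atomKernel C α τ) * F s :=
    fun s => by
      rw [lintegral_mul_const _ (by fun_prop), lintegral_sub_right_eq_self (atomKernel C α) s]
  have h3 : ∫⁻ s, ∫⁻ s', atomKernel C α (s' - s) * F s' = (∫⁻ τ, atomKernel C α τ) * ∫⁻ s, F s := by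
    have := lintegral_lintegral_sub_mul (K := fun τ => atomKernel C α (-τ)) (f := F)
      (by fun_prop) hFm
    simp only [neg_sub] at this
    rw [this, lintegral_neg_eq_self (atomKernel C α)]
  rw [lintegral_add_right _ (by simp_rw [h2]; fun_prop), h3]
  simp_rw [h2]
  rw [lintegral_const_mul _ hFm, hFi, ← add_mul, ← two_mul]
  gcongr
  calc 2 * ∫⁻ τ, atomKernel C α τ ≤ 2 * ENNReal.ofReal (2 + 2 * C) := by
        gcongr; exact lintegral_atomKernel_le hC hα
    _ = ENNReal.ofReal (4 + 4 * C) := by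
        rw [show (2 : ℝ≥0∞) = ENNReal.ofReal 2 by simp, ← ENNReal.ofReal_mul (by norm_num)]
        congr 1; ring

/-- The retarded interaction of two atoms of different scales. -/
theorem lintegral_retarded_atoms_le {C α β : ℝ} (hC : 0 ≤ C) (hα : 0 < α) (hαβ : α ≤ β)
    {f g : ℝ → ℝ≥0∞} {x y : ℝ → H} (hx : AtomPath C α f x) (hy : AtomPath C β g y)
    (hxy : ∀ s t, s ≠ t → ‖inner ℂ (y t) (x s)‖ₑ ≤
      ENNReal.ofReal (C * α ^ 8 * β ^ 8 * (|t - s|⁻¹) ^ 3) * (f s * g t)) :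
    ∫⁻ t, ‖inner ℂ (y t) (∫ s in Set.Iio t, x s)‖ₑ ≤
      ENNReal.ofReal ((5 + 5 * C) * (α / β)) * ((∫⁻ s, f s ^ 2) + ∫⁻ t, g t ^ 2) := by
  have hβ : 0 < β := lt_of_lt_of_le hα hαβ
  -- The cut between near and far times. For t - s < m, Cauchy–Schwarz and the localized estimate
  -- for x give β⁻⁴ m^{1/2} = α/β; for t - s ≥ m, dispersion gives α⁸β⁸m⁻² = (α/β)⁴. Both are
  -- positive powers of the ratio of scales.
  set m : ℝ := α ^ 2 * β ^ 6 with hm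
  have hm0 : 0 < m := by positivity
  have hf := hx.measurable
  have hg := hy.measurable
  set near : ℝ → ℝ≥0∞ := Set.indicator (Set.Ico 0 m) (fun _ => 1) with hnear
  have hnear_m : Measurable near := Measurable.indicator (by fun_prop) measurableSet_Ico
  set far : ℝ → ℝ≥0∞ := Set.indicator (Set.Ici m) (fun τ => ENNReal.ofReal ((τ⁻¹) ^ 3)) with hfar
  have hfar_m : Measurable far := Measurable.indicator (by fun_prop) measurableSet_Ici
  have hpt : ∀ t, ‖inner ℂ (y t) (∫ s in Set.Iio t, x s)‖ₑ ≤
      ENNReal.ofReal (α / β) * (g t ^ 2 + ENNReal.ofReal ((4 + 4 * C) * m⁻¹) *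
        ∫⁻ s, near (t - s) * f s ^ 2) +
      ENNReal.ofReal (C * α ^ 8 * β ^ 8) * (∫⁻ s, far (t - s) * f s ^ 2 +
        far (t - s) * g t ^ 2) := by
    intro t
    have hsplit : ∫ s in Set.Iio t, x s =
        (∫ s in Set.Ioo (t - m) t, x s) + ∫ s in Set.Iic (t - m), x s := by
      have hu : Set.Iio t = Set.Ioo (t - m) t ∪ Set.Iic (t - m) := by
        ext s
        simp only [Set.mem_Iio, Set.mem_union, Set.mem_Ioo, Set.mem_Iic]
        constructor
        · intro h
          rcases lt_or_ge (t - m) s with h' | h'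
          · exact Or.inl ⟨h', h⟩
          · exact Or.inr h'
        · rintro (h | h)
          · exact h.2
          · linarith
      rw [hu]
      refine setIntegral_union ?_ measurableSet_Iic hx.integrable.integrableOn
        hx.integrable.integrableOn
      rw [Set.disjoint_left]
      intro s hs hs'
      exact absurd hs.1 (not_lt.2 hs')
    rw [hsplit, inner_add_right]
    refine (enorm_add_le _ _).trans (add_le_add ?_ ?_)
    · set I := ∫ s in Set.Ioo (t - m) t, x s with hI
      have hI2 : ‖I‖ₑ ^ 2 ≤ ENNReal.ofReal (4 + 4 * C) * ∫⁻ s, near (t - s) * f s ^ 2 := by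
        refine (hx.enorm_integral_sq_le hC hα measurableSet_Ioo).trans (mul_le_mul_right ?_ _)
        rw [← lintegral_indicator measurableSet_Ioo]
        refine lintegral_mono fun s => ?_
        by_cases hs : s ∈ Set.Ioo (t - m) t
        · have : t - s ∈ Set.Ico 0 m := ⟨by linarith [hs.2], by linarith [hs.1]⟩
          rw [Set.indicator_of_mem hs, hnear, Set.indicator_of_mem this, one_mul]
        · rw [Set.indicator_of_notMem hs]
          exact zero_le
      have h2 : ‖inner ℂ (y t) I‖ₑ ≤ ‖y t‖ₑ * ‖I‖ₑ := by
        simp only [← ofReal_norm]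
        rw [← ENNReal.ofReal_mul (norm_nonneg _)]
        exact ENNReal.ofReal_le_ofReal (norm_inner_le_norm _ _)
      calc ‖inner ℂ (y t) I‖ₑ ≤ (ENNReal.ofReal ((β⁻¹) ^ 4) * g t) * ‖I‖ₑ :=
            h2.trans (mul_le_mul_left (hy.norm_le t) _)
        -- The weight αβ³ is the square root of m: after squaring, it cancels the length of the time
        -- window.
        _ = ENNReal.ofReal (α / β) * (g t * (ENNReal.ofReal ((α * β ^ 3)⁻¹) * ‖I‖ₑ)) := by
            have : (β⁻¹) ^ 4 = α / β * (α * β ^ 3)⁻¹ := by field_simp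
            rw [this, ENNReal.ofReal_mul (by positivity)]
            ring
        _ ≤ ENNReal.ofReal (α / β) * (g t ^ 2 + (ENNReal.ofReal ((α * β ^ 3)⁻¹) * ‖I‖ₑ) ^ 2) := by
            gcongr
            exact ENNReal_mul_le_sq_add_sq _ _
        _ ≤ _ := by
            gcongr
            rw [mul_pow, ← ENNReal.ofReal_pow (by positivity)]
            have : ((α * β ^ 3)⁻¹) ^ 2 = m⁻¹ := by rw [hm]; field_simp
            rw [this, mul_comm (4 + 4 * C), ENNReal.ofReal_mul (by positivity), mul_assoc]
            gcongr
    · have h3 : inner ℂ (y t) (∫ s in Set.Iic (t - m), x s) =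
          ∫ s in Set.Iic (t - m), inner ℂ (y t) (x s) :=
        (integral_inner hx.integrable.integrableOn (y t)).symm
      rw [h3]
      refine (enorm_integral_le_lintegral_enorm _).trans ?_
      rw [← lintegral_const_mul _ (by fun_prop), ← lintegral_indicator measurableSet_Iic]
      refine lintegral_mono fun s => ?_
      by_cases hs : s ∈ Set.Iic (t - m)
      · have hs' : t - s ∈ Set.Ici m := by
          have : s ≤ t - m := hs
          show m ≤ t - s
          linarith
        have hts : 0 < t - s := lt_of_lt_of_le hm0 hs'
        rw [Set.indicator_of_mem hs, hfar, Set.indicator_of_mem hs']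
        refine (hxy s t (by linarith [hts] |> ne_of_lt)).trans ?_
        rw [ENNReal.ofReal_mul (by positivity), abs_of_pos hts, mul_assoc, ← mul_add]
        gcongr
        exact ENNReal_mul_le_sq_add_sq _ _
      · rw [Set.indicator_of_notMem hs]
        exact zero_le
  refine (lintegral_mono hpt).trans ?_
  set A := ∫⁻ s, f s ^ 2 with hA
  set B := ∫⁻ t, g t ^ 2 with hB
  have hnear_i : ∫⁻ t, near t = ENNReal.ofReal m := by
    rw [hnear, lintegral_indicator measurableSet_Ico]
    simp
  have hfar_i : ∫⁻ t, far t ≤ ENNReal.ofReal ((m⁻¹) ^ 2) := by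
    rw [hfar, lintegral_indicator measurableSet_Ici]
    exact lintegral_inv_cube_tail hm0
  have e1 : ∫⁻ t, ∫⁻ s, near (t - s) * f s ^ 2 = ENNReal.ofReal m * A := by
    rw [lintegral_lintegral_sub_mul hnear_m (hf.pow_const 2), hnear_i]
  have e2 : ∫⁻ t, ∫⁻ s, (far (t - s) * f s ^ 2 + far (t - s) * g t ^ 2) ≤
      ENNReal.ofReal ((m⁻¹) ^ 2) * (A + B) := by
    have : ∀ t, ∫⁻ s, (far (t - s) * f s ^ 2 + far (t - s) * g t ^ 2) =
        (∫⁻ s, far (t - s) * f s ^ 2) + (∫⁻ τ, far τ) * g t ^ 2 := fun t => by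
      rw [lintegral_add_left (by fun_prop), lintegral_mul_const _ (by fun_prop),
        lintegral_sub_left_eq_self far t]
    simp_rw [this]
    rw [lintegral_add_right _ (by fun_prop), lintegral_lintegral_sub_mul hfar_m (hf.pow_const 2),
      lintegral_const_mul _ (by fun_prop), ← mul_add]
    gcongr
  have mI : Measurable fun t => ∫⁻ s, near (t - s) * f s ^ 2 :=
    Measurable.lintegral_prod_right' (f := fun p : ℝ × ℝ => near (p.1 - p.2) * f p.2 ^ 2)
      (by fun_prop)
  have mF : Measurable fun t => ∫⁻ s, (far (t - s) * f s ^ 2 + far (t - s) * g t ^ 2) :=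
    Measurable.lintegral_prod_right' (f := fun p : ℝ × ℝ => far (p.1 - p.2) * f p.2 ^ 2 +
      far (p.1 - p.2) * g p.1 ^ 2) (by fun_prop)
  rw [lintegral_add_left (by fun_prop), lintegral_const_mul _ (by fun_prop),
    lintegral_const_mul _ mF, lintegral_add_left (by fun_prop), lintegral_const_mul _ mI, e1]
  have hαβ1 : α / β ≤ 1 := (div_le_one hβ).2 hαβ
  have hαβ0 : 0 < α / β := by positivity
  calc _ ≤ ENNReal.ofReal (α / β) * (B + ENNReal.ofReal ((4 + 4 * C) * m⁻¹) *
        (ENNReal.ofReal m * A)) + ENNReal.ofReal (C * α ^ 8 * β ^ 8) *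
          (ENNReal.ofReal ((m⁻¹) ^ 2) * (A + B)) := by gcongr
    _ = ENNReal.ofReal (α / β) * (B + ENNReal.ofReal (4 + 4 * C) * A) +
          ENNReal.ofReal (C * (α / β) ^ 4) * (A + B) := by
        rw [← mul_assoc (ENNReal.ofReal ((4 + 4 * C) * m⁻¹)), ← ENNReal.ofReal_mul (by positivity),
          ← mul_assoc (ENNReal.ofReal (C * α ^ 8 * β ^ 8)), ← ENNReal.ofReal_mul (by positivity)]
        have e3 : (4 + 4 * C) * m⁻¹ * m = 4 + 4 * C := by field_simp
        have e4 : C * α ^ 8 * β ^ 8 * (m⁻¹) ^ 2 = C * (α / β) ^ 4 := by rw [hm]; field_simp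
        rw [e3, e4]
    _ ≤ ENNReal.ofReal (α / β) * (ENNReal.ofReal (4 + 4 * C) * B + ENNReal.ofReal (4 + 4 * C) * A) +
          ENNReal.ofReal ((1 + C) * (α / β)) * (A + B) := by
        have k1 : B ≤ ENNReal.ofReal (4 + 4 * C) * B := by
          refine le_mul_of_one_le_left zero_le ?_
          rw [← ENNReal.ofReal_one]
          exact ENNReal.ofReal_le_ofReal (by linarith)
        have k2 : C * (α / β) ^ 4 ≤ (1 + C) * (α / β) := by
          have : (α / β) ^ 4 ≤ α / β := by
            calc (α / β) ^ 4 ≤ (α / β) ^ 1 := pow_le_pow_of_le_one hαβ0.le hαβ1 (by norm_num)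
              _ = _ := pow_one _
          nlinarith
        gcongr
    _ = _ := by
        rw [← mul_add, add_comm B A, ← mul_assoc, ← ENNReal.ofReal_mul (by positivity), ← add_mul,
          ← ENNReal.ofReal_add (by positivity) (by positivity)]
        congr 2
        ring

/-- When β < α, Fubini and the substitution (s, t) ↦ (-t, -s), which preserves the order of the two
times, exchange the roles of x and y. -/
theorem enorm_retarded_atoms_le {C α β : ℝ} (hC : 0 ≤ C) (hα : 0 < α) (hβ : 0 < β)
    {f g : ℝ → ℝ≥0∞} {x y : ℝ → H} (hx : AtomPath C α f x) (hy : AtomPath C β g y)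
    (hxy : ∀ s t, s ≠ t → ‖inner ℂ (y t) (x s)‖ₑ ≤
      ENNReal.ofReal (C * α ^ 8 * β ^ 8 * (|t - s|⁻¹) ^ 3) * (f s * g t)) :
    ‖∫ t, inner ℂ (y t) (∫ s in Set.Iio t, x s)‖ₑ ≤
      ENNReal.ofReal ((5 + 5 * C) * min (α / β) (β / α)) *
        ((∫⁻ s, f s ^ 2) + ∫⁻ t, g t ^ 2) := by
  rcases le_total α β with h | h
  · have : min (α / β) (β / α) = α / β := min_eq_left (by
      rw [div_le_div_iff₀ hβ hα]; nlinarith)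
    rw [this]
    exact (enorm_integral_le_lintegral_enorm _).trans
      (lintegral_retarded_atoms_le hC hα h hx hy hxy)
  · have : min (α / β) (β / α) = β / α := min_eq_right (by
      rw [div_le_div_iff₀ hα hβ]; nlinarith)
    rw [this]
    have hxyi : Integrable (fun p : ℝ × ℝ => Set.indicator {p : ℝ × ℝ | p.2 < p.1}
        (fun p => inner ℂ (y p.1) (x p.2)) p) (volume.prod volume) := by
      refine Integrable.indicator ?_ (measurableSet_lt measurable_snd measurable_fst)
      refine (hy.integrable.norm.mul_prod hx.integrable.norm).mono' ?_
        (Eventually.of_forall fun p => norm_inner_le_norm _ _)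
      exact (hy.integrable.1.comp_fst).inner (hx.integrable.1.comp_snd)
    have e1 : ∫ t, inner ℂ (y t) (∫ s in Set.Iio t, x s) =
        ∫ s, inner ℂ (∫ t in Set.Ioi s, y t) (x s) := by
      have l1 : ∀ t, inner ℂ (y t) (∫ s in Set.Iio t, x s) =
          ∫ s, Set.indicator {p : ℝ × ℝ | p.2 < p.1} (fun p => inner ℂ (y p.1) (x p.2)) (t, s) := by
        intro t
        rw [← integral_inner hx.integrable.integrableOn (y t), ← integral_indicator measurableSet_Iio]
        rfl
      have l2 : ∀ s, inner ℂ (∫ t in Set.Ioi s, y t) (x s) =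
          ∫ t, Set.indicator {p : ℝ × ℝ | p.2 < p.1} (fun p => inner ℂ (y p.1) (x p.2)) (t, s) := by
        intro s
        rw [← inner_conj_symm, ← integral_inner hy.integrable.integrableOn (x s), ← integral_conj,
          ← integral_indicator measurableSet_Ioi]
        simp only [inner_conj_symm]
        rfl
      simp_rw [l1, l2]
      exact integral_integral_swap hxyi
    have e2 : ∫⁻ s, ‖inner ℂ (∫ t in Set.Ioi s, y t) (x s)‖ₑ =
        ∫⁻ t, ‖inner ℂ (x (-t)) (∫ s in Set.Iio t, y (-s))‖ₑ := by
      rw [← lintegral_neg_eq_self]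
      refine lintegral_congr fun t => ?_
      have : ∫ s in Set.Iio t, y (-s) = ∫ s in Set.Ioi (-t), y s := by
        rw [← integral_Iic_eq_integral_Iio]
        exact integral_comp_neg_Iic t y
      rw [this, ← inner_conj_symm, RCLike.enorm_conj]
    rw [e1]
    refine (enorm_integral_le_lintegral_enorm _).trans ?_
    rw [e2, add_comm (∫⁻ s, f s ^ 2)]
    have := lintegral_retarded_atoms_le hC hβ h hy.comp_neg hx.comp_neg (fun s t hst => by
      have := hxy (-t) (-s) (by simpa using hst.symm)
      rw [← inner_conj_symm, RCLike.enorm_conj]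
      rw [show |-s - -t| = |t - s| by congr 1; ring] at this
      refine this.trans (le_of_eq ?_)
      rw [mul_comm (f (-t))]
      congr 2
      ring)
    rwa [lintegral_neg_eq_self (fun t => f t ^ 2), lintegral_neg_eq_self (fun t => g t ^ 2)] at this

end QuadNLS
end

/-! ### Recovering Lᵖ norms by testing with Schwartz functions. -/

noncomputable section
namespace QuadNLS

theorem enorm_integral_mul_le {p q : ℝ≥0∞} [ENNReal.HolderConjugate p q] {f g : R6 → ℂ}
    (hf : AEStronglyMeasurable f volume) (hg : AEStronglyMeasurable g volume) :
    ‖∫ x, f x * g x‖ₑ ≤ eLpNorm f p volume * eLpNorm g q volume := by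
  refine (enorm_integral_le_lintegral_enorm _).trans ?_
  rw [← eLpNorm_one_eq_lintegral_enorm]
  change eLpNorm (f • g) 1 volume ≤ _
  exact eLpNorm_smul_le_mul_eLpNorm (p := p) (q := q) (r := 1) hg hf

theorem integrable_mul_of_memLp {p q : ℝ≥0∞} [ENNReal.HolderConjugate p q] {f g : R6 → ℂ}
    (hf : MemLp f p volume) (hg : MemLp g q volume) : Integrable (fun x => f x * g x) volume :=
  memLp_one_iff_integrable.1 (hg.smul (r := 1) hf)

theorem rpow_exponent_sub_le {q : ℝ≥0∞} (hq1 : 1 ≤ q) (hq2 : q ≤ 2) {a : ℝ≥0∞} {V : ℝ} (hV : 0 ≤ V)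
    (ha : a ≤ ENNReal.ofReal V) :
    a ^ (1 / q.toReal - 1 / (2 : ℝ≥0∞).toReal) ≤ ENNReal.ofReal (1 + V) := by
  have h1 : q ≠ ⊤ := ne_top_of_le_ne_top (by norm_num) hq2
  have h3 : q.toReal ≤ 2 := by simpa using ENNReal.toReal_mono (by norm_num) hq2
  have h4 : 1 ≤ q.toReal := by simpa using ENNReal.toReal_mono h1 hq1
  have h5 := one_div_le_one_div_of_le (by linarith) h3
  have h6 : 1 / q.toReal ≤ 1 := by rw [div_le_one (by linarith)]; exact h4
  simp only [ENNReal.toReal_ofNat]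
  have h7 : a ≤ ENNReal.ofReal (1 + V) := ha.trans (ENNReal.ofReal_le_ofReal (by linarith))
  refine (ENNReal.rpow_le_rpow h7 (by linarith)).trans ?_
  calc _ ≤ ENNReal.ofReal (1 + V) ^ (1 : ℝ) := by
        refine ENNReal.rpow_le_rpow_of_exponent_le ?_ (by linarith)
        rw [← ENNReal.ofReal_one]
        exact ENNReal.ofReal_le_ofReal (by linarith)
    _ = _ := ENNReal.rpow_one _

theorem exists_smooth_cutoff {R : ℝ} (hR : 0 < R) : ∃ b : R6 → ℝ, ContDiff ℝ ∞ b ∧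
    (∀ x, 0 ≤ b x ∧ b x ≤ 1) ∧ (∀ x, ‖x‖ ≤ R → b x = 1) ∧ ∀ x, R + 1 ≤ ‖x‖ → b x = 0 := by
  let b : ContDiffBump (0 : R6) := ⟨R, R + 1, hR, by linarith⟩
  exact ⟨b, b.contDiff, fun x => ⟨b.nonneg, b.le_one⟩,
    fun x hx => b.one_of_mem_closedBall (by simpa [b] using hx),
    fun x hx => b.zero_of_le_dist (by simpa [b] using hx)⟩

/-- Simultaneous approximation in all `L^q` with `1 ≤ q ≤ 2`. -/
theorem exists_schwartz_eLpNorm_sub_le {f : R6 → ℂ} (hf : MemLp f 2 volume) {R : ℝ}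
    (hR : ∀ x, R < ‖x‖ → f x = 0) {δ : ℝ} (hδ : 0 < δ) :
    ∃ φ : 𝓢(R6, ℂ), ∀ q : ℝ≥0∞, 1 ≤ q → q ≤ 2 →
      eLpNorm (fun x => f x - φ x) q volume ≤ ENNReal.ofReal δ := by
  set R' : ℝ := max R 1
  have hR'0 : 0 < R' := lt_of_lt_of_le one_pos (le_max_right _ _)
  set B : Set R6 := Metric.closedBall 0 (R' + 1)
  set V : ℝ := (volume B).toReal with hV
  have hVt : volume B ≠ ⊤ := (isCompact_closedBall (0 : R6) (R' + 1)).measure_lt_top.ne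
  -- The error is supported in a ball of volume V, on which passing from L² to L^q costs at most 1 +
  -- V for every q in [1, 2]. One L² approximation therefore serves all these exponents.
  set δ' : ℝ := δ / (1 + V)
  have hδ' : 0 < δ' := by positivity
  obtain ⟨g, hgc, hgs, hg⟩ := hf.exist_eLpNorm_sub_le (by norm_num) (by norm_num) hδ'
  obtain ⟨b, hbs, hb01, hb1, hb0⟩ := exists_smooth_cutoff hR'0
  have hsm : ContDiff ℝ ∞ (fun x => b x • g x) := hbs.smul hgs
  have hcs : HasCompactSupport (fun x => b x • g x) :=
    hgc.mono fun x hx => by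
      rw [Function.mem_support] at hx ⊢
      exact right_ne_zero_of_smul hx
  refine ⟨hcs.toSchwartzMap hsm, fun q hq1 hq2 => ?_⟩
  have key : ∀ x, f x - b x • g x = b x • (f x - g x) := by
    intro x
    by_cases hx : ‖x‖ ≤ R'
    · simp [hb1 x hx]
    · rw [hR x ((le_max_left _ _).trans_lt (not_le.1 hx))]
      simp
  have hind : (fun x => f x - b x • g x) = B.indicator (fun x => f x - b x • g x) := by
    funext x
    by_cases hx : x ∈ B
    · simp [hx]
    · rw [Set.indicator_of_notMem hx, key, hb0, zero_smul]
      simp only [B, Metric.mem_closedBall, not_le, dist_zero_right] at hx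
      exact hx.le
  have h2 : eLpNorm (fun x => f x - b x • g x) 2 (volume.restrict B) ≤ ENNReal.ofReal δ' := by
    refine (eLpNorm_restrict_le _ _ _ _).trans (le_trans (eLpNorm_mono fun x => ?_) hg)
    rw [key, norm_smul, Real.norm_of_nonneg (hb01 x).1]
    exact mul_le_of_le_one_left (norm_nonneg _) (hb01 x).2
  have hme : AEStronglyMeasurable (fun x => f x - b x • g x) (volume.restrict B) :=
    (hf.1.sub hsm.continuous.aestronglyMeasurable).restrict
  have hφ : (fun x => f x - hcs.toSchwartzMap hsm x) = fun x => f x - b x • g x := rfl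
  rw [hφ, hind, eLpNorm_indicator_eq_eLpNorm_restrict Metric.isClosed_closedBall.measurableSet]
  refine (eLpNorm_le_eLpNorm_mul_rpow_measure_univ hq2 hme).trans ?_
  have hvol := rpow_exponent_sub_le hq1 hq2 (a := (volume.restrict B) Set.univ) (V := V)
    ENNReal.toReal_nonneg (by rw [Measure.restrict_apply_univ, ENNReal.ofReal_toReal hVt])
  calc _ ≤ ENNReal.ofReal δ' * ENNReal.ofReal (1 + V) := mul_le_mul' h2 hvol
    _ = ENNReal.ofReal δ := by
      rw [← ENNReal.ofReal_mul hδ'.le]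
      congr 1
      exact div_mul_cancel₀ _ (by positivity)

/-- The exponents q and e + 1 are conjugate, and the extremizer of the dual problem is the conjugate
of g times |g|^{e-1}. Truncation makes its norms finite, so that it can be approximated by Schwartz
functions and the resulting N^{e+1} ≤ K N^e can be divided by N^e. Membership of g in L^r only
serves to pass to the limit in the pairing. -/
theorem eLpNorm_indicator_le_of_forall_schwartz {e : ℕ} (he : 1 ≤ e) {r r' q : ℝ≥0∞}
    [ENNReal.HolderConjugate r r'] (hr'1 : 1 ≤ r') (hr'2 : r' ≤ 2)
    (hqe : q * e = (e + 1 : ℕ)) (hq1 : 1 ≤ q) (hq2 : q ≤ 2) {g : R6 → ℂ} (hgm : StronglyMeasurable g)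
    (hg : MemLp g r volume) {K : ℝ≥0∞}
    (h : ∀ φ : 𝓢(R6, ℂ), ‖∫ x, g x * φ x‖ₑ ≤ K * eLpNorm φ q volume) (n : ℕ) :
    eLpNorm ({x | ‖x‖ ≤ n ∧ ‖g x‖ ≤ n}.indicator g) (e + 1 : ℕ) volume ≤ K := by
  by_cases hK : K = ⊤
  · simp [hK]
  set E : Set R6 := {x | ‖x‖ ≤ n ∧ ‖g x‖ ≤ n}
  have hE : MeasurableSet E :=
    (measurableSet_le measurable_norm measurable_const).inter
      (measurableSet_le hgm.norm.measurable measurable_const)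
  set gE := E.indicator g
  have hgE : StronglyMeasurable gE := hgm.indicator hE
  have hgEn : ∀ x, ‖gE x‖ ≤ n := fun x => by
    by_cases hx : x ∈ E
    · simp only [gE, Set.indicator_of_mem hx]; exact hx.2
    · simp [gE, hx]
  have hgE0 : ∀ x, (n : ℝ) < ‖x‖ → gE x = 0 := fun x hx =>
    Set.indicator_of_notMem (fun hm => absurd hm.1 (not_le.2 hx)) _
  have hfin : volume E ≠ ⊤ := by
    refine ne_top_of_le_ne_top (isCompact_closedBall (0 : R6) n).measure_lt_top.ne
      (measure_mono fun x hx => by simpa using hx.1)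
  have hbdd : ∀ (f : R6 → ℂ) (C : ℝ) (p : ℝ≥0∞), AEStronglyMeasurable f volume →
      (∀ x, ‖f x‖ ≤ C) → (∀ x, x ∉ E → f x = 0) → MemLp f p volume := by
    intro f C p hf hC h0
    have h1 : E.indicator f = f := by
      funext x
      by_cases hx : x ∈ E
      · simp [hx]
      · simp [hx, h0 x hx]
    rw [← h1, memLp_indicator_iff_restrict hE]
    have : IsFiniteMeasure (volume.restrict E) := ⟨by simpa using hfin.lt_top⟩
    exact MemLp.of_bound hf.restrict C (Eventually.of_forall hC)
  set hh : R6 → ℂ := fun x => (starRingEnd ℂ) (gE x) * ((‖gE x‖ ^ (e - 1) : ℝ) : ℂ)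
  have hhm : AEStronglyMeasurable hh volume := by
    have h1 : StronglyMeasurable fun x => (starRingEnd ℂ) (gE x) :=
      Complex.continuous_conj.comp_stronglyMeasurable hgE
    have h2 : StronglyMeasurable fun x => ((‖gE x‖ ^ (e - 1) : ℝ) : ℂ) :=
      Complex.continuous_ofReal.comp_stronglyMeasurable (hgE.norm.pow _)
    exact (h1.mul h2).aestronglyMeasurable
  have hhnorm : ∀ x, ‖hh x‖ = ‖gE x‖ ^ e := fun x => by
    simp only [hh, norm_mul, RCLike.norm_conj, Complex.norm_real, Real.norm_eq_abs, abs_pow,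
      abs_norm]
    rw [← pow_succ']
    congr 1
    omega
  have hhbd : ∀ x, ‖hh x‖ ≤ (n : ℝ) ^ e := fun x => by
    rw [hhnorm]; exact pow_le_pow_left₀ (norm_nonneg _) (hgEn x) _
  have hh0 : ∀ x, x ∉ E → hh x = 0 := fun x hx => by
    rw [← norm_eq_zero, hhnorm]
    simp [gE, hx]
    omega
  have hh2 : MemLp hh 2 volume := hbdd hh _ 2 hhm hhbd hh0
  have hhr : MemLp hh r' volume := hbdd hh _ r' hhm hhbd hh0
  have hprod : ∀ x, g x * hh x = ((‖gE x‖ ^ (e + 1) : ℝ) : ℂ) := fun x => by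
    by_cases hx : x ∈ E
    · have : gE x = g x := by simp [gE, hx]
      simp only [hh]
      rw [this, ← mul_assoc, Complex.mul_conj, Complex.normSq_eq_norm_sq]
      push_cast
      rw [← pow_add]
      congr 1
      omega
    · rw [hh0 x hx]
      simp [gE, hx]
  set N := eLpNorm gE (e + 1 : ℕ) volume
  have hNt : N ≠ ⊤ := (hbdd gE n _ hgE.aestronglyMeasurable hgEn
    (fun x hx => by simp [gE, hx])).2.ne
  have hNpow : ‖∫ x, g x * hh x‖ₑ = N ^ (e + 1) := by
    simp only [hprod]
    rw [integral_complex_ofReal]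
    have h1 : (∫ x, ‖gE x‖ ^ (e + 1)) = (N ^ (e + 1)).toReal := by
      have h2 := eLpNorm_nnreal_pow_eq_lintegral (f := gE) (μ := volume) (p := ((e + 1 : ℕ) : ℝ≥0))
        (by positivity)
      have hm : AEStronglyMeasurable (fun x => ‖gE x‖ ^ (e + 1)) volume :=
        (hgE.norm.pow _).aestronglyMeasurable
      rw [integral_eq_lintegral_of_nonneg_ae
        (Eventually.of_forall fun x => pow_nonneg (norm_nonneg _) _) hm]
      congr 1
      have h3 : (((e + 1 : ℕ) : ℝ≥0) : ℝ) = ((e + 1 : ℕ) : ℝ) := by simp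
      rw [h3, ENNReal.rpow_natCast] at h2
      simp only [N]
      have h4 : (((e + 1 : ℕ) : ℝ≥0) : ℝ≥0∞) = ((e + 1 : ℕ) : ℝ≥0∞) := by simp
      rw [h4] at h2
      rw [h2]
      refine lintegral_congr fun x => ?_
      rw [ENNReal.rpow_natCast, ← ofReal_norm, ENNReal.ofReal_pow (norm_nonneg _)]
    rw [h1, ← ofReal_norm]
    simp only [Complex.norm_real, Real.norm_eq_abs, ENNReal.abs_toReal]
    rw [ENNReal.ofReal_toReal (ENNReal.pow_ne_top hNt)]
  have hhq : eLpNorm hh q volume = N ^ e := by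
    have h1 : eLpNorm hh q volume = eLpNorm (fun x => ‖gE x‖ ^ (e : ℝ)) q volume :=
      eLpNorm_congr_norm_ae (Eventually.of_forall fun x => by
        rw [hhnorm, Real.rpow_natCast, Real.norm_of_nonneg (by positivity)])
    rw [h1, eLpNorm_norm_rpow _ (by exact_mod_cast he)]
    simp only [ENNReal.ofReal_natCast, hqe, ENNReal.rpow_natCast, N]
  have hlim : N ^ (e + 1) ≤ K * N ^ e := by
    have hb : ∀ δ : ℝ, 0 < δ → N ^ (e + 1) ≤
        K * (N ^ e + ENNReal.ofReal δ) + eLpNorm g r volume * ENNReal.ofReal δ := by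
      intro δ hδ
      obtain ⟨φ, hφ⟩ := exists_schwartz_eLpNorm_sub_le hh2
        (R := n) (fun x hx => hh0 x fun hm => absurd hm.1 (not_le.2 hx)) hδ
      have i1 : Integrable (fun x => g x * φ x) volume :=
        integrable_mul_of_memLp hg (φ.memLp r' volume)
      have i2 : Integrable (fun x => g x * (hh x - φ x)) volume :=
        integrable_mul_of_memLp hg (hhr.sub (φ.memLp r' volume))
      have e1 : ∫ x, g x * hh x = (∫ x, g x * φ x) + ∫ x, g x * (hh x - φ x) := by
        rw [← integral_add i1 i2]
        congr 1; funext x; ring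
      rw [← hNpow, e1]
      refine (enorm_add_le _ _).trans (add_le_add ((h φ).trans ?_) ?_)
      · gcongr
        have e2 : (φ : R6 → ℂ) = fun x => hh x - (hh x - φ x) := by funext x; ring
        rw [e2]
        refine (eLpNorm_sub_le hhm (hhm.sub φ.continuous.aestronglyMeasurable) hq1).trans ?_
        rw [hhq]
        exact add_le_add le_rfl (hφ q hq1 hq2)
      · refine (enorm_integral_mul_le (p := r) (q := r') hg.1
          (hhm.sub φ.continuous.aestronglyMeasurable)).trans ?_
        exact mul_le_mul' le_rfl (hφ r' hr'1 hr'2)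
    have ht : Tendsto (fun δ : ℝ => K * (N ^ e + ENNReal.ofReal δ) +
        eLpNorm g r volume * ENNReal.ofReal δ) (𝓝[>] 0)
        (𝓝 (K * (N ^ e + ENNReal.ofReal 0) + eLpNorm g r volume * ENNReal.ofReal 0)) := by
      have h0 : Tendsto (fun δ : ℝ => ENNReal.ofReal δ) (𝓝[>] 0) (𝓝 (ENNReal.ofReal 0)) :=
        (ENNReal.continuous_ofReal.tendsto 0).mono_left nhdsWithin_le_nhds
      refine Tendsto.add (ENNReal.Tendsto.const_mul (tendsto_const_nhds.add h0) (Or.inr hK))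
        (ENNReal.Tendsto.const_mul h0 (Or.inr hg.2.ne))
    simp only [ENNReal.ofReal_zero, add_zero, mul_zero] at ht
    exact ge_of_tendsto ht (eventually_mem_nhdsWithin.mono fun δ hδ => hb δ hδ)
  by_cases hN0 : N = 0
  · rw [hN0]; exact zero_le
  rw [pow_succ, mul_comm] at hlim
  exact (ENNReal.mul_le_mul_iff_left (pow_ne_zero _ hN0) (ENNReal.pow_ne_top hNt)).1 hlim

/-- Fatou's lemma removes the truncation. Finiteness of the norm on the left is not assumed, so the
lemma can also be used to gain integrability. -/
theorem eLpNorm_le_of_forall_schwartz {e : ℕ} (he : 1 ≤ e) {r r' q : ℝ≥0∞}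
    [ENNReal.HolderConjugate r r'] (hr'1 : 1 ≤ r') (hr'2 : r' ≤ 2)
    (hqe : q * e = (e + 1 : ℕ)) (hq1 : 1 ≤ q) (hq2 : q ≤ 2) {g : R6 → ℂ}
    (hg : MemLp g r volume) {K : ℝ≥0∞}
    (h : ∀ φ : 𝓢(R6, ℂ), ‖∫ x, g x * φ x‖ₑ ≤ K * eLpNorm φ q volume) :
    eLpNorm g (e + 1 : ℕ) volume ≤ K := by
  obtain ⟨g', hg'm, hgg'⟩ := hg.1
  have h' : ∀ φ : 𝓢(R6, ℂ), ‖∫ x, g' x * φ x‖ₑ ≤ K * eLpNorm φ q volume := fun φ => by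
    have : ∫ x, g' x * φ x = ∫ x, g x * φ x :=
      integral_congr_ae (hgg'.mono fun x hx => by simp only [hx])
    rw [this]; exact h φ
  rw [eLpNorm_congr_ae hgg']
  have hlim : ∀ x, Tendsto (fun n : ℕ => {x | ‖x‖ ≤ n ∧ ‖g' x‖ ≤ n}.indicator g' x) atTop
      (𝓝 (g' x)) := by
    intro x
    obtain ⟨n, hn⟩ := exists_nat_ge (max ‖x‖ ‖g' x‖)
    refine tendsto_const_nhds.congr' ?_
    filter_upwards [eventually_ge_atTop n] with m hm
    have hm' : (n : ℝ) ≤ m := by exact_mod_cast hm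
    rw [Set.indicator_of_mem]
    exact ⟨(le_max_left _ _).trans (hn.trans hm'), (le_max_right _ _).trans (hn.trans hm')⟩
  refine (Lp.eLpNorm_lim_le_liminf_eLpNorm
    (f := fun n : ℕ => {x | ‖x‖ ≤ n ∧ ‖g' x‖ ≤ n}.indicator g') (fun n => ?_) g'
    (Eventually.of_forall hlim)).trans ?_
  · exact (hg'm.indicator ((measurableSet_le measurable_norm measurable_const).inter
      (measurableSet_le hg'm.norm.measurable measurable_const))).aestronglyMeasurable
  · refine (liminf_le_liminf (Eventually.of_forall fun n =>
      eLpNorm_indicator_le_of_forall_schwartz he hr'1 hr'2 hqe hq1 hq2 hg'm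
        ((memLp_congr_ae hgg').1 hg) h' n)).trans ?_
    simp

instance holderConjugate_two_two : ENNReal.HolderConjugate 2 2 := ⟨by
  rw [inv_one]; exact ENNReal.inv_two_add_inv_two⟩

instance holderConjugate_three : ENNReal.HolderConjugate 3 (3 / 2) := ⟨by
  rw [inv_one, ENNReal.inv_div (by norm_num) (by norm_num), ← one_div, ← ENNReal.add_div]
  norm_num [one_add_one_eq_two]
  exact ENNReal.div_self (by norm_num) (by norm_num)⟩

theorem three_halves_le_two : (3 / 2 : ℝ≥0∞) ≤ 2 := by
  rw [ENNReal.div_le_iff (by norm_num) (by norm_num)]; norm_num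

theorem one_le_three_halves : (1 : ℝ≥0∞) ≤ 3 / 2 := factOneLeThreeHalves.out

/-- Exponents `r` of spaces in which the duality lemmas are used. -/
class DualExponent (r : ℝ≥0∞) (r' : outParam ℝ≥0∞) : Prop where
  conj : ENNReal.HolderConjugate r r'
  one_le : 1 ≤ r'
  le_two : r' ≤ 2

instance : DualExponent 2 2 := ⟨inferInstance, by norm_num, le_rfl⟩
instance : DualExponent 3 (3 / 2) := ⟨inferInstance, one_le_three_halves, three_halves_le_two⟩

theorem eLpNorm_two_le_of_forall_schwartz {r r' : ℝ≥0∞} [h1 : DualExponent r r'] {g : R6 → ℂ}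
    (hg : MemLp g r volume) {K : ℝ≥0∞}
    (h : ∀ φ : 𝓢(R6, ℂ), ‖∫ x, g x * φ x‖ₑ ≤ K * eLpNorm φ 2 volume) :
    eLpNorm g 2 volume ≤ K := by
  have := h1.conj
  exact_mod_cast eLpNorm_le_of_forall_schwartz (e := 1) le_rfl h1.one_le h1.le_two (q := 2)
    (by norm_num) (by norm_num) le_rfl hg h

theorem eLpNorm_three_le_of_forall_schwartz {r r' : ℝ≥0∞} [h1 : DualExponent r r'] {g : R6 → ℂ}
    (hg : MemLp g r volume) {K : ℝ≥0∞}
    (h : ∀ φ : 𝓢(R6, ℂ), ‖∫ x, g x * φ x‖ₑ ≤ K * eLpNorm φ (3 / 2) volume) :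
    eLpNorm g 3 volume ≤ K := by
  have := h1.conj
  have h3 : ((3 / 2 : ℝ≥0∞)) * (2 : ℕ) = (2 + 1 : ℕ) := by
    push_cast
    rw [ENNReal.div_mul_cancel (by norm_num) (by norm_num)]
  have := eLpNorm_le_of_forall_schwartz (e := 2) (by norm_num) h1.one_le h1.le_two (q := 3 / 2)
    h3 one_le_three_halves three_halves_le_two hg h
  norm_num at this
  exact this

end QuadNLS
end

/-! ### Decomposition into atoms, and a countable norming family for L³. -/

noncomputable section
namespace QuadNLS

/-- The ratio `2^{1/8}` of the scales of consecutive atoms. -/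
def atomRatio : ℝ := (2 : ℝ) ^ (1 / 8 : ℝ)

theorem atomRatio_pos : 0 < atomRatio := by unfold atomRatio; positivity

theorem one_lt_atomRatio : 1 < atomRatio := Real.one_lt_rpow (by norm_num) (by norm_num)

theorem atomRatio_pow : atomRatio ^ 8 = 2 := by
  unfold atomRatio
  rw [← Real.rpow_natCast, ← Real.rpow_mul (by norm_num)]
  norm_num

/-- The scale of the `n`-th of `2 K + 1` atoms. -/
def atomScale (K n : ℕ) : ℝ := atomRatio ^ n / atomRatio ^ K

theorem atomScale_pos (K n : ℕ) : 0 < atomScale K n := by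
  have := atomRatio_pos
  unfold atomScale; positivity

theorem atomScale_pow (K n : ℕ) : atomScale K n ^ 8 = (2 ^ K * (1 / 2) ^ n)⁻¹ := by
  unfold atomScale
  rw [div_pow, ← pow_mul, ← pow_mul, mul_comm n, mul_comm K, pow_mul, pow_mul, atomRatio_pow]
  rw [mul_inv, one_div, inv_pow, inv_inv, div_eq_mul_inv, mul_comm]

theorem lintegral_level_one_le {A : Set R6} (hA : MeasurableSet A) {φ : R6 → ℂ} {T : ℝ}
    (hT : 0 < T) (h : ∀ x ∈ A, T / 2 ≤ √‖φ x‖) :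
    eLpNorm (A.indicator φ) 1 volume ≤
      ENNReal.ofReal (2 * T⁻¹) * ∫⁻ x in A, ENNReal.ofReal (√‖φ x‖ ^ 3) := by
  rw [eLpNorm_indicator_eq_eLpNorm_restrict hA, eLpNorm_one_eq_lintegral_enorm,
    ← lintegral_const_mul' _ _ ENNReal.ofReal_ne_top]
  refine setLIntegral_mono' hA fun x hx => ?_
  rw [← ofReal_norm, ← ENNReal.ofReal_mul (by positivity)]
  refine ENNReal.ofReal_le_ofReal ?_
  have h1 := Real.sq_sqrt (norm_nonneg (φ x))
  have h2 : 1 ≤ 2 * T⁻¹ * √‖φ x‖ := by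
    rw [← div_eq_mul_inv, div_mul_eq_mul_div, le_div_iff₀ hT]
    linarith [h x hx]
  calc ‖φ x‖ = √‖φ x‖ ^ 2 * 1 := by rw [h1, mul_one]
    _ ≤ √‖φ x‖ ^ 2 * (2 * T⁻¹ * √‖φ x‖) := by gcongr
    _ = _ := by ring

theorem lintegral_level_two_le {A : Set R6} (hA : MeasurableSet A) {φ : R6 → ℂ} {T : ℝ}
    (hT : 0 < T) (h : ∀ x ∈ A, √‖φ x‖ ≤ T) :
    eLpNorm (A.indicator φ) 2 volume ^ 2 ≤
      ENNReal.ofReal T * ∫⁻ x in A, ENNReal.ofReal (√‖φ x‖ ^ 3) := by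
  rw [eLpNorm_indicator_eq_eLpNorm_restrict hA]
  have h2 := eLpNorm_nnreal_pow_eq_lintegral (f := φ) (μ := volume.restrict A) (p := 2)
    (by norm_num)
  norm_num at h2
  rw [h2, ← lintegral_const_mul' _ _ ENNReal.ofReal_ne_top]
  refine setLIntegral_mono' hA fun x hx => ?_
  rw [← ofReal_norm, ← ENNReal.ofReal_mul (by positivity), ← ENNReal.ofReal_pow (norm_nonneg _)]
  refine ENNReal.ofReal_le_ofReal ?_
  have h1 := Real.sq_sqrt (norm_nonneg (φ x))
  calc ‖φ x‖ ^ 2 = √‖φ x‖ * √‖φ x‖ ^ 3 := by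
        nth_rw 1 [← h1]; ring
    _ ≤ _ := by gcongr; exact h x hx

theorem lintegral_sqrt_norm_pow_three (φ : R6 → ℂ) :
    ∫⁻ x, ENNReal.ofReal (√‖φ x‖ ^ 3) = eLpNorm φ (3 / 2) volume ^ (3 / 2 : ℝ) := by
  have h2 := eLpNorm_nnreal_pow_eq_lintegral (f := φ) (μ := volume) (p := 3 / 2)
    (by norm_num)
  have h3 : ((3 / 2 : ℝ≥0) : ℝ≥0∞) = 3 / 2 := by
    rw [ENNReal.coe_div (by norm_num)]; norm_num
  rw [h3] at h2
  push_cast at h2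
  rw [h2]
  refine lintegral_congr fun x => ?_
  rw [← ofReal_norm, ENNReal.ofReal_rpow_of_nonneg (norm_nonneg _) (by norm_num)]
  congr 1
  rw [Real.sqrt_eq_rpow, ← Real.rpow_natCast, ← Real.rpow_mul (norm_nonneg _)]
  norm_num

theorem norm_toLp_le_ofReal {p : ℝ≥0∞} {ψ : 𝓢(R6, ℂ)} {C : ℝ} (hC : 0 ≤ C)
    (h : eLpNorm ψ p volume ≤ ENNReal.ofReal C) : ‖ψ.toLp p volume‖ ≤ C := by
  rw [SchwartzMap.norm_toLp]
  exact ENNReal.toReal_le_of_le_ofReal hC h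

theorem toReal_le_one_sqrt {Q : ℝ} (h0 : 0 ≤ Q) (h : Q ≤ 1) : Q ≤ √Q := by
  have h1 := Real.sq_sqrt h0
  have h2 : √Q ≤ 1 := Real.sqrt_le_one.2 h
  nlinarith [Real.sqrt_nonneg Q]

/-- The pieces live on the layers of √|φ| between consecutive dyadic thresholds T. There |φ| is
comparable to T², the scale satisfies α⁸ = T⁻¹, and Q is the integral of |φ|^{3/2} over the layer.
The L¹ and L² sizes come from |φ| ≤ 2T⁻¹|φ|^{3/2} and |φ|² ≤ T|φ|^{3/2}. -/
theorem exists_level_sets (φ : 𝓢(R6, ℂ)) (hφ : eLpNorm φ (3 / 2) volume ≤ 1) (K : ℕ)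
    (hK : ∀ x, √‖φ x‖ < 2 ^ K) :
    ∃ (f : ℕ → R6 → ℂ) (Q : ℕ → ℝ), (∀ n, 0 ≤ Q n) ∧
      (∀ n, MemLp (f n) 2 volume) ∧
      (∀ n, ∃ R : ℝ, ∀ x, R < ‖x‖ → f n x = 0) ∧
      (∀ n, eLpNorm (f n) 1 volume ≤ ENNReal.ofReal (2 * √(Q n) * atomScale K n ^ 8)) ∧
      (∀ n, eLpNorm (f n) 2 volume ≤ ENNReal.ofReal (√(Q n) * (atomScale K n)⁻¹ ^ 4)) ∧
      (∑ n ∈ Finset.range (2 * K + 1), Q n ≤ 1) ∧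
      eLpNorm (fun x => φ x - ∑ n ∈ Finset.range (2 * K + 1), f n x) 2 volume ^ 2 ≤
        ENNReal.ofReal ((1 / 2) ^ (K + 1)) := by
  set T : ℕ → ℝ := fun n => 2 ^ K * (1 / 2) ^ n with hT
  have hTpos : ∀ n, 0 < T n := fun n => by positivity
  have hTs : ∀ n, T (n + 1) = T n / 2 := fun n => by simp only [hT, pow_succ]; ring
  have hTa : ∀ m n, m ≤ n → T n ≤ T m := fun m n hmn => by
    simp only [hT]
    gcongr ?_ * ?_
    exact pow_le_pow_of_le_one (by norm_num) (by norm_num) hmn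
  set w : R6 → ℝ := fun x => √‖φ x‖ with hw
  have hwc : Continuous w := φ.continuous.norm.sqrt
  set B : ℕ → Set R6 := fun n => {x | w x < T n}
  have hB : ∀ n, MeasurableSet (B n) := fun n =>
    measurableSet_lt hwc.measurable measurable_const
  have hBm : ∀ m n, m ≤ n → B n ⊆ B m := fun m n hmn x hx => lt_of_lt_of_le hx (hTa m n hmn)
  set A : ℕ → Set R6 := fun n => B n \ B (n + 1)
  have hA : ∀ n, MeasurableSet (A n) := fun n => (hB n).diff (hB _)
  set I : ℕ → ℝ≥0∞ := fun n => ∫⁻ x in A n, ENNReal.ofReal (w x ^ 3)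
  have htot : ∫⁻ x, ENNReal.ofReal (w x ^ 3) ≤ 1 := by
    rw [hw, lintegral_sqrt_norm_pow_three]
    exact ENNReal.rpow_le_one hφ (by norm_num)
  have hI1 : ∀ n, I n ≤ 1 := fun n => (setLIntegral_le_lintegral _ _).trans htot
  have hIt : ∀ n, I n ≠ ⊤ := fun n => ne_top_of_le_ne_top ENNReal.one_ne_top (hI1 n)
  have hQ1 : ∀ n, (I n).toReal ≤ 1 := fun n => by
    simpa using ENNReal.toReal_mono ENNReal.one_ne_top (hI1 n)
  have hlow : ∀ n, ∀ x ∈ A n, T n / 2 ≤ √‖φ x‖ := fun n x hx => by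
    rw [← hTs]; exact not_lt.1 hx.2
  have hup : ∀ n, ∀ x ∈ A n, √‖φ x‖ ≤ T n := fun n x hx => le_of_lt hx.1
  refine ⟨fun n => (A n).indicator φ, fun n => (I n).toReal, fun n => ENNReal.toReal_nonneg,
    fun n => (φ.memLp 2 volume).indicator (hA n), fun n => ?_, fun n => ?_, fun n => ?_, ?_, ?_⟩
  -- On a layer |φ| is bounded below by (T/2)², so the decay of φ confines the layer to a ball.
  · obtain ⟨C, hC0, hC⟩ := φ.decay 1 0
    refine ⟨C / (T n / 2) ^ 2, fun x hx => Set.indicator_of_notMem (fun hxA => ?_) _⟩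
    have h1 := hC x
    simp only [pow_one, norm_iteratedFDeriv_zero] at h1
    have h2 : (T n / 2) ^ 2 ≤ ‖φ x‖ := by
      rw [← Real.sq_sqrt (norm_nonneg (φ x))]
      exact pow_le_pow_left₀ (by have := hTpos n; positivity) (hlow n x hxA) 2
    have h3 : 0 < (T n / 2) ^ 2 := by have := hTpos n; positivity
    rw [div_lt_iff₀ h3] at hx
    have h4 : ‖x‖ * (T n / 2) ^ 2 ≤ ‖x‖ * ‖φ x‖ := by gcongr
    linarith
  · refine (lintegral_level_one_le (hA n) (hTpos n) (hlow n)).trans ?_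
    change ENNReal.ofReal (2 * (T n)⁻¹) * I n ≤ _
    rw [atomScale_pow, ← ENNReal.ofReal_toReal (hIt n), ← ENNReal.ofReal_mul (by have := hTpos n; positivity)]
    refine ENNReal.ofReal_le_ofReal ?_
    -- As Q ≤ 1, it may be replaced by √Q, the amplitude common to the L¹ and L² bounds, whose
    -- squares are summable over the layers.
    have := toReal_le_one_sqrt ENNReal.toReal_nonneg (hQ1 n)
    calc 2 * (T n)⁻¹ * (I n).toReal ≤ 2 * (T n)⁻¹ * √(I n).toReal := by
          have := hTpos n; gcongr
      _ = _ := by ring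
  · have h1 := lintegral_level_two_le (hA n) (hTpos n) (hup n)
    change _ ≤ ENNReal.ofReal (T n) * I n at h1
    have h2 : ENNReal.ofReal (T n) * I n =
        ENNReal.ofReal (√(I n).toReal * (atomScale K n)⁻¹ ^ 4) ^ 2 := by
      rw [← ENNReal.ofReal_pow (by have := atomScale_pos K n; positivity), mul_pow,
        Real.sq_sqrt ENNReal.toReal_nonneg, ← pow_mul, inv_pow]
      norm_num only
      rw [atomScale_pow, inv_inv, ENNReal.ofReal_mul ENNReal.toReal_nonneg,
        ENNReal.ofReal_toReal (hIt n), mul_comm]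
    rw [h2] at h1
    exact (ENNReal.pow_le_pow_left_iff (by norm_num)).1 h1
  · have hd : Set.PairwiseDisjoint (↑(Finset.range (2 * K + 1))) A := by
      have hlt : ∀ m n, m < n → Disjoint (A m) (A n) := fun m n hmn =>
        Set.disjoint_left.2 fun x hxm hxn => hxm.2 (hBm (m + 1) n hmn hxn.1)
      intro m _ n _ hmn
      rcases lt_or_gt_of_ne hmn with h | h
      · exact hlt m n h
      · exact (hlt n m h).symm
    rw [← ENNReal.toReal_sum (fun n _ => hIt n)]
    simp only [I]
    rw [← lintegral_biUnion_finset hd (fun n _ => hA n)]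
    simpa using ENNReal.toReal_mono ENNReal.one_ne_top
      ((setLIntegral_le_lintegral _ _).trans htot)
  · have hsum : (fun x => φ x - ∑ n ∈ Finset.range (2 * K + 1), (A n).indicator φ x) =
        (B (2 * K + 1)).indicator φ := by
      have h1 : ∀ n x, (A n).indicator φ x = (B n).indicator φ x - (B (n + 1)).indicator φ x := by
        intro n x
        by_cases h2 : x ∈ B (n + 1)
        · have h3 : x ∈ B n := hBm n (n + 1) (Nat.le_succ n) h2
          have h4 : x ∉ A n := fun h => h.2 h2
          simp [h2, h3, h4]
        · by_cases h3 : x ∈ B n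
          · have h4 : x ∈ A n := ⟨h3, h2⟩
            simp [h2, h3, h4]
          · have h4 : x ∉ A n := fun h => h3 h.1
            simp [h2, h3, h4]
      funext x
      simp only [h1]
      rw [Finset.sum_range_sub']
      have h2 : x ∈ B 0 := by
        change w x < T 0
        simpa [hT] using hK x
      rw [Set.indicator_of_mem h2]
      ring
    rw [hsum]
    refine (lintegral_level_two_le (hB _) (hTpos (2 * K + 1)) fun x hx => le_of_lt hx).trans ?_
    -- The thresholds run from 2^K, above the maximum of √|φ|, down to 2^{-(K+1)}; below the last
    -- one the L² norm is small.
    have h3 : T (2 * K + 1) = (1 / 2) ^ (K + 1) := by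
      simp only [hT]
      have : 2 * K + 1 = K + (K + 1) := by ring
      rw [this, pow_add, ← mul_assoc, ← mul_pow]
      norm_num
    rw [h3]
    calc _ ≤ ENNReal.ofReal ((1 / 2) ^ (K + 1)) * 1 := by
          gcongr
          exact (setLIntegral_le_lintegral _ _).trans htot
      _ = _ := mul_one _

/-- Decomposition of a Schwartz function in the unit ball of `L^{3/2}` into atoms at dyadic
scales, which are controlled in `L¹` and `L²`. -/
theorem exists_atoms (φ : 𝓢(R6, ℂ)) (hφ : eLpNorm φ (3 / 2) volume ≤ 1) {δ : ℝ} (hδ : 0 < δ) :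
    ∃ K₀ : ℕ, ∀ K ≥ K₀, ∃ (ψ : ℕ → 𝓢(R6, ℂ)) (p : ℕ → ℝ), (∀ n, 0 ≤ p n) ∧
      (∀ n, ‖(ψ n).toLp 1 volume‖ ≤ 2 * p n * atomScale K n ^ 8) ∧
      (∀ n, ‖(ψ n).toLp 2 volume‖ ≤ p n * (atomScale K n)⁻¹ ^ 4) ∧
      (∑ n ∈ Finset.range (2 * K + 1), p n ^ 2 ≤ 4) ∧
      ‖(φ - ∑ n ∈ Finset.range (2 * K + 1), ψ n).toLp 2 volume‖ ≤ δ := by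
  obtain ⟨C, hC0, hC⟩ := φ.decay 0 0
  simp only [pow_zero, one_mul, norm_iteratedFDeriv_zero] at hC
  obtain ⟨K₁, hK₁⟩ := pow_unbounded_of_one_lt √C (one_lt_two : (1 : ℝ) < 2)
  obtain ⟨K₂, hK₂⟩ := exists_pow_lt_of_lt_one (show 0 < (δ / 2) ^ 2 by positivity)
    (by norm_num : (1 / 2 : ℝ) < 1)
  refine ⟨max K₁ K₂, fun K hK => ?_⟩
  have hKb : ∀ x, √‖φ x‖ < 2 ^ K := fun x =>
    ((Real.sqrt_le_sqrt (hC x)).trans_lt hK₁).trans_le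
      (pow_le_pow_right₀ one_le_two ((le_max_left _ _).trans hK))
  obtain ⟨f, Q, hQ0, hf2, hfR, hf1n, hf2n, hQs, hrem⟩ := exists_level_sets φ hφ K hKb
  -- The error allotted to smoothing one of the 2K + 1 atoms: the squares η² add up to η ≤ 1, and
  -- the L² errors δη/2 add up to δ/2.
  set η : ℝ := 1 / (2 * K + 1)
  have hη : 0 < η := by positivity
  have hηK : (2 * K + 1) * η = 1 := mul_one_div_cancel (by positivity)
  set d : ℕ → ℝ := fun n => min (2 * η * atomScale K n ^ 8)
    (min (η * (atomScale K n)⁻¹ ^ 4) (δ / 2 * η))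
  have hd : ∀ n, 0 < d n := fun n => by
    have := atomScale_pos K n
    simp only [d, lt_min_iff]
    refine ⟨by positivity, by positivity, by positivity⟩
  have hψ : ∀ n, ∃ ψ : 𝓢(R6, ℂ), ∀ q : ℝ≥0∞, 1 ≤ q → q ≤ 2 →
      eLpNorm (fun x => f n x - ψ x) q volume ≤ ENNReal.ofReal (d n) := fun n => by
    obtain ⟨R, hR⟩ := hfR n
    exact exists_schwartz_eLpNorm_sub_le (hf2 n) hR (hd n)
  choose ψ hψ using hψ
  have hbound : ∀ (q : ℝ≥0∞) (n : ℕ) (X Y : ℝ), 1 ≤ q → q ≤ 2 → 0 ≤ X → 0 ≤ Y →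
      eLpNorm (f n) q volume ≤ ENNReal.ofReal X → d n ≤ Y →
      ‖(ψ n).toLp q volume‖ ≤ X + Y := by
    intro q n X Y hq1 hq2 hX hY h1 h2
    refine norm_toLp_le_ofReal (by positivity) ?_
    have e2 : (ψ n : R6 → ℂ) = fun x => f n x - (f n x - ψ n x) := by funext x; ring
    rw [e2, ENNReal.ofReal_add hX hY]
    refine (eLpNorm_sub_le (hf2 n).1 ((hf2 n).1.sub (ψ n).continuous.aestronglyMeasurable)
      hq1).trans (add_le_add h1 ((hψ n q hq1 hq2).trans (ENNReal.ofReal_le_ofReal h2)))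
  refine ⟨ψ, fun n => √(Q n) + η, fun n => by positivity, fun n => ?_, fun n => ?_, ?_, ?_⟩
  · have := atomScale_pos K n
    refine (hbound 1 n _ (2 * η * atomScale K n ^ 8) le_rfl (by norm_num) (by positivity)
      (by positivity) (hf1n n) (min_le_left _ _)).trans (le_of_eq (by ring))
  · have := atomScale_pos K n
    refine (hbound 2 n _ (η * (atomScale K n)⁻¹ ^ 4) (by norm_num) le_rfl (by positivity)
      (by positivity) (hf2n n) ((min_le_right _ _).trans (min_le_left _ _))).trans
      (le_of_eq (by ring))
  · have h1 : ∀ n, (√(Q n) + η) ^ 2 ≤ 2 * Q n + 2 * η ^ 2 := fun n => by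
      nlinarith [sq_nonneg (√(Q n) - η), Real.sq_sqrt (hQ0 n)]
    refine (Finset.sum_le_sum fun n _ => h1 n).trans ?_
    rw [Finset.sum_add_distrib, ← Finset.mul_sum, Finset.sum_const, Finset.card_range,
      nsmul_eq_mul]
    push_cast
    have h2 : η ≤ 1 := by
      rw [← hηK]; nlinarith [show (0 : ℝ) ≤ K by positivity]
    have h3 : (2 * (K : ℝ) + 1) * (2 * η ^ 2) = 2 * η * ((2 * K + 1) * η) := by ring
    rw [h3, hηK]
    linarith
  · refine norm_toLp_le_ofReal hδ.le ?_
    have e1 : ((φ - ∑ n ∈ Finset.range (2 * K + 1), ψ n : 𝓢(R6, ℂ)) : R6 → ℂ) =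
        (fun x => φ x - ∑ n ∈ Finset.range (2 * K + 1), f n x) +
          ∑ n ∈ Finset.range (2 * K + 1), fun x => f n x - ψ n x := by
      funext x
      simp only [sub_apply, Pi.add_apply, Finset.sum_apply, sum_apply,
        Finset.sum_sub_distrib]
      ring
    have m1 : ∀ n, AEStronglyMeasurable (fun x => f n x - ψ n x) volume := fun n =>
      (hf2 n).1.sub (ψ n).continuous.aestronglyMeasurable
    have m2 : AEStronglyMeasurable
        (fun x => φ x - ∑ n ∈ Finset.range (2 * K + 1), f n x) volume :=
      φ.continuous.aestronglyMeasurable.sub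
        (Finset.aestronglyMeasurable_fun_sum _ fun n _ => (hf2 n).1)
    rw [e1]
    refine (eLpNorm_add_le m2 (Finset.aestronglyMeasurable_sum _ fun n _ => m1 n)
      (by norm_num)).trans ?_
    have h1 : eLpNorm (fun x => φ x - ∑ n ∈ Finset.range (2 * K + 1), f n x) 2 volume ≤
        ENNReal.ofReal (δ / 2) := by
      refine (ENNReal.pow_le_pow_left_iff (n := 2) (by norm_num)).1 (hrem.trans ?_)
      rw [← ENNReal.ofReal_pow (by positivity)]
      refine ENNReal.ofReal_le_ofReal (le_trans ?_ hK₂.le)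
      exact pow_le_pow_of_le_one (by norm_num) (by norm_num)
        (((le_max_right _ _).trans hK).trans (Nat.le_succ K))
    have h2 : eLpNorm (∑ n ∈ Finset.range (2 * K + 1), fun x => f n x - ψ n x) 2 volume ≤
        ENNReal.ofReal (δ / 2) := by
      refine (eLpNorm_sum_le (fun n _ => m1 n) (by norm_num)).trans ?_
      refine (Finset.sum_le_sum fun n _ => (hψ n 2 (by norm_num) le_rfl).trans
        (ENNReal.ofReal_le_ofReal ((min_le_right _ _).trans (min_le_right _ _)))).trans ?_
      rw [Finset.sum_const, Finset.card_range, nsmul_eq_mul, ← ENNReal.ofReal_natCast,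
        ← ENNReal.ofReal_mul (by positivity)]
      refine ENNReal.ofReal_le_ofReal (le_of_eq ?_)
      push_cast
      rw [mul_comm (δ / 2), ← mul_assoc, hηK, one_mul]
    refine (add_le_add h1 h2).trans ?_
    rw [← ENNReal.ofReal_add (by positivity) (by positivity), add_halves]

theorem enorm_integral_le_of_dense {r r' : ℝ≥0∞} [h1 : DualExponent r r'] {g : R6 → ℂ}
    (hg : MemLp g r volume) {ψ : ℕ → 𝓢(R6, ℂ)} {φ : 𝓢(R6, ℂ)}
    (h : ∀ ε : ℝ, 0 < ε → ∃ n, eLpNorm (fun x => φ x - ψ n x) r' volume ≤ ENNReal.ofReal ε) :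
    ‖∫ x, g x * φ x‖ₑ ≤ ⨆ n, ‖∫ x, g x * ψ n x‖ₑ := by
  have := h1.conj
  have ht : Tendsto (fun δ : ℝ => (⨆ n, ‖∫ x, g x * ψ n x‖ₑ) +
        eLpNorm g r volume * ENNReal.ofReal δ) (𝓝[>] 0)
        (𝓝 ((⨆ n, ‖∫ x, g x * ψ n x‖ₑ) + eLpNorm g r volume * ENNReal.ofReal 0)) := by
    have h0 : Tendsto (fun δ : ℝ => ENNReal.ofReal δ) (𝓝[>] 0) (𝓝 (ENNReal.ofReal 0)) :=
      (ENNReal.continuous_ofReal.tendsto 0).mono_left nhdsWithin_le_nhds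
    exact tendsto_const_nhds.add (ENNReal.Tendsto.const_mul h0 (Or.inr hg.2.ne))
  simp only [ENNReal.ofReal_zero, add_zero, mul_zero] at ht
  refine ge_of_tendsto ht (eventually_mem_nhdsWithin.mono fun δ hδ => ?_)
  obtain ⟨n, hn⟩ := h δ hδ
  have i1 : Integrable (fun x => g x * ψ n x) volume :=
    integrable_mul_of_memLp hg ((ψ n).memLp r' volume)
  have i2 : Integrable (fun x => g x * (φ x - ψ n x)) volume :=
    integrable_mul_of_memLp hg ((φ.memLp r' volume).sub ((ψ n).memLp r' volume))
  have e1 : ∫ x, g x * φ x = (∫ x, g x * ψ n x) + ∫ x, g x * (φ x - ψ n x) := by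
    rw [← integral_add i1 i2]
    congr 1; funext x; ring
  rw [e1]
  refine (enorm_add_le _ _).trans (add_le_add (le_iSup (fun n => ‖∫ x, g x * ψ n x‖ₑ) n) ?_)
  refine (enorm_integral_mul_le (p := r) (q := r') hg.1
    (φ.continuous.sub (ψ n).continuous).aestronglyMeasurable).trans ?_
  exact mul_le_mul' le_rfl hn

theorem eLpNorm_three_le_iSup_of_dense {r r' : ℝ≥0∞} [DualExponent r r'] {g : R6 → ℂ}
    (hg : MemLp g r volume) {ψ : ℕ → 𝓢(R6, ℂ)}
    (h : ∀ φ : 𝓢(R6, ℂ), eLpNorm φ (3 / 2) volume ≤ 1 → ∀ ε : ℝ, 0 < ε →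
      ∃ n, eLpNorm (fun x => φ x - ψ n x) r' volume ≤ ENNReal.ofReal ε) :
    eLpNorm g 3 volume ≤ ⨆ n, ‖∫ x, g x * ψ n x‖ₑ := by
  refine eLpNorm_three_le_of_forall_schwartz hg fun φ => ?_
  set m := eLpNorm φ (3 / 2) volume with hm
  have hmt : m ≠ ⊤ := (φ.memLp (3 / 2) volume).2.ne
  by_cases hm0 : m = 0
  · have h1 : (φ : R6 → ℂ) =ᵐ[volume] 0 :=
      (eLpNorm_eq_zero_iff φ.continuous.aestronglyMeasurable
        (zero_lt_one.trans_le one_le_three_halves).ne').1 hm0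
    have h2 : ∫ x, g x * φ x = 0 := by
      rw [← integral_zero R6 ℂ]
      exact integral_congr_ae (h1.mono fun x hx => by simp [hx])
    simp [h2]
  have hmr : 0 < m.toReal := ENNReal.toReal_pos hm0 hmt
  set φ' : 𝓢(R6, ℂ) := ((m.toReal : ℂ)⁻¹) • φ
  have hφ' : eLpNorm φ' (3 / 2) volume ≤ 1 := by
    have e1 : (φ' : R6 → ℂ) = ((m.toReal : ℂ)⁻¹) • (φ : R6 → ℂ) := rfl
    rw [e1, eLpNorm_const_smul, ← hm, ← ofReal_norm, norm_inv, Complex.norm_real,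
      Real.norm_of_nonneg hmr.le, ENNReal.ofReal_inv_of_pos hmr, ENNReal.ofReal_toReal hmt,
      ENNReal.inv_mul_cancel hm0 hmt]
  have h3 := enorm_integral_le_of_dense hg (h φ' hφ')
  have e2 : ∫ x, g x * φ x = (m.toReal : ℂ) * ∫ x, g x * φ' x := by
    rw [← integral_const_mul]
    congr 1; funext x
    have h5 : (m.toReal : ℂ) ≠ 0 := by exact_mod_cast hmr.ne'
    simp only [φ', smul_apply, smul_eq_mul]
    field_simp
  rw [e2, enorm_mul, mul_comm]
  refine mul_le_mul' h3 ?_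
  rw [← ofReal_norm, Complex.norm_real, Real.norm_of_nonneg hmr.le, ENNReal.ofReal_toReal hmt]

/-- A countable set of test functions which norms `L³`. -/
theorem exists_countable_test : ∃ ψ : ℕ → 𝓢(R6, ℂ),
    (∀ n, eLpNorm (ψ n) (3 / 2) volume ≤ 1) ∧
    (∀ g : R6 → ℂ, MemLp g 2 volume → eLpNorm g 3 volume ≤ ⨆ n, ‖∫ x, g x * ψ n x‖ₑ) ∧
    (∀ g : R6 → ℂ, MemLp g 3 volume → eLpNorm g 3 volume ≤ ⨆ n, ‖∫ x, g x * ψ n x‖ₑ) := by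
  let S := {φ : 𝓢(R6, ℂ) // eLpNorm φ (3 / 2) volume ≤ 1}
  -- Separability of the product gives density in L² and L^{3/2} simultaneously, so one sequence
  -- norms L³ among functions known to be in L² as well as among those known to be in L³.
  let J : S → Lp ℂ 2 (volume : Measure R6) × Lp ℂ (3 / 2) (volume : Measure R6) :=
    fun φ => (φ.1.toLp 2 volume, φ.1.toLp (3 / 2) volume)
  have : Fact ((2 : ℝ≥0∞) ≠ ⊤) := ⟨by norm_num⟩
  have : Fact ((3 / 2 : ℝ≥0∞) ≠ ⊤) := ⟨ne_top_of_le_ne_top (by norm_num) three_halves_le_two⟩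
  have hne : Nonempty (Set.range J) := ⟨⟨_, ⟨⟨0, by
    have : ((0 : 𝓢(R6, ℂ)) : R6 → ℂ) = 0 := rfl
    simp [this]⟩, rfl⟩⟩⟩
  have hs2 : SecondCountableTopology (Lp ℂ 2 (volume : Measure R6)) :=
    Lp.SecondCountableTopology
  have hs3 : SecondCountableTopology (Lp ℂ (3 / 2) (volume : Measure R6)) :=
    Lp.SecondCountableTopology
  have hsep : TopologicalSpace.SeparableSpace (Set.range J) := inferInstance
  obtain ⟨y, hy⟩ := TopologicalSpace.exists_dense_seq (Set.range J)
  have hch : ∀ n, ∃ φ : S, J φ = (y n).1 := fun n => (y n).2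
  choose s hs using hch
  have hdense : ∀ φ : 𝓢(R6, ℂ), eLpNorm φ (3 / 2) volume ≤ 1 → ∀ ε : ℝ, 0 < ε →
      ∃ n, eLpNorm (fun x => φ x - (s n).1 x) 2 volume ≤ ENNReal.ofReal ε ∧
        eLpNorm (fun x => φ x - (s n).1 x) (3 / 2) volume ≤ ENNReal.ofReal ε := by
    intro φ hφ ε hε
    obtain ⟨n, hn⟩ := hy.exists_dist_lt ⟨J ⟨φ, hφ⟩, ⟨⟨φ, hφ⟩, rfl⟩⟩ hε
    rw [Subtype.dist_eq, ← hs, Prod.dist_eq, max_lt_iff, dist_eq_norm, dist_eq_norm] at hn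
    have key : ∀ (p : ℝ≥0∞) [Fact (1 ≤ p)],
        ‖φ.toLp p volume - (s n).1.toLp p volume‖ < ε →
        eLpNorm (fun x => φ x - (s n).1 x) p volume ≤ ENNReal.ofReal ε := by
      intro p _ h
      rw [← toLp_schwartz_sub, SchwartzMap.norm_toLp] at h
      exact (ENNReal.le_ofReal_iff_toReal_le ((φ - (s n).1).memLp p volume).2.ne hε.le).2 h.le
    exact ⟨n, key 2 hn.1, key (3 / 2) hn.2⟩
  refine ⟨fun n => (s n).1, fun n => (s n).2, fun g hg => ?_, fun g hg => ?_⟩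
  · exact eLpNorm_three_le_iSup_of_dense hg fun φ hφ ε hε =>
      (hdense φ hφ ε hε).imp fun n hn => hn.1
  · exact eLpNorm_three_le_iSup_of_dense hg fun φ hφ ε hε =>
      (hdense φ hφ ε hε).imp fun n hn => hn.2

end QuadNLS
end

/-! ### The retarded bilinear estimate at the endpoint. -/

noncomputable section
namespace QuadNLS

section Retarded

variable {H : Type*} [NormedAddCommGroup H] [InnerProductSpace ℂ H]

/-- The retarded interaction `∬_{s < t} ⟨y t, x s⟩`. -/
def retarded (x y : ℝ → H) : ℂ := ∫ t, inner ℂ (y t) (∫ s in Set.Iio t, x s)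

theorem continuous_integral_Iio {x : ℝ → H} (hx : Integrable x) :
    Continuous fun t => ∫ s in Set.Iio t, x s := by
  have h : (fun t => ∫ s in Set.Iio t, x s) =
      fun t => (∫ s in Set.Iic 0, x s) + ∫ s in (0 : ℝ)..t, x s := by
    funext t
    rw [← integral_Iic_eq_integral_Iio,
      ← intervalIntegral.integral_Iic_sub_Iic hx.integrableOn hx.integrableOn]
    abel
  rw [h]
  exact continuous_const.add
    (intervalIntegral.continuous_primitive (fun a b => hx.intervalIntegrable) 0)

theorem enorm_inner_le (x y : H) : ‖inner ℂ x y‖ₑ ≤ ‖x‖ₑ * ‖y‖ₑ := by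
  simp only [← ofReal_norm]
  rw [← ENNReal.ofReal_mul (norm_nonneg _)]
  exact ENNReal.ofReal_le_ofReal (norm_inner_le_norm _ _)

theorem enorm_setIntegral_le (x : ℝ → H) (J : Set ℝ) : ‖∫ s in J, x s‖ₑ ≤ ∫⁻ s, ‖x s‖ₑ :=
  (enorm_integral_le_lintegral_enorm _).trans (setLIntegral_le_lintegral _ _)

theorem integrable_retarded {x y : ℝ → H} (hx : Integrable x) (hy : Integrable y) :
    Integrable fun t => inner ℂ (y t) (∫ s in Set.Iio t, x s) := by
  refine ⟨hy.1.inner (continuous_integral_Iio hx).aestronglyMeasurable, ?_⟩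
  refine lt_of_le_of_lt (lintegral_mono fun t => (enorm_inner_le _ _).trans
    (mul_le_mul_right (enorm_setIntegral_le x (Set.Iio t)) _)) ?_
  rw [lintegral_mul_const' _ _ hx.2.ne]
  exact ENNReal.mul_lt_top hy.2 hx.2

theorem enorm_retarded_le (x y : ℝ → H) (hx : Integrable x) :
    ‖retarded x y‖ₑ ≤ (∫⁻ s, ‖x s‖ₑ) * ∫⁻ t, ‖y t‖ₑ := by
  refine (enorm_integral_le_lintegral_enorm _).trans ?_
  refine (lintegral_mono fun t => (enorm_inner_le _ _).trans
    (mul_le_mul_right (enorm_setIntegral_le x (Set.Iio t)) _)).trans ?_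
  rw [lintegral_mul_const' _ _ hx.2.ne, mul_comm]

theorem retarded_add_left {x x' y : ℝ → H} (hx : Integrable x) (hx' : Integrable x')
    (hy : Integrable y) : retarded (x + x') y = retarded x y + retarded x' y := by
  simp only [retarded]
  rw [← integral_add (integrable_retarded hx hy) (integrable_retarded hx' hy)]
  congr 1; funext t
  simp only [Pi.add_apply]
  rw [integral_add hx.integrableOn hx'.integrableOn, inner_add_right]

theorem retarded_add_right {x y y' : ℝ → H} (hx : Integrable x) (hy : Integrable y)
    (hy' : Integrable y') : retarded x (y + y') = retarded x y + retarded x y' := by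
  simp only [retarded]
  rw [← integral_add (integrable_retarded hx hy) (integrable_retarded hx hy')]
  congr 1; funext t
  simp only [Pi.add_apply]
  rw [inner_add_left]

theorem retarded_sum_left {s : Finset ℕ} {x : ℕ → ℝ → H} {y : ℝ → H} (hx : ∀ n, Integrable (x n))
    (hy : Integrable y) : retarded (∑ n ∈ s, x n) y = ∑ n ∈ s, retarded (x n) y := by
  classical
  induction s using Finset.induction_on with
  | empty => simp [retarded]
  | insert a s ha ih =>
    rw [Finset.sum_insert ha, Finset.sum_insert ha,
      retarded_add_left (hx a) (integrable_finsetSum' _ fun n _ => hx n) hy, ih]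

theorem retarded_sum_right {s : Finset ℕ} {x : ℝ → H} {y : ℕ → ℝ → H} (hx : Integrable x)
    (hy : ∀ n, Integrable (y n)) : retarded x (∑ n ∈ s, y n) = ∑ n ∈ s, retarded x (y n) := by
  classical
  induction s using Finset.induction_on with
  | empty => simp [retarded]
  | insert a s ha ih =>
    rw [Finset.sum_insert ha, Finset.sum_insert ha,
      retarded_add_right hx (hy a) (integrable_finsetSum' _ fun n _ => hy n), ih]

end Retarded

theorem sum_pow_inj_le {r : ℝ} (h0 : 0 ≤ r) (h1 : r < 1) (s : Finset ℕ) (e : ℕ → ℕ)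
    (he : Set.InjOn e s) : ∑ l ∈ s, r ^ e l ≤ (1 - r)⁻¹ := by
  classical
  rw [← Finset.sum_image (f := fun n => r ^ n) he, ← tsum_geometric_of_lt_one h0 h1]
  exact (summable_geometric_of_lt_one h0 h1).sum_le_tsum _ fun n _ => by positivity

/-- The smaller ratio of the scales k and l is `atomRatio⁻¹` to the power |k - l|; the indices on
each side of k contribute at most one geometric series, independently of the number of scales. -/
theorem sum_min_atomScale_le (K k n : ℕ) :
    ∑ l ∈ Finset.range n, min (atomScale K k / atomScale K l) (atomScale K l / atomScale K k) ≤
      2 * (1 - atomRatio⁻¹)⁻¹ := by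
  have hρ := atomRatio_pos
  have hr0 : 0 ≤ atomRatio⁻¹ := by positivity
  have hr1 : atomRatio⁻¹ < 1 := inv_lt_one_of_one_lt₀ one_lt_atomRatio
  have hdiv : ∀ m l, m ≤ l → atomScale K m / atomScale K l = atomRatio⁻¹ ^ (l - m) := by
    intro m l hml
    obtain ⟨d, rfl⟩ := Nat.exists_eq_add_of_le hml
    simp only [atomScale, Nat.add_sub_cancel_left, pow_add, inv_pow]
    field_simp
  rw [← Finset.sum_filter_add_sum_filter_not (Finset.range n) (fun l => l ≤ k), two_mul]
  refine add_le_add ?_ ?_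
  · refine le_trans (Finset.sum_le_sum (g := fun l => atomRatio⁻¹ ^ (k - l)) fun l hl => ?_)
      (sum_pow_inj_le hr0 hr1 _ _ ?_)
    · rw [← hdiv l k (Finset.mem_filter.1 hl).2]
      exact min_le_right _ _
    · intro l hl m hm h
      have h1 := (Finset.mem_filter.1 (Finset.mem_coe.1 hl)).2
      have h2 := (Finset.mem_filter.1 (Finset.mem_coe.1 hm)).2
      omega
  · refine le_trans (Finset.sum_le_sum (g := fun l => atomRatio⁻¹ ^ (l - k)) fun l hl => ?_)
      (sum_pow_inj_le hr0 hr1 _ _ ?_)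
    · rw [← hdiv k l (not_le.1 (Finset.mem_filter.1 hl).2).le]
      exact min_le_left _ _
    · intro l hl m hm h
      have h1 := (Finset.mem_filter.1 (Finset.mem_coe.1 hl)).2
      have h2 := (Finset.mem_filter.1 (Finset.mem_coe.1 hm)).2
      simp only at h
      omega

theorem toLp_schwartz_add (p : ℝ≥0∞) [Fact (1 ≤ p)] (f g : 𝓢(R6, ℂ)) :
    (f + g).toLp p volume = f.toLp p volume + g.toLp p volume :=
  map_add (SchwartzMap.toLpCLM ℂ ℂ p volume) f g

theorem inner_toLp (f g : 𝓢(R6, ℂ)) :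
    inner ℂ (f.toLp 2 volume) (g.toLp 2 volume) = ∫ x, (starRingEnd ℂ) (f x) * g x := by
  rw [L2.inner_def]
  refine integral_congr_ae ?_
  filter_upwards [f.coeFn_toLp 2 volume, g.coeFn_toLp 2 volume] with x h1 h2
  rw [h1, h2, RCLike.inner_apply, mul_comm]

/-- Polarization of the L² isometry. -/
theorem inner_sch_toLp (c t : ℝ) (f g : 𝓢(R6, ℂ)) :
    inner ℂ ((sch c t f).toLp 2 volume) ((sch c t g).toLp 2 volume) =
      inner ℂ (f.toLp 2 volume) (g.toLp 2 volume) := by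
  rw [inner_eq_sum_norm_sq_div_four, inner_eq_sum_norm_sq_div_four (f.toLp 2 volume)]
  simp only [← toLp_schwartz_smul, ← toLp_schwartz_add, ← toLp_schwartz_sub, ← map_smul,
    ← map_add, ← map_sub, norm_sch_toLp_two]

theorem inner_sch_toLp_sub (c s t : ℝ) (f g : 𝓢(R6, ℂ)) :
    inner ℂ ((sch c s f).toLp 2 volume) ((sch c t g).toLp 2 volume) =
      ∫ x, (starRingEnd ℂ) (f x) * sch c (t - s) g x := by
  rw [← inner_toLp, ← inner_sch_toLp c s f, sch_sch]
  congr 4; ring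

/-- Unitarity collects the two evolutions into one over the time difference, to which the dispersive
bound from L¹ to L^∞ applies. -/
theorem norm_inner_sch_le {c : ℝ} (hc : c ≠ 0) {s t : ℝ} (hst : s ≠ t) (f g : 𝓢(R6, ℂ)) :
    ‖inner ℂ ((sch c (-s) f).toLp 2 volume) ((sch c (-t) g).toLp 2 volume)‖ ≤
      (|c|⁻¹) ^ 3 * (|t - s|⁻¹) ^ 3 * (‖f.toLp 1 volume‖ * ‖g.toLp 1 volume‖) := by
  rw [inner_sch_toLp_sub]
  have hne : c * (-t - -s) ≠ 0 := mul_ne_zero hc (by intro h; apply hst; linarith)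
  have i1 : Integrable (fun x => ‖f x‖) volume := f.integrable.norm
  have e1 : ‖f.toLp 1 volume‖ = ∫ x, ‖f x‖ := by
    rw [SchwartzMap.norm_toLp, eLpNorm_one_eq_lintegral_enorm,
      integral_norm_eq_lintegral_enorm f.continuous.aestronglyMeasurable]
  calc _ ≤ ∫ x, ‖(starRingEnd ℂ) (f x) * sch c (-t - -s) g x‖ := norm_integral_le_integral_norm _
    _ ≤ ∫ x, ‖f x‖ * ((|c * (-t - -s)|⁻¹) ^ 3 * ‖g.toLp 1 volume‖) := by
        refine integral_mono_of_nonneg (Eventually.of_forall fun x => norm_nonneg _)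
          (i1.mul_const _) (Eventually.of_forall fun x => ?_)
        simp only [norm_mul, RCLike.norm_conj]
        gcongr
        exact norm_sch_apply_le c _ hne g x
    _ = _ := by
        rw [integral_mul_const, ← e1, abs_mul, mul_inv, mul_pow,
          show |-t - -s| = |t - s| by rw [← abs_neg]; congr 1; ring]
        ring

/-- The path `s ↦ a(s) e^{-i c s Δ} φ_{i(s)}`. -/
def schPath {N : ℕ} (c : ℝ) (a : ℝ → ℂ) (φ : Fin N → 𝓢(R6, ℂ)) (i : ℝ → Fin N) (s : ℝ) :
    Lp ℂ 2 (volume : Measure R6) := a s • (sch c (-s) (φ (i s))).toLp 2 volume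

instance factTwoNeTop : Fact ((2 : ℝ≥0∞) ≠ ⊤) := ⟨by norm_num⟩
instance factThreeNeTop : Fact ((3 : ℝ≥0∞) ≠ ⊤) := ⟨by norm_num⟩

theorem stronglyMeasurable_comp_fin {E : Type*} [NormedAddCommGroup E]
    [SecondCountableTopology E] {N : ℕ} {F : Fin N → ℝ → E} (hF : ∀ n, StronglyMeasurable (F n))
    {i : ℝ → Fin N} (hi : Measurable i) : StronglyMeasurable fun s => F (i s) s := by
  borelize E
  have h1 : Measurable fun p : ℝ × Fin N => F p.2 p.1 :=
    measurable_from_prod_countable_left fun n => (hF n).measurable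
  exact (h1.comp (measurable_id.prodMk hi)).stronglyMeasurable

theorem stronglyMeasurable_sch_comp {N : ℕ} (c : ℝ) (φ : Fin N → 𝓢(R6, ℂ)) {i : ℝ → Fin N}
    (hi : Measurable i) : StronglyMeasurable fun s => (sch c (-s) (φ (i s))).toLp 2 volume :=
  stronglyMeasurable_comp_fin (F := fun n s => (sch c (-s) (φ n)).toLp 2 volume)
    (fun n => ((continuous_sch_toLp_two c (φ n)).comp continuous_neg).stronglyMeasurable) hi

theorem enorm_schPath {N : ℕ} (c : ℝ) (a : ℝ → ℂ) (φ : Fin N → 𝓢(R6, ℂ)) (i : ℝ → Fin N) (s : ℝ) :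
    ‖schPath c a φ i s‖ₑ = ‖a s‖ₑ * ENNReal.ofReal ‖(φ (i s)).toLp 2 volume‖ := by
  rw [schPath, enorm_smul, ← ofReal_norm (E := Lp ℂ 2 volume), norm_sch_toLp_two]

theorem lintegral_schPath_le {N : ℕ} (c : ℝ) (a : ℝ → ℂ) {φ : Fin N → 𝓢(R6, ℂ)} (i : ℝ → Fin N)
    {δ : ℝ} (hδ : ∀ n, ‖(φ n).toLp 2 volume‖ ≤ δ) :
    ∫⁻ s, ‖schPath c a φ i s‖ₑ ≤ ENNReal.ofReal δ * ∫⁻ s, ‖a s‖ₑ := by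
  simp only [enorm_schPath]
  rw [← lintegral_const_mul' _ _ ENNReal.ofReal_ne_top]
  refine lintegral_mono fun s => ?_
  rw [mul_comm]
  gcongr
  exact hδ _

theorem integrable_schPath {N : ℕ} (c : ℝ) {a : ℝ → ℂ} (ha : Integrable a)
    (φ : Fin N → 𝓢(R6, ℂ)) {i : ℝ → Fin N} (hi : Measurable i) : Integrable (schPath c a φ i) := by
  refine ⟨ha.1.smul (stronglyMeasurable_sch_comp c φ hi).aestronglyMeasurable, ?_⟩
  refine lt_of_le_of_lt (lintegral_schPath_le c a (φ := φ) i
    (δ := ∑ n, ‖(φ n).toLp 2 volume‖) fun n => ?_) (ENNReal.mul_lt_top ENNReal.ofReal_lt_top ha.2)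
  exact Finset.single_le_sum (f := fun n => ‖(φ n).toLp 2 volume‖)
    (fun _ _ => norm_nonneg _) (Finset.mem_univ n)

theorem enorm_inner_schPath_le {N M : ℕ} {c : ℝ} (hc : c ≠ 0) {α β : ℝ}
    {a b : ℝ → ℂ} {φ : Fin N → 𝓢(R6, ℂ)} {ψ : Fin M → 𝓢(R6, ℂ)} {p : Fin N → ℝ} {q : Fin M → ℝ}
    (hq : ∀ n, 0 ≤ q n) (hp : ∀ n, 0 ≤ p n) (hβ : 0 < β) (hα : 0 < α)
    (h1 : ∀ n, ‖(φ n).toLp 1 volume‖ ≤ 2 * p n * α ^ 8)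
    (h2 : ∀ n, ‖(ψ n).toLp 1 volume‖ ≤ 2 * q n * β ^ 8) (i : ℝ → Fin N) (j : ℝ → Fin M)
    {s t : ℝ} (hst : s ≠ t) :
    ‖inner ℂ (schPath c b ψ j t) (schPath c a φ i s)‖ₑ ≤
      ENNReal.ofReal (4 * (|c|⁻¹) ^ 3 * α ^ 8 * β ^ 8 * (|t - s|⁻¹) ^ 3) *
        ((‖a s‖ₑ * ENNReal.ofReal (p (i s))) * (‖b t‖ₑ * ENNReal.ofReal (q (j t)))) := by
  rw [schPath, schPath, inner_smul_left, inner_smul_right, enorm_mul, enorm_mul, RCLike.enorm_conj]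
  have h3 : ‖inner ℂ ((sch c (-t) (ψ (j t))).toLp 2 volume) ((sch c (-s) (φ (i s))).toLp 2 volume)‖ₑ
      ≤ ENNReal.ofReal (4 * (|c|⁻¹) ^ 3 * α ^ 8 * β ^ 8 * (|t - s|⁻¹) ^ 3) *
        (ENNReal.ofReal (p (i s)) * ENNReal.ofReal (q (j t))) := by
    rw [← ofReal_norm, ← ENNReal.ofReal_mul (hp _), ← ENNReal.ofReal_mul (by positivity)]
    refine ENNReal.ofReal_le_ofReal ((norm_inner_sch_le hc hst.symm _ _).trans ?_)
    rw [abs_sub_comm s t]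
    calc _ ≤ (|c|⁻¹) ^ 3 * (|t - s|⁻¹) ^ 3 * ((2 * q (j t) * β ^ 8) * (2 * p (i s) * α ^ 8)) := by
          have := hq (j t)
          gcongr
          · exact h2 _
          · exact h1 _
      _ = _ := by ring
  calc _ ≤ ‖b t‖ₑ * (‖a s‖ₑ * (ENNReal.ofReal (4 * (|c|⁻¹) ^ 3 * α ^ 8 * β ^ 8 * (|t - s|⁻¹) ^ 3) *
        (ENNReal.ofReal (p (i s)) * ENNReal.ofReal (q (j t))))) := by gcongr
    _ = _ := by ring

theorem atomPath_schPath {N : ℕ} {c : ℝ} (hc : c ≠ 0) {α : ℝ} (hα : 0 < α) {a : ℝ → ℂ}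
    (ha : Integrable a) (ham : Measurable a) {φ : Fin N → 𝓢(R6, ℂ)} {p : Fin N → ℝ}
    (hp : ∀ n, 0 ≤ p n)
    (h1 : ∀ n, ‖(φ n).toLp 1 volume‖ ≤ 2 * p n * α ^ 8)
    (h2 : ∀ n, ‖(φ n).toLp 2 volume‖ ≤ p n * α⁻¹ ^ 4)
    {i : ℝ → Fin N} (hi : Measurable i) :
    AtomPath (4 * (|c|⁻¹) ^ 3) α (fun s => ‖a s‖ₑ * ENNReal.ofReal (p (i s)))
      (schPath c a φ i) where
  integrable := integrable_schPath c ha φ hi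
  measurable := ham.enorm.mul ((Measurable.of_discrete (f := fun n => ENNReal.ofReal (p n))).comp hi)
  norm_le s := by
    rw [enorm_schPath, mul_left_comm, ← ENNReal.ofReal_mul (by positivity)]
    gcongr
    rw [mul_comm]; exact h2 _
  inner_le s s' hs := by
    refine (enorm_inner_schPath_le hc hp hp hα hα h1 h1 i i hs.symm).trans (le_of_eq ?_)
    rw [show 4 * (|c|⁻¹) ^ 3 * α ^ 8 * α ^ 8 * (|s - s'|⁻¹) ^ 3 =
      4 * (|c|⁻¹) ^ 3 * α ^ 16 * (|s - s'|⁻¹) ^ 3 by ring]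
    ring

theorem schPath_sum {N : ℕ} (c : ℝ) (a : ℝ → ℂ) (φ : Fin N → 𝓢(R6, ℂ)) (χ : ℕ → Fin N → 𝓢(R6, ℂ))
    (s : Finset ℕ) (i : ℝ → Fin N) : schPath c a φ i = (∑ k ∈ s, schPath c a (χ k) i) +
      schPath c a (fun n => φ n - ∑ k ∈ s, χ k n) i := by
  funext t
  simp only [schPath, Pi.add_apply, Finset.sum_apply]
  rw [map_sub, toLp_schwartz_sub, map_sum]
  have h : (∑ k ∈ s, sch c (-t) (χ k (i t))).toLp 2 volume =
      ∑ k ∈ s, (sch c (-t) (χ k (i t))).toLp 2 volume :=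
    map_sum (SchwartzMap.toLpCLM ℂ ℂ 2 volume) _ _
  rw [h, smul_sub, Finset.smul_sum]
  abel

/-- At each time the squared amplitudes of the atoms sum to at most 4, the normalization of
`exists_atoms`. Summing under the integral keeps the total over all scales bounded, although the
test function changes with time. -/
theorem sum_lintegral_sq_le {N : ℕ} {a : ℝ → ℂ} (ham : Measurable a)
    (ha : ∫⁻ s, ‖a s‖ₑ ^ 2 ≤ 1) {i : ℝ → Fin N} (hi : Measurable i) {s : Finset ℕ}
    {p : Fin N → ℕ → ℝ} (hp : ∀ n, ∑ k ∈ s, p n k ^ 2 ≤ 4) (hp0 : ∀ n k, 0 ≤ p n k) :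
    ∑ k ∈ s, ∫⁻ t, (‖a t‖ₑ * ENNReal.ofReal (p (i t) k)) ^ 2 ≤ 4 := by
  have hm : ∀ k, Measurable fun t => (‖a t‖ₑ * ENNReal.ofReal (p (i t) k)) ^ 2 := fun k =>
    (ham.enorm.mul ((Measurable.of_discrete
      (f := fun n => ENNReal.ofReal (p n k))).comp hi)).pow_const 2
  rw [← lintegral_finsetSum _ fun k _ => hm k]
  calc _ ≤ ∫⁻ t, 4 * ‖a t‖ₑ ^ 2 := by
        refine lintegral_mono fun t => ?_
        simp only [mul_pow]
        rw [← Finset.mul_sum, mul_comm]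
        gcongr
        simp only [← ENNReal.ofReal_pow (hp0 _ _)]
        rw [← ENNReal.ofReal_sum_of_nonneg fun k _ => by positivity,
          show (4 : ℝ≥0∞) = ENNReal.ofReal 4 by simp]
        exact ENNReal.ofReal_le_ofReal (hp _)
    _ = 4 * ∫⁻ t, ‖a t‖ₑ ^ 2 := lintegral_const_mul' _ _ (by norm_num)
    _ ≤ 4 * 1 := by gcongr
    _ = 4 := mul_one _

/-- The constant of the retarded bilinear estimate. -/
def bilinConst (c : ℝ) : ℝ :=
  (5 + 5 * (4 * (|c|⁻¹) ^ 3)) * (2 * (1 - atomRatio⁻¹)⁻¹) * 8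

theorem one_sub_atomRatio_inv_pos : 0 < 1 - atomRatio⁻¹ :=
  sub_pos.2 (inv_lt_one_of_one_lt₀ one_lt_atomRatio)

theorem bilinConst_nonneg (c : ℝ) : 0 ≤ bilinConst c := by
  have := one_sub_atomRatio_inv_pos
  unfold bilinConst; positivity

/-- Schur's test for the symmetric matrix of scale ratios, whose row sums do not depend on the
number of scales; the 8 is 4 + 4. -/
theorem sum_sum_min_mul_le {A : ℝ} (hA : 0 ≤ A) (K n : ℕ) {F G : ℕ → ℝ≥0∞}
    (hF : ∑ k ∈ Finset.range n, F k ≤ 4) (hG : ∑ k ∈ Finset.range n, G k ≤ 4) :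
    ∑ l ∈ Finset.range n, ∑ k ∈ Finset.range n,
      ENNReal.ofReal (A * min (atomScale K k / atomScale K l) (atomScale K l / atomScale K k)) *
        (F k + G l) ≤ ENNReal.ofReal (A * (2 * (1 - atomRatio⁻¹)⁻¹) * 8) := by
  have hs := one_sub_atomRatio_inv_pos
  set m : ℕ → ℕ → ℝ := fun k l =>
    min (atomScale K k / atomScale K l) (atomScale K l / atomScale K k) with hm
  have hm0 : ∀ k l, 0 ≤ m k l := fun k l => by
    have := atomScale_pos K k
    have := atomScale_pos K l
    exact le_min (by positivity) (by positivity)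
  have hsym : ∀ k l, m k l = m l k := fun k l => min_comm _ _
  set S : ℝ := 2 * (1 - atomRatio⁻¹)⁻¹
  have hS : ∀ k, ∑ l ∈ Finset.range n, ENNReal.ofReal (A * m k l) ≤ ENNReal.ofReal (A * S) := by
    intro k
    rw [← ENNReal.ofReal_sum_of_nonneg fun l _ => mul_nonneg hA (hm0 k l), ← Finset.mul_sum]
    exact ENNReal.ofReal_le_ofReal (mul_le_mul_of_nonneg_left (sum_min_atomScale_le K k n) hA)
  have hS' : ∀ l, ∑ k ∈ Finset.range n, ENNReal.ofReal (A * m k l) ≤ ENNReal.ofReal (A * S) := by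
    intro l
    simp only [hsym _ l]
    exact hS l
  change ∑ l ∈ Finset.range n, ∑ k ∈ Finset.range n, ENNReal.ofReal (A * m k l) * (F k + G l) ≤ _
  simp only [mul_add, Finset.sum_add_distrib]
  have e1 : ∑ l ∈ Finset.range n, ∑ k ∈ Finset.range n, ENNReal.ofReal (A * m k l) * F k ≤
      ENNReal.ofReal (A * S) * 4 := by
    rw [Finset.sum_comm]
    simp only [← Finset.sum_mul]
    refine (Finset.sum_le_sum fun k _ => mul_le_mul_left (hS k) (F k)).trans ?_
    rw [← Finset.mul_sum]
    gcongr
  have e2 : ∑ l ∈ Finset.range n, ∑ k ∈ Finset.range n, ENNReal.ofReal (A * m k l) * G l ≤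
      ENNReal.ofReal (A * S) * 4 := by
    simp only [← Finset.sum_mul]
    refine (Finset.sum_le_sum fun l _ => mul_le_mul_left (hS' l) (G l)).trans ?_
    rw [← Finset.mul_sum]
    gcongr
  refine (add_le_add e1 e2).trans (le_of_eq ?_)
  rw [← mul_add, ENNReal.ofReal_mul (by positivity : 0 ≤ A * S)]
  norm_num

/-- The endpoint retarded bilinear Strichartz estimate. -/
theorem enorm_retarded_schPath_le {N M : ℕ} {c : ℝ} (hc : c ≠ 0) {a b : ℝ → ℂ}
    (ha : Integrable a) (ham : Measurable a) (ha2 : ∫⁻ s, ‖a s‖ₑ ^ 2 ≤ 1)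
    (hb : Integrable b) (hbm : Measurable b) (hb2 : ∫⁻ s, ‖b s‖ₑ ^ 2 ≤ 1)
    {φ : Fin N → 𝓢(R6, ℂ)} {ψ : Fin M → 𝓢(R6, ℂ)}
    (hφ : ∀ n, eLpNorm (φ n) (3 / 2) volume ≤ 1) (hψ : ∀ n, eLpNorm (ψ n) (3 / 2) volume ≤ 1)
    {i : ℝ → Fin N} (hi : Measurable i) {j : ℝ → Fin M} (hj : Measurable j) :
    ‖retarded (schPath c a φ i) (schPath c b ψ j)‖ₑ ≤ ENNReal.ofReal (bilinConst c) := by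
  set x := schPath c a φ i
  set y := schPath c b ψ j
  have hx : Integrable x := integrable_schPath c ha φ hi
  have hy : Integrable y := integrable_schPath c hb ψ hj
  set A₁ := ∫⁻ s, ‖a s‖ₑ
  set B₁ := ∫⁻ s, ‖b s‖ₑ
  set X₁ := ∫⁻ s, ‖x s‖ₑ
  set Y₁ := ∫⁻ s, ‖y s‖ₑ
  -- The atomic decomposition is exact only up to δ in L². The remainders are estimated crudely, in
  -- L¹ in time, by finite quantities without uniform control; they disappear as δ → 0.
  have key : ∀ δ : ℝ, 0 < δ → δ < 1 → ‖retarded x y‖ₑ ≤ ENNReal.ofReal (bilinConst c) +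
      (A₁ * (Y₁ + B₁) + X₁ * B₁) * ENNReal.ofReal δ := by
    intro δ hδ hδ1
    choose K₁ hK₁ using fun n => exists_atoms (φ n) (hφ n) hδ
    choose K₂ hK₂ using fun n => exists_atoms (ψ n) (hψ n) hδ
    -- One K for the finitely many test functions, so that all of them are decomposed over the same
    -- scales.
    set K := max (Finset.univ.sup K₁) (Finset.univ.sup K₂)
    choose f p hp0 hf1 hf2 hps hfr using fun n => hK₁ n K
      ((Finset.le_sup (Finset.mem_univ n)).trans (le_max_left _ _))
    choose g q hq0 hg1 hg2 hqs hgr using fun n => hK₂ n K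
      ((Finset.le_sup (Finset.mem_univ n)).trans (le_max_right _ _))
    set R := Finset.range (2 * K + 1)
    set xk : ℕ → ℝ → Lp ℂ 2 (volume : Measure R6) := fun k => schPath c a (fun n => f n k) i
    set yk : ℕ → ℝ → Lp ℂ 2 (volume : Measure R6) := fun k => schPath c b (fun n => g n k) j
    set xr := schPath c a (fun n => φ n - ∑ k ∈ R, f n k) i
    set yr := schPath c b (fun n => ψ n - ∑ k ∈ R, g n k) j
    have hxd : x = (∑ k ∈ R, xk k) + xr := schPath_sum c a φ (fun k n => f n k) R i
    have hyd : y = (∑ k ∈ R, yk k) + yr := schPath_sum c b ψ (fun k n => g n k) R j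
    have hxk : ∀ k, Integrable (xk k) := fun k => integrable_schPath c ha _ hi
    have hyk : ∀ k, Integrable (yk k) := fun k => integrable_schPath c hb _ hj
    have hxr : Integrable xr := integrable_schPath c ha _ hi
    have hyr : Integrable yr := integrable_schPath c hb _ hj
    have hxS : Integrable (∑ k ∈ R, xk k) := integrable_finsetSum' _ fun k _ => hxk k
    have hyS : Integrable (∑ k ∈ R, yk k) := integrable_finsetSum' _ fun k _ => hyk k
    have hdec : retarded x y = retarded (∑ k ∈ R, xk k) (∑ k ∈ R, yk k) +
        (retarded xr (∑ k ∈ R, yk k) + retarded x yr) := by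
      conv_lhs => rw [hyd]
      rw [retarded_add_right hx hyS hyr]
      nth_rw 1 [hxd]
      rw [retarded_add_left hxS hxr hyS, add_assoc]
    have hxr1 : ∫⁻ s, ‖xr s‖ₑ ≤ ENNReal.ofReal δ * A₁ := lintegral_schPath_le c a i hfr
    have hyr1 : ∫⁻ s, ‖yr s‖ₑ ≤ ENNReal.ofReal δ * B₁ := lintegral_schPath_le c b j hgr
    have hyr1' : ∫⁻ s, ‖yr s‖ₑ ≤ B₁ := by
      refine hyr1.trans (mul_le_of_le_one_left' ?_)
      rw [← ENNReal.ofReal_one]; exact ENNReal.ofReal_le_ofReal hδ1.le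
    have hyS1 : ∫⁻ s, ‖(∑ k ∈ R, yk k) s‖ₑ ≤ Y₁ + B₁ := by
      have e1 : ∑ k ∈ R, yk k = y - yr := by rw [hyd]; abel
      rw [e1]
      calc _ ≤ ∫⁻ s, (‖y s‖ₑ + ‖yr s‖ₑ) := lintegral_mono fun s => enorm_sub_le
        _ = Y₁ + ∫⁻ s, ‖yr s‖ₑ := lintegral_add_left' hy.1.enorm _
        _ ≤ _ := by gcongr
    have main : ‖retarded (∑ k ∈ R, xk k) (∑ k ∈ R, yk k)‖ₑ ≤ ENNReal.ofReal (bilinConst c) := by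
      rw [retarded_sum_right hxS hyk]
      simp only [retarded_sum_left hxk (hyk _)]
      refine (enorm_sum_le _ _).trans ((Finset.sum_le_sum fun l _ => enorm_sum_le _ _).trans ?_)
      refine le_trans (Finset.sum_le_sum fun l _ => Finset.sum_le_sum fun k _ => ?_)
        (sum_sum_min_mul_le (A := 5 + 5 * (4 * (|c|⁻¹) ^ 3)) (by positivity) K (2 * K + 1)
        (sum_lintegral_sq_le ham ha2 hi hps hp0) (sum_lintegral_sq_le hbm hb2 hj hqs hq0))
      exact enorm_retarded_atoms_le (by positivity) (atomScale_pos K k) (atomScale_pos K l)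
        (atomPath_schPath hc (atomScale_pos K k) ha ham (fun n => hp0 n k) (fun n => hf1 n k)
          (fun n => hf2 n k) hi)
        (atomPath_schPath hc (atomScale_pos K l) hb hbm (fun n => hq0 n l) (fun n => hg1 n l)
          (fun n => hg2 n l) hj)
        (fun s t hst => enorm_inner_schPath_le hc (fun n => hq0 n l) (fun n => hp0 n k)
          (atomScale_pos K l) (atomScale_pos K k) (fun n => hf1 n k) (fun n => hg1 n l) i j hst)
    rw [hdec]
    refine (enorm_add_le _ _).trans (add_le_add main ((enorm_add_le _ _).trans ?_))
    calc _ ≤ (ENNReal.ofReal δ * A₁) * (Y₁ + B₁) + X₁ * (ENNReal.ofReal δ * B₁) :=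
          add_le_add ((enorm_retarded_le _ _ hxr).trans (mul_le_mul' hxr1 hyS1))
            ((enorm_retarded_le _ _ hx).trans (mul_le_mul' le_rfl hyr1))
      _ = _ := by ring
  have hfin : A₁ * (Y₁ + B₁) + X₁ * B₁ ≠ ⊤ :=
    ENNReal.add_ne_top.2 ⟨ENNReal.mul_ne_top ha.2.ne (ENNReal.add_ne_top.2 ⟨hy.2.ne, hb.2.ne⟩),
      ENNReal.mul_ne_top hx.2.ne hb.2.ne⟩
  have ht : Tendsto (fun δ : ℝ => ENNReal.ofReal (bilinConst c) +
      (A₁ * (Y₁ + B₁) + X₁ * B₁) * ENNReal.ofReal δ) (𝓝[>] 0)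
      (𝓝 (ENNReal.ofReal (bilinConst c) + (A₁ * (Y₁ + B₁) + X₁ * B₁) * ENNReal.ofReal 0)) := by
    have h0 : Tendsto (fun δ : ℝ => ENNReal.ofReal δ) (𝓝[>] 0) (𝓝 (ENNReal.ofReal 0)) :=
      (ENNReal.continuous_ofReal.tendsto 0).mono_left nhdsWithin_le_nhds
    exact tendsto_const_nhds.add (ENNReal.Tendsto.const_mul h0 (Or.inr hfin))
  simp only [ENNReal.ofReal_zero, add_zero, mul_zero] at ht
  refine ge_of_tendsto ht ?_
  filter_upwards [Ioo_mem_nhdsGT (show (0 : ℝ) < 1 by norm_num)] with δ hδ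
  exact key δ hδ.1 hδ.2

end QuadNLS
end

/-! ### From the bilinear estimate to linear ones: selection in time and averaging of functionals.
-/

noncomputable section
namespace QuadNLS

theorem bilinConst_neg (c : ℝ) : bilinConst (-c) = bilinConst c := by
  simp [bilinConst]

/-- The constant of the linear estimates. -/
def linConst (c : ℝ) : ℝ := 1 + 2 * bilinConst c

theorem linConst_neg (c : ℝ) : linConst (-c) = linConst c := by
  simp [linConst, bilinConst_neg]

theorem one_le_linConst (c : ℝ) : 1 ≤ linConst c := by
  have := bilinConst_nonneg c
  unfold linConst; linarith

theorem linConst_nonneg (c : ℝ) : 0 ≤ linConst c := zero_le_one.trans (one_le_linConst c)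

theorem schPath_comp_neg {N : ℕ} (c : ℝ) (a : ℝ → ℂ) (φ : Fin N → 𝓢(R6, ℂ)) (i : ℝ → Fin N)
    (s : ℝ) : schPath c a φ i (-s) = schPath (-c) (fun s => a (-s)) φ (fun s => i (-s)) s := by
  simp only [schPath, sch_neg_coeff, neg_neg]

theorem integral_inner_left' {H : Type*} [NormedAddCommGroup H] [InnerProductSpace ℂ H]
    [CompleteSpace H] {x : ℝ → H} (hx : Integrable x) (X : H) :
    inner ℂ (∫ t, x t) X = ∫ t, inner ℂ (x t) X := by
  rw [← inner_conj_symm, ← integral_inner hx X, ← integral_conj]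
  simp only [inner_conj_symm]

/-- The squared norm is a double integral over pairs of times. The part with s < t is a retarded
interaction, and so is the part with s > t after reversal of time, which replaces c by -c. The
constant avoids a square root through 2B ≤ (1 + 2B)². -/
theorem enorm_integral_schPath_le {N : ℕ} {c : ℝ} (hc : c ≠ 0) {a : ℝ → ℂ}
    (ha : Integrable a) (ham : Measurable a) (ha2 : ∫⁻ s, ‖a s‖ₑ ^ 2 ≤ 1)
    {φ : Fin N → 𝓢(R6, ℂ)} (hφ : ∀ n, eLpNorm (φ n) (3 / 2) volume ≤ 1)
    {i : ℝ → Fin N} (hi : Measurable i) :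
    ‖∫ s, schPath c a φ i s‖ₑ ≤ ENNReal.ofReal (linConst c) := by
  set x := schPath c a φ i with hxdef
  set x' := schPath (-c) (fun s => a (-s)) φ (fun s => i (-s))
  have hx : Integrable x := integrable_schPath c ha φ hi
  have hx' : Integrable x' := integrable_schPath (-c) ha.comp_neg φ (hi.comp measurable_neg)
  have hxx' : ∀ s, x (-s) = x' s := schPath_comp_neg c a φ i
  set X := ∫ s, x s
  have hsplit : ∀ t, X = (∫ s in Set.Iio t, x s) + ∫ s in Set.Ioi t, x s := fun t => by
    rw [← integral_Iic_eq_integral_Iio, ← setIntegral_union (Set.Iic_disjoint_Ioi le_rfl)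
      measurableSet_Ioi hx.integrableOn hx.integrableOn, Set.Iic_union_Ioi, setIntegral_univ]
  have hre : ∀ τ, ∫ s in Set.Ioi (-τ), x s = ∫ s in Set.Iio τ, x' s := fun τ => by
    rw [← integral_Iic_eq_integral_Iio, ← integral_comp_neg_Iic]
    simp only [hxx']
  have e2 : ∀ t, ∫ s in Set.Ioi t, x s = ∫ s in Set.Iio (-t), x' s := fun t => by
    rw [← hre, neg_neg]
  have i2 : Integrable fun t => inner ℂ (x t) (∫ s in Set.Ioi t, x s) := by
    have := (integrable_retarded hx' hx').comp_neg
    refine this.congr (ae_of_all _ fun t => ?_)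
    change inner ℂ (x' (-t)) (∫ s in Set.Iio (-t), x' s) = inner ℂ (x t) (∫ s in Set.Ioi t, x s)
    rw [e2, ← hxx' (-t), neg_neg]
  have e1 : inner ℂ X X = retarded x x + retarded x' x' := by
    have e0 : inner ℂ X X = ∫ t, inner ℂ (x t) X := integral_inner_left' hx X
    rw [e0]
    have : ∀ t, inner ℂ (x t) X = inner ℂ (x t) (∫ s in Set.Iio t, x s) +
        inner ℂ (x t) (∫ s in Set.Ioi t, x s) := fun t => by
      rw [← inner_add_right, ← hsplit t]
    simp only [this]
    refine (integral_add (integrable_retarded hx hx) i2).trans ?_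
    congr 1
    rw [← integral_neg_eq_self]
    simp only [hre, hxx']
    rfl
  have h1 : ‖inner ℂ X X‖ₑ ≤ ENNReal.ofReal (2 * bilinConst c) := by
    rw [e1, two_mul, ENNReal.ofReal_add (bilinConst_nonneg c) (bilinConst_nonneg c)]
    refine (enorm_add_le _ _).trans (add_le_add
      (enorm_retarded_schPath_le hc ha ham ha2 ha ham ha2 hφ hφ hi hi) ?_)
    have ha2' : ∫⁻ s, ‖a (-s)‖ₑ ^ 2 ≤ 1 := by
      rwa [lintegral_neg_eq_self (fun s => ‖a s‖ₑ ^ 2)]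
    rw [← bilinConst_neg c]
    exact enorm_retarded_schPath_le (neg_ne_zero.2 hc) ha.comp_neg (ham.comp measurable_neg)
      ha2' ha.comp_neg (ham.comp measurable_neg) ha2' hφ hφ (hi.comp measurable_neg)
      (hi.comp measurable_neg)
  have h2 : ‖inner ℂ X X‖ₑ = ‖X‖ₑ ^ 2 := by
    rw [inner_self_eq_norm_sq_to_K, enorm_pow, ← ofReal_norm (E := ℂ)]
    simp
  rw [h2] at h1
  refine (ENNReal.pow_le_pow_left_iff (n := 2) (by norm_num)).1 (h1.trans ?_)
  rw [← ENNReal.ofReal_pow (linConst_nonneg c)]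
  refine ENNReal.ofReal_le_ofReal ?_
  have := bilinConst_nonneg c
  unfold linConst
  nlinarith

/-- An index maximizing `‖c n t‖` among `n ≤ N`. -/
def argmaxIndex (c : ℕ → ℝ → ℂ) : ℕ → ℝ → ℕ
  | 0, _ => 0
  | N + 1, t => if ‖c (argmaxIndex c N t) t‖ < ‖c (N + 1) t‖ then N + 1 else argmaxIndex c N t

theorem argmaxIndex_le (c : ℕ → ℝ → ℂ) (N : ℕ) (t : ℝ) : argmaxIndex c N t ≤ N := by
  induction N with
  | zero => simp [argmaxIndex]
  | succ N ih =>
    simp only [argmaxIndex]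
    split_ifs <;> omega

theorem norm_le_argmaxIndex (c : ℕ → ℝ → ℂ) (N : ℕ) (t : ℝ) :
    ∀ n ≤ N, ‖c n t‖ ≤ ‖c (argmaxIndex c N t) t‖ := by
  induction N with
  | zero => intro n hn; simp [Nat.le_zero.1 hn, argmaxIndex]
  | succ N ih =>
    intro n hn
    simp only [argmaxIndex]
    split_ifs with h
    · rcases Nat.lt_or_ge N n with h1 | h1
      · rw [show n = N + 1 by omega]
      · exact (ih n h1).trans h.le
    · rcases Nat.lt_or_ge N n with h1 | h1
      · rw [show n = N + 1 by omega]; exact not_lt.1 h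
      · exact ih n h1

theorem measurable_comp_nat {c : ℕ → ℝ → ℂ} (hc : ∀ n, Measurable (c n)) {m : ℝ → ℕ}
    (hm : Measurable m) : Measurable fun t => c (m t) t := by
  have h1 : Measurable fun p : ℝ × ℕ => c p.2 p.1 := measurable_from_prod_countable_left hc
  exact h1.comp (measurable_id.prodMk hm)

theorem measurable_argmaxIndex {c : ℕ → ℝ → ℂ} (hc : ∀ n, Measurable (c n)) (N : ℕ) :
    Measurable (argmaxIndex c N) := by
  induction N with
  | zero => exact measurable_const
  | succ N ih =>
    exact Measurable.ite (measurableSet_lt (measurable_comp_nat hc ih).norm (hc (N + 1)).norm)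
      measurable_const ih

/-- Selection of a maximizing index. -/
theorem lintegral_iSup_sq_le_of_selection {c : ℕ → ℝ → ℂ} (hc : ∀ n, Measurable (c n)) {J : Set ℝ}
    (hJ : MeasurableSet J) (hJv : volume J ≠ ⊤) (hb : ∀ n, ∃ M : ℝ, ∀ t ∈ J, ‖c n t‖ ≤ M)
    {C : ℝ≥0∞}
    (h : ∀ (N : ℕ) (j : ℝ → Fin N) (b : ℝ → ℂ), Measurable j → Measurable b → Integrable b →
      (∀ t, t ∉ J → b t = 0) → ∫⁻ t, ‖b t‖ₑ ^ 2 ≤ 1 → ‖∫ t, b t * c (j t) t‖ₑ ≤ C) :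
    ∫⁻ t in J, (⨆ n, ‖c n t‖ₑ) ^ 2 ≤ C ^ 2 := by
  have hmeas : ∀ N, Measurable fun t => c (argmaxIndex c N t) t := fun N =>
    measurable_comp_nat hc (measurable_argmaxIndex hc N)
  -- The supremum is the increasing limit of the maxima over n ≤ N, and each maximum is attained at
  -- a measurable index; monotone convergence leaves finitely many functions.
  have hsup : ∀ t, (⨆ n, ‖c n t‖ₑ) ^ 2 = ⨆ N, ‖c (argmaxIndex c N t) t‖ₑ ^ 2 := by
    intro t
    have e1 : (⨆ n, ‖c n t‖ₑ) = ⨆ N, ‖c (argmaxIndex c N t) t‖ₑ := by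
      refine le_antisymm (iSup_le fun n => ?_) (iSup_le fun N => le_iSup (fun n => ‖c n t‖ₑ) _)
      refine le_trans ?_ (le_iSup (fun N => ‖c (argmaxIndex c N t) t‖ₑ) n)
      exact enorm_le_iff_norm_le.2 (norm_le_argmaxIndex c n t n le_rfl)
    rw [e1, ENNReal.iSup_pow]
  simp only [hsup]
  rw [lintegral_iSup (fun N => (hmeas N).enorm.pow_const 2)]
  swap
  · intro N N' hN t
    refine pow_le_pow_left' (enorm_le_iff_norm_le.2 ?_) 2
    exact norm_le_argmaxIndex c N' t _ ((argmaxIndex_le c N t).trans hN)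
  refine iSup_le fun N => ?_
  set d : ℝ → ℂ := fun t => c (argmaxIndex c N t) t
  set I := ∫⁻ t in J, ‖d t‖ₑ ^ 2 with hI
  obtain ⟨M, hM⟩ : ∃ M : ℝ, ∀ t ∈ J, ‖d t‖ ≤ M := by
    choose M hM using hb
    refine ⟨∑ n ∈ Finset.range (N + 1), |M n|, fun t ht => (hM _ t ht).trans ?_⟩
    refine (le_abs_self _).trans (Finset.single_le_sum (f := fun n => |M n|)
      (fun _ _ => abs_nonneg _) (Finset.mem_range.2 ?_))
    have := argmaxIndex_le c N t
    omega
  have hIt : I ≠ ⊤ := by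
    refine ne_top_of_le_ne_top (ENNReal.mul_ne_top (ENNReal.ofReal_ne_top (r := M ^ 2)) hJv) ?_
    rw [← setLIntegral_const]
    refine setLIntegral_mono' hJ fun t ht => ?_
    rw [← ofReal_norm, ← ENNReal.ofReal_pow (norm_nonneg _)]
    exact ENNReal.ofReal_le_ofReal (pow_le_pow_left₀ (norm_nonneg _) (hM t ht) 2)
  by_cases hI0 : I = 0
  · rw [hI0]; exact zero_le
  set r : ℝ := √I.toReal
  have hr : 0 < r := Real.sqrt_pos.2 (ENNReal.toReal_pos hI0 hIt)
  have hr2 : ENNReal.ofReal r ^ 2 = I := by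
    rw [← ENNReal.ofReal_pow hr.le, Real.sq_sqrt ENNReal.toReal_nonneg, ENNReal.ofReal_toReal hIt]
  -- The normalized extremizer for duality in L²(J). It is bounded with support in a set of finite
  -- measure, hence also integrable.
  set b : ℝ → ℂ := J.indicator fun t => (r : ℂ)⁻¹ * (starRingEnd ℂ) (d t)
  have hbm : Measurable b := Measurable.indicator
    (measurable_const.mul (Complex.continuous_conj.measurable.comp (hmeas N))) hJ
  have hbn : ∀ t, ‖b t‖ₑ = J.indicator (fun t => (ENNReal.ofReal r)⁻¹ * ‖d t‖ₑ) t := by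
    intro t
    by_cases ht : t ∈ J
    · simp only [b, Set.indicator_of_mem ht, enorm_mul, RCLike.enorm_conj]
      congr 1
      rw [← ofReal_norm, norm_inv, Complex.norm_real, Real.norm_of_nonneg hr.le,
        ENNReal.ofReal_inv_of_pos hr]
    · simp [b, ht]
  have hr0 : ENNReal.ofReal r ≠ 0 := by simpa using hr
  have hb2 : ∫⁻ t, ‖b t‖ₑ ^ 2 ≤ 1 := by
    have : ∀ t, ‖b t‖ₑ ^ 2 = J.indicator (fun t => ((ENNReal.ofReal r)⁻¹) ^ 2 * ‖d t‖ₑ ^ 2) t := by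
      intro t
      rw [hbn]
      by_cases ht : t ∈ J
      · simp [ht, mul_pow]
      · simp [ht]
    simp only [this]
    rw [lintegral_indicator hJ, lintegral_const_mul' _ _ (by simp [hr]), ← hI, ← hr2, ← mul_pow,
      ENNReal.inv_mul_cancel hr0 ENNReal.ofReal_ne_top, one_pow]
  have hbi : Integrable b := by
    have : IsFiniteMeasure (volume.restrict J) := ⟨by simpa using hJv.lt_top⟩
    refine (integrable_indicator_iff hJ).2 (Integrable.of_bound
      (measurable_const.mul (Complex.continuous_conj.measurable.comp
        (hmeas N))).aestronglyMeasurable (r⁻¹ * M) ?_)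
    filter_upwards [ae_restrict_mem hJ] with t ht
    simp only [norm_mul, norm_inv, Complex.norm_real, Real.norm_of_nonneg hr.le, RCLike.norm_conj]
    have := hM t ht
    gcongr
  have hj : Measurable fun t => Fin.ofNat (N + 1) (argmaxIndex c N t) :=
    (Measurable.of_discrete (f := Fin.ofNat (N + 1))).comp (measurable_argmaxIndex hc N)
  have hmain := h (N + 1) (fun t => Fin.ofNat (N + 1) (argmaxIndex c N t)) b hj hbm hbi
    (fun t ht => by simp [b, ht]) hb2
  have e3 : ∀ t, b t * c (Fin.ofNat (N + 1) (argmaxIndex c N t)) t =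
      ((J.indicator (fun t => r⁻¹ * ‖d t‖ ^ 2) t : ℝ) : ℂ) := by
    intro t
    have h1 : ((Fin.ofNat (N + 1) (argmaxIndex c N t)) : ℕ) = argmaxIndex c N t := by
      simp [Fin.ofNat, Nat.mod_eq_of_lt (Nat.lt_succ_of_le (argmaxIndex_le c N t))]
    rw [h1]
    by_cases ht : t ∈ J
    · simp only [b, Set.indicator_of_mem ht]
      rw [mul_assoc, mul_comm ((starRingEnd ℂ) (d t))]
      change _ * (d t * _) = _
      rw [Complex.mul_conj, Complex.normSq_eq_norm_sq]
      push_cast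
      ring
    · simp [b, ht]
  simp only [e3] at hmain
  rw [integral_complex_ofReal, integral_indicator hJ, integral_const_mul] at hmain
  have e4 : ∫ t in J, ‖d t‖ ^ 2 = I.toReal := by
    rw [integral_eq_lintegral_of_nonneg_ae (Eventually.of_forall fun t => by positivity)
      ((hmeas N).norm.pow_const 2).aestronglyMeasurable]
    congr 1
    refine lintegral_congr fun t => ?_
    rw [ENNReal.ofReal_pow (norm_nonneg _), ofReal_norm]
  have e5 : r⁻¹ * I.toReal = r := by
    have := Real.sq_sqrt (ENNReal.toReal_nonneg (a := I))
    change r ^ 2 = _ at this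
    rw [← this]; field_simp
  rw [e4, e5, ← ofReal_norm, Complex.norm_real, Real.norm_of_nonneg hr.le] at hmain
  rw [← hr2]
  exact pow_le_pow_left' hmain 2

/-- The bilinear pairing of an `L^p` function with a Schwartz function. -/
def pair {p p' : ℝ≥0∞} [Fact (1 ≤ p)] [h : DualExponent p p'] (ψ : 𝓢(R6, ℂ)) :
    Lp ℂ p (volume : Measure R6) →L[ℂ] ℂ :=
  have := h.conj
  LinearMap.mkContinuous
    { toFun := fun f => ∫ x, f x * ψ x
      map_add' := fun f g => by
        rw [← integral_add (integrable_mul_of_memLp (Lp.memLp f) (ψ.memLp p' volume))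
          (integrable_mul_of_memLp (Lp.memLp g) (ψ.memLp p' volume))]
        refine integral_congr_ae ?_
        filter_upwards [Lp.coeFn_add f g] with x hx
        rw [hx, Pi.add_apply, add_mul]
      map_smul' := fun a f => by
        rw [RingHom.id_apply, smul_eq_mul, ← integral_const_mul]
        refine integral_congr_ae ?_
        filter_upwards [Lp.coeFn_smul a f] with x hx
        rw [hx, Pi.smul_apply, smul_eq_mul, mul_assoc] }
    (eLpNorm ψ p' volume).toReal fun f => by
      have h1 := enorm_integral_mul_le (p := p) (q := p') (Lp.memLp f).1
        ψ.continuous.aestronglyMeasurable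
      have h2 := ENNReal.toReal_mono (ENNReal.mul_ne_top (Lp.memLp f).2.ne
        (ψ.memLp p' volume).2.ne) h1
      rw [toReal_enorm, ENNReal.toReal_mul] at h2
      rw [mul_comm, Lp.norm_def]
      exact h2

theorem pair_apply {p p' : ℝ≥0∞} [Fact (1 ≤ p)] [DualExponent p p'] (ψ : 𝓢(R6, ℂ))
    (f : Lp ℂ p (volume : Measure R6)) : pair ψ f = ∫ x, f x * ψ x := rfl

theorem pair_toLp {p p' : ℝ≥0∞} [Fact (1 ≤ p)] [DualExponent p p'] (ψ φ : 𝓢(R6, ℂ)) :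
    pair ψ (φ.toLp p volume) = ∫ x, φ x * ψ x := by
  rw [pair_apply]
  refine integral_congr_ae ?_
  filter_upwards [φ.coeFn_toLp p volume] with x hx
  rw [hx]

/-- The space `L² × L³`. -/
abbrev L23 : Type := Lp ℂ 2 (volume : Measure R6) × Lp ℂ 3 (volume : Measure R6)

/-- The embedding of the Schwartz space in `L² × L³`. -/
def toL23 : 𝓢(R6, ℂ) →L[ℂ] L23 :=
  (SchwartzMap.toLpCLM ℂ ℂ 2 volume).prod (SchwartzMap.toLpCLM ℂ ℂ 3 volume)

theorem toL23_fst (φ : 𝓢(R6, ℂ)) : (toL23 φ).1 = φ.toLp 2 volume := rfl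
theorem toL23_snd (φ : 𝓢(R6, ℂ)) : (toL23 φ).2 = φ.toLp 3 volume := rfl

/-- The quotient by the closure of the range kills the integrand, hence the integral. Closed
conditions satisfied by Schwartz functions thereby pass to integrals of them. -/
theorem integral_toL23_mem_closure {g : ℝ → 𝓢(R6, ℂ)} {μ : Measure ℝ}
    (hg : Integrable (fun t => toL23 (g t)) μ) :
    ∫ t, toL23 (g t) ∂μ ∈ closure (Set.range toL23) := by
  let P : Submodule ℂ L23 := (LinearMap.range toL23.toLinearMap).topologicalClosure
  have : IsClosed (P : Set L23) := Submodule.isClosed_topologicalClosure _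
  have h1 : P.mkQL (∫ t, toL23 (g t) ∂μ) = 0 := by
    rw [← ContinuousLinearMap.integral_comp_comm _ hg]
    have h2 : ∀ t, P.mkQL (toL23 (g t)) = 0 := fun t =>
      (Submodule.Quotient.mk_eq_zero P).2
        (Submodule.le_topologicalClosure _ ⟨g t, rfl⟩)
    simp only [h2, integral_zero]
  exact (Submodule.Quotient.mk_eq_zero P).1 h1

/-- The weighted geometric mean of the two norms is at most the norm of L² × L³, so the functional
is continuous for it and extends by Hahn–Banach. -/
theorem exists_clm_extension {ℓ : 𝓢(R6, ℂ) →ₗ[ℂ] ℂ} {n₁ n₂ θ : ℝ} (h1 : 0 ≤ n₁)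
    (h2 : 0 ≤ n₂) (hθ0 : 0 ≤ θ) (hθ1 : θ ≤ 1)
    (hℓ : ∀ ψ, ‖ℓ ψ‖ ≤ n₁ * ‖ψ.toLp 3 volume‖ +
      n₂ * (‖ψ.toLp 2 volume‖ ^ (1 - θ) * ‖ψ.toLp 3 volume‖ ^ θ)) :
    ∃ L : L23 →L[ℂ] ℂ, ∀ ψ, L (toL23 ψ) = ℓ ψ := by
  have hbd : ∃ C, ∀ ψ, ‖ℓ ψ‖ ≤ C * ‖toL23.toLinearMap ψ‖ := by
    refine ⟨n₁ + n₂, fun ψ => (hℓ ψ).trans ?_⟩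
    have e1 : ‖ψ.toLp 2 volume‖ ≤ ‖toL23 ψ‖ := norm_fst_le (toL23 ψ)
    have e2 : ‖ψ.toLp 3 volume‖ ≤ ‖toL23 ψ‖ := norm_snd_le (toL23 ψ)
    have e3 : ‖ψ.toLp 2 volume‖ ^ (1 - θ) * ‖ψ.toLp 3 volume‖ ^ θ ≤ ‖toL23 ψ‖ := by
      calc _ ≤ ‖toL23 ψ‖ ^ (1 - θ) * ‖toL23 ψ‖ ^ θ := by
            gcongr
        _ = ‖toL23 ψ‖ := by
            rw [← Real.rpow_add_of_nonneg (norm_nonneg _) (by linarith) hθ0]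
            simp
    change _ ≤ (n₁ + n₂) * ‖toL23 ψ‖
    rw [add_mul]
    gcongr
  obtain ⟨L, hL, -⟩ := exists_extension_norm_eq (LinearMap.range toL23.toLinearMap)
    (ℓ.compLeftInverse toL23.toLinearMap)
  refine ⟨L, fun ψ => ?_⟩
  have := hL ⟨toL23 ψ, ⟨ψ, rfl⟩⟩
  rw [← LinearMap.compLeftInverse_apply_of_bdd ℓ toL23.toLinearMap hbd ψ (toL23 ψ) rfl]
  exact this

/-- On the right stand the norms of the integral rather than the integrals of the norms, so
cancellation in time is kept. This is possible because the bound is a closed condition on L² × L³,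
inherited by the closure of the Schwartz functions. -/
theorem norm_integral_functional_le {ℓ : 𝓢(R6, ℂ) →ₗ[ℂ] ℂ} {n₁ n₂ θ : ℝ} (h1 : 0 ≤ n₁)
    (h2 : 0 ≤ n₂) (hθ0 : 0 ≤ θ) (hθ1 : θ ≤ 1)
    (hℓ : ∀ ψ, ‖ℓ ψ‖ ≤ n₁ * ‖ψ.toLp 3 volume‖ +
      n₂ * (‖ψ.toLp 2 volume‖ ^ (1 - θ) * ‖ψ.toLp 3 volume‖ ^ θ))
    {g : ℝ → 𝓢(R6, ℂ)} {μ : Measure ℝ} (hg : Integrable (fun t => toL23 (g t)) μ) :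
    Integrable (fun t => ℓ (g t)) μ ∧
    ‖∫ t, ℓ (g t) ∂μ‖ ≤ n₁ * ‖(∫ t, toL23 (g t) ∂μ).2‖ +
      n₂ * (‖(∫ t, toL23 (g t) ∂μ).1‖ ^ (1 - θ) * ‖(∫ t, toL23 (g t) ∂μ).2‖ ^ θ) := by
  obtain ⟨L, hLJ⟩ := exists_clm_extension h1 h2 hθ0 hθ1 hℓ
  refine ⟨by simpa only [hLJ] using L.integrable_comp hg, ?_⟩
  have e1 : ∫ t, ℓ (g t) ∂μ = L (∫ t, toL23 (g t) ∂μ) := by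
    rw [← L.integral_comp_comm hg]
    simp only [hLJ]
  rw [e1]
  have hcl : IsClosed {z : L23 | ‖L z‖ ≤ n₁ * ‖z.2‖ + n₂ * (‖z.1‖ ^ (1 - θ) * ‖z.2‖ ^ θ)} := by
    refine isClosed_le L.continuous.norm ?_
    refine (continuous_const.mul continuous_snd.norm).add (continuous_const.mul ?_)
    exact (continuous_fst.norm.rpow_const fun _ => Or.inr (by linarith)).mul
      (continuous_snd.norm.rpow_const fun _ => Or.inr hθ0)
  refine closure_minimal ?_ hcl (integral_toL23_mem_closure hg)
  rintro _ ⟨ψ, rfl⟩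
  simp only [Set.mem_ofPred_eq, hLJ, toL23_fst, toL23_snd]
  exact hℓ ψ

end QuadNLS
end

/-! ### The advanced integral and the homogeneous estimate. -/

noncomputable section
namespace QuadNLS

/-- The complex conjugate of a Schwartz function. -/
def conjS (ψ : 𝓢(R6, ℂ)) : 𝓢(R6, ℂ) :=
  SchwartzMap.postcompCLM (𝕜 := ℝ) (Complex.conjCLE : ℂ ≃L[ℝ] ℂ).toContinuousLinearMap ψ

theorem conjS_apply (ψ : 𝓢(R6, ℂ)) (x : R6) : conjS ψ x = (starRingEnd ℂ) (ψ x) := rfl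

theorem eLpNorm_conjS (p : ℝ≥0∞) (ψ : 𝓢(R6, ℂ)) :
    eLpNorm (conjS ψ) p volume = eLpNorm ψ p volume :=
  eLpNorm_congr_norm_ae (Eventually.of_forall fun x => by rw [conjS_apply, RCLike.norm_conj])

theorem norm_conjS_toLp (p : ℝ≥0∞) (ψ : 𝓢(R6, ℂ)) :
    ‖(conjS ψ).toLp p volume‖ = ‖ψ.toLp p volume‖ := by
  rw [SchwartzMap.norm_toLp, SchwartzMap.norm_toLp, eLpNorm_conjS]

theorem enorm_toLp {p : ℝ≥0∞} (ψ : 𝓢(R6, ℂ)) : ‖ψ.toLp p volume‖ₑ = eLpNorm ψ p volume := by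
  rw [Lp.enorm_def]
  exact eLpNorm_congr_ae (ψ.coeFn_toLp p volume)

theorem pair_eq_inner_star (ψ : 𝓢(R6, ℂ)) (f : Lp ℂ 2 (volume : Measure R6)) :
    pair ψ f = inner ℂ (star f) (ψ.toLp 2 volume) := by
  rw [pair_apply, L2.inner_def]
  refine integral_congr_ae ?_
  filter_upwards [ψ.coeFn_toLp 2 volume, Lp.coeFn_star f] with x h1 h2
  rw [h1, h2, RCLike.inner_apply, mul_comm]
  simp

instance secondCountableTopology_L23 : SecondCountableTopology L23 :=
  have h2 : SecondCountableTopology (Lp ℂ 2 (volume : Measure R6)) := inferInstance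
  have h3 : SecondCountableTopology (Lp ℂ 3 (volume : Measure R6)) := inferInstance
  @TopologicalSpace.instSecondCountableTopologyProd _ _ _ _ h2 h3

theorem continuous_toL23_sch (c : ℝ) (φ : 𝓢(R6, ℂ)) : Continuous fun t => toL23 (sch c t φ) :=
  (continuous_sch_toLp_two c φ).prodMk (continuous_sch_toLp_three c φ)

/-- The L² norm is conserved and the sup norm is at most the L¹ norm of the Fourier transform, which
does not change in time; together they bound the L³ norm. -/
theorem exists_norm_toL23_sch_le (c : ℝ) (φ : 𝓢(R6, ℂ)) :
    ∃ C : ℝ, 0 ≤ C ∧ ∀ t, ‖toL23 (sch c t φ)‖ ≤ C := by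
  set B := ‖(FourierTransform.fourier φ).toLp 1 volume‖
  have hB : ∀ t x, ‖sch c t φ x‖ ≤ B := fun t x => by
    have := norm_apply_le_of_fourier (f := sch c t φ) (g := φ) zero_le_one (fun ξ => by
      rw [fourier_sch, norm_mul, norm_schrodingerSymbol]) x
    simpa using this
  set A := ‖φ.toLp 2 volume‖
  set C := max A (max 1 (B * A ^ 2))
  refine ⟨C, (norm_nonneg _).trans (le_max_left _ _), fun t => ?_⟩
  rw [Prod.norm_def, max_le_iff]
  refine ⟨?_, ?_⟩
  · rw [toL23_fst, norm_sch_toLp_two]; exact le_max_left _ _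
  · rw [toL23_snd]
    have h1 := norm_toLp_three_pow_le (sch c t φ) (hB t)
    rw [norm_sch_toLp_two] at h1
    refine le_trans ?_ (le_max_right _ _)
    by_contra hlt
    push Not at hlt
    set n := ‖(sch c t φ).toLp 3 volume‖
    have h2 : 1 < n := (le_max_left _ _).trans_lt hlt
    have h3 : B * A ^ 2 < n := (le_max_right _ _).trans_lt hlt
    nlinarith [sq_nonneg n]

section Path

variable {M : ℕ} (c : ℝ) (b : ℝ → ℂ) (ψ : Fin M → 𝓢(R6, ℂ)) (j : ℝ → Fin M)

theorem stronglyMeasurable_toL23_sch {j : ℝ → Fin M} (hj : Measurable j) (s : ℝ) :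
    StronglyMeasurable fun t => toL23 (sch c (t - s) (ψ (j t))) :=
  stronglyMeasurable_comp_fin (F := fun n t => toL23 (sch c (t - s) (ψ n)))
    (fun n => ((continuous_toL23_sch c (ψ n)).comp (continuous_id.sub continuous_const)
      ).stronglyMeasurable) hj

theorem exists_norm_toL23_sch_comp_le :
    ∃ C : ℝ, 0 ≤ C ∧ ∀ τ n, ‖toL23 (sch c τ (ψ n))‖ ≤ C := by
  choose C h0 hC using fun n => exists_norm_toL23_sch_le c (ψ n)
  exact ⟨∑ n, C n, Finset.sum_nonneg fun n _ => h0 n, fun τ n => (hC n τ).trans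
    (Finset.single_le_sum (f := C) (fun n _ => h0 n) (Finset.mem_univ n))⟩

theorem integrable_toL23_sch {b : ℝ → ℂ} (hb : Integrable b) {j : ℝ → Fin M} (hj : Measurable j)
    (s : ℝ) : Integrable fun t => toL23 (b t • sch c (t - s) (ψ (j t))) := by
  obtain ⟨C, -, hC⟩ := exists_norm_toL23_sch_comp_le c ψ
  simp only [map_smul]
  exact hb.smul_bdd C (stronglyMeasurable_toL23_sch c ψ hj s).aestronglyMeasurable
    (Eventually.of_forall fun t => hC _ _)

/-- The advanced integral `∫_{t > s} b(t) e^{i c (t - s) Δ} ψ_{j(t)} dt`. -/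
def advanced (s : ℝ) : L23 := ∫ t in Set.Ioi s, toL23 (b t • sch c (t - s) (ψ (j t)))

variable {c b ψ j}

theorem fst_integral {μ : Measure ℝ} {f : ℝ → L23} (hf : Integrable f μ) :
    (∫ t, f t ∂μ).1 = ∫ t, (f t).1 ∂μ :=
  ((ContinuousLinearMap.fst ℂ (Lp ℂ 2 (volume : Measure R6))
    (Lp ℂ 3 (volume : Measure R6))).integral_comp_comm hf).symm

theorem snd_integral {μ : Measure ℝ} {f : ℝ → L23} (hf : Integrable f μ) :
    (∫ t, f t ∂μ).2 = ∫ t, (f t).2 ∂μ :=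
  ((ContinuousLinearMap.snd ℂ (Lp ℂ 2 (volume : Measure R6))
    (Lp ℂ 3 (volume : Measure R6))).integral_comp_comm hf).symm

theorem toL23_smul_fst (a : ℂ) (φ : 𝓢(R6, ℂ)) : (toL23 (a • φ)).1 = a • φ.toLp 2 volume := by
  rw [map_smul]; rfl

theorem advanced_fst (hb : Integrable b) (hj : Measurable j) (s : ℝ) :
    (advanced c b ψ j s).1 =
      ∫ t in Set.Ioi s, b t • (sch c (t - s) (ψ (j t))).toLp 2 volume := by
  rw [advanced, fst_integral (integrable_toL23_sch c ψ hb hj s).integrableOn]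
  simp only [toL23_smul_fst]

/-- Translating time by s gives the integral of a path for the coefficient -c with amplitude cut off
to t > s, so the unrestricted estimate applies. -/
theorem enorm_advanced_fst_le (hc : c ≠ 0) (hb : Integrable b) (hbm : Measurable b)
    (hb2 : ∫⁻ t, ‖b t‖ₑ ^ 2 ≤ 1) (hψ : ∀ n, eLpNorm (ψ n) (3 / 2) volume ≤ 1)
    (hj : Measurable j) (s : ℝ) :
    ‖(advanced c b ψ j s).1‖ₑ ≤ ENNReal.ofReal (linConst c) := by
  set b' : ℝ → ℂ := (Set.Ioi s).indicator b
  have e1 : (advanced c b ψ j s).1 =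
      ∫ t, schPath (-c) (fun t => b' (t + s)) ψ (fun t => j (t + s)) t := by
    rw [advanced_fst hb hj, ← integral_indicator measurableSet_Ioi,
      ← integral_add_right_eq_self _ s]
    congr 1; funext t
    simp only [schPath, sch_neg_coeff, neg_neg, b']
    by_cases ht : t + s ∈ Set.Ioi s
    · rw [Set.indicator_of_mem ht, Set.indicator_of_mem ht, add_sub_cancel_right]
    · rw [Set.indicator_of_notMem ht, Set.indicator_of_notMem ht, zero_smul]
  rw [e1, ← linConst_neg]
  have hb'm : Measurable b' := hbm.indicator measurableSet_Ioi
  refine enorm_integral_schPath_le (neg_ne_zero.2 hc)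
    ((hb.indicator measurableSet_Ioi).comp_add_right s)
    (hb'm.comp (measurable_id.add_const s)) ?_ hψ (hj.comp (measurable_id.add_const s))
  rw [lintegral_add_right_eq_self (fun t => ‖b' t‖ₑ ^ 2) s]
  refine le_trans (lintegral_mono fun t => ?_) hb2
  refine pow_le_pow_left' ?_ 2
  by_cases ht : t ∈ Set.Ioi s
  · simp [b', Set.indicator_of_mem ht]
  · simp [b', Set.indicator_of_notMem ht]

/-- Both components integrate the same Schwartz functions, so no test function separates them. The
L³ norm can then be computed from pairings in L², where unitarity is available. -/
theorem pair_advanced_snd (hb : Integrable b) (hj : Measurable j) (s : ℝ) (χ : 𝓢(R6, ℂ)) :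
    pair χ (advanced c b ψ j s).2 = pair χ (advanced c b ψ j s).1 := by
  have hi := (integrable_toL23_sch c ψ hb hj s).integrableOn (s := Set.Ioi s)
  rw [advanced, fst_integral hi, snd_integral hi, ← (pair χ).integral_comp_comm hi.fst,
    ← (pair χ).integral_comp_comm hi.snd]
  congr 1

theorem pair_advanced_fst (hb : Integrable b) (hj : Measurable j) (s : ℝ) (χ : 𝓢(R6, ℂ)) :
    pair χ (advanced c b ψ j s).1 = inner ℂ ((sch c s (conjS χ)).toLp 2 volume)
      (∫ t in Set.Ioi s, b t • (sch c t (ψ (j t))).toLp 2 volume) := by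
  have hi := (integrable_toL23_sch c ψ hb hj s).integrableOn (s := Set.Ioi s)
  have hi0 : Integrable fun t => b t • (sch c t (ψ (j t))).toLp 2 volume := by
    have := (integrable_toL23_sch c ψ hb hj 0).fst
    simpa only [toL23_smul_fst, sub_zero] using this
  rw [advanced, fst_integral hi, ← (pair χ).integral_comp_comm hi.fst,
    ← integral_inner hi0.integrableOn]
  congr 1; funext t
  rw [toL23_smul_fst, map_smul, inner_smul_right, inner_sch_toLp_sub, pair_toLp, smul_eq_mul]
  simp only [conjS_apply, Complex.conj_conj, mul_comm]

theorem continuous_pair_advanced (hb : Integrable b) (hj : Measurable j) (χ : 𝓢(R6, ℂ)) :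
    Continuous fun s => pair χ (advanced c b ψ j s).1 := by
  have hi0 : Integrable fun t => b t • (sch c t (ψ (j t))).toLp 2 volume := by
    have := (integrable_toL23_sch c ψ hb hj 0).fst
    simpa only [toL23_smul_fst, sub_zero] using this
  simp only [pair_advanced_fst hb hj]
  refine (continuous_sch_toLp_two c (conjS χ)).inner ?_
  have h1 : ∀ s, ∫ t in Set.Ioi s, b t • (sch c t (ψ (j t))).toLp 2 volume =
      (∫ t, b t • (sch c t (ψ (j t))).toLp 2 volume) -
        ∫ t in Set.Iio s, b t • (sch c t (ψ (j t))).toLp 2 volume := fun s => by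
    rw [← integral_Iic_eq_integral_Iio, eq_sub_iff_add_eq', ← setIntegral_union
      (Set.Iic_disjoint_Ioi le_rfl) measurableSet_Ioi hi0.integrableOn hi0.integrableOn,
      Set.Iic_union_Ioi, setIntegral_univ]
  simp only [h1]
  exact continuous_const.sub (continuous_integral_Iio hi0)

/-- Reversal of time makes the advanced integral retarded, and conjugating the test functions turns
the bilinear pairing into the inner product; what remains is the endpoint bilinear estimate. -/
theorem enorm_integral_mul_pair_advanced_le (hc : c ≠ 0) (hb : Integrable b) (hbm : Measurable b)
    (hb2 : ∫⁻ t, ‖b t‖ₑ ^ 2 ≤ 1) (hψ : ∀ n, eLpNorm (ψ n) (3 / 2) volume ≤ 1)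
    (hj : Measurable j) {N : ℕ} {χ : Fin N → 𝓢(R6, ℂ)}
    (hχ : ∀ n, eLpNorm (χ n) (3 / 2) volume ≤ 1) {i : ℝ → Fin N} (hi : Measurable i) {a : ℝ → ℂ}
    (ha : Integrable a) (ham : Measurable a) (ha2 : ∫⁻ t, ‖a t‖ₑ ^ 2 ≤ 1) :
    ‖∫ s, a s * pair (χ (i s)) (advanced c b ψ j s).1‖ₑ ≤ ENNReal.ofReal (linConst c) := by
  have e1 : ∫ s, a s * pair (χ (i s)) (advanced c b ψ j s).1 =
      retarded (schPath c (fun t => b (-t)) ψ (fun t => j (-t)))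
        (schPath c (fun s => (starRingEnd ℂ) (a (-s))) (fun n => conjS (χ n)) (fun s => i (-s))) := by
    rw [← integral_neg_eq_self, retarded]
    congr 1; funext σ
    rw [pair_advanced_fst hb hj, schPath, inner_smul_left, Complex.conj_conj]
    congr 2
    rw [← integral_Iic_eq_integral_Iio, ← integral_comp_neg_Iic]
    rfl
  have hneg : ∀ {f : ℝ → ℂ}, ∫⁻ t, ‖f t‖ₑ ^ 2 ≤ 1 → ∫⁻ t, ‖f (-t)‖ₑ ^ 2 ≤ 1 := by
    intro f hf
    rwa [lintegral_neg_eq_self (fun s => ‖f s‖ₑ ^ 2)]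
  rw [e1]
  refine (enorm_retarded_schPath_le hc hb.comp_neg (hbm.comp measurable_neg) (hneg hb2) ?_ ?_ ?_ hψ
    (fun n => by rw [eLpNorm_conjS]; exact hχ n) (hj.comp measurable_neg)
    (hi.comp measurable_neg)).trans (ENNReal.ofReal_le_ofReal ?_)
  · exact ⟨(Complex.continuous_conj.measurable.comp (ham.comp measurable_neg)).aestronglyMeasurable,
      by simpa only [HasFiniteIntegral, RCLike.enorm_conj] using ha.comp_neg.2⟩
  · exact Complex.continuous_conj.measurable.comp (ham.comp measurable_neg)
  · simpa only [RCLike.enorm_conj] using hneg ha2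
  · have := bilinConst_nonneg c
    unfold linConst; linarith

/-- A countable supremum of continuous functions of time replaces the L³ norm: it is measurable by
construction and has the form required by the selection lemma. -/
theorem exists_advanced_snd_bound (hc : c ≠ 0) (hb : Integrable b) (hbm : Measurable b)
    (hb2 : ∫⁻ t, ‖b t‖ₑ ^ 2 ≤ 1) (hψ : ∀ n, eLpNorm (ψ n) (3 / 2) volume ≤ 1)
    (hj : Measurable j) (α β : ℝ) :
    ∃ m : ℝ → ℝ≥0∞, Measurable m ∧ (∀ s, ‖(advanced c b ψ j s).2‖ₑ ≤ m s) ∧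
      ∫⁻ s in Set.Icc α β, m s ^ 2 ≤ ENNReal.ofReal (linConst c) ^ 2 := by
  obtain ⟨χ, hχ1, -, hχ3⟩ := exists_countable_test
  have hcont : ∀ n, Continuous fun s => pair (χ n) (advanced c b ψ j s).1 := fun n =>
    continuous_pair_advanced hb hj (χ n)
  refine ⟨fun s => ⨆ n, ‖pair (χ n) (advanced c b ψ j s).1‖ₑ,
    Measurable.iSup fun n => (hcont n).measurable.enorm, fun s => ?_, ?_⟩
  · rw [Lp.enorm_def]
    refine (hχ3 _ (Lp.memLp _)).trans (le_of_eq ?_)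
    congr 1; funext n
    rw [← pair_advanced_snd hb hj, pair_apply]
  · exact lintegral_iSup_sq_le_of_selection (fun n => (hcont n).measurable) measurableSet_Icc
      (by simp) (fun n => isCompact_Icc.exists_bound_of_continuousOn (hcont n).continuousOn)
      fun N i a hi ham ha _ ha2 => enorm_integral_mul_pair_advanced_le hc hb hbm hb2 hψ hj
        (χ := fun n => χ n) (fun n => hχ1 n) hi ha ham ha2

end Path

/-- The homogeneous Strichartz estimate at the endpoint. -/
theorem lintegral_sch_toLp_three_sq_le {c : ℝ} (hc : c ≠ 0) (φ : 𝓢(R6, ℂ)) (t α β : ℝ) :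
    ∫⁻ s in Set.Icc α β, ‖(sch c (t - s) φ).toLp 3 volume‖ₑ ^ 2 ≤
      (ENNReal.ofReal (linConst c) * ‖φ.toLp 2 volume‖ₑ) ^ 2 := by
  obtain ⟨χ, hχ1, hχ2, -⟩ := exists_countable_test
  have e1 : ∀ n s, ∫ x, sch c (t - s) φ x * χ n x =
      inner ℂ ((sch c (-t) (conjS φ)).toLp 2 volume) ((sch c (-s) (χ n)).toLp 2 volume) := by
    intro n s
    rw [inner_sch_toLp_sub, integral_sch_mul]
    simp only [conjS_apply, Complex.conj_conj]
    rw [show -s - -t = t - s by ring]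
  have hcont : ∀ n, Continuous fun s => ∫ x, sch c (t - s) φ x * χ n x := fun n => by
    simp only [e1]
    exact continuous_const.inner ((continuous_sch_toLp_two c (χ n)).comp continuous_neg)
  refine le_trans (lintegral_mono fun s => pow_le_pow_left' ?_ 2)
    (lintegral_iSup_sq_le_of_selection (c := fun n s => ∫ x, sch c (t - s) φ x * χ n x)
      (fun n => (hcont n).measurable) measurableSet_Icc
      (by simp) (fun n => isCompact_Icc.exists_bound_of_continuousOn (hcont n).continuousOn)
      fun N i a hi ham ha _ ha2 => ?_)
  · rw [enorm_toLp]
    exact hχ2 _ ((sch c (t - s) φ).memLp 2 volume)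
  · have hint := integrable_schPath c ha (fun n : Fin N => χ n) hi
    have e2 : ∫ s, a s * ∫ x, sch c (t - s) φ x * χ (i s) x =
        inner ℂ ((sch c (-t) (conjS φ)).toLp 2 volume)
          (∫ s, schPath c a (fun n : Fin N => χ n) i s) := by
      rw [← integral_inner hint]
      congr 1; funext s
      rw [schPath, inner_smul_right, e1]
    rw [e2]
    refine (enorm_inner_le _ _).trans ?_
    rw [mul_comm]
    refine mul_le_mul' (enorm_integral_schPath_le hc ha ham ha2 (fun n => hχ1 n) hi) (le_of_eq ?_)
    rw [← ofReal_norm, ← ofReal_norm, norm_sch_toLp_two, norm_conjS_toLp]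

theorem enorm_le_of_norm_le_interp {E F G : Type*} [NormedAddCommGroup E] [NormedAddCommGroup F]
    [NormedAddCommGroup G] {x : E} {y : F} {z : G} {n₁ n₂ : ℝ≥0} {θ : ℝ} (hθ0 : 0 ≤ θ)
    (hθ1 : θ ≤ 1) (h : ‖x‖ ≤ n₁ * ‖z‖ + n₂ * (‖y‖ ^ (1 - θ) * ‖z‖ ^ θ)) :
    ‖x‖ₑ ≤ n₁ * ‖z‖ₑ + n₂ * (‖y‖ₑ ^ (1 - θ) * ‖z‖ₑ ^ θ) := by
  simp only [← ofReal_norm]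
  refine (ENNReal.ofReal_le_ofReal h).trans (le_of_eq ?_)
  rw [ENNReal.ofReal_add (by positivity) (by positivity), ENNReal.ofReal_mul (by positivity),
    ENNReal.ofReal_mul (by positivity), ENNReal.ofReal_mul (by positivity),
    ENNReal.ofReal_rpow_of_nonneg (norm_nonneg _) (by linarith),
    ENNReal.ofReal_rpow_of_nonneg (norm_nonneg _) hθ0]
  simp

/-- Hölder in time, with weights 1/2 + 1/2 for the first term and (1 - θ/2) + θ/2 for the second.
With θ = 2/q, the exponent (1 - θ/2)⁻¹ is the conjugate of q. -/
theorem lintegral_interp_le {μ : Measure ℝ} {n₁ n₂ m : ℝ → ℝ≥0∞} (h1 : Measurable n₁)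
    (h2 : Measurable n₂) (hm : Measurable m) {θ : ℝ} (hθ0 : 0 ≤ θ) (hθ1 : θ ≤ 1) (K : ℝ≥0∞) :
    ∫⁻ s, (n₁ s * m s + n₂ s * (K ^ (1 - θ) * m s ^ θ)) ∂μ ≤
      (∫⁻ s, n₁ s ^ 2 ∂μ) ^ (1 / 2 : ℝ) * (∫⁻ s, m s ^ 2 ∂μ) ^ (1 / 2 : ℝ) +
      (∫⁻ s, n₂ s ^ (1 - θ / 2)⁻¹ ∂μ) ^ (1 - θ / 2) *
        (K ^ (1 - θ) * (∫⁻ s, m s ^ 2 ∂μ) ^ (θ / 2)) := by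
  have hp : 0 < 1 - θ / 2 := by linarith
  refine (le_of_eq (lintegral_add_left (h1.mul hm) _)).trans ?_
  refine add_le_add ?_ ?_
  · have := ENNReal.lintegral_mul_norm_pow_le (μ := μ) (f := fun s => n₁ s ^ 2)
      (g := fun s => m s ^ 2) (h1.pow_const 2).aemeasurable (hm.pow_const 2).aemeasurable
      (p := 1 / 2) (q := 1 / 2) (by norm_num) (by norm_num) (by norm_num)
    refine le_trans (le_of_eq (lintegral_congr fun s => ?_)) this
    simp only [← ENNReal.rpow_natCast, ← ENNReal.rpow_mul]
    norm_num
  · have := ENNReal.lintegral_mul_norm_pow_le (μ := μ) (f := fun s => n₂ s ^ (1 - θ / 2)⁻¹)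
      (g := fun s => m s ^ 2) (h2.pow_const _).aemeasurable (hm.pow_const 2).aemeasurable
      (p := 1 - θ / 2) (q := θ / 2) hp.le (by linarith) (by ring)
    have e1 : ∀ s, n₂ s * (K ^ (1 - θ) * m s ^ θ) = K ^ (1 - θ) *
        ((n₂ s ^ (1 - θ / 2)⁻¹) ^ (1 - θ / 2) * (m s ^ 2) ^ (θ / 2)) := fun s => by
      rw [← ENNReal.rpow_mul, inv_mul_cancel₀ hp.ne', ENNReal.rpow_one, ← ENNReal.rpow_natCast,
        ← ENNReal.rpow_mul]
      rw [show ((2 : ℕ) : ℝ) * (θ / 2) = θ by push_cast; ring]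
      ring
    simp only [e1]
    refine (le_of_eq (lintegral_const_mul _ (((h2.pow_const _).pow_const _).mul
      ((hm.pow_const 2).pow_const _)))).trans ?_
    refine (mul_le_mul_right this _).trans (le_of_eq (by ring))

theorem lintegral_interp_le' {μ : Measure ℝ} {n₁ n₂ m : ℝ → ℝ≥0∞} (h1 : Measurable n₁)
    (h2 : Measurable n₂) (hm : Measurable m) {θ : ℝ} (hθ0 : 0 ≤ θ) (hθ1 : θ ≤ 1) {K : ℝ≥0∞}
    (hK : ∫⁻ s, m s ^ 2 ∂μ ≤ K ^ 2) :
    ∫⁻ s, (n₁ s * m s + n₂ s * (K ^ (1 - θ) * m s ^ θ)) ∂μ ≤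
      K * ((∫⁻ s, n₁ s ^ 2 ∂μ) ^ (1 / 2 : ℝ) +
      (∫⁻ s, n₂ s ^ (1 - θ / 2)⁻¹ ∂μ) ^ (1 - θ / 2)) := by
  refine (lintegral_interp_le h1 h2 hm hθ0 hθ1 K).trans ?_
  have e1 : (∫⁻ s, m s ^ 2 ∂μ) ^ (1 / 2 : ℝ) ≤ K := by
    refine (ENNReal.rpow_le_rpow hK (by norm_num)).trans (le_of_eq ?_)
    rw [← ENNReal.rpow_natCast, ← ENNReal.rpow_mul]; norm_num
  have e2 : K ^ (1 - θ) * (∫⁻ s, m s ^ 2 ∂μ) ^ (θ / 2) ≤ K := by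
    calc _ ≤ K ^ (1 - θ) * (K ^ 2) ^ (θ / 2) := by gcongr
      _ = K := by
        rw [← ENNReal.rpow_natCast, ← ENNReal.rpow_mul, ← ENNReal.rpow_add_of_nonneg _ _
          (by linarith) (by push_cast; linarith)]
        rw [show (1 - θ) + ((2 : ℕ) : ℝ) * (θ / 2) = 1 by push_cast; ring, ENNReal.rpow_one]
  rw [mul_add, mul_comm K, mul_comm K]
  gcongr

end QuadNLS
end

/-! ### Inhomogeneous Strichartz estimates. -/

noncomputable section
namespace QuadNLS

/-- A measurable family of functionals controlled by interpolated `L²` and `L³` norms. -/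
structure InterpBounded (θ : ℝ) (n₁ n₂ : ℝ → ℝ≥0) (ℓ : ℝ → 𝓢(R6, ℂ) →ₗ[ℂ] ℂ) : Prop where
  nonneg : 0 ≤ θ
  le_one : θ ≤ 1
  measurable₁ : Measurable n₁
  measurable₂ : Measurable n₂
  measurable : ∀ ψ, Measurable fun s => ℓ s ψ
  -- The first term models pairing with an L^{3/2} function of norm n₁. The second models, after
  -- interpolation, pairing with a function of norm n₂ in the dual of L^r, where 1/r = (1 - θ)/2 +
  -- θ/3.
  bound : ∀ s ψ, ‖ℓ s ψ‖ ≤ n₁ s * ‖ψ.toLp 3 volume‖ +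
    n₂ s * (‖ψ.toLp 2 volume‖ ^ (1 - θ) * ‖ψ.toLp 3 volume‖ ^ θ)

/-- The total size of the data of an inhomogeneous problem on a time interval. -/
def interpSize (θ : ℝ) (n₁ n₂ : ℝ → ℝ≥0) (J : Set ℝ) : ℝ≥0∞ :=
  (∫⁻ s in J, (n₁ s : ℝ≥0∞) ^ 2) ^ (1 / 2 : ℝ) +
    (∫⁻ s in J, (n₂ s : ℝ≥0∞) ^ (1 - θ / 2)⁻¹) ^ (1 - θ / 2)

namespace InterpBounded

variable {θ : ℝ} {n₁ n₂ : ℝ → ℝ≥0} {ℓ : ℝ → 𝓢(R6, ℂ) →ₗ[ℂ] ℂ} (h : InterpBounded θ n₁ n₂ ℓ)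

include h in
-- Carathéodory's criterion: continuity in the propagation time, by extension to L² × L³, and
-- measurability in s give joint measurability.
theorem measurable_sch_comp (c : ℝ) {M : ℕ} (ψ : Fin M → 𝓢(R6, ℂ)) {j : ℝ → Fin M}
    (hj : Measurable j) :
    Measurable fun p : ℝ × ℝ => ℓ p.1 (sch c (p.2 - p.1) (ψ (j p.2))) := by
  have h1 : ∀ φ : 𝓢(R6, ℂ), Measurable fun p : ℝ × ℝ => ℓ p.1 (sch c (p.2 - p.1) φ) := by
    intro φ
    have h2 := stronglyMeasurable_uncurry_of_continuous_of_stronglyMeasurable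
      (u := fun (τ : ℝ) (s : ℝ) => ℓ s (sch c τ φ)) (fun s => by
        obtain ⟨L, hL⟩ := exists_clm_extension (n₁ s).2 (n₂ s).2 h.nonneg h.le_one (h.bound s)
        simp only [← hL]
        exact L.continuous.comp (continuous_toL23_sch c φ))
      (fun τ => (h.measurable (sch c τ φ)).stronglyMeasurable)
    exact h2.measurable.comp ((measurable_snd.sub measurable_fst).prodMk measurable_fst)
  have h3 : Measurable fun q : (ℝ × ℝ) × Fin M => ℓ q.1.1 (sch c (q.1.2 - q.1.1) (ψ q.2)) :=
    measurable_from_prod_countable_left fun n => h1 (ψ n)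
  exact h3.comp (measurable_id.prodMk (hj.comp measurable_snd))

include h in
theorem norm_le_toL23 (s : ℝ) (ψ : 𝓢(R6, ℂ)) : ‖ℓ s ψ‖ ≤ (n₁ s + n₂ s) * ‖toL23 ψ‖ := by
  refine (h.bound s ψ).trans ?_
  have e1 : ‖ψ.toLp 2 volume‖ ≤ ‖toL23 ψ‖ := norm_fst_le (toL23 ψ)
  have e2 : ‖ψ.toLp 3 volume‖ ≤ ‖toL23 ψ‖ := norm_snd_le (toL23 ψ)
  have h0 := h.nonneg
  have h1 := h.le_one
  have e3 : ‖ψ.toLp 2 volume‖ ^ (1 - θ) * ‖ψ.toLp 3 volume‖ ^ θ ≤ ‖toL23 ψ‖ := by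
    calc _ ≤ ‖toL23 ψ‖ ^ (1 - θ) * ‖toL23 ψ‖ ^ θ := by
          gcongr
      _ = ‖toL23 ψ‖ := by
          rw [← Real.rpow_add_of_nonneg (norm_nonneg _) (by linarith) h0]
          simp
  rw [add_mul]
  gcongr

include h in
theorem lintegral_ne_top {J : Set ℝ} (hJ : volume J ≠ ⊤) (hs : interpSize θ n₁ n₂ J ≠ ⊤) :
    ∫⁻ s in J, ((n₁ s : ℝ≥0∞) + n₂ s) ≠ ⊤ := by
  have h1 := lintegral_interp_le (μ := volume.restrict J) (m := fun _ => 1)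
    h.measurable₁.coe_nnreal_ennreal h.measurable₂.coe_nnreal_ennreal
    measurable_const h.nonneg h.le_one 1
  simp only [ENNReal.one_rpow, mul_one, one_pow, lintegral_const, one_mul,
    Measure.restrict_apply_univ] at h1
  refine ne_top_of_le_ne_top ?_ h1
  rw [interpSize, ENNReal.add_ne_top] at hs
  have h0 := h.nonneg
  exact ENNReal.add_ne_top.2 ⟨ENNReal.mul_ne_top hs.1 (ENNReal.rpow_ne_top_of_nonneg (by norm_num) hJ),
    ENNReal.mul_ne_top hs.2 (ENNReal.rpow_ne_top_of_nonneg (by linarith) hJ)⟩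

/-- The kernel of the inhomogeneous term tested with a path of Schwartz functions. -/
def kernel (ℓ : ℝ → 𝓢(R6, ℂ) →ₗ[ℂ] ℂ) (c α β : ℝ) {M : ℕ} (b : ℝ → ℂ) (ψ : Fin M → 𝓢(R6, ℂ))
    (j : ℝ → Fin M) (p : ℝ × ℝ) : ℂ :=
  {p : ℝ × ℝ | p.1 ∈ Set.Icc α β ∧ p.1 < p.2}.indicator
    (fun p => b p.2 * ℓ p.1 (sch c (p.2 - p.1) (ψ (j p.2)))) p

theorem kernel_of_mem {c α β : ℝ} {M : ℕ} {b : ℝ → ℂ} {ψ : Fin M → 𝓢(R6, ℂ)} {j : ℝ → Fin M}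
    {s t : ℝ} (hs : s ∈ Set.Icc α β) (hst : s < t) :
    kernel ℓ c α β b ψ j (s, t) = b t * ℓ s (sch c (t - s) (ψ (j t))) :=
  Set.indicator_of_mem (s := {p : ℝ × ℝ | p.1 ∈ Set.Icc α β ∧ p.1 < p.2}) ⟨hs, hst⟩ _

theorem kernel_of_notMem {c α β : ℝ} {M : ℕ} {b : ℝ → ℂ} {ψ : Fin M → 𝓢(R6, ℂ)} {j : ℝ → Fin M}
    {s t : ℝ} (hst : ¬(s ∈ Set.Icc α β ∧ s < t)) : kernel ℓ c α β b ψ j (s, t) = 0 :=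
  Set.indicator_of_notMem (s := {p : ℝ × ℝ | p.1 ∈ Set.Icc α β ∧ p.1 < p.2}) hst _

include h in
theorem integrable_kernel (c : ℝ) {α β : ℝ} (hs : interpSize θ n₁ n₂ (Set.Icc α β) ≠ ⊤) {M : ℕ}
    {b : ℝ → ℂ} (hb : Integrable b) (hbm : Measurable b) (ψ : Fin M → 𝓢(R6, ℂ)) {j : ℝ → Fin M}
    (hj : Measurable j) : Integrable (kernel ℓ c α β b ψ j) (volume.prod volume) := by
  have hset : MeasurableSet {p : ℝ × ℝ | p.1 ∈ Set.Icc α β ∧ p.1 < p.2} :=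
    (measurable_fst measurableSet_Icc).inter (measurableSet_lt measurable_fst measurable_snd)
  have hm : Measurable (kernel ℓ c α β b ψ j) :=
    ((hbm.comp measurable_snd).mul (h.measurable_sch_comp c ψ hj)).indicator hset
  obtain ⟨C, hC0, hC⟩ := exists_norm_toL23_sch_comp_le c ψ
  refine ⟨hm.aestronglyMeasurable, ?_⟩
  rw [HasFiniteIntegral, lintegral_prod _ hm.enorm.aemeasurable]
  have hbd : ∀ s t, ‖kernel ℓ c α β b ψ j (s, t)‖ₑ ≤
      (Set.Icc α β).indicator (fun s => ((n₁ s : ℝ≥0∞) + n₂ s) * ENNReal.ofReal C) s * ‖b t‖ₑ := by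
    intro s t
    by_cases hst : (s, t) ∈ {p : ℝ × ℝ | p.1 ∈ Set.Icc α β ∧ p.1 < p.2}
    · rw [kernel, Set.indicator_of_mem hst, Set.indicator_of_mem hst.1, enorm_mul, mul_comm]
      gcongr
      rw [← ofReal_norm]
      refine (ENNReal.ofReal_le_ofReal ((h.norm_le_toL23 s _).trans
        (mul_le_mul_of_nonneg_left (hC _ _) (by positivity)))).trans (le_of_eq ?_)
      rw [ENNReal.ofReal_mul (by positivity), ENNReal.ofReal_add (by positivity) (by positivity)]
      simp
    · rw [kernel, Set.indicator_of_notMem hst]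
      simp
  refine lt_of_le_of_lt (lintegral_mono fun s => lintegral_mono fun t => hbd s t) ?_
  simp only [lintegral_const_mul _ hbm.enorm]
  rw [lintegral_mul_const' _ _ hb.2.ne, lintegral_indicator measurableSet_Icc,
    lintegral_mul_const' _ _ ENNReal.ofReal_ne_top]
  exact ENNReal.mul_lt_top (ENNReal.mul_lt_top (h.lintegral_ne_top (by simp) hs).lt_top
    ENNReal.ofReal_lt_top) hb.2

include h in
-- For fixed s, integration in t moves the functional onto the advanced integral of the test path.
-- Its L² norm is bounded uniformly in s and its L³ norm is square integrable in s, so Hölder in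
-- time finishes for every θ at once.
theorem enorm_integral_kernel_le {c : ℝ} (hc : c ≠ 0) {α β : ℝ} {M : ℕ} {b : ℝ → ℂ}
    (hb : Integrable b) (hbm : Measurable b) (hb2 : ∫⁻ t, ‖b t‖ₑ ^ 2 ≤ 1) {ψ : Fin M → 𝓢(R6, ℂ)}
    (hψ : ∀ n, eLpNorm (ψ n) (3 / 2) volume ≤ 1) {j : ℝ → Fin M} (hj : Measurable j) :
    ‖∫ s, ∫ t, kernel ℓ c α β b ψ j (s, t)‖ₑ ≤
      ENNReal.ofReal (linConst c) * interpSize θ n₁ n₂ (Set.Icc α β) := by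
  obtain ⟨m, hm, hm2, hm3⟩ := exists_advanced_snd_bound hc hb hbm hb2 hψ hj α β
  have h0 := h.nonneg
  have h1 := h.le_one
  have key : ∀ s, ‖∫ t, kernel ℓ c α β b ψ j (s, t)‖ₑ ≤ (Set.Icc α β).indicator
      (fun s => n₁ s * m s + n₂ s * (ENNReal.ofReal (linConst c) ^ (1 - θ) * m s ^ θ)) s := by
    intro s
    by_cases hs : s ∈ Set.Icc α β
    · have e1 : ∀ t, kernel ℓ c α β b ψ j (s, t) =
          (Set.Ioi s).indicator (fun t => ℓ s (b t • sch c (t - s) (ψ (j t)))) t := by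
        intro t
        by_cases ht : s < t
        · rw [kernel_of_mem hs ht,
            Set.indicator_of_mem (show t ∈ Set.Ioi s from ht), map_smul, smul_eq_mul]
        · rw [kernel_of_notMem (fun h => ht h.2),
            Set.indicator_of_notMem (show t ∉ Set.Ioi s from ht)]
      simp only [e1]
      rw [integral_indicator measurableSet_Ioi, Set.indicator_of_mem hs]
      have h2 := (norm_integral_functional_le (n₁ s).2 (n₂ s).2 h0 h1 (h.bound s)
        (integrable_toL23_sch c ψ hb hj s).integrableOn (μ := volume.restrict (Set.Ioi s))).2
      refine (enorm_le_of_norm_le_interp h0 h1 h2).trans ?_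
      gcongr
      · exact hm2 s
      · exact enorm_advanced_fst_le hc hb hbm hb2 hψ hj s
      · exact hm2 s
    · have e1 : ∀ t, kernel ℓ c α β b ψ j (s, t) = 0 := fun t => by
        rw [kernel_of_notMem (fun h => hs h.1)]
      simp [e1]
  refine (enorm_integral_le_lintegral_enorm _).trans ((lintegral_mono key).trans ?_)
  rw [lintegral_indicator measurableSet_Icc]
  exact lintegral_interp_le' h.measurable₁.coe_nnreal_ennreal h.measurable₂.coe_nnreal_ennreal hm
    h0 h1 hm3

include h in
-- The free evolution has a conserved L² norm and a square integrable L³ norm, both at most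
-- `linConst c` times the initial L² norm, and Hölder in time applies.
theorem lintegral_enorm_sch_le {c : ℝ} (hc : c ≠ 0) (α β t : ℝ) (φ : 𝓢(R6, ℂ)) :
    ∫⁻ s in Set.Icc α β, ‖ℓ s (sch c (t - s) φ)‖ₑ ≤
      ENNReal.ofReal (linConst c) * interpSize θ n₁ n₂ (Set.Icc α β) * ‖φ.toLp 2 volume‖ₑ := by
  have h0 := h.nonneg
  have h1 := h.le_one
  set K := ENNReal.ofReal (linConst c) * ‖φ.toLp 2 volume‖ₑ
  have hm : Measurable fun s => ‖(sch c (t - s) φ).toLp 3 volume‖ₑ :=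
    (((continuous_sch_toLp_three c φ).comp (continuous_const.sub continuous_id)).enorm).measurable
  have hφK : ‖φ.toLp 2 volume‖ₑ ≤ K := by
    refine le_mul_of_one_le_left' ?_
    rw [← ENNReal.ofReal_one]
    exact ENNReal.ofReal_le_ofReal (one_le_linConst c)
  calc _ ≤ ∫⁻ s in Set.Icc α β, (n₁ s * ‖(sch c (t - s) φ).toLp 3 volume‖ₑ +
        n₂ s * (K ^ (1 - θ) * ‖(sch c (t - s) φ).toLp 3 volume‖ₑ ^ θ)) := by
        refine lintegral_mono fun s => (enorm_le_of_norm_le_interp h0 h1 (h.bound s _)).trans ?_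
        gcongr
        rw [← ofReal_norm, norm_sch_toLp_two, ofReal_norm]
        exact hφK
    _ ≤ K * interpSize θ n₁ n₂ (Set.Icc α β) :=
        lintegral_interp_le' h.measurable₁.coe_nnreal_ennreal h.measurable₂.coe_nnreal_ennreal hm
          h0 h1 (lintegral_sch_toLp_three_sq_le hc φ t α β)
    _ = _ := by ring

end InterpBounded

/-- The Duhamel formula, tested with Schwartz functions. -/
def IsDuhamel (c α β : ℝ) (ℓ : ℝ → 𝓢(R6, ℂ) →ₗ[ℂ] ℂ) (D : ℝ → Lp ℂ 2 (volume : Measure R6)) :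
    Prop :=
  ∀ t ∈ Set.Icc α β, ∀ ψ : 𝓢(R6, ℂ), pair ψ (D t) =
    pair (sch c (t - α) ψ) (D α) + ∫ s in Set.Ico α t, ℓ s (sch c (t - s) ψ)

theorem enorm_pair_le (ψ : 𝓢(R6, ℂ)) (f : Lp ℂ 2 (volume : Measure R6)) :
    ‖pair ψ f‖ₑ ≤ ‖f‖ₑ * ‖ψ.toLp 2 volume‖ₑ := by
  rw [pair_apply, enorm_toLp, Lp.enorm_def]
  exact enorm_integral_mul_le (Lp.memLp f).1 ψ.continuous.aestronglyMeasurable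

/-- The inhomogeneous Strichartz estimates: the energy norm. -/
theorem IsDuhamel.enorm_le {c : ℝ} (hc : c ≠ 0) {α β : ℝ} {θ : ℝ} {n₁ n₂ : ℝ → ℝ≥0}
    {ℓ : ℝ → 𝓢(R6, ℂ) →ₗ[ℂ] ℂ} (h : InterpBounded θ n₁ n₂ ℓ)
    {D : ℝ → Lp ℂ 2 (volume : Measure R6)} (hD : IsDuhamel c α β ℓ D) {t : ℝ}
    (ht : t ∈ Set.Icc α β) :
    ‖D t‖ₑ ≤ ENNReal.ofReal (linConst c) * (‖D α‖ₑ + interpSize θ n₁ n₂ (Set.Icc α β)) := by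
  rw [Lp.enorm_def]
  refine eLpNorm_two_le_of_forall_schwartz (Lp.memLp (D t)) fun φ => ?_
  change ‖pair φ (D t)‖ₑ ≤ _
  rw [hD t ht φ, mul_add, add_mul]
  refine (enorm_add_le _ _).trans (add_le_add ?_ ?_)
  · refine (enorm_pair_le _ _).trans ?_
    rw [← ofReal_norm (E := Lp ℂ 2 volume) (SchwartzMap.toLp _ _ _), norm_sch_toLp_two, ofReal_norm,
      enorm_toLp]
    gcongr
    refine le_mul_of_one_le_left' ?_
    rw [← ENNReal.ofReal_one]
    exact ENNReal.ofReal_le_ofReal (one_le_linConst c)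
  · refine (enorm_integral_le_lintegral_enorm _).trans ?_
    rw [← enorm_toLp]
    refine le_trans ?_ (h.lintegral_enorm_sch_le hc α β t φ)
    exact lintegral_mono_set fun s hs => ⟨hs.1, hs.2.le.trans ht.2⟩

/-- The inhomogeneous Strichartz estimates: the endpoint norm. -/
theorem IsDuhamel.lintegral_eLpNorm_three_sq_le {c : ℝ} (hc : c ≠ 0) {α β : ℝ} {θ : ℝ}
    {n₁ n₂ : ℝ → ℝ≥0} {ℓ : ℝ → 𝓢(R6, ℂ) →ₗ[ℂ] ℂ} (h : InterpBounded θ n₁ n₂ ℓ)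
    {D : ℝ → Lp ℂ 2 (volume : Measure R6)} (hD : IsDuhamel c α β ℓ D)
    (hDc : ∀ ψ : 𝓢(R6, ℂ), Continuous fun t => pair ψ (D t)) :
    ∫⁻ t in Set.Icc α β, eLpNorm (D t) 3 volume ^ 2 ≤
      (ENNReal.ofReal (linConst c) * (‖D α‖ₑ + interpSize θ n₁ n₂ (Set.Icc α β))) ^ 2 := by
  set A := interpSize θ n₁ n₂ (Set.Icc α β)
  set Λ := ENNReal.ofReal (linConst c)
  by_cases hA : A = ⊤
  -- The infinite case is trivial and must be set aside: the integrability behind Fubini below uses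
  -- a finite size of the forcing.
  · have hΛ : Λ ≠ 0 := by
      simp only [Λ, ne_eq, ENNReal.ofReal_eq_zero, not_le]
      exact zero_lt_one.trans_le (one_le_linConst c)
    rw [hA, add_top, ENNReal.mul_top hΛ]
    simp
  obtain ⟨χ, hχ1, hχ2, -⟩ := exists_countable_test
  refine le_trans (lintegral_mono fun t => pow_le_pow_left' (hχ2 _ (Lp.memLp (D t))) 2)
    (lintegral_iSup_sq_le_of_selection (c := fun n t => pair (χ n) (D t))
      (fun n => (hDc (χ n)).measurable) measurableSet_Icc
      (by simp) (fun n => isCompact_Icc.exists_bound_of_continuousOn (hDc (χ n)).continuousOn)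
      fun N j b hj hbm hb hb0 hb2 => ?_)
  set ψ : Fin N → 𝓢(R6, ℂ) := fun n => χ n
  have hψ : ∀ n, eLpNorm (ψ n) (3 / 2) volume ≤ 1 := fun n => hχ1 n
  have hK := h.integrable_kernel c hA hb hbm ψ hj
  have hadv := (integrable_toL23_sch c ψ hb hj α).fst
  simp only [toL23_smul_fst] at hadv
  have e1 : ∀ t, b t * pair (ψ (j t)) (D t) =
      inner ℂ (star (D α)) ((Set.Ici α).indicator
        (fun t => b t • (sch c (t - α) (ψ (j t))).toLp 2 volume) t) +
      ∫ s, InterpBounded.kernel ℓ c α β b ψ j (s, t) := by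
    intro t
    by_cases ht : t ∈ Set.Icc α β
    · rw [hD t ht, mul_add, Set.indicator_of_mem (show t ∈ Set.Ici α from ht.1),
        inner_smul_right, ← pair_eq_inner_star]
      congr 1
      rw [← integral_const_mul, ← integral_indicator measurableSet_Ico]
      congr 1; funext s
      by_cases hs : s ∈ Set.Ico α t
      · rw [Set.indicator_of_mem hs,
          InterpBounded.kernel_of_mem ⟨hs.1, hs.2.le.trans ht.2⟩ hs.2]
      · rw [Set.indicator_of_notMem hs, InterpBounded.kernel_of_notMem (fun h => hs ⟨h.1.1, h.2⟩)]
    · have h1 : (Set.Ici α).indicator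
          (fun t => b t • (sch c (t - α) (ψ (j t))).toLp 2 volume) t = 0 := by
        by_cases h2 : t ∈ Set.Ici α
        · rw [Set.indicator_of_mem h2, hb0 t ht, zero_smul]
        · rw [Set.indicator_of_notMem h2]
      have h3 : ∀ s, InterpBounded.kernel ℓ c α β b ψ j (s, t) = 0 := fun s => by
        rw [InterpBounded.kernel]
        refine Set.indicator_apply_eq_zero.2 fun _ => ?_
        simp [hb0 t ht]
      rw [hb0 t ht, h1]
      simp [h3]
  have i1 := hadv.indicator (measurableSet_Ici (a := α))
  have i2 : Integrable fun t => inner ℂ (star (D α)) ((Set.Ici α).indicator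
      (fun t => b t • (sch c (t - α) (ψ (j t))).toLp 2 volume) t) :=
    (innerSL ℂ (star (D α))).integrable_comp i1
  have e4 : ∫ t, b t * pair (ψ (j t)) (D t) =
      (∫ t, inner ℂ (star (D α)) ((Set.Ici α).indicator
        (fun t => b t • (sch c (t - α) (ψ (j t))).toLp 2 volume) t)) +
      ∫ t, ∫ s, InterpBounded.kernel ℓ c α β b ψ j (s, t) := by
    simp only [e1]
    exact integral_add i2 hK.integral_prod_right
  change ‖∫ t, b t * pair (ψ (j t)) (D t)‖ₑ ≤ _
  rw [e4, mul_add]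
  refine (enorm_add_le _ _).trans (add_le_add ?_ ?_)
  · have e2 : ∫ t, inner ℂ (star (D α)) ((Set.Ici α).indicator
        (fun t => b t • (sch c (t - α) (ψ (j t))).toLp 2 volume) t) =
        inner ℂ (star (D α)) (advanced c b ψ j α).1 := by
      rw [integral_inner i1, advanced_fst hb hj, integral_indicator measurableSet_Ici,
        integral_Ici_eq_integral_Ioi]
    rw [e2]
    refine (enorm_inner_le _ _).trans ?_
    rw [mul_comm]
    refine mul_le_mul' (enorm_advanced_fst_le hc hb hbm hb2 hψ hj α) (le_of_eq ?_)
    rw [Lp.enorm_def, Lp.enorm_def]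
    refine eLpNorm_congr_norm_ae ?_
    filter_upwards [Lp.coeFn_star (D α)] with x hx
    rw [hx, Pi.star_apply, norm_star]
  -- Fubini exchanges the retarded integral of the forcing for the advanced integral of the test
  -- path.
  · have e3 : ∫ t, ∫ s, InterpBounded.kernel ℓ c α β b ψ j (s, t) =
        ∫ s, ∫ t, InterpBounded.kernel ℓ c α β b ψ j (s, t) :=
      (integral_integral_swap (f := fun s t => InterpBounded.kernel ℓ c α β b ψ j (s, t)) hK).symm
    change ‖∫ t, ∫ s, InterpBounded.kernel ℓ c α β b ψ j (s, t)‖ₑ ≤ _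
    rw [e3]
    exact h.enorm_integral_kernel_le hc hb hbm hb2 hψ hj

end QuadNLS
end

/-! ### Translations, difference quotients and weak derivatives. -/

noncomputable section
namespace QuadNLS

/-- Translation of Schwartz functions. -/
def shift (a : R6) : 𝓢(R6, ℂ) →L[ℂ] 𝓢(R6, ℂ) := SchwartzMap.compSubConstCLM ℂ a

theorem shift_apply (a : R6) (φ : 𝓢(R6, ℂ)) (x : R6) : shift a φ x = φ (x - a) := rfl

theorem eLpNorm_comp_sub (f : R6 → ℂ) (hf : AEStronglyMeasurable f volume) (a : R6) (p : ℝ≥0∞) :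
    eLpNorm (fun x => f (x - a)) p volume = eLpNorm f p volume :=
  eLpNorm_comp_measurePreserving (p := p) hf (measurePreserving_sub_right volume a)

theorem aesm_schwartz (φ : 𝓢(R6, ℂ)) : AEStronglyMeasurable (φ : R6 → ℂ) volume :=
  φ.continuous.aestronglyMeasurable

theorem eLpNorm_shift (a : R6) (φ : 𝓢(R6, ℂ)) (p : ℝ≥0∞) :
    eLpNorm (shift a φ) p volume = eLpNorm φ p volume :=
  eLpNorm_comp_sub _ (aesm_schwartz φ) a p

theorem shift_lineDeriv (a v : R6) (φ : 𝓢(R6, ℂ)) : shift a (∂_{v} φ) = ∂_{v} (shift a φ) := by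
  ext x
  change fderiv ℝ φ (x - a) v = fderiv ℝ (fun x => φ (x - a)) x v
  rw [fderiv_comp_sub]

theorem lintegral_enorm_mul_le {p q : ℝ≥0∞} [ENNReal.HolderConjugate p q] {f g : R6 → ℂ}
    (hf : AEStronglyMeasurable f volume) (hg : AEStronglyMeasurable g volume) :
    ∫⁻ x, ‖f x * g x‖ₑ ≤ eLpNorm f p volume * eLpNorm g q volume := by
  rw [← eLpNorm_one_eq_lintegral_enorm]
  change eLpNorm (f • g) 1 volume ≤ _
  exact eLpNorm_smul_le_mul_eLpNorm (p := p) (q := q) (r := 1) hg hf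

theorem sub_shift_eq_integral (φ : 𝓢(R6, ℂ)) (v x : R6) (h : ℝ) :
    φ x - shift (h • v) φ x = ∫ s in (0 : ℝ)..h, shift (s • v) (∂_{v} φ) x := by
  have hd : ∀ s : ℝ, HasDerivAt (fun s : ℝ => -φ (x - s • v)) (shift (s • v) (∂_{v} φ) x) s := by
    intro s
    have h1 : HasDerivAt (fun s : ℝ => x - s • v) (-v) s := by
      simpa using ((hasDerivAt_id s).smul_const v).const_sub x
    have h2 := (φ.differentiable (x - s • v)).hasFDerivAt.comp_hasDerivAt s h1
    have h3 := h2.neg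
    simp only [map_neg, neg_neg] at h3
    exact h3
  have hc : Continuous fun s : ℝ => shift (s • v) (∂_{v} φ) x := by
    simp only [shift_apply]
    exact (∂_{v} φ).continuous.comp (by fun_prop)
  rw [intervalIntegral.integral_eq_sub_of_hasDerivAt (fun s _ => hd s) (hc.intervalIntegrable _ _)]
  simp [shift_apply]
  ring

section Shift

variable {F : R6 → ℂ}

theorem enorm_integral_shift_le {r r' : ℝ≥0∞} [ENNReal.HolderConjugate r r'] (hF : MemLp F r volume) (a : R6) (φ : 𝓢(R6, ℂ)) :
    ‖∫ x, F x * shift a φ x‖ₑ ≤ eLpNorm F r volume * eLpNorm φ r' volume := by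
  rw [← eLpNorm_shift a φ r']
  exact enorm_integral_mul_le hF.1 (aesm_schwartz _)

theorem integral_sub_shift {r r' : ℝ≥0∞} [ENNReal.HolderConjugate r r'] (hF : MemLp F r volume) (φ : 𝓢(R6, ℂ)) (v : R6) {h : ℝ} (hh : 0 ≤ h) :
    ∫ x, F x * (φ x - shift (h • v) φ x) =
      ∫ s in (0 : ℝ)..h, ∫ x, F x * shift (s • v) (∂_{v} φ) x := by
  have hm : AEStronglyMeasurable (Function.uncurry fun (s : ℝ) (x : R6) =>
      F x * shift (s • v) (∂_{v} φ) x) ((volume.restrict (Set.Ioc 0 h)).prod volume) := by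
    refine (hF.1.comp_snd).mul (Continuous.aestronglyMeasurable ?_)
    simp only [shift_apply]
    exact (∂_{v} φ).continuous.comp (by fun_prop)
  have hi : Integrable (Function.uncurry fun (s : ℝ) (x : R6) =>
      F x * shift (s • v) (∂_{v} φ) x) ((volume.restrict (Set.Ioc 0 h)).prod volume) := by
    refine ⟨hm, ?_⟩
    rw [hasFiniteIntegral_iff_enorm, lintegral_prod _ hm.enorm]
    refine lt_of_le_of_lt (lintegral_mono fun s => ?_)
      (b := ∫⁻ _ in Set.Ioc 0 h, eLpNorm F r volume * eLpNorm (∂_{v} φ : 𝓢(R6, ℂ)) r' volume) ?_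
    · rw [← eLpNorm_shift (s • v) (∂_{v} φ) r']
      exact lintegral_enorm_mul_le hF.1 (aesm_schwartz (shift (s • v) (∂_{v} φ)))
    · rw [lintegral_const]
      exact ENNReal.mul_lt_top (ENNReal.mul_lt_top hF.2 ((∂_{v} φ : 𝓢(R6, ℂ)).memLp r' volume).2) (by simp)
  simp_rw [intervalIntegral.integral_of_le hh, sub_shift_eq_integral,
    intervalIntegral.integral_of_le hh]
  rw [integral_integral_swap hi]
  simp_rw [integral_const_mul]

theorem enorm_integral_sub_shift_le {r r' : ℝ≥0∞} [ENNReal.HolderConjugate r r'] (hF : MemLp F r volume) (φ : 𝓢(R6, ℂ)) (v : R6) {h : ℝ}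
    (hh : 0 ≤ h) :
    ‖∫ x, F x * (φ x - shift (h • v) φ x)‖ₑ ≤
      ENNReal.ofReal h * (eLpNorm F r volume * eLpNorm (∂_{v} φ : 𝓢(R6, ℂ)) r' volume) := by
  rw [integral_sub_shift (r' := r') hF φ v hh, intervalIntegral.integral_of_le hh]
  refine (enorm_integral_le_lintegral_enorm _).trans ?_
  refine (lintegral_mono fun s => enorm_integral_shift_le (r' := r') hF _ _).trans ?_
  rw [lintegral_const, mul_comm]
  simp

theorem integrable_mul_schwartz {r r' : ℝ≥0∞} [ENNReal.HolderConjugate r r'] (hF : MemLp F r volume) (φ : 𝓢(R6, ℂ)) :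
    Integrable (fun x => F x * φ x) volume :=
  integrable_mul_of_memLp (q := r') hF (φ.memLp r' volume)

theorem continuous_integral_shift {r r' : ℝ≥0∞} [ENNReal.HolderConjugate r r'] (hF : MemLp F r volume) (φ : 𝓢(R6, ℂ)) (v : R6) :
    Tendsto (fun h : ℝ => ∫ x, F x * shift (h • v) φ x) (𝓝[>] 0) (𝓝 (∫ x, F x * φ x)) := by
  have hb : Tendsto (fun h : ℝ => ENNReal.ofReal h *
      (eLpNorm F r volume * eLpNorm (∂_{v} φ : 𝓢(R6, ℂ)) r' volume)) (𝓝[>] 0) (𝓝 0) := by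
    have h1 : Tendsto (fun h : ℝ => ENNReal.ofReal h) (𝓝[>] 0) (𝓝 0) := by
      have := (ENNReal.continuous_ofReal.tendsto 0).mono_left (nhdsWithin_le_nhds (s := Set.Ioi 0))
      simpa using this
    simpa using ENNReal.Tendsto.mul_const h1
      (Or.inr (ENNReal.mul_ne_top hF.2.ne ((∂_{v} φ : 𝓢(R6, ℂ)).memLp r' volume).2.ne))
  rw [tendsto_iff_edist_tendsto_0]
  refine tendsto_of_tendsto_of_tendsto_of_le_of_le' tendsto_const_nhds hb
    (Eventually.of_forall fun _ => zero_le) ?_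
  filter_upwards [self_mem_nhdsWithin] with h hh
  rw [edist_comm, edist_eq_enorm_sub, ← integral_sub (integrable_mul_schwartz (r' := r') hF _)
    (integrable_mul_schwartz (r' := r') hF _)]
  simp_rw [← mul_sub]
  exact enorm_integral_sub_shift_le hF φ v (le_of_lt hh)

/-- The difference quotient is the mean over [0, h] of the pairings with translates of the
derivative, and these tend to their value at 0. -/
theorem tendsto_integral_sub_shift {r r' : ℝ≥0∞} [ENNReal.HolderConjugate r r'] (hF : MemLp F r volume) (φ : 𝓢(R6, ℂ)) (v : R6) :
    Tendsto (fun h : ℝ => (h : ℂ)⁻¹ * ∫ x, F x * (φ x - shift (h • v) φ x)) (𝓝[>] 0)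
      (𝓝 (∫ x, F x * (∂_{v} φ) x)) := by
  have h1 := continuous_integral_shift (r' := r') hF (∂_{v} φ) v
  rw [Metric.tendsto_nhds] at h1 ⊢
  intro ε hε
  obtain ⟨δ, hδ, hd⟩ := (mem_nhdsGT_iff_exists_Ioo_subset).1 (h1 (ε / 2) (by linarith))
  filter_upwards [Ioo_mem_nhdsGT hδ] with h hh
  have h0 : (0 : ℝ) < h := hh.1
  rw [integral_sub_shift (r' := r') hF φ v h0.le]
  set I := ∫ x, F x * (∂_{v} φ) x
  set J : ℝ → ℂ := fun s => ∫ x, F x * shift (s • v) (∂_{v} φ) x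
  have hJ : ∀ s ∈ Set.Ioc 0 h, ‖J s - I‖ ≤ ε / 2 := fun s hs => by
    have := hd ⟨hs.1, hs.2.trans_lt hh.2⟩
    rw [Set.mem_ofPred_eq, dist_eq_norm] at this
    exact this.le
  have hJb : ∀ s ∈ Set.Ioc 0 h, ‖J s‖ ≤ ε / 2 + ‖I‖ := fun s hs => by
    have := norm_add_le (J s - I) I
    rw [sub_add_cancel] at this
    linarith [hJ s hs]
  have hJi : IntervalIntegrable J volume 0 h := by
    rw [intervalIntegrable_iff_integrableOn_Ioc_of_le h0.le]
    refine ⟨?_, ?_⟩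
    · have hm : AEStronglyMeasurable (Function.uncurry fun (s : ℝ) (x : R6) =>
          F x * shift (s • v) (∂_{v} φ) x) ((volume.restrict (Set.Ioc 0 h)).prod volume) := by
        refine (hF.1.comp_snd).mul (Continuous.aestronglyMeasurable ?_)
        simp only [shift_apply]
        exact (∂_{v} φ).continuous.comp (by fun_prop)
      exact hm.integral_prod_right'
    · exact HasFiniteIntegral.restrict_of_bounded (ε / 2 + ‖I‖) (by simp)
        ((ae_restrict_iff' measurableSet_Ioc).2 (Eventually.of_forall hJb))
  have hI : (∫ _ in (0 : ℝ)..h, I) = (h : ℂ) * I := by simp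
  have e : (h : ℂ)⁻¹ * (∫ s in (0 : ℝ)..h, J s) - I = (h : ℂ)⁻¹ * ∫ s in (0 : ℝ)..h, (J s - I) := by
    rw [intervalIntegral.integral_sub hJi (by simp), hI, mul_sub, ← mul_assoc, inv_mul_cancel₀
      (by exact_mod_cast h0.ne'), one_mul]
  rw [dist_eq_norm, e, norm_mul]
  have h3 : ‖∫ s in (0 : ℝ)..h, (J s - I)‖ ≤ ε / 2 * |h - 0| :=
    intervalIntegral.norm_integral_le_of_norm_le_const fun s hs => hJ s (by
      rwa [Set.uIoc_of_le h0.le] at hs)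
  rw [sub_zero, abs_of_pos h0] at h3
  rw [norm_inv, Complex.norm_real, Real.norm_eq_abs, abs_of_pos h0]
  calc h⁻¹ * ‖∫ s in (0 : ℝ)..h, (J s - I)‖ ≤ h⁻¹ * (ε / 2 * h) := by gcongr
    _ = ε / 2 := by field_simp
    _ < ε := by linarith

end Shift

/-- `D` is the derivative of `F` in the direction `v` in the sense of distributions. -/
def HasWeakDeriv (v : R6) (F D : R6 → ℂ) : Prop :=
  ∀ φ : 𝓢(R6, ℂ), ∫ x, D x * φ x = -∫ x, F x * (∂_{v} φ) x

/-- The difference of a translate of `F` and `F`. -/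
def diffq (a : R6) (F : R6 → ℂ) : R6 → ℂ := fun x => F (x + a) - F x

theorem MemLp.comp_add {p : ℝ≥0∞} {F : R6 → ℂ} (hF : MemLp F p volume) (a : R6) :
    MemLp (fun x => F (x + a)) p volume :=
  hF.comp_measurePreserving (measurePreserving_add_right volume a)

theorem MemLp.diffq {p : ℝ≥0∞} {F : R6 → ℂ} (hF : MemLp F p volume) (a : R6) :
    MemLp (diffq a F) p volume := (MemLp.comp_add hF a).sub hF

section Diff

variable {F D : R6 → ℂ} {v : R6}

theorem integral_diffq_mul {r r' : ℝ≥0∞} [ENNReal.HolderConjugate r r'] (hF : MemLp F r volume) (a : R6) (φ : 𝓢(R6, ℂ)) :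
    ∫ x, diffq a F x * φ x = -∫ x, F x * (φ x - shift a φ x) := by
  have h1 : ∫ x, F (x + a) * φ x = ∫ x, F x * shift a φ x := by
    rw [← integral_add_right_eq_self (fun x => F x * shift a φ x) a]
    simp [shift_apply]
  have h2 := integrable_mul_schwartz (r' := r') hF φ
  have h3 := integrable_mul_schwartz (r' := r') hF (shift a φ)
  have h4 := integrable_mul_schwartz (r' := r') (MemLp.comp_add hF a) φ
  simp_rw [diffq, sub_mul, mul_sub]
  rw [integral_sub h4 h2, integral_sub h2 h3, h1]
  ring

theorem HasWeakDeriv.integral_diffq_mul {r r' : ℝ≥0∞} [ENNReal.HolderConjugate r r'] (hw : HasWeakDeriv v F D) (hF : MemLp F r volume)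
    (φ : 𝓢(R6, ℂ)) {h : ℝ} (hh : 0 ≤ h) :
    ∫ x, diffq (h • v) F x * φ x = ∫ s in (0 : ℝ)..h, ∫ x, D x * shift (s • v) φ x := by
  rw [QuadNLS.integral_diffq_mul (r' := r') hF, integral_sub_shift (r' := r') hF φ v hh,
    ← intervalIntegral.integral_neg]
  congr 1
  ext s
  rw [shift_lineDeriv, hw]

theorem HasWeakDeriv.enorm_integral_diffq_mul_le {r r' p p' : ℝ≥0∞} [ENNReal.HolderConjugate r r']
    [ENNReal.HolderConjugate p p'] (hw : HasWeakDeriv v F D) (hF : MemLp F r volume)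
    (hD : MemLp D p volume) (φ : 𝓢(R6, ℂ)) {h : ℝ} (hh : 0 ≤ h) :
    ‖∫ x, diffq (h • v) F x * φ x‖ₑ ≤
      ENNReal.ofReal h * eLpNorm D p volume * eLpNorm φ p' volume := by
  rw [hw.integral_diffq_mul (r' := r') hF φ hh, intervalIntegral.integral_of_le hh]
  refine (enorm_integral_le_lintegral_enorm _).trans ?_
  refine (lintegral_mono fun s => enorm_integral_shift_le (r' := p') hD _ _).trans ?_
  rw [lintegral_const, mul_comm, mul_assoc]
  simp

theorem HasWeakDeriv.tendsto_integral_diffq {r r' : ℝ≥0∞} [ENNReal.HolderConjugate r r'] (hw : HasWeakDeriv v F D) (hF : MemLp F r volume)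
    (φ : 𝓢(R6, ℂ)) :
    Tendsto (fun h : ℝ => (h : ℂ)⁻¹ * ∫ x, diffq (h • v) F x * φ x) (𝓝[>] 0)
      (𝓝 (∫ x, D x * φ x)) := by
  rw [hw φ]
  have := (tendsto_integral_sub_shift (r' := r') hF φ v).neg
  refine this.congr fun h => ?_
  rw [QuadNLS.integral_diffq_mul (r' := r') hF, mul_neg]

end Diff

/-- Tested against φ, the difference is an integral over [0, h] of pairings of D with translates of
φ, which all have the same norm. The function F itself need not be in L². -/
theorem HasWeakDeriv.eLpNorm_diffq_two_le {F D : R6 → ℂ} {v : R6} (hw : HasWeakDeriv v F D)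
    (hF : MemLp F 3 volume) (hD : MemLp D 2 volume) {h : ℝ} (hh : 0 ≤ h) :
    eLpNorm (diffq (h • v) F) 2 volume ≤ ENNReal.ofReal h * eLpNorm D 2 volume :=
  eLpNorm_two_le_of_forall_schwartz (MemLp.diffq hF _) fun φ =>
    hw.enorm_integral_diffq_mul_le (r' := 3 / 2) hF hD φ hh

theorem HasWeakDeriv.eLpNorm_diffq_three_le {F D : R6 → ℂ} {v : R6} (hw : HasWeakDeriv v F D)
    (hF : MemLp F 3 volume) (hD : MemLp D 3 volume) {h : ℝ} (hh : 0 ≤ h) :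
    eLpNorm (diffq (h • v) F) 3 volume ≤ ENNReal.ofReal h * eLpNorm D 3 volume :=
  eLpNorm_three_le_of_forall_schwartz (MemLp.diffq hF _) fun φ =>
    hw.enorm_integral_diffq_mul_le (r' := 3 / 2) hF hD φ hh

/-- Difference quotients converge to D in the sense of distributions, and a norm obtained by testing
is lower semicontinuous. Integrability of D in L³ is not assumed: this is how it is gained. -/
theorem HasWeakDeriv.eLpNorm_three_le_liminf {F D : R6 → ℂ} {v : R6} (hw : HasWeakDeriv v F D)
    (hF : MemLp F 3 volume) (hD : MemLp D 2 volume) {h : ℕ → ℝ} (h0 : ∀ n, 0 < h n)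
    (hh : Tendsto h atTop (𝓝 0)) :
    eLpNorm D 3 volume ≤
      liminf (fun n => (ENNReal.ofReal (h n))⁻¹ * eLpNorm (diffq (h n • v) F) 3 volume) atTop := by
  refine eLpNorm_three_le_of_forall_schwartz (r := 2) hD fun φ => ?_
  have ht : Tendsto h atTop (𝓝[>] 0) :=
    tendsto_nhdsWithin_iff.2 ⟨hh, Eventually.of_forall h0⟩
  have h1 := ((hw.tendsto_integral_diffq (r' := 3 / 2) hF φ).comp ht).enorm
  have hb : ∀ n, ‖((h n : ℝ) : ℂ)⁻¹ * ∫ x, diffq (h n • v) F x * φ x‖ₑ ≤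
      (ENNReal.ofReal (h n))⁻¹ * eLpNorm (diffq (h n • v) F) 3 volume *
        eLpNorm φ (3 / 2) volume := fun n => by
    rw [enorm_mul, mul_assoc]
    gcongr
    · rw [enorm_inv (by exact_mod_cast (h0 n).ne'), ← ofReal_norm, Complex.norm_real,
        Real.norm_eq_abs, abs_of_pos (h0 n)]
    · exact enorm_integral_mul_le (MemLp.diffq hF _).1 (aesm_schwartz _)
  rw [← h1.liminf_eq]
  refine (liminf_le_liminf (Eventually.of_forall hb)).trans ?_
  by_cases hφ : eLpNorm φ (3 / 2) volume = 0
  · simp [hφ]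
  · have hφt : eLpNorm φ (3 / 2) volume ≠ ⊤ := (φ.memLp (3 / 2) volume).2.ne
    refine le_of_eq ?_
    have := (ENNReal.continuous_mul_const (a := eLpNorm φ (3 / 2) volume) hφt)
    have hmono : Monotone fun c : ℝ≥0∞ => c * eLpNorm φ (3 / 2) volume := fun a b hab =>
      mul_le_mul_left hab _
    exact (hmono.map_liminf_of_continuousAt _ this.continuousAt).symm

instance holderTriple_three_three : ENNReal.HolderTriple 3 3 (3 / 2) := ⟨by
  rw [ENNReal.inv_div (by norm_num) (by norm_num), ← two_mul, ENNReal.div_eq_inv_mul, mul_comm]⟩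

instance holderTriple_six_two : ENNReal.HolderTriple 6 2 (3 / 2) := ⟨by
  rw [ENNReal.inv_div (by norm_num) (by norm_num)]
  have h6 : (6 : ℝ≥0∞)⁻¹ = ENNReal.ofReal (1 / 6) := by
    rw [ENNReal.ofReal_div_of_pos (by norm_num)]; simp
  have h2 : (2 : ℝ≥0∞)⁻¹ = ENNReal.ofReal (1 / 2) := by
    rw [ENNReal.ofReal_div_of_pos (by norm_num)]; simp
  have h3 : (2 / 3 : ℝ≥0∞) = ENNReal.ofReal (2 / 3) := by
    rw [ENNReal.ofReal_div_of_pos (by norm_num)]; simp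
  rw [h6, h2, h3, ← ENNReal.ofReal_add (by norm_num) (by norm_num)]
  norm_num⟩

instance holderConjugate_three_halves : ENNReal.HolderConjugate (3 / 2) 3 :=
  ENNReal.HolderConjugate.symm

theorem diffq_mul (a : R6) (f g : R6 → ℂ) (x : R6) :
    diffq a (fun x => f x * g x) x = diffq a f x * g (x + a) + f x * diffq a g x := by
  simp only [diffq]; ring

/-- A bound for the gradient of a product. -/
theorem enorm_integral_mul_mul_lineDeriv_le {f g : R6 → ℂ} {v : R6} {A₁ A₆ B₂ B₃ : ℝ≥0∞}
    (hf : MemLp f 3 volume) (hg : MemLp g 3 volume)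
    (hf1 : ∀ h : ℝ, 0 < h → eLpNorm (diffq (h • v) f) 3 volume ≤ ENNReal.ofReal h * A₁)
    (hf6 : eLpNorm f 6 volume ≤ A₆) (hg3 : eLpNorm g 3 volume ≤ B₃)
    (hg2 : ∀ h : ℝ, 0 < h → eLpNorm (diffq (h • v) g) 2 volume ≤ ENNReal.ofReal h * B₂)
    (ψ : 𝓢(R6, ℂ)) :
    ‖∫ x, f x * g x * (∂_{v} ψ) x‖ₑ ≤ (A₁ * B₃ + A₆ * B₂) * eLpNorm ψ 3 volume := by
  have hQ : MemLp (fun x => f x * g x) (3 / 2) volume := hg.smul hf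
  have h1 := (tendsto_integral_sub_shift (r' := 3) hQ ψ v).enorm
  refine le_of_tendsto h1 ?_
  filter_upwards [self_mem_nhdsWithin] with h hh
  have hh' : (0 : ℝ) < h := hh
  have e := integral_diffq_mul (r' := 3) hQ (h • v) ψ
  have hd : eLpNorm (diffq (h • v) fun x => f x * g x) (3 / 2) volume ≤
      ENNReal.ofReal h * (A₁ * B₃ + A₆ * B₂) := by
    -- The discrete product rule; its two terms are placed in L³·L³ and L⁶·L², both inside L^{3/2}.
    -- Working with differences makes a product rule for weak derivatives unnecessary.
    have e1 : (diffq (h • v) fun x => f x * g x) =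
        diffq (h • v) f • (fun x => g (x + h • v)) + f • diffq (h • v) g := by
      ext x; exact diffq_mul _ _ _ _
    have m1 := (MemLp.diffq hf (h • v)).1
    have m2 := (MemLp.diffq hg (h • v)).1
    have m3 := (MemLp.comp_add hg (h • v)).1
    rw [e1]
    refine (eLpNorm_add_le (m1.smul m3) (hf.1.smul m2) one_le_three_halves).trans ?_
    rw [mul_add]
    gcongr
    · refine (eLpNorm_smul_le_mul_eLpNorm (p := 3) (q := 3) m3 m1).trans ?_
      rw [← mul_assoc]
      gcongr
      · exact hf1 h hh'
      · refine le_trans (le_of_eq ?_) hg3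
        exact eLpNorm_comp_measurePreserving hg.1 (measurePreserving_add_right volume (h • v))
    · refine (eLpNorm_smul_le_mul_eLpNorm (p := 6) (q := 2) m2 hf.1).trans ?_
      rw [mul_left_comm]
      gcongr
      exact hg2 h hh'
  rw [enorm_mul, ← enorm_neg (∫ x, f x * g x * _), ← e, enorm_inv (by exact_mod_cast hh'.ne'),
    ← ofReal_norm ((h : ℝ) : ℂ), Complex.norm_real, Real.norm_eq_abs, abs_of_pos hh']
  have h0 : ENNReal.ofReal h ≠ 0 := by simpa using hh'
  calc _ ≤ (ENNReal.ofReal h)⁻¹ * (ENNReal.ofReal h * (A₁ * B₃ + A₆ * B₂) *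
        eLpNorm ψ 3 volume) := by
        gcongr
        refine (enorm_integral_mul_le (p := 3 / 2) (q := 3) (MemLp.diffq hQ _).1
          (aesm_schwartz _)).trans ?_
        gcongr
    _ = _ := by
        rw [← mul_assoc, ← mul_assoc, ENNReal.inv_mul_cancel h0 ENNReal.ofReal_ne_top, one_mul]

/-- Hölder applied to |f|^p and |f|^q with weights (1 - θ)r/p and θr/q, which add up to 1. -/
theorem eLpNorm_le_interp {f : R6 → ℂ} (hf : AEStronglyMeasurable f volume) {p q r θ : ℝ}
    (hp : 0 < p) (hq : 0 < q) (hr : 0 < r) (h0 : 0 ≤ θ) (h1 : θ ≤ 1)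
    (h : 1 / r = (1 - θ) / p + θ / q) :
    eLpNorm f (ENNReal.ofReal r) volume ≤ eLpNorm f (ENNReal.ofReal p) volume ^ (1 - θ) *
      eLpNorm f (ENNReal.ofReal q) volume ^ θ := by
  have key : ∀ s : ℝ, 0 < s → eLpNorm f (ENNReal.ofReal s) volume =
      (∫⁻ x, ‖f x‖ₑ ^ s) ^ (1 / s) := fun s hs => by
    rw [eLpNorm_eq_lintegral_rpow_enorm_toReal (by simpa using hs) ENNReal.ofReal_ne_top,
      ENNReal.toReal_ofReal hs.le]
  have hs : (1 - θ) * r / p + θ * r / q = 1 := by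
    field_simp at h ⊢
    linarith
  rw [key r hr, key p hp, key q hq]
  have h2 := ENNReal.lintegral_mul_norm_pow_le (μ := volume) (f := fun x => ‖f x‖ₑ ^ p)
    (g := fun x => ‖f x‖ₑ ^ q) (hf.enorm.pow_const _) (hf.enorm.pow_const _)
    (p := (1 - θ) * r / p) (q := θ * r / q) (by have : 0 ≤ 1 - θ := by linarith
                                                positivity) (by positivity) hs
  have e : ∀ x, (‖f x‖ₑ ^ p) ^ ((1 - θ) * r / p) * (‖f x‖ₑ ^ q) ^ (θ * r / q) = ‖f x‖ₑ ^ r := by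
    intro x
    rw [← ENNReal.rpow_mul, ← ENNReal.rpow_mul, ← ENNReal.rpow_add_of_nonneg]
    · congr 1; field_simp; ring
    · have : 0 ≤ 1 - θ := by linarith
      positivity
    · positivity
  simp_rw [e] at h2
  refine (ENNReal.rpow_le_rpow h2 (by positivity)).trans (le_of_eq ?_)
  rw [ENNReal.mul_rpow_of_nonneg _ _ (by positivity), ← ENNReal.rpow_mul, ← ENNReal.rpow_mul,
    ← ENNReal.rpow_mul, ← ENNReal.rpow_mul]
  congr 2 <;> field_simp

end QuadNLS
end

noncomputable section
namespace QuadNLS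

/-! ### The Sobolev inequality -/

/-- Smooth cutoffs at scale `n + 1`. -/
def cutoffBump : ContDiffBump (0 : R6) := ⟨1, 2, one_pos, one_lt_two⟩

def cutoff (n : ℕ) (x : R6) : ℝ := cutoffBump (((n : ℝ) + 1)⁻¹ • x)

theorem cutoff_contDiff (n : ℕ) : ContDiff ℝ ∞ (cutoff n) :=
  cutoffBump.contDiff.comp (contDiff_const_smul _)

theorem norm_scaled (n : ℕ) (x : R6) : ‖((n : ℝ) + 1)⁻¹ • x‖ = ‖x‖ / ((n : ℝ) + 1) := by
  have : (0 : ℝ) < (n : ℝ) + 1 := by positivity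
  rw [norm_smul, norm_inv, Real.norm_eq_abs, abs_of_pos this, div_eq_inv_mul]

theorem cutoff_eq_one {n : ℕ} {x : R6} (hx : ‖x‖ ≤ n + 1) : cutoff n x = 1 := by
  refine cutoffBump.one_of_mem_closedBall ?_
  have : (0 : ℝ) < (n : ℝ) + 1 := by positivity
  rw [mem_closedBall_zero_iff, norm_scaled, div_le_iff₀ this]
  change ‖x‖ ≤ 1 * _
  linarith

theorem cutoff_eq_zero {n : ℕ} {x : R6} (hx : 2 * ((n : ℝ) + 1) ≤ ‖x‖) : cutoff n x = 0 := by
  refine cutoffBump.zero_of_le_dist ?_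
  have : (0 : ℝ) < (n : ℝ) + 1 := by positivity
  rw [dist_zero_right, norm_scaled, le_div_iff₀ this]
  exact hx

theorem cutoff_nonneg (n : ℕ) (x : R6) : 0 ≤ cutoff n x := cutoffBump.nonneg
theorem cutoff_le_one (n : ℕ) (x : R6) : cutoff n x ≤ 1 := cutoffBump.le_one

theorem cutoff_hasCompactSupport (n : ℕ) : HasCompactSupport (cutoff n) := by
  refine HasCompactSupport.intro (isCompact_closedBall (0 : R6) (2 * ((n : ℝ) + 1))) fun x hx => ?_
  rw [mem_closedBall_zero_iff, not_le] at hx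
  exact cutoff_eq_zero hx.le

theorem tendsto_cutoff (x : R6) : Tendsto (fun n => cutoff n x) atTop (𝓝 1) := by
  obtain ⟨m, hm⟩ := exists_nat_ge ‖x‖
  refine tendsto_const_nhds.congr' ?_
  filter_upwards [eventually_ge_atTop m] with n hn
  have : (m : ℝ) ≤ n := by exact_mod_cast hn
  exact (cutoff_eq_one (by linarith)).symm

theorem exists_fderiv_cutoff_le : ∃ K : ℝ, 0 ≤ K ∧ ∀ n x, ‖fderiv ℝ (cutoff n) x‖ ≤
    K / ((n : ℝ) + 1) := by
  obtain ⟨K, hK⟩ := (cutoffBump.contDiff (n := 1)).continuous_fderiv (by norm_num) |>.bounded_above_of_compact_support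
    (cutoffBump.hasCompactSupport.fderiv (𝕜 := ℝ))
  refine ⟨K, (norm_nonneg _).trans (hK 0), fun n x => ?_⟩
  have h0 : (0 : ℝ) < (n : ℝ) + 1 := by positivity
  have e : fderiv ℝ (cutoff n) x = ((n : ℝ) + 1)⁻¹ • fderiv ℝ cutoffBump (((n : ℝ) + 1)⁻¹ • x) :=
    fderiv_comp_smul _
  rw [e, norm_smul, norm_inv, Real.norm_eq_abs, abs_of_pos h0, div_eq_inv_mul]
  gcongr
  exact hK _

theorem fderiv_cutoff_eq_zero {n : ℕ} {x : R6} (hx : ‖x‖ < n + 1) : fderiv ℝ (cutoff n) x = 0 := by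
  have h : cutoff n =ᶠ[𝓝 x] fun _ => 1 := by
    filter_upwards [(isOpen_lt continuous_norm continuous_const).mem_nhds hx] with y hy
    exact cutoff_eq_one (le_of_lt hy)
  rw [h.fderiv_eq, fderiv_const_apply]

theorem fderiv_cutoff_eq_zero' {n : ℕ} {x : R6} (hx : 2 * ((n : ℝ) + 1) < ‖x‖) :
    fderiv ℝ (cutoff n) x = 0 := by
  have h : cutoff n =ᶠ[𝓝 x] fun _ => 0 := by
    filter_upwards [(isOpen_lt continuous_const continuous_norm).mem_nhds hx] with y hy
    exact cutoff_eq_zero (le_of_lt hy)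
  rw [h.fderiv_eq, fderiv_const_apply]

/-- The gradient is O(1/n) on a ball of volume O(n⁶): in dimension six its L⁶ norm is invariant
under scaling. -/
theorem exists_eLpNorm_fderiv_cutoff_le :
    ∃ K : ℝ≥0, ∀ n, eLpNorm (fderiv ℝ (cutoff n)) 6 volume ≤ K := by
  obtain ⟨K, hK0, hK⟩ := exists_fderiv_cutoff_le
  have hv : volume (Metric.ball (0 : R6) 1) ≠ ⊤ := measure_ball_lt_top.ne
  refine ⟨(ENNReal.ofReal (2 * K) * volume (Metric.ball (0 : R6) 1) ^ (1 / 6 : ℝ)).toNNReal,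
    fun n => ?_⟩
  rw [ENNReal.coe_toNNReal (ENNReal.mul_ne_top ENNReal.ofReal_ne_top
    (ENNReal.rpow_ne_top_of_nonneg (by norm_num) hv))]
  have h0 : (0 : ℝ) < (n : ℝ) + 1 := by positivity
  have h1 : eLpNorm (fderiv ℝ (cutoff n)) 6 volume ≤
      eLpNorm ((Metric.closedBall (0 : R6) (2 * ((n : ℝ) + 1))).indicator
        fun _ => K / ((n : ℝ) + 1)) 6 volume := by
    refine eLpNorm_mono fun x => ?_
    by_cases hx : ‖x‖ ≤ 2 * ((n : ℝ) + 1)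
    · rw [Set.indicator_of_mem (by simpa using hx), Real.norm_eq_abs,
        abs_of_nonneg (by positivity)]
      exact hK n x
    · rw [fderiv_cutoff_eq_zero' (not_le.1 hx), norm_zero]
      exact norm_nonneg _
  refine h1.trans ?_
  rw [eLpNorm_indicator_const (measurableSet_closedBall) (by norm_num) (by norm_num),
    Measure.addHaar_closedBall _ _ (by positivity)]
  simp only [finrank_euclideanSpace, Fintype.card_fin, ENNReal.toReal_ofNat]
  rw [ENNReal.mul_rpow_of_nonneg _ _ (by norm_num), ← mul_assoc,
    ENNReal.ofReal_rpow_of_nonneg (by positivity) (by norm_num), ← Real.rpow_natCast,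
    ← Real.rpow_mul (by positivity), Real.enorm_eq_ofReal (by positivity),
    ← ENNReal.ofReal_mul (by positivity)]
  norm_num
  gcongr
  rw [show (2 : ℝ≥0∞) = ENNReal.ofReal 2 by simp, ← ENNReal.ofReal_mul (by norm_num)]
  refine ENNReal.ofReal_le_ofReal (le_of_eq ?_)
  field_simp

theorem tendsto_eLpNorm_tail {w : R6 → ℂ} (hw : MemLp w 3 volume) :
    Tendsto (fun n : ℕ => eLpNorm ({x : R6 | (n : ℝ) + 1 ≤ ‖x‖}.indicator w) 3 volume) atTop
      (𝓝 0) := by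
  have hS : ∀ n : ℕ, MeasurableSet {x : R6 | (n : ℝ) + 1 ≤ ‖x‖} := fun n =>
    measurableSet_le measurable_const measurable_norm
  have h1 : Tendsto (fun n : ℕ => ∫⁻ x, ‖{x : R6 | (n : ℝ) + 1 ≤ ‖x‖}.indicator w x‖ₑ ^ (3 : ℝ))
      atTop (𝓝 (∫⁻ _ : R6, 0)) := by
    refine tendsto_lintegral_of_dominated_convergence' (fun x => ‖w x‖ₑ ^ (3 : ℝ))
      (fun n => ((hw.1.indicator (hS n)).enorm.pow_const _)) (fun n => ?_) ?_ ?_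
    · refine Eventually.of_forall fun x => ?_
      simp only
      gcongr
      rw [enorm_indicator_eq_indicator_enorm]
      exact Set.indicator_le_self _ _ _
    · have := lintegral_rpow_enorm_lt_top_of_eLpNorm_lt_top (by norm_num) (by norm_num) hw.2
      simpa using this.ne
    · refine Eventually.of_forall fun x => ?_
      obtain ⟨m, hm⟩ := exists_nat_ge ‖x‖
      refine tendsto_const_nhds.congr' ?_
      filter_upwards [eventually_ge_atTop m] with n hn
      have : (m : ℝ) ≤ n := by exact_mod_cast hn
      rw [Set.indicator_of_notMem]
      · simp
      · rw [Set.mem_ofPred_eq]; linarith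
  simp_rw [eLpNorm_eq_lintegral_rpow_enorm_toReal (p := 3) (by norm_num) (by norm_num)]
  have h2 := (ENNReal.continuous_rpow_const (y := 1 / (3 : ℝ))).tendsto 0
  rw [lintegral_zero] at h1
  have h3 := h2.comp h1
  simpa [Function.comp_def] using h3

instance holderTriple_six_three_two : ENNReal.HolderTriple 6 3 2 := ⟨by
  have h6 : (6 : ℝ≥0∞)⁻¹ = ENNReal.ofReal (1 / 6) := by
    rw [ENNReal.ofReal_div_of_pos (by norm_num)]; simp
  have h2 : (2 : ℝ≥0∞)⁻¹ = ENNReal.ofReal (1 / 2) := by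
    rw [ENNReal.ofReal_div_of_pos (by norm_num)]; simp
  have h3 : (3 : ℝ≥0∞)⁻¹ = ENNReal.ofReal (1 / 3) := by
    rw [ENNReal.ofReal_div_of_pos (by norm_num)]; simp
  rw [h6, h2, h3, ← ENNReal.ofReal_add (by norm_num) (by norm_num)]
  norm_num⟩

/-- The exponents of the Sobolev embedding that are used. -/
def SobolevPair (p p' : ℝ≥0) : Prop := (p = 2 ∧ p' = 3) ∨ (p = 3 ∧ p' = 6)

theorem SobolevPair.one_le {p p' : ℝ≥0} (h : SobolevPair p p') : 1 ≤ p := by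
  rcases h with ⟨rfl, rfl⟩ | ⟨rfl, rfl⟩ <;> norm_num

theorem SobolevPair.eq {p p' : ℝ≥0} (h : SobolevPair p p') :
    (p' : ℝ)⁻¹ = (p : ℝ)⁻¹ - (Module.finrank ℝ R6 : ℝ)⁻¹ := by
  rcases h with ⟨rfl, rfl⟩ | ⟨rfl, rfl⟩ <;> norm_num

/-- For p = 2 the bounded L⁶ norm of the gradient of the cutoff is paired with the L³ tail of w; for
p = 3 its uniform decay is enough. -/
theorem tendsto_eLpNorm_fderiv_cutoff_smul {p p' : ℝ≥0} (hp : SobolevPair p p') {w : R6 → ℂ}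
    (hw : MemLp w 3 volume) :
    Tendsto (fun n => eLpNorm (fun x => ‖fderiv ℝ (cutoff n) x‖ * ‖w x‖) p volume) atTop (𝓝 0) := by
  rcases hp with ⟨rfl, rfl⟩ | ⟨rfl, rfl⟩
  · obtain ⟨K, hK⟩ := exists_eLpNorm_fderiv_cutoff_le
    have h1 : Tendsto (fun n : ℕ => (K : ℝ≥0∞) *
        eLpNorm ({x : R6 | (n : ℝ) + 1 ≤ ‖x‖}.indicator w) 3 volume) atTop (𝓝 0) := by
      simpa using ENNReal.Tendsto.const_mul (tendsto_eLpNorm_tail hw) (Or.inr ENNReal.coe_ne_top)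
    refine tendsto_of_tendsto_of_tendsto_of_le_of_le tendsto_const_nhds h1 (fun _ => zero_le)
      fun n => ?_
    have hS : MeasurableSet {x : R6 | (n : ℝ) + 1 ≤ ‖x‖} :=
      measurableSet_le measurable_const measurable_norm
    have e : (fun x => ‖fderiv ℝ (cutoff n) x‖ * ‖w x‖) = (fun x => ‖fderiv ℝ (cutoff n) x‖) •
        fun x => ‖{x : R6 | (n : ℝ) + 1 ≤ ‖x‖}.indicator w x‖ := by
      ext x
      simp only [Pi.smul_apply', smul_eq_mul]
      by_cases hx : (n : ℝ) + 1 ≤ ‖x‖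
      · rw [Set.indicator_of_mem (show x ∈ {x : R6 | (n : ℝ) + 1 ≤ ‖x‖} from hx)]
      · rw [fderiv_cutoff_eq_zero (not_le.1 hx)]; simp
    have hc : Continuous (fderiv ℝ (cutoff n)) :=
      (cutoff_contDiff n).continuous_fderiv (by simp)
    rw [e]
    change eLpNorm _ 2 volume ≤ _
    refine (eLpNorm_smul_le_mul_eLpNorm (p := 6) (q := 3) (hw.1.indicator hS).norm
      hc.norm.aestronglyMeasurable).trans ?_
    rw [eLpNorm_norm, eLpNorm_norm]
    gcongr
    exact hK n
  · obtain ⟨K, hK0, hK⟩ := exists_fderiv_cutoff_le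
    have h1 : Tendsto (fun n : ℕ => ENNReal.ofReal (K / ((n : ℝ) + 1)) * eLpNorm w 3 volume) atTop
        (𝓝 0) := by
      have : Tendsto (fun n : ℕ => ENNReal.ofReal (K / ((n : ℝ) + 1))) atTop (𝓝 0) := by
        rw [← ENNReal.ofReal_zero]
        refine (ENNReal.continuous_ofReal.tendsto 0).comp ?_
        have := (tendsto_one_div_add_atTop_nhds_zero_nat (𝕜 := ℝ)).const_mul K
        simpa [div_eq_mul_inv] using this
      simpa using ENNReal.Tendsto.mul_const this (Or.inr hw.2.ne)
    refine tendsto_of_tendsto_of_tendsto_of_le_of_le tendsto_const_nhds h1 (fun _ => zero_le)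
      fun n => ?_
    refine eLpNorm_le_mul_eLpNorm_of_ae_le_mul (Eventually.of_forall fun x => ?_) _
    simp only [norm_mul, norm_norm]
    gcongr
    exact hK n x

/-- The Sobolev constant. -/
def sobolevConst (p : ℝ≥0) : ℝ≥0 := SNormLESNormFDerivOfEqConst ℂ (volume : Measure R6) p

/-- Cutting off reduces to compact support; the term in which the cutoff is differentiated tends to
zero, and Fatou's lemma restores w. -/
theorem sobolev_of_contDiff {p p' : ℝ≥0} (hp : SobolevPair p p') {w : R6 → ℂ}
    (hws : ContDiff ℝ ∞ w) (hw : MemLp w 3 volume) :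
    eLpNorm w p' volume ≤ sobolevConst p * eLpNorm (fderiv ℝ w) p volume := by
  have hlim : ∀ x, Tendsto (fun n => cutoff n x • w x) atTop (𝓝 (w x)) := fun x => by
    simpa using (tendsto_cutoff x).smul_const (w x)
  have hs : ∀ n, ContDiff ℝ ∞ fun x => cutoff n x • w x := fun n => (cutoff_contDiff n).smul hws
  have hb : ∀ n, eLpNorm (fun x => cutoff n x • w x) p' volume ≤ sobolevConst p *
      (eLpNorm (fderiv ℝ w) p volume +
        eLpNorm (fun x => ‖fderiv ℝ (cutoff n) x‖ * ‖w x‖) p volume) := fun n => by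
    refine (eLpNorm_le_eLpNorm_fderiv_of_eq volume ((hs n).of_le (by simp))
      ((cutoff_hasCompactSupport n).mono fun x hx => ?_) hp.one_le (by simp) hp.eq).trans ?_
    · rw [Function.mem_support] at hx ⊢
      exact fun h => hx (by simp [h])
    · change (sobolevConst p : ℝ≥0∞) * _ ≤ _
      gcongr
      have hc : Continuous (fderiv ℝ (cutoff n)) := (cutoff_contDiff n).continuous_fderiv (by simp)
      have hc' : Continuous (fderiv ℝ w) := hws.continuous_fderiv (by simp)
      rw [← eLpNorm_norm (fderiv ℝ w)]
      refine le_trans (eLpNorm_mono_real fun x => ?_) (eLpNorm_add_le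
        hc'.norm.aestronglyMeasurable ((hc.norm.mul hws.continuous.norm).aestronglyMeasurable)
        (by exact_mod_cast hp.one_le))
      rw [fderiv_fun_smul ((cutoff_contDiff n).differentiable (by simp) x)
        (hws.differentiable (by simp) x)]
      refine (norm_add_le _ _).trans (add_le_add ?_ ?_)
      · rw [norm_smul, Real.norm_eq_abs, abs_of_nonneg (cutoff_nonneg n x)]
        exact mul_le_of_le_one_left (norm_nonneg _) (cutoff_le_one n x)
      · rw [ContinuousLinearMap.norm_smulRight_apply]
  refine (Lp.eLpNorm_lim_le_liminf_eLpNorm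
    (fun n => (hs n).continuous.aestronglyMeasurable) w (Eventually.of_forall hlim)).trans ?_
  refine (liminf_le_liminf (Eventually.of_forall hb)).trans (le_of_eq (Tendsto.liminf_eq ?_))
  have := (tendsto_eLpNorm_fderiv_cutoff_smul hp hw).const_add (eLpNorm (fderiv ℝ w) p volume)
  simpa using ENNReal.Tendsto.const_mul this (Or.inr ENNReal.coe_ne_top)

/-! ### Mollification -/

section Mollify

open scoped Convolution

variable (ρ : ContDiffBump (0 : R6))

/-- Mollification of `f`. -/
def mollify (f : R6 → ℂ) : R6 → ℂ := ρ.normed volume ⋆[ContinuousLinearMap.lsmul ℝ ℝ, volume] f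

theorem mollify_apply (f : R6 → ℂ) (x : R6) :
    mollify ρ f x = ∫ t, ρ.normed volume t • f (x - t) := rfl

theorem mollify_congr {f g : R6 → ℂ} (h : f =ᵐ[volume] g) : mollify ρ f = mollify ρ g := by
  ext x
  rw [mollify_apply, mollify_apply]
  refine integral_congr_ae ?_
  filter_upwards [(Measure.measurePreserving_sub_left volume x).quasiMeasurePreserving.ae_eq_comp h]
    with t ht
  simp only [Function.comp_apply] at ht
  rw [ht]

/-- Jensen's inequality for the probability measure whose density is the mollifier. -/
theorem enorm_mollify_rpow_le {f : R6 → ℂ} (hf : StronglyMeasurable f) {p : ℝ} (hp : 1 ≤ p)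
    (x : R6) :
    ‖mollify ρ f x‖ₑ ^ p ≤ ∫⁻ t, ENNReal.ofReal (ρ.normed volume t) * ‖f (x - t)‖ₑ ^ p := by
  set d : R6 → ℝ≥0∞ := fun t => ENNReal.ofReal (ρ.normed volume t)
  have hd : Measurable d := (ρ.continuous_normed.measurable).ennreal_ofReal
  have hd1 : ∫⁻ t, d t = 1 := by
    rw [← ofReal_integral_eq_lintegral_ofReal ρ.integrable_normed
      (Eventually.of_forall fun t => ρ.nonneg_normed t), ρ.integral_normed, ENNReal.ofReal_one]
  have hν : IsProbabilityMeasure ((volume : Measure R6).withDensity d) :=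
    ⟨by rw [withDensity_apply _ MeasurableSet.univ, setLIntegral_univ, hd1]⟩
  have hm : StronglyMeasurable fun t => f (x - t) :=
    hf.comp_measurable (measurable_const.sub measurable_id)
  have h1 : ‖mollify ρ f x‖ₑ ≤
      eLpNorm (fun t => f (x - t)) 1 ((volume : Measure R6).withDensity d) := by
    rw [eLpNorm_one_eq_lintegral_enorm, lintegral_withDensity_eq_lintegral_mul _ hd hm.enorm]
    refine (enorm_integral_le_lintegral_enorm _).trans (lintegral_mono fun t => ?_)
    change ‖ρ.normed volume t • f (x - t)‖ₑ ≤ d t * ‖f (x - t)‖ₑ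
    rw [enorm_smul, Real.enorm_eq_ofReal (ρ.nonneg_normed t)]
  have h2 := eLpNorm_le_eLpNorm_of_exponent_le (p := 1) (q := ENNReal.ofReal p)
    (μ := (volume : Measure R6).withDensity d) (by simpa using hp) hm.aestronglyMeasurable
  have hp0 : 0 < p := by linarith
  calc _ ≤ eLpNorm (fun t => f (x - t)) (ENNReal.ofReal p)
        ((volume : Measure R6).withDensity d) ^ p := by
        gcongr; exact h1.trans h2
    _ = ∫⁻ t, ‖f (x - t)‖ₑ ^ p ∂((volume : Measure R6).withDensity d) := by
        rw [eLpNorm_eq_lintegral_rpow_enorm_toReal (by simpa using hp0) ENNReal.ofReal_ne_top,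
          ENNReal.toReal_ofReal hp0.le, ← ENNReal.rpow_mul, one_div, inv_mul_cancel₀ hp0.ne',
          ENNReal.rpow_one]
    _ = _ := by
        rw [lintegral_withDensity_eq_lintegral_mul _ hd (hm.enorm.pow_const _)]
        rfl

theorem eLpNorm_mollify_le {f : R6 → ℂ} (hf : AEStronglyMeasurable f volume) {p : ℝ≥0}
    (hp : 1 ≤ p) : eLpNorm (mollify ρ f) p volume ≤ eLpNorm f p volume := by
  obtain ⟨g, hg, hfg⟩ := hf
  rw [mollify_congr ρ hfg, eLpNorm_congr_ae hfg]
  have hp0 : (0 : ℝ) < p := lt_of_lt_of_le one_pos (by exact_mod_cast hp)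
  rw [eLpNorm_nnreal_eq_lintegral (by positivity), eLpNorm_nnreal_eq_lintegral (by positivity)]
  refine ENNReal.rpow_le_rpow ?_ (by positivity)
  refine (lintegral_mono fun x => enorm_mollify_rpow_le ρ hg (by exact_mod_cast hp) x).trans ?_
  rw [lintegral_lintegral_swap]
  · have e : ∀ t, ∫⁻ x, ENNReal.ofReal (ρ.normed volume t) * ‖g (x - t)‖ₑ ^ (p : ℝ) =
        ENNReal.ofReal (ρ.normed volume t) * ∫⁻ x, ‖g x‖ₑ ^ (p : ℝ) := fun t => by
      rw [lintegral_const_mul' _ _ ENNReal.ofReal_ne_top,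
        lintegral_sub_right_eq_self (fun x => ‖g x‖ₑ ^ (p : ℝ)) t]
    simp_rw [e]
    rw [lintegral_mul_const _ (ρ.continuous_normed.measurable).ennreal_ofReal,
      ← ofReal_integral_eq_lintegral_ofReal ρ.integrable_normed
      (Eventually.of_forall fun t => ρ.nonneg_normed t), ρ.integral_normed, ENNReal.ofReal_one,
      one_mul]
  · refine Measurable.aemeasurable ?_
    refine Measurable.mul ((ρ.continuous_normed.measurable.comp measurable_snd).ennreal_ofReal) ?_
    exact ((hg.comp_measurable (measurable_fst.sub measurable_snd)).enorm).pow_const _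

theorem mollify_contDiff {f : R6 → ℂ} (hf : LocallyIntegrable f volume) :
    ContDiff ℝ ∞ (mollify ρ f) :=
  ρ.hasCompactSupport_normed.contDiff_convolution_left _ ρ.contDiff_normed hf

/-- The translated and reflected mollifier as a Schwartz function. -/
def mollifier (x : R6) : 𝓢(R6, ℂ) :=
  HasCompactSupport.toSchwartzMap (f := fun t => ((ρ.normed volume (x - t) : ℝ) : ℂ))
    (by
      have h1 : HasCompactSupport fun t => ρ.normed (volume : Measure R6) (x - t) :=
        ρ.hasCompactSupport_normed.comp_homeomorph (Homeomorph.subLeft x)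
      exact h1.comp_left Complex.ofReal_zero)
    (Complex.ofRealCLM.contDiff.comp (ρ.contDiff_normed.comp (contDiff_const.sub contDiff_id)))

theorem mollifier_apply (x t : R6) :
    mollifier ρ x t = ((ρ.normed volume (x - t) : ℝ) : ℂ) := rfl

theorem mollify_eq (f : R6 → ℂ) (x : R6) : mollify ρ f x = ∫ t, f t * mollifier ρ x t := by
  rw [mollify_apply, ← integral_sub_left_eq_self _ volume x]
  refine integral_congr_ae (Eventually.of_forall fun t => ?_)
  simp only [sub_sub_cancel, mollifier_apply, Complex.real_smul]
  ring

theorem shift_mollifier (x a : R6) : shift a (mollifier ρ x) = mollifier ρ (x + a) := by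
  ext t
  rw [shift_apply, mollifier_apply, mollifier_apply]
  rw [show x - (t - a) = x + a - t by abel]

/-- The mollifier centred at x is a Schwartz function, and moving x translates it; slopes of the
mollification are therefore difference quotients tested against it, whose limit is the weak
derivative. -/
theorem fderiv_mollify {w D : R6 → ℂ} {v : R6} (hw : MemLp w 3 volume) (h : HasWeakDeriv v w D)
    (x : R6) : fderiv ℝ (mollify ρ w) x v = mollify ρ D x := by
  have hl : LocallyIntegrable w volume := hw.locallyIntegrable (by norm_num)
  have hd := ((mollify_contDiff ρ hl).differentiable (by simp) x).hasFDerivAt.hasLineDerivAt v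
  have h1 := (HasDerivAt.tendsto_slope_zero hd).mono_left
    (nhdsWithin_mono 0 (fun y hy => ne_of_gt hy) : 𝓝[>] (0 : ℝ) ≤ 𝓝[≠] 0)
  have h2 := (tendsto_integral_sub_shift (r' := 3 / 2) hw (mollifier ρ x) v).neg
  rw [← h, ← mollify_eq] at h2
  refine tendsto_nhds_unique h1 (h2.congr fun s => ?_)
  have e : ∫ t, w t * (mollifier ρ x t - shift (s • v) (mollifier ρ x) t) =
      mollify ρ w x - mollify ρ w (x + s • v) := by
    rw [mollify_eq, mollify_eq, ← shift_mollifier, ← integral_sub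
      (integrable_mul_schwartz (r' := 3 / 2) hw _) (integrable_mul_schwartz (r' := 3 / 2) hw _)]
    simp_rw [mul_sub]
  rw [e, zero_add, zero_smul, add_zero, Complex.real_smul, Complex.ofReal_inv]
  ring

end Mollify

theorem norm_clm_le_sum (A : R6 →L[ℝ] ℂ) : ‖A‖ ≤ ∑ k, ‖A (unitVec k)‖ := by
  refine A.opNorm_le_bound (Finset.sum_nonneg fun _ _ => norm_nonneg _) fun x => ?_
  have hx : x = ∑ k, x k • unitVec k := by
    ext i
    simp [unitVec, Finset.sum_apply, Pi.single_apply]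
  conv_lhs => rw [hx]
  rw [map_sum, Finset.sum_mul]
  refine (norm_sum_le _ _).trans (Finset.sum_le_sum fun k _ => ?_)
  rw [map_smul, norm_smul, mul_comm]
  gcongr
  exact PiLp.norm_apply_le x k

/-- Mollification commutes with weak derivatives, does not increase Lᵖ norms and converges almost
everywhere, so Fatou's lemma carries the smooth inequality over. -/
theorem sobolev {p p' : ℝ≥0} (hp : SobolevPair p p') {w : R6 → ℂ} {D : Fin 6 → R6 → ℂ}
    (hw : MemLp w 3 volume) (hD : ∀ k, AEStronglyMeasurable (D k) volume)
    (h : ∀ k, HasWeakDeriv (unitVec k) w (D k)) :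
    eLpNorm w p' volume ≤ sobolevConst p * ∑ k, eLpNorm (D k) p volume := by
  let ρ : ℕ → ContDiffBump (0 : R6) := fun n =>
    ⟨1 / ((n : ℝ) + 1), 2 * (1 / ((n : ℝ) + 1)), by positivity, by
      have : (0 : ℝ) < 1 / ((n : ℝ) + 1) := by positivity
      linarith⟩
  have hl : LocallyIntegrable w volume := hw.locallyIntegrable (by norm_num)
  have hρ : Tendsto (fun n => (ρ n).rOut) atTop (𝓝 0) := by
    have := (tendsto_one_div_add_atTop_nhds_zero_nat (𝕜 := ℝ)).const_mul 2
    rw [mul_zero] at this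
    exact this
  have hlim := ContDiffBump.ae_convolution_tendsto_right_of_locallyIntegrable (φ := ρ) (K := 2)
    hρ (Eventually.of_forall fun n => le_rfl) hl
  refine (Lp.eLpNorm_lim_le_liminf_eLpNorm (f := fun n => mollify (ρ n) w)
    (fun n => (mollify_contDiff _ hl).continuous.aestronglyMeasurable) w hlim).trans ?_
  refine (liminf_le_liminf (Eventually.of_forall fun n => ?_)).trans
    (le_of_eq (liminf_const _))
  have hm : MemLp (mollify (ρ n) w) 3 volume :=
    ⟨(mollify_contDiff _ hl).continuous.aestronglyMeasurable,
      (eLpNorm_mollify_le (ρ n) hw.1 (p := 3) (by norm_num)).trans_lt hw.2⟩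
  refine (sobolev_of_contDiff hp (mollify_contDiff _ hl) hm).trans ?_
  gcongr
  have hc : Continuous (fderiv ℝ (mollify (ρ n) w)) :=
    (mollify_contDiff _ hl).continuous_fderiv (by simp)
  refine (eLpNorm_mono_real fun x => norm_clm_le_sum _).trans ?_
  have e : (fun x => ∑ k, ‖fderiv ℝ (mollify (ρ n) w) x (unitVec k)‖) =
      ∑ k, fun x => ‖fderiv ℝ (mollify (ρ n) w) x (unitVec k)‖ := by
    ext x; simp
  rw [e]
  refine (eLpNorm_sum_le (fun k _ => (hc.clm_apply continuous_const).norm.aestronglyMeasurable)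
    (by exact_mod_cast hp.one_le)).trans (Finset.sum_le_sum fun k _ => ?_)
  rw [eLpNorm_norm]
  simp_rw [fderiv_mollify (ρ n) hw (h k)]
  exact eLpNorm_mollify_le (ρ n) (hD k) hp.one_le

end QuadNLS
end

noncomputable section
namespace QuadNLS

/-! ### Norms of distributions given by functions -/

theorem ae_eq_of_forall_schwartz {f g : R6 → ℂ} (hf : LocallyIntegrable f volume)
    (hg : LocallyIntegrable g volume) (h : ∀ φ : 𝓢(R6, ℂ), ∫ x, φ x * f x = ∫ x, φ x * g x) :
    f =ᵐ[volume] g := by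
  refine ae_eq_of_integral_contDiff_smul_eq hf hg fun χ hχ hχc => ?_
  have := h (HasCompactSupport.toSchwartzMap (f := fun t => ((χ t : ℝ) : ℂ))
    (hχc.comp_left Complex.ofReal_zero) (Complex.ofRealCLM.contDiff.comp hχ))
  simp only [Complex.real_smul]
  exact this

/-- A locally integrable representative is unique almost everywhere: the infimum has g as its only
competitor, or, when g is not in Lᵖ, none, and is then infinite. -/
theorem scalarLpNorm_eq {T : 𝓢'(R6, ℂ)} {g : R6 → ℂ} (hg : LocallyIntegrable g volume)
    (hT : ∀ φ : 𝓢(R6, ℂ), T φ = ∫ x, φ x * g x) {p : ℝ≥0∞} (hp : 1 ≤ p) :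
    scalarLpNorm p T = eLpNorm g p volume := by
  refine le_antisymm ?_ (le_iInf fun g' => le_iInf fun hg' => le_iInf fun h' => le_of_eq ?_)
  · by_cases h : eLpNorm g p volume = ⊤
    · rw [h]; exact le_top
    · exact iInf_le_of_le g (iInf_le_of_le ⟨hg.aestronglyMeasurable, lt_top_iff_ne_top.2 h⟩
        (iInf_le_of_le hT le_rfl))
  · exact eLpNorm_congr_ae (ae_eq_of_forall_schwartz hg (hg'.locallyIntegrable hp)
      fun φ => (hT φ).symm.trans (h' φ))

theorem exists_of_scalarLpNorm_lt_top {T : 𝓢'(R6, ℂ)} {p : ℝ≥0∞} (h : scalarLpNorm p T < ⊤) :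
    ∃ g : R6 → ℂ, MemLp g p volume ∧ ∀ φ : 𝓢(R6, ℂ), T φ = ∫ x, φ x * g x := by
  simp only [scalarLpNorm, iInf_lt_iff] at h
  obtain ⟨g, hg, hT, -⟩ := h
  exact ⟨g, hg, hT⟩

theorem toDist_apply (w : State) (j : Fin 2) (φ : 𝓢(R6, ℂ)) :
    State.toDist w j φ = pair φ (w j) := by
  rw [pair_apply]
  simp only [State.toDist, Lp.toTemperedDistribution_apply, smul_eq_mul, mul_comm]

theorem lineDeriv_toDist_apply (w : State) (j : Fin 2) (v : R6) (φ : 𝓢(R6, ℂ)) :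
    (∂_{v} (State.toDist w j)) φ = -pair (∂_{v} φ) (w j) := by
  change State.toDist w j (-∂_{v} φ) = _
  rw [map_neg, toDist_apply]

theorem memLp_locallyIntegrable {p : ℝ≥0∞} [h : Fact (1 ≤ p)] (f : Lp ℂ p (volume : Measure R6)) :
    LocallyIntegrable f volume := (Lp.memLp f).locallyIntegrable h.out

theorem lpNorm_toDist (w : State) {p : ℝ≥0∞} (hp : 1 ≤ p) :
    lpNorm p (State.toDist w) = ∑ j, eLpNorm (w j) p volume := by
  refine Finset.sum_congr rfl fun j _ => scalarLpNorm_eq (memLp_locallyIntegrable _) ?_ hp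
  intro φ
  rw [toDist_apply, pair_apply]
  simp_rw [mul_comm]

/-- The weak derivative in `L²`, if it exists. -/
def weakGrad (k : Fin 6) (F : Lp ℂ 3 (volume : Measure R6)) : Lp ℂ 2 (volume : Measure R6) :=
  open Classical in
  if h : ∃ D : Lp ℂ 2 (volume : Measure R6), HasWeakDeriv (unitVec k) F D then h.choose else 0

/-- The components of `w` have weak derivatives in `L²`. -/
def HasGrad (w : State) : Prop := ∀ k j, HasWeakDeriv (unitVec k) (w j) (weakGrad k (w j))

theorem HasWeakDeriv.unique {v : R6} {F D D' : R6 → ℂ} (h : HasWeakDeriv v F D)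
    (h' : HasWeakDeriv v F D') (hD : LocallyIntegrable D volume)
    (hD' : LocallyIntegrable D' volume) : D =ᵐ[volume] D' :=
  ae_eq_of_forall_schwartz hD hD' fun φ => by
    simp_rw [mul_comm (φ _)]
    rw [h φ, h' φ]

theorem hasWeakDeriv_weakGrad {k : Fin 6} {F : Lp ℂ 3 (volume : Measure R6)}
    {D : Lp ℂ 2 (volume : Measure R6)} (h : HasWeakDeriv (unitVec k) F D) :
    HasWeakDeriv (unitVec k) F (weakGrad k F) := by
  have h' : ∃ D : Lp ℂ 2 (volume : Measure R6), HasWeakDeriv (unitVec k) F D := ⟨D, h⟩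
  rw [weakGrad, dif_pos h']
  exact h'.choose_spec

theorem hasGrad_of_gradLpNorm_lt_top {w : State} (h : gradLpNorm 2 (State.toDist w) < ⊤) :
    HasGrad w := fun k j => by
  have h1 : scalarLpNorm 2 (∂_{unitVec k} (State.toDist w j)) < ⊤ := by
    simp only [gradLpNorm, lpNorm] at h
    exact (ENNReal.sum_lt_top.1 ((ENNReal.sum_lt_top.1 h) k (Finset.mem_univ k))) j
      (Finset.mem_univ j)
  obtain ⟨g, hg, hT⟩ := exists_of_scalarLpNorm_lt_top h1
  refine hasWeakDeriv_weakGrad (D := hg.toLp g) fun φ => ?_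
  have := hT φ
  rw [lineDeriv_toDist_apply, pair_apply] at this
  rw [this]
  refine integral_congr_ae (hg.coeFn_toLp.mono fun x hx => ?_)
  simp only [hx, mul_comm]

theorem gradLpNorm_eq {w : State} (h : HasGrad w) {p : ℝ≥0∞} (hp : 1 ≤ p) :
    gradLpNorm p (State.toDist w) = ∑ k, ∑ j, eLpNorm (weakGrad k (w j)) p volume := by
  refine Finset.sum_congr rfl fun k _ => Finset.sum_congr rfl fun j _ =>
    scalarLpNorm_eq (memLp_locallyIntegrable _) (fun φ => ?_) hp
  rw [lineDeriv_toDist_apply, pair_apply]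
  simp_rw [mul_comm (φ _)]
  exact (h k j φ).symm

theorem HasGrad.eLpNorm_le {w : State} (h : HasGrad w) (k : Fin 6) (j : Fin 2) {p : ℝ≥0∞}
    (hp : 1 ≤ p) : eLpNorm (weakGrad k (w j)) p volume ≤ gradLpNorm p (State.toDist w) := by
  rw [gradLpNorm_eq h hp]
  refine le_trans ?_ (Finset.single_le_sum (f := fun k => ∑ j, eLpNorm (weakGrad k (w j)) p volume)
    (fun _ _ => zero_le) (Finset.mem_univ k))
  exact Finset.single_le_sum (f := fun j => eLpNorm (weakGrad k (w j)) p volume)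
    (fun _ _ => zero_le) (Finset.mem_univ j)

theorem weakGrad_eq {k : Fin 6} {F : Lp ℂ 3 (volume : Measure R6)}
    {D : Lp ℂ 2 (volume : Measure R6)} (h : HasWeakDeriv (unitVec k) F D) : weakGrad k F = D :=
  Lp.ext ((hasWeakDeriv_weakGrad h).unique h (memLp_locallyIntegrable _)
    (memLp_locallyIntegrable _))

theorem hasWeakDeriv_iff_pair {p q : ℝ≥0∞} {p' q' : ℝ≥0∞} [Fact (1 ≤ p)] [Fact (1 ≤ q)]
    [DualExponent p p'] [DualExponent q q'] {v : R6} {F : Lp ℂ p (volume : Measure R6)}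
    {D : Lp ℂ q (volume : Measure R6)} :
    HasWeakDeriv v F D ↔ ∀ φ, pair φ D = -pair (∂_{v} φ) F := Iff.rfl

theorem HasGrad.sub {w z : State} (hw : HasGrad w) (hz : HasGrad z) (k : Fin 6) (j : Fin 2) :
    HasWeakDeriv (unitVec k) ((w - z) j : Lp ℂ 3 (volume : Measure R6))
      (weakGrad k (w j) - weakGrad k (z j) : Lp ℂ 2 (volume : Measure R6)) := by
  rw [hasWeakDeriv_iff_pair]
  intro φ
  rw [map_sub, hasWeakDeriv_iff_pair.1 (hw k j), hasWeakDeriv_iff_pair.1 (hz k j), Pi.sub_apply,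
    map_sub]
  ring

theorem HasGrad.hasGrad_sub {w z : State} (hw : HasGrad w) (hz : HasGrad z) : HasGrad (w - z) :=
  fun k j => hasWeakDeriv_weakGrad (hw.sub hz k j)

theorem HasGrad.weakGrad_sub {w z : State} (hw : HasGrad w) (hz : HasGrad z) (k : Fin 6)
    (j : Fin 2) : weakGrad k ((w - z) j) = weakGrad k (w j) - weakGrad k (z j) :=
  weakGrad_eq (hw.sub hz k j)

theorem HasGrad.sobolev_three {w : State} (h : HasGrad w) (j : Fin 2) :
    eLpNorm (w j) 3 volume ≤ sobolevConst 2 * gradLpNorm 2 (State.toDist w) := by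
  refine (sobolev (Or.inl ⟨rfl, rfl⟩) (Lp.memLp (w j)) (fun k => Lp.aestronglyMeasurable _)
    (fun k => h k j)).trans ?_
  rw [gradLpNorm_eq h (by norm_num)]
  gcongr with k
  exact Finset.single_le_sum (f := fun j => eLpNorm (weakGrad k (w j)) 2 volume)
    (fun _ _ => zero_le) (Finset.mem_univ j)

theorem HasGrad.sobolev_six {w : State} (h : HasGrad w) (j : Fin 2) :
    eLpNorm (w j) 6 volume ≤ sobolevConst 3 * gradLpNorm 3 (State.toDist w) := by
  refine (sobolev (Or.inr ⟨rfl, rfl⟩) (Lp.memLp (w j)) (fun k => Lp.aestronglyMeasurable _)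
    (fun k => h k j)).trans ?_
  rw [gradLpNorm_eq h (by norm_num)]
  gcongr with k
  exact Finset.single_le_sum (f := fun j => eLpNorm (weakGrad k (w j)) 3 volume)
    (fun _ _ => zero_le) (Finset.mem_univ j)

/-! ### Continuity and measurability in time -/

/-- Sublevel sets are closed: an Lᵖ limit is an almost everywhere limit along a subsequence, and
Fatou makes the L^q norm lower semicontinuous even where it is infinite. -/
theorem measurable_eLpNorm_of_continuous {p : ℝ≥0∞} [hp : Fact (1 ≤ p)]
    {D : ℝ → Lp ℂ p (volume : Measure R6)} (hD : Continuous D) (q : ℝ≥0∞) :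
    Measurable fun t => eLpNorm (D t) q volume := by
  refine measurable_of_Iic fun c => (IsSeqClosed.isClosed ?_).measurableSet
  intro s t hs hst
  have h0 : p ≠ 0 := (zero_lt_one.trans_le hp.out).ne'
  have h1 : TendstoInMeasure volume (fun n => (D (s n) : R6 → ℂ)) atTop (D t) :=
    tendstoInMeasure_of_tendsto_Lp ((hD.tendsto t).comp hst)
  obtain ⟨ns, -, hns⟩ := h1.exists_seq_tendsto_ae
  change eLpNorm (D t) q volume ≤ c
  refine (Lp.eLpNorm_lim_le_liminf_eLpNorm (fun n => Lp.aestronglyMeasurable (D (s (ns n)))) _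
    hns).trans ?_
  refine (liminf_le_liminf (Eventually.of_forall fun n => (?_ : _ ≤ c))).trans
    (le_of_eq (liminf_const c))
  exact hs (ns n)

namespace ContinuousHdot1

variable {u v : ℝ → State} (hu : ContinuousHdot1 u) (hv : ContinuousHdot1 v)

include hu

theorem hasGrad (t : ℝ) : HasGrad (u t) := hasGrad_of_gradLpNorm_lt_top (hu.1 t)

theorem continuous_weakGrad (k : Fin 6) (j : Fin 2) : Continuous fun t => weakGrad k (u t j) := by
  refine continuous_iff_continuousAt.2 fun s => ?_
  rw [ContinuousAt, tendsto_iff_edist_tendsto_0]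
  refine tendsto_of_tendsto_of_tendsto_of_le_of_le tendsto_const_nhds (hu.2 s)
    (fun _ => zero_le) fun t => ?_
  simp only
  rw [edist_eq_enorm_sub, ← (hu.hasGrad t).weakGrad_sub (hu.hasGrad s), Lp.enorm_def]
  exact ((hu.hasGrad t).hasGrad_sub (hu.hasGrad s)).eLpNorm_le k j (by norm_num)

theorem continuous_apply (j : Fin 2) : Continuous fun t => u t j := by
  refine continuous_iff_continuousAt.2 fun s => ?_
  rw [ContinuousAt, tendsto_iff_edist_tendsto_0]
  have h1 := ENNReal.Tendsto.const_mul (a := (sobolevConst 2 : ℝ≥0∞)) (hu.2 s)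
    (Or.inr ENNReal.coe_ne_top)
  rw [mul_zero] at h1
  refine tendsto_of_tendsto_of_tendsto_of_le_of_le tendsto_const_nhds h1
    (fun _ => zero_le) fun t => ?_
  simp only
  rw [edist_eq_enorm_sub, Lp.enorm_def]
  exact ((hu.hasGrad t).hasGrad_sub (hu.hasGrad s)).sobolev_three j

theorem measurable_gradLpNorm {p : ℝ≥0∞} (hp : 1 ≤ p) :
    Measurable fun t => gradLpNorm p (State.toDist (u t)) := by
  simp_rw [fun t => gradLpNorm_eq (hu.hasGrad t) hp]
  exact Finset.measurable_sum _ fun k _ => Finset.measurable_sum _ fun j _ =>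
    measurable_eLpNorm_of_continuous (hu.continuous_weakGrad k j) p

theorem measurable_lpNorm {p : ℝ≥0∞} (hp : 1 ≤ p) :
    Measurable fun t => lpNorm p (State.toDist (u t)) := by
  simp_rw [fun t => lpNorm_toDist (u t) hp]
  exact Finset.measurable_sum _ fun j _ => measurable_eLpNorm_of_continuous (hu.continuous_apply j) p

theorem gradLpNorm_two_eq (t : ℝ) :
    gradLpNorm 2 (State.toDist (u t)) = ∑ k, ∑ j, ‖weakGrad k (u t j)‖ₑ := by
  rw [gradLpNorm_eq (hu.hasGrad t) (by norm_num)]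
  simp_rw [Lp.enorm_def]

theorem continuous_gradLpNorm_two : Continuous fun t => gradLpNorm 2 (State.toDist (u t)) := by
  simp_rw [hu.gradLpNorm_two_eq]
  exact continuous_finsetSum _ fun k _ => continuous_finsetSum _ fun j _ =>
    (hu.continuous_weakGrad k j).enorm

include hv in
theorem sub : ContinuousHdot1 fun t => u t - v t := by
  have hg : ∀ t, HasGrad (u t - v t) := fun t => (hu.hasGrad t).hasGrad_sub (hv.hasGrad t)
  have e : ∀ t k j, weakGrad k ((u t - v t) j) = weakGrad k (u t j) - weakGrad k (v t j) :=
    fun t k j => (hu.hasGrad t).weakGrad_sub (hv.hasGrad t) k j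
  refine ⟨fun t => ?_, fun s => ?_⟩
  · rw [gradLpNorm_eq (hg t) (by norm_num)]
    exact ENNReal.sum_lt_top.2 fun k _ => ENNReal.sum_lt_top.2 fun j _ => (Lp.memLp _).2
  · have h1 : ∀ t, gradLpNorm 2 (State.toDist (u t - v t - (u s - v s))) =
        ∑ k, ∑ j, ‖(weakGrad k (u t j) - weakGrad k (v t j)) -
          (weakGrad k (u s j) - weakGrad k (v s j))‖ₑ := fun t => by
      rw [gradLpNorm_eq ((hg t).hasGrad_sub (hg s)) (by norm_num)]
      refine Finset.sum_congr rfl fun k _ => Finset.sum_congr rfl fun j _ => ?_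
      rw [← e, ← e, ← (hg t).weakGrad_sub (hg s), Lp.enorm_def]
    simp_rw [h1]
    have h2 : Continuous fun t => ∑ k, ∑ j, ‖(weakGrad k (u t j) - weakGrad k (v t j)) -
          (weakGrad k (u s j) - weakGrad k (v s j))‖ₑ :=
      continuous_finsetSum _ fun k _ => continuous_finsetSum _ fun j _ =>
        (((hu.continuous_weakGrad k j).sub (hv.continuous_weakGrad k j)).sub
          continuous_const).enorm
    have h3 := h2.tendsto s
    simpa using h3

end ContinuousHdot1

end QuadNLS
end

noncomputable section
namespace QuadNLS

/-! ### The Duhamel formula from arbitrary initial times -/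

/-- The Duhamel formula for arbitrary initial and final times. -/
def DuhamelEq (c : ℝ) (ℓ : ℝ → 𝓢(R6, ℂ) →ₗ[ℂ] ℂ) (D : ℝ → Lp ℂ 2 (volume : Measure R6)) : Prop :=
  ∀ (a t : ℝ) (ψ : 𝓢(R6, ℂ)), pair ψ (D t) =
    pair (sch c (t - a) ψ) (D a) + ∫ s in a..t, ℓ s (sch c (t - s) ψ)

theorem DuhamelEq.isDuhamel {c : ℝ} {ℓ : ℝ → 𝓢(R6, ℂ) →ₗ[ℂ] ℂ}
    {D : ℝ → Lp ℂ 2 (volume : Measure R6)} (h : DuhamelEq c ℓ D) (α β : ℝ) :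
    IsDuhamel c α β ℓ D := fun t ht ψ => by
  rw [h α t ψ, intervalIntegral.integral_of_le ht.1, integral_Ico_eq_integral_Ioc]

/-- Reversal of time changes the sign of c and of the forcing; backward estimates become forward
ones. -/
theorem DuhamelEq.reflect {c : ℝ} {ℓ : ℝ → 𝓢(R6, ℂ) →ₗ[ℂ] ℂ}
    {D : ℝ → Lp ℂ 2 (volume : Measure R6)} (h : DuhamelEq c ℓ D) :
    DuhamelEq (-c) (fun s => -ℓ (-s)) (fun t => D (-t)) := fun a t ψ => by
  rw [h (-a) (-t) ψ, sch_neg_coeff, show -(t - a) = -t - -a by ring]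
  congr 1
  have h1 := intervalIntegral.integral_comp_neg (a := a) (b := t)
    (fun s => ℓ s (sch c (-t - s) ψ))
  rw [intervalIntegral.integral_symm, ← h1, ← intervalIntegral.integral_neg]
  refine intervalIntegral.integral_congr fun s _ => ?_
  simp only [LinearMap.neg_apply]
  rw [sch_neg_coeff, show -(t - s) = -t - -s by ring]

theorem InterpBounded.reflect {θ : ℝ} {n₁ n₂ : ℝ → ℝ≥0} {ℓ : ℝ → 𝓢(R6, ℂ) →ₗ[ℂ] ℂ}
    (h : InterpBounded θ n₁ n₂ ℓ) :
    InterpBounded θ (fun s => n₁ (-s)) (fun s => n₂ (-s)) (fun s => -ℓ (-s)) where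
  nonneg := h.nonneg
  le_one := h.le_one
  measurable₁ := h.measurable₁.comp measurable_neg
  measurable₂ := h.measurable₂.comp measurable_neg
  measurable ψ := ((h.measurable ψ).comp measurable_neg).neg
  bound s ψ := by
    rw [LinearMap.neg_apply, norm_neg]
    exact h.bound (-s) ψ

theorem setLIntegral_comp_neg (f : ℝ → ℝ≥0∞) (α β : ℝ) :
    ∫⁻ s in Set.Icc (-β) (-α), f (-s) = ∫⁻ s in Set.Icc α β, f s := by
  have h : (Neg.neg : ℝ → ℝ) ⁻¹' Set.Icc α β = Set.Icc (-β) (-α) := by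
    ext x; simp only [Set.mem_preimage, Set.mem_Icc]; constructor <;> rintro ⟨h1, h2⟩ <;>
      constructor <;> linarith
  rw [← h]
  exact (Measure.measurePreserving_neg volume).setLIntegral_comp_preimage_emb
    (MeasurableEquiv.neg ℝ).measurableEmbedding _ _

theorem interpSize_reflect (θ : ℝ) (n₁ n₂ : ℝ → ℝ≥0) (α β : ℝ) :
    interpSize θ (fun s => n₁ (-s)) (fun s => n₂ (-s)) (Set.Icc (-β) (-α)) =
      interpSize θ n₁ n₂ (Set.Icc α β) := by
  rw [interpSize, interpSize, setLIntegral_comp_neg (fun s => (n₁ s : ℝ≥0∞) ^ 2),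
    setLIntegral_comp_neg (fun s => (n₂ s : ℝ≥0∞) ^ (1 - θ / 2)⁻¹)]

/-- The Strichartz estimates, forward and backward in time. -/
theorem DuhamelEq.strichartz {c : ℝ} (hc : c ≠ 0) {θ : ℝ} {n₁ n₂ : ℝ → ℝ≥0}
    {ℓ : ℝ → 𝓢(R6, ℂ) →ₗ[ℂ] ℂ} (h : InterpBounded θ n₁ n₂ ℓ)
    {D : ℝ → Lp ℂ 2 (volume : Measure R6)} (hD : DuhamelEq c ℓ D)
    (hDc : ∀ ψ : 𝓢(R6, ℂ), Continuous fun t => pair ψ (D t)) (a b : ℝ) :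
    (∀ t ∈ Set.uIcc a b, ‖D t‖ₑ ≤
      ENNReal.ofReal (linConst c) * (‖D a‖ₑ + interpSize θ n₁ n₂ (Set.uIcc a b))) ∧
    ∫⁻ t in Set.uIcc a b, eLpNorm (D t) 3 volume ^ 2 ≤
      (ENNReal.ofReal (linConst c) * (‖D a‖ₑ + interpSize θ n₁ n₂ (Set.uIcc a b))) ^ 2 := by
  rcases le_total a b with hab | hab
  · rw [Set.uIcc_of_le hab]
    exact ⟨fun t ht => (hD.isDuhamel a b).enorm_le hc h ht,
      (hD.isDuhamel a b).lintegral_eLpNorm_three_sq_le hc h hDc⟩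
  · rw [Set.uIcc_of_ge hab]
    have hc' : -c ≠ 0 := neg_ne_zero.2 hc
    have h1 := hD.reflect.isDuhamel (-a) (-b)
    have h2 := interpSize_reflect θ n₁ n₂ b a
    refine ⟨fun t ht => ?_, ?_⟩
    · have h3 := h1.enorm_le hc' h.reflect (t := -t) ⟨by linarith [ht.2], by linarith [ht.1]⟩
      rwa [h2, linConst_neg, neg_neg, neg_neg] at h3
    · have h3 := h1.lintegral_eLpNorm_three_sq_le hc' h.reflect
        (fun ψ => (hDc ψ).comp continuous_neg)
      rw [h2, linConst_neg, neg_neg, setLIntegral_comp_neg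
        (fun t => eLpNorm (D t) 3 volume ^ 2)] at h3
      exact h3

/-! ### The nonlinearity -/

/-- The pairing of `L^{3/2}` and `L³`. -/
def dualPair : Lp ℂ (3 / 2) (volume : Measure R6) →L[ℂ] Lp ℂ 3 (volume : Measure R6) →L[ℂ] ℂ :=
  (ContinuousLinearMap.mul ℂ ℂ).lpPairing volume (3 / 2) 3

/-- The nonlinearity, tested with a Schwartz function. -/
def nonlinTest (w : State) (j : Fin 2) : 𝓢(R6, ℂ) →ₗ[ℂ] ℂ :=
  (dualPair (nonlinLp w j)).toLinearMap ∘ₗ (SchwartzMap.toLpCLM ℂ ℂ 3 volume).toLinearMap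

theorem nonlinTest_eq (w : State) (j : Fin 2) (φ : 𝓢(R6, ℂ)) :
    nonlinTest w j φ = dualPair (nonlinLp w j) (φ.toLp 3 volume) := rfl

theorem nonlinTest_apply (w : State) (j : Fin 2) (φ : 𝓢(R6, ℂ)) :
    nonlinTest w j φ = ∫ x, nonlinLp w j x * φ x := by
  rw [nonlinTest_eq, dualPair, ContinuousLinearMap.lpPairing_eq_integral]
  refine integral_congr_ae ((φ.coeFn_toLp 3 volume).mono fun x hx => ?_)
  simp only [hx, ContinuousLinearMap.mul_apply']

theorem nonlinLp_coeFn (w : State) (j : Fin 2) :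
    nonlinLp w j =ᵐ[volume] fun x => nonlin (fun i => w i x) j := (memLp_nonlin w j).coeFn_toLp

theorem nonlinTest_apply' (w : State) (j : Fin 2) (φ : 𝓢(R6, ℂ)) :
    nonlinTest w j φ = ∫ x, nonlin (fun i => w i x) j * φ x := by
  rw [nonlinTest_apply]
  exact integral_congr_ae ((nonlinLp_coeFn w j).mono fun x hx => by simp only [hx])

/-- Each component is the bounded bilinear Hölder product from L³ × L³ to L^{3/2}, composed in one
case with conjugation. -/
theorem continuous_nonlinLp {u : ℝ → State} (hu : ∀ j, Continuous fun t => u t j) (j : Fin 2) :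
    Continuous fun t => nonlinLp (u t) j := by
  let B := (ContinuousLinearMap.mul ℂ ℂ).holderL (volume : Measure R6) 3 3 (3 / 2)
  fin_cases j
  · have e : (fun t => nonlinLp (u t) 0) = fun t => B (u t 1)
        (((Complex.conjCLE : ℂ →L[ℝ] ℂ).compLpL 3 (volume : Measure R6)) (u t 0)) := by
      ext1 t
      refine Lp.ext ?_
      filter_upwards [nonlinLp_coeFn (u t) 0, (ContinuousLinearMap.mul ℂ ℂ).coeFn_holder
        (r := 3 / 2) (u t 1)
        (((Complex.conjCLE : ℂ →L[ℝ] ℂ).compLpL 3 (volume : Measure R6)) (u t 0)),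
        (Complex.conjCLE : ℂ →L[ℝ] ℂ).coeFn_compLpL (u t 0)] with x h1 h2 h3
      rw [h1]
      refine Eq.trans ?_ h2.symm
      rw [h3]
      rfl
    change Continuous fun t => nonlinLp (u t) 0
    rw [e]
    exact (B.continuous.comp (hu 1)).clm_apply
      ((ContinuousLinearMap.continuous _).comp (hu 0))
  · have e : (fun t => nonlinLp (u t) 1) = fun t => B (u t 0) (u t 0) := by
      ext1 t
      refine Lp.ext ?_
      filter_upwards [nonlinLp_coeFn (u t) 1, (ContinuousLinearMap.mul ℂ ℂ).coeFn_holder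
        (r := 3 / 2) (u t 0) (u t 0)] with x h1 h2
      rw [h1]
      refine Eq.trans ?_ h2.symm
      simp [nonlin, sq]
    change Continuous fun t => nonlinLp (u t) 1
    rw [e]
    exact (B.continuous.comp (hu 0)).clm_apply (hu 0)

theorem continuous_nonlinTest {u : ℝ → State} (hu : ∀ j, Continuous fun t => u t j) (j : Fin 2)
    {ψ : ℝ → 𝓢(R6, ℂ)} (hψ : Continuous fun t => (ψ t).toLp 3 (volume : Measure R6)) :
    Continuous fun t => nonlinTest (u t) j (ψ t) := by
  simp_rw [nonlinTest_eq]
  exact (dualPair.continuous.comp (continuous_nonlinLp hu j)).clm_apply hψ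

theorem continuous_sch_sub_toLp_three (c t : ℝ) (φ : 𝓢(R6, ℂ)) :
    Continuous fun s => (sch c (t - s) φ).toLp 3 (volume : Measure R6) :=
  (continuous_sch_toLp_three c φ).comp (continuous_const.sub continuous_id)

/-- The evolution is moved onto the test function, and the group law allows the formula from time 0
to be restarted at a. -/
theorem IsSolution.duhamel {κ : ℝ} {u : ℝ → State} (hu : IsSolution κ u) (a t : ℝ) (j : Fin 2)
    (φ : 𝓢(R6, ℂ)) : pair φ (u t j) = pair (sch (coeff κ j) (t - a) φ) (u a j) +
      ∫ s in a..t, Complex.I * nonlinTest (u s) j (sch (coeff κ j) (t - s) φ) := by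
  set c := coeff κ j
  have key : ∀ t φ, pair φ (u t j) = pair (sch c t φ) (u 0 j) +
      Complex.I * ∫ s in (0 : ℝ)..t, nonlinTest (u s) j (sch c (t - s) φ) := fun t φ => by
    have := hu.2.2 t j φ
    rw [toDist_apply, flow_apply, toDist_apply] at this
    rw [this]
    congr 2
    refine intervalIntegral.integral_congr fun s _ => ?_
    simp only [flow_apply, nonlinTest_apply]
    rw [Lp.toTemperedDistribution_apply]
    simp_rw [smul_eq_mul, mul_comm]
    rfl
  have hc : Continuous fun s => nonlinTest (u s) j (sch c (t - s) φ) :=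
    continuous_nonlinTest hu.1.continuous_apply j (continuous_sch_sub_toLp_three c t φ)
  rw [key t φ, key a, sch_sch, show a + (t - a) = t by ring]
  simp_rw [sch_sch, show ∀ s, a - s + (t - a) = t - s by intro s; ring]
  rw [intervalIntegral.integral_const_mul, add_assoc, ← mul_add,
    intervalIntegral.integral_add_adjacent_intervals (hc.intervalIntegrable _ _)
      (hc.intervalIntegrable _ _)]

end QuadNLS
end

noncomputable section
namespace QuadNLS

/-! ### Strichartz estimates for almost everywhere finite data -/

theorem norm_le_of_enorm_le {z : ℂ} {ψ : 𝓢(R6, ℂ)} {N₁ N₂ : ℝ≥0∞} (h1 : N₁ ≠ ⊤) (h2 : N₂ ≠ ⊤)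
    {θ : ℝ} (h0 : 0 ≤ θ) (hθ : θ ≤ 1)
    (h : ‖z‖ₑ ≤ N₁ * eLpNorm ψ 3 volume +
      N₂ * (eLpNorm ψ 2 volume ^ (1 - θ) * eLpNorm ψ 3 volume ^ θ)) :
    ‖z‖ ≤ N₁.toNNReal * ‖ψ.toLp 3 volume‖ +
      N₂.toNNReal * (‖ψ.toLp 2 volume‖ ^ (1 - θ) * ‖ψ.toLp 3 volume‖ ^ θ) := by
  have e : ∀ p [Fact (1 ≤ p)], eLpNorm ψ p volume = ENNReal.ofReal ‖ψ.toLp p volume‖ :=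
    fun p _ => by
      rw [← enorm_toLp]
      exact (ofReal_norm (E := Lp ℂ p volume) _).symm
  rw [e 3, e 2, ENNReal.ofReal_rpow_of_nonneg (norm_nonneg _) (by linarith),
    ENNReal.ofReal_rpow_of_nonneg (norm_nonneg _) h0, ← ENNReal.coe_toNNReal h1,
    ← ENNReal.coe_toNNReal h2, ← ENNReal.ofReal_coe_nnreal, ← ENNReal.ofReal_coe_nnreal,
    ← ENNReal.ofReal_mul (by positivity), ← ENNReal.ofReal_mul (by positivity),
    ← ENNReal.ofReal_mul (by positivity), ← ENNReal.ofReal_add (by positivity) (by positivity),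
    ← ofReal_norm] at h
  exact (ENNReal.ofReal_le_ofReal_iff (by positivity)).1 h

/-- At the null set of times where a bound is infinite the functional may be replaced by zero
without affecting the Duhamel integral. -/
theorem DuhamelEq.strichartz_of_enorm {c : ℝ} (hc : c ≠ 0) {θ : ℝ} (h0 : 0 ≤ θ) (hθ : θ ≤ 1)
    {N₁ N₂ : ℝ → ℝ≥0∞} (hN₁ : Measurable N₁) (hN₂ : Measurable N₂)
    {ℓ : ℝ → 𝓢(R6, ℂ) →ₗ[ℂ] ℂ} (hℓ : ∀ ψ, Measurable fun s => ℓ s ψ)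
    (hb : ∀ s ψ, ‖ℓ s ψ‖ₑ ≤ N₁ s * eLpNorm ψ 3 volume +
      N₂ s * (eLpNorm ψ 2 volume ^ (1 - θ) * eLpNorm ψ 3 volume ^ θ))
    (hfin : ∀ᵐ s, N₁ s < ⊤ ∧ N₂ s < ⊤) {D : ℝ → Lp ℂ 2 (volume : Measure R6)}
    (hD : DuhamelEq c ℓ D) (hDc : ∀ ψ : 𝓢(R6, ℂ), Continuous fun t => pair ψ (D t)) (a b : ℝ) :
    (∀ t ∈ Set.uIcc a b, ‖D t‖ₑ ≤ ENNReal.ofReal (linConst c) * (‖D a‖ₑ +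
      ((∫⁻ s in Set.uIcc a b, N₁ s ^ 2) ^ (1 / 2 : ℝ) +
        (∫⁻ s in Set.uIcc a b, N₂ s ^ (1 - θ / 2)⁻¹) ^ (1 - θ / 2)))) ∧
    ∫⁻ t in Set.uIcc a b, eLpNorm (D t) 3 volume ^ 2 ≤
      (ENNReal.ofReal (linConst c) * (‖D a‖ₑ +
      ((∫⁻ s in Set.uIcc a b, N₁ s ^ 2) ^ (1 / 2 : ℝ) +
        (∫⁻ s in Set.uIcc a b, N₂ s ^ (1 - θ / 2)⁻¹) ^ (1 - θ / 2)))) ^ 2 := by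
  classical
  set G : Set ℝ := {s | N₁ s < ⊤ ∧ N₂ s < ⊤}
  have hG : MeasurableSet G := (measurableSet_lt hN₁ measurable_const).inter
    (measurableSet_lt hN₂ measurable_const)
  set ℓ' : ℝ → 𝓢(R6, ℂ) →ₗ[ℂ] ℂ := fun s => if s ∈ G then ℓ s else 0
  have hB : InterpBounded θ (fun s => (N₁ s).toNNReal) (fun s => (N₂ s).toNNReal) ℓ' :=
    { nonneg := h0
      le_one := hθ
      measurable₁ := hN₁.ennreal_toNNReal
      measurable₂ := hN₂.ennreal_toNNReal
      measurable := fun ψ => by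
        have : (fun s => ℓ' s ψ) = fun s => if s ∈ G then ℓ s ψ else 0 := by
          ext s; simp only [ℓ']; split_ifs <;> rfl
        rw [this]
        exact Measurable.ite hG (hℓ ψ) measurable_const
      bound := fun s ψ => by
        by_cases hs : s ∈ G
        · simp only [ℓ', if_pos hs]
          exact norm_le_of_enorm_le hs.1.ne hs.2.ne h0 hθ (hb s ψ)
        · simp only [ℓ', if_neg hs, LinearMap.zero_apply, norm_zero]
          positivity }
  have hD' : DuhamelEq c ℓ' D := fun a t ψ => by
    rw [hD a t ψ]
    congr 1
    refine intervalIntegral.integral_congr_ae (hfin.mono fun s hs _ => ?_)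
    simp only [ℓ', if_pos (show s ∈ G from hs)]
  have hS : interpSize θ (fun s => (N₁ s).toNNReal) (fun s => (N₂ s).toNNReal) (Set.uIcc a b) ≤
      (∫⁻ s in Set.uIcc a b, N₁ s ^ 2) ^ (1 / 2 : ℝ) +
        (∫⁻ s in Set.uIcc a b, N₂ s ^ (1 - θ / 2)⁻¹) ^ (1 - θ / 2) := by
    have h3 : 0 ≤ 1 - θ / 2 := by linarith
    rw [interpSize]
    gcongr <;> exact ENNReal.coe_toNNReal_le_self
  obtain ⟨h1, h2⟩ := hD'.strichartz hc hB hDc a b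
  refine ⟨fun t ht => (h1 t ht).trans ?_, h2.trans ?_⟩ <;> gcongr

/-! ### The gradient of a solution is in the endpoint space -/

/-- The exponent 12/5 is halfway between 2 and 3 on the scale of reciprocals, and 1/4 + 5/12 = 2/3
makes it the partner of L⁴ inside L^{3/2}. -/
theorem eLpNorm_two_three_interp {f : R6 → ℂ} (hf : AEStronglyMeasurable f volume) :
    eLpNorm f (ENNReal.ofReal (12 / 5)) volume ≤
      eLpNorm f 2 volume ^ (1 / 2 : ℝ) * eLpNorm f 3 volume ^ (1 / 2 : ℝ) := by
  have := eLpNorm_le_interp hf (p := 2) (q := 3) (r := 12 / 5) (θ := 1 / 2) (by norm_num)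
    (by norm_num) (by norm_num) (by norm_num) (by norm_num) (by norm_num)
  norm_num at this ⊢
  exact this

instance holderTriple_four : ENNReal.HolderTriple 4 (ENNReal.ofReal (12 / 5)) (3 / 2) := ⟨by
  have h4 : (4 : ℝ≥0∞)⁻¹ = ENNReal.ofReal (1 / 4) := by
    rw [ENNReal.ofReal_div_of_pos (by norm_num)]; simp
  have h3 : (3 / 2 : ℝ≥0∞)⁻¹ = ENNReal.ofReal (2 / 3) := by
    rw [ENNReal.inv_div (by norm_num) (by norm_num), ENNReal.ofReal_div_of_pos (by norm_num)]; simp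
  rw [h4, h3, ← ENNReal.ofReal_inv_of_pos (by norm_num),
    ← ENNReal.ofReal_add (by norm_num) (by norm_num)]
  norm_num⟩

theorem eLpNorm_mul_four_le {f g : R6 → ℂ} (hf : AEStronglyMeasurable f volume)
    (hg : AEStronglyMeasurable g volume) {A P Q : ℝ≥0∞} (hA : eLpNorm f 4 volume ≤ A)
    (hP : eLpNorm g 2 volume ≤ P) (hQ : eLpNorm g 3 volume ≤ Q) :
    eLpNorm (fun x => f x * g x) (3 / 2) volume ≤ A * (P ^ (1 / 2 : ℝ) * Q ^ (1 / 2 : ℝ)) := by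
  refine (eLpNorm_smul_le_mul_eLpNorm (p := 4) (q := ENNReal.ofReal (12 / 5)) hg hf).trans ?_
  gcongr
  refine (eLpNorm_two_three_interp hg).trans ?_
  gcongr

theorem eLpNorm_conj (f : R6 → ℂ) (p : ℝ≥0∞) :
    eLpNorm (fun x => (starRingEnd ℂ) (f x)) p volume = eLpNorm f p volume :=
  eLpNorm_congr_norm_ae (Eventually.of_forall fun x => by simp)

theorem aesm_conj {f : R6 → ℂ} (hf : AEStronglyMeasurable f volume) :
    AEStronglyMeasurable (fun x => (starRingEnd ℂ) (f x)) volume :=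
  Complex.continuous_conj.comp_aestronglyMeasurable hf

theorem aesm_comp_add {f : R6 → ℂ} (hf : AEStronglyMeasurable f volume) (a : R6) :
    AEStronglyMeasurable (fun x => f (x + a)) volume :=
  hf.comp_measurePreserving (measurePreserving_add_right volume a)

theorem eLpNorm_comp_add {f : R6 → ℂ} (hf : AEStronglyMeasurable f volume) (a : R6) (p : ℝ≥0∞) :
    eLpNorm (fun x => f (x + a)) p volume = eLpNorm f p volume :=
  eLpNorm_comp_measurePreserving hf (measurePreserving_add_right volume a)

theorem eLpNorm_diffq_mul_le {f g : R6 → ℂ} (hf : AEStronglyMeasurable f volume)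
    (hg : AEStronglyMeasurable g volume) {A P Q : ℝ≥0∞} {a : R6} (hA : eLpNorm f 4 volume ≤ A)
    (hA' : eLpNorm g 4 volume ≤ A)
    (hP : eLpNorm (diffq a f) 2 volume ≤ P) (hQ : eLpNorm (diffq a f) 3 volume ≤ Q)
    (hP' : eLpNorm (diffq a g) 2 volume ≤ P) (hQ' : eLpNorm (diffq a g) 3 volume ≤ Q) :
    eLpNorm (diffq a fun x => f x * g x) (3 / 2) volume ≤
      2 * (A * (P ^ (1 / 2 : ℝ) * Q ^ (1 / 2 : ℝ))) := by
  have e : (diffq a fun x => f x * g x) = (fun x => g (x + a) * diffq a f x) +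
      fun x => f x * diffq a g x := by
    ext x
    rw [diffq_mul, Pi.add_apply, mul_comm (diffq a f x)]
  have m1 : AEStronglyMeasurable (diffq a f) volume := (aesm_comp_add hf a).sub hf
  have m2 : AEStronglyMeasurable (diffq a g) volume := (aesm_comp_add hg a).sub hg
  rw [e, two_mul]
  refine (eLpNorm_add_le ((aesm_comp_add hg a).mul m1) (hf.mul m2) one_le_three_halves).trans
    (add_le_add ?_ ?_)
  · exact eLpNorm_mul_four_le (aesm_comp_add hg a) m1 ((eLpNorm_comp_add hg a 4).trans_le hA') hP hQ
  · exact eLpNorm_mul_four_le hf m2 hA hP' hQ'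

/-- The `L^p` norm of the difference of a translate of a state and the state. -/
def diffNorm (a : R6) (p : ℝ≥0∞) (w : State) : ℝ≥0∞ := ∑ j, eLpNorm (diffq a (w j)) p volume

theorem le_sum_two (f : Fin 2 → ℝ≥0∞) (j : Fin 2) : f j ≤ ∑ i, f i :=
  Finset.single_le_sum (f := f) (fun _ _ => zero_le) (Finset.mem_univ j)

theorem eLpNorm_diffq_nonlin_le (w : State) (a : R6) (j : Fin 2) :
    eLpNorm (diffq a fun x => nonlin (fun i => w i x) j) (3 / 2) volume ≤
      2 * (lpNorm 4 (State.toDist w) *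
        (diffNorm a 2 w ^ (1 / 2 : ℝ) * diffNorm a 3 w ^ (1 / 2 : ℝ))) := by
  have h4 : ∀ j, eLpNorm (w j) 4 volume ≤ lpNorm 4 (State.toDist w) := fun j => by
    rw [lpNorm_toDist w (by norm_num)]
    exact le_sum_two (fun j => eLpNorm (w j) 4 volume) j
  have hd : ∀ p j, eLpNorm (diffq a (w j)) p volume ≤ diffNorm a p w := fun p j =>
    le_sum_two (fun j => eLpNorm (diffq a (w j)) p volume) j
  have hm : ∀ j, AEStronglyMeasurable (w j) volume := fun j => Lp.aestronglyMeasurable _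
  have hdc : ∀ p j, eLpNorm (diffq a fun x => (starRingEnd ℂ) (w j x)) p volume ≤
      diffNorm a p w := fun p j => by
    refine le_trans (le_of_eq ?_) (hd p j)
    rw [← eLpNorm_conj]
    congr 1; ext x; simp [diffq]
  fin_cases j
  · exact eLpNorm_diffq_mul_le (hm 1) (aesm_conj (hm 0)) (h4 1) ((eLpNorm_conj _ _).trans_le (h4 0))
      (hd 2 1) (hd 3 1) (hdc 2 0) (hdc 3 0)
  · have e : (fun x => nonlin (fun i => w i x) 1) = fun x => w 0 x * w 0 x := by
      ext x; simp [nonlin, sq]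
    change eLpNorm (diffq a fun x => nonlin (fun i => w i x) 1) (3 / 2) volume ≤ _
    rw [e]
    exact eLpNorm_diffq_mul_le (hm 0) (hm 0) (h4 0) (h4 0) (hd 2 0) (hd 3 0) (hd 2 0) (hd 3 0)

/-- The difference of a translate of `F` and `F`, in `L³`. -/
def diffLp (a : R6) (F : Lp ℂ 3 (volume : Measure R6)) : Lp ℂ 3 (volume : Measure R6) :=
  Lp.compMeasurePreserving (fun x => x + a) (measurePreserving_add_right volume a) F - F

theorem diffLp_coeFn (a : R6) (F : Lp ℂ 3 (volume : Measure R6)) :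
    diffLp a F =ᵐ[volume] diffq a F := by
  filter_upwards [Lp.coeFn_sub (Lp.compMeasurePreserving (fun x => x + a)
    (measurePreserving_add_right volume a) F) F, Lp.coeFn_compMeasurePreserving F
    (measurePreserving_add_right volume a)] with x h1 h2
  rw [diffLp, h1, Pi.sub_apply, h2]
  rfl

theorem continuous_diffLp (a : R6) : Continuous (diffLp a) :=
  (Lp.isometry_compMeasurePreserving _).continuous.sub continuous_id

theorem ContinuousHdot1.measurable_diffNorm {u : ℝ → State} (hu : ContinuousHdot1 u) (a : R6)
    (p : ℝ≥0∞) : Measurable fun t => diffNorm a p (u t) := by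
  refine Finset.measurable_sum _ fun j _ => ?_
  simp_rw [← fun t => eLpNorm_congr_ae (p := p) (diffLp_coeFn a (u t j))]
  exact measurable_eLpNorm_of_continuous ((continuous_diffLp a).comp (hu.continuous_apply j)) p

theorem ContinuousHdot1.continuous_diffNorm_three {u : ℝ → State} (hu : ContinuousHdot1 u)
    (a : R6) : Continuous fun t => diffNorm a 3 (u t) := by
  refine continuous_finsetSum _ fun j _ => ?_
  simp_rw [← fun t => eLpNorm_congr_ae (p := 3) (diffLp_coeFn a (u t j)), ← Lp.enorm_def]
  exact ((continuous_diffLp a).comp (hu.continuous_apply j)).enorm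

theorem diffNorm_three_lt_top (a : R6) (w : State) : diffNorm a 3 w < ⊤ :=
  ENNReal.sum_lt_top.2 fun j _ => (MemLp.diffq (Lp.memLp (w j)) a).2

theorem HasGrad.diffNorm_two_le {w : State} (hw : HasGrad w) (k : Fin 6) {h : ℝ} (hh : 0 ≤ h) :
    diffNorm (h • unitVec k) 2 w ≤ ENNReal.ofReal h * gradLpNorm 2 (State.toDist w) := by
  rw [diffNorm, gradLpNorm_eq hw (by norm_num)]
  refine (Finset.sum_le_sum fun j _ => (hw k j).eLpNorm_diffq_two_le (Lp.memLp _) (Lp.memLp _)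
    hh).trans ?_
  rw [← Finset.mul_sum]
  gcongr
  exact Finset.single_le_sum (f := fun k => ∑ j, eLpNorm (weakGrad k (w j)) 2 volume)
    (fun _ _ => zero_le) (Finset.mem_univ k)

theorem exists_bound_of_continuous {f : ℝ → ℝ≥0∞} (hf : Continuous f) (hfin : ∀ t, f t ≠ ⊤)
    {J : Set ℝ} (hJ : IsCompact J) : ∃ K : ℝ≥0, ∀ t ∈ J, f t ≤ K := by
  rcases J.eq_empty_or_nonempty with rfl | hne
  · exact ⟨0, by simp⟩
  · obtain ⟨t, -, ht⟩ := hJ.exists_isMaxOn hne hf.continuousOn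
    refine ⟨(f t).toNNReal, fun s hs => ?_⟩
    rw [ENNReal.coe_toNNReal (hfin t)]
    exact ht hs

theorem ENNReal_sqrt_mul_le (x y : ℝ≥0∞) : 2 * (x * y) ^ (1 / 2 : ℝ) ≤ x + y := by
  by_cases hx : x = ⊤
  · simp [hx]
  by_cases hy : y = ⊤
  · simp [hy]
  lift x to ℝ≥0 using hx
  lift y to ℝ≥0 using hy
  rw [← ENNReal.coe_mul, ← ENNReal.coe_rpow_of_nonneg _ (by norm_num)]
  rw [← NNReal.sqrt_eq_rpow]
  norm_cast
  rw [← NNReal.coe_le_coe]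
  push_cast
  rw [Real.sqrt_mul (NNReal.coe_nonneg x) (y : ℝ)]
  have h1 := Real.sq_sqrt (NNReal.coe_nonneg x)
  have h2 := Real.sq_sqrt (NNReal.coe_nonneg y)
  nlinarith [sq_nonneg (Real.sqrt x - Real.sqrt y)]

/-- By 2√(BY) ≤ B + Y the unknown is absorbed whatever the size of B; the cancellation needs Y to be
finite beforehand. -/
theorem le_of_le_add_sqrt_mul {Y A B : ℝ≥0∞} (hY : Y ≠ ⊤) (h : Y ≤ A + (B * Y) ^ (1 / 2 : ℝ)) :
    Y ≤ 2 * A + B := by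
  have h1 : 2 * Y ≤ 2 * A + B + Y := by
    calc 2 * Y ≤ 2 * (A + (B * Y) ^ (1 / 2 : ℝ)) := by gcongr
      _ ≤ 2 * A + (B + Y) := by rw [mul_add]; gcongr; exact ENNReal_sqrt_mul_le B Y
      _ = _ := by ring
  rw [two_mul] at h1
  exact (ENNReal.add_le_add_iff_right hY).1 h1

theorem lintegral_sum_sq_le {ι : Type*} (s : Finset ι) (f : ι → ℝ → ℝ≥0∞)
    (hf : ∀ i ∈ s, Measurable (f i)) (J : Set ℝ) {B : ℝ≥0∞}
    (h : ∀ i ∈ s, ∫⁻ t in J, f i t ^ 2 ≤ B ^ 2) :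
    ∫⁻ t in J, (∑ i ∈ s, f i t) ^ 2 ≤ (s.card * B) ^ 2 := by
  have h1 : ∀ t, (∑ i ∈ s, f i t) ^ 2 ≤ s.card * ∑ i ∈ s, f i t ^ 2 := fun t => by
    have := ENNReal.inner_le_Lp_mul_Lq s (fun i => f i t) (fun _ => 1) (p := 2) (q := 2)
      (by constructor <;> norm_num)
    simp only [mul_one, ENNReal.one_rpow, Finset.sum_const, nsmul_eq_mul] at this
    calc (∑ i ∈ s, f i t) ^ 2 ≤ ((∑ i ∈ s, f i t ^ (2 : ℝ)) ^ (1 / 2 : ℝ) *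
          (s.card : ℝ≥0∞) ^ (1 / 2 : ℝ)) ^ 2 := pow_le_pow_left' this 2
      _ = _ := by
        rw [mul_pow, ← ENNReal.rpow_mul_natCast, ← ENNReal.rpow_mul_natCast]
        norm_num
        ring
  calc _ ≤ ∫⁻ t in J, s.card * ∑ i ∈ s, f i t ^ 2 := lintegral_mono h1
    _ = s.card * ∑ i ∈ s, ∫⁻ t in J, f i t ^ 2 := by
        rw [lintegral_const_mul _ (Finset.measurable_sum _ fun i hi => (hf i hi).pow_const 2),
          lintegral_finsetSum _ fun i hi => (hf i hi).pow_const 2]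
    _ ≤ s.card * ∑ i ∈ s, B ^ 2 := by gcongr with i hi; exact h i hi
    _ = _ := by rw [Finset.sum_const, nsmul_eq_mul]; ring

/-- A common bound of the constants of the linear estimates for the two components. -/
def pairConst (κ : ℝ) : ℝ≥0∞ := ENNReal.ofReal (linConst 1) + ENNReal.ofReal (linConst κ)

theorem linConst_le_pairConst (κ : ℝ) (j : Fin 2) :
    ENNReal.ofReal (linConst (coeff κ j)) ≤ pairConst κ := by
  fin_cases j
  · exact le_self_add
  · exact le_add_self

theorem pairConst_ne_top (κ : ℝ) : pairConst κ ≠ ⊤ :=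
  ENNReal.add_ne_top.2 ⟨ENNReal.ofReal_ne_top, ENNReal.ofReal_ne_top⟩

theorem coeff_ne_zero {κ : ℝ} (hκ : 0 < κ) (j : Fin 2) : coeff κ j ≠ 0 := by
  fin_cases j
  · exact one_ne_zero
  · exact hκ.ne'

end QuadNLS
end

noncomputable section
namespace QuadNLS

open scoped FourierTransform in
theorem fourier_shift (a : R6) (φ : 𝓢(R6, ℂ)) (ξ : R6) :
    𝓕 (shift a φ) ξ = Real.fourierChar (inner ℝ (-a) ξ) • 𝓕 φ ξ := by
  have := congrFun (VectorFourier.fourierIntegral_comp_add_right Real.fourierChar volume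
    (innerₗ R6) φ (-a)) ξ
  exact this

open scoped FourierTransform in
-- On the Fourier side a translation is multiplication by a character, which commutes with the
-- symbol.
theorem shift_sch (c t : ℝ) (a : R6) (φ : 𝓢(R6, ℂ)) :
    shift a (sch c t φ) = sch c t (shift a φ) := by
  have h : 𝓕 (shift a (sch c t φ)) = 𝓕 (sch c t (shift a φ)) := by
    ext ξ
    rw [fourier_shift, fourier_sch, fourier_sch, fourier_shift, mul_smul_comm]
  have h' : 𝓕⁻ (𝓕 (shift a (sch c t φ))) = 𝓕⁻ (𝓕 (sch c t (shift a φ))) := by rw [h]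
  rwa [FourierTransform.fourierInv_fourier_eq, FourierTransform.fourierInv_fourier_eq] at h'

theorem lpNorm_four_lt_top_ae {κ : ℝ} {u : ℝ → State} (hu : IsSolution κ u) :
    ∀ᵐ t, lpNorm 4 (State.toDist (u t)) < ⊤ := by
  have hm := hu.1.measurable_lpNorm (p := 4) (by norm_num)
  have h1 : ∀ n : ℕ, ∀ᵐ t ∂(volume.restrict (Set.Icc (-(n : ℝ)) n)),
      lpNorm 4 (State.toDist (u t)) < ⊤ := fun n => by
    have h2 := hu.2.1 (-n) n
    have h3 := lintegral_rpow_enorm_lt_top_of_eLpNorm_lt_top (by norm_num) (by norm_num) h2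
    have h4 := ae_lt_top (hm.pow_const 4) (μ := volume.restrict (Set.Icc (-(n : ℝ)) n))
      (by simpa using h3.ne)
    exact h4.mono fun t ht => by
      by_contra hcon
      simp only [not_lt, top_le_iff] at hcon
      simp [hcon] at ht
  have h5 : (Set.univ : Set ℝ) = ⋃ n : ℕ, Set.Icc (-(n : ℝ)) n := by
    ext t
    obtain ⟨n, hn⟩ := exists_nat_ge |t|
    simp only [Set.mem_univ, Set.mem_iUnion, true_iff]
    exact ⟨n, abs_le.1 hn⟩
  have h6 := (ae_restrict_iUnion_iff (μ := volume) (fun n : ℕ => Set.Icc (-(n : ℝ)) n)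
    (fun t => lpNorm 4 (State.toDist (u t)) < ⊤)).2 h1
  rwa [← h5, Measure.restrict_univ] at h6

section Difference

variable {κ : ℝ} {u : ℝ → State} (k : Fin 6) (h : ℝ)

/-- The difference of a translate of a component of `u` and the component, in `L²`. -/
def diffTwo (w : State) (j : Fin 2) : Lp ℂ 2 (volume : Measure R6) :=
  open Classical in
  if hm : MemLp (diffq (h • unitVec k) (w j)) 2 volume then hm.toLp _ else 0

theorem diffTwo_coeFn {w : State} (hw : HasGrad w) (hh : 0 ≤ h) (j : Fin 2) :
    diffTwo k h w j =ᵐ[volume] diffq (h • unitVec k) (w j) := by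
  have hm : MemLp (diffq (h • unitVec k) (w j)) 2 volume :=
    ⟨(MemLp.diffq (Lp.memLp (w j)) _).1, ((hw k j).eLpNorm_diffq_two_le (Lp.memLp _) (Lp.memLp _)
      hh).trans_lt (ENNReal.mul_lt_top ENNReal.ofReal_lt_top (Lp.memLp _).2)⟩
  rw [diffTwo, dif_pos hm]
  exact hm.coeFn_toLp

theorem pair_diffTwo {w : State} (hw : HasGrad w) (hh : 0 ≤ h) (j : Fin 2) (φ : 𝓢(R6, ℂ)) :
    pair φ (diffTwo k h w j) = pair (shift (h • unitVec k) φ - φ) (w j) := by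
  rw [pair_apply, pair_apply]
  have h1 : ∫ x, diffTwo k h w j x * φ x = ∫ x, diffq (h • unitVec k) (w j) x * φ x :=
    integral_congr_ae ((diffTwo_coeFn k h hw hh j).mono fun x hx => by simp only [hx])
  rw [h1, integral_diffq_mul (r' := 3 / 2) (Lp.memLp (w j)), ← integral_neg]
  refine integral_congr_ae (Eventually.of_forall fun x => ?_)
  simp only [sub_apply]
  ring

/-- The nonlinear term of the equation for `diffTwo`. -/
def diffTest (u : ℝ → State) (j : Fin 2) (s : ℝ) : 𝓢(R6, ℂ) →ₗ[ℂ] ℂ :=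
  Complex.I • (nonlinTest (u s) j ∘ₗ ((shift (h • unitVec k)).toLinearMap - LinearMap.id))

theorem diffTest_apply (j : Fin 2) (s : ℝ) (ψ : 𝓢(R6, ℂ)) : diffTest k h u j s ψ =
    Complex.I * nonlinTest (u s) j (shift (h • unitVec k) ψ - ψ) := rfl

theorem enorm_diffTest_le (j : Fin 2) (s : ℝ) (ψ : 𝓢(R6, ℂ)) : ‖diffTest k h u j s ψ‖ₑ ≤
    2 * (lpNorm 4 (State.toDist (u s)) * (diffNorm (h • unitVec k) 2 (u s) ^ (1 / 2 : ℝ) *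
      diffNorm (h • unitVec k) 3 (u s) ^ (1 / 2 : ℝ))) * eLpNorm ψ 3 volume := by
  have e : nonlinTest (u s) j (shift (h • unitVec k) ψ - ψ) =
      ∫ x, diffq (h • unitVec k) (fun x => nonlin (fun i => u s i x) j) x * ψ x := by
    rw [integral_diffq_mul (r' := 3) (memLp_nonlin (u s) j), nonlinTest_apply', ← integral_neg]
    refine integral_congr_ae (Eventually.of_forall fun x => ?_)
    simp only [sub_apply]
    ring
  rw [diffTest_apply, enorm_mul, e]
  have hI : ‖Complex.I‖ₑ = 1 := by rw [← ofReal_norm]; simp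
  rw [hI, one_mul]
  refine (enorm_integral_mul_le (p := 3 / 2) (q := 3) (MemLp.diffq (memLp_nonlin (u s) j) _).1
    (aesm_schwartz ψ)).trans ?_
  gcongr
  exact eLpNorm_diffq_nonlin_le (u s) _ j

theorem IsSolution.duhamelEq_diffTwo (hu : IsSolution κ u) (hh : 0 ≤ h) (j : Fin 2) :
    DuhamelEq (coeff κ j) (diffTest k h u j) (fun t => diffTwo k h (u t) j) := fun a t ψ => by
  rw [pair_diffTwo k h (hu.1.hasGrad t) hh, pair_diffTwo k h (hu.1.hasGrad a) hh, hu.duhamel a t,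
    shift_sch, map_sub]
  congr 1
  refine intervalIntegral.integral_congr fun s _ => ?_
  simp only [diffTest_apply]
  rw [shift_sch, map_sub]

/-- Let P and Q be the L² and L³ norms of the increment of u, and m the L⁴ norm of u. The increment
of the nonlinearity has size m P^{1/2} Q^{1/2} in L^{3/2}, so the Strichartz inequality is sublinear
in the time norm Y of Q and Y is absorbed without smallness or subdivision of the interval. P is
O(h) by the energy bound, and Y is finite beforehand because u is continuous in L³. -/
theorem IsSolution.exists_lintegral_diffNorm_le (hκ : 0 < κ) (hu : IsSolution κ u) (a b : ℝ) :
    ∃ K : ℝ≥0, ∀ k : Fin 6, ∀ h : ℝ, 0 < h →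
      ∫⁻ t in Set.Icc a b, diffNorm (h • unitVec k) 3 (u t) ^ 2 ≤ (ENNReal.ofReal h * K) ^ 2 := by
  rcases lt_or_ge b a with hab | hab
  · exact ⟨0, fun k h hh => by simp [Set.Icc_eq_empty hab.not_ge]⟩
  set J := Set.Icc a b
  have hJ : Set.uIcc a b = J := Set.uIcc_of_le hab
  obtain ⟨K₀, hK₀⟩ := exists_bound_of_continuous hu.1.continuous_gradLpNorm_two
    (fun t => (hu.1.1 t).ne) (isCompact_Icc (a := a) (b := b))
  set m : ℝ → ℝ≥0∞ := fun t => lpNorm 4 (State.toDist (u t))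
  have hm : Measurable m := hu.1.measurable_lpNorm (by norm_num)
  set U : ℝ≥0∞ := ∫⁻ t in J, m t ^ 4
  have hU : U ≠ ⊤ := by
    have := lintegral_rpow_enorm_lt_top_of_eLpNorm_lt_top (by norm_num) (by norm_num) (hu.2.1 a b)
    simpa using this.ne
  set Λ := pairConst κ
  have hΛ : Λ ≠ ⊤ := pairConst_ne_top κ
  -- The outcome of `le_of_le_add_sqrt_mul` with the step h factored out.
  set K : ℝ≥0∞ := 4 * Λ * K₀ + 64 * Λ ^ 2 * K₀ * U ^ (1 / 2 : ℝ)
  have hK : K ≠ ⊤ := by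
    have := ENNReal.rpow_ne_top_of_nonneg (y := 1 / 2) (by norm_num) hU
    finiteness
  refine ⟨K.toNNReal, fun k h hh => ?_⟩
  rw [ENNReal.coe_toNNReal hK]
  set H := ENNReal.ofReal h
  have hH : H ≠ ⊤ := ENNReal.ofReal_ne_top
  set P : ℝ → ℝ≥0∞ := fun t => diffNorm (h • unitVec k) 2 (u t)
  set Q : ℝ → ℝ≥0∞ := fun t => diffNorm (h • unitVec k) 3 (u t)
  have hPm : Measurable P := hu.1.measurable_diffNorm _ _
  have hQm : Measurable Q := hu.1.measurable_diffNorm _ _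
  have hP : ∀ t, P t ≤ H * gradLpNorm 2 (State.toDist (u t)) := fun t =>
    (hu.1.hasGrad t).diffNorm_two_le k hh.le
  have hPK : ∀ t ∈ J, P t ≤ H * K₀ := fun t ht => (hP t).trans (by gcongr; exact hK₀ t ht)
  set N : ℝ → ℝ≥0∞ := fun t => 2 * (m t * (P t ^ (1 / 2 : ℝ) * Q t ^ (1 / 2 : ℝ)))
  have hNm : Measurable N := (hm.mul ((hPm.pow_const _).mul (hQm.pow_const _))).const_mul 2
  set Y : ℝ≥0∞ := (∫⁻ t in J, Q t ^ 2) ^ (1 / 2 : ℝ)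
  have hYt : Y ≠ ⊤ := by
    refine ENNReal.rpow_ne_top_of_nonneg (by norm_num) ?_
    obtain ⟨B, hB⟩ := exists_bound_of_continuous (hu.1.continuous_diffNorm_three (h • unitVec k))
      (fun t => (diffNorm_three_lt_top _ _).ne) (isCompact_Icc (a := a) (b := b))
    refine ne_top_of_le_ne_top ?_ (setLIntegral_mono (μ := volume) (s := J) (g := fun _ => (B : ℝ≥0∞) ^ 2)
      measurable_const fun t ht => pow_le_pow_left' (hB t ht) 2)
    rw [setLIntegral_const]
    exact ENNReal.mul_ne_top (by finiteness) (by simp [J])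
  set S : ℝ≥0∞ := (∫⁻ t in J, N t ^ 2) ^ (1 / 2 : ℝ)
  have hS : S ≤ (4 * H * K₀ * U ^ (1 / 2 : ℝ) * Y) ^ (1 / 2 : ℝ) := by
    refine ENNReal.rpow_le_rpow ?_ (by norm_num)
    calc ∫⁻ t in J, N t ^ 2 ≤ ∫⁻ t in J, 4 * H * K₀ * (m t ^ 2 * Q t) := by
          refine setLIntegral_mono (((hm.pow_const 2).mul hQm).const_mul _) fun t ht => ?_
          have e : ∀ x : ℝ≥0∞, (x ^ (1 / 2 : ℝ)) ^ 2 = x := fun x => by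
            rw [← ENNReal.rpow_mul_natCast]; norm_num
          calc N t ^ 2 = 4 * (m t ^ 2 * (P t * Q t)) := by
                simp only [N, mul_pow, e]; norm_num
            _ ≤ 4 * (m t ^ 2 * (H * K₀ * Q t)) := by gcongr; exact hPK t ht
            _ = _ := by ring
      _ = 4 * H * K₀ * ∫⁻ t in J, m t ^ 2 * Q t :=
          lintegral_const_mul _ ((hm.pow_const 2).mul hQm)
      _ ≤ 4 * H * K₀ * (U ^ (1 / 2 : ℝ) * Y) := by
          gcongr
          have := ENNReal.lintegral_mul_le_Lp_mul_Lq (volume.restrict J) (p := 2) (q := 2)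
            (by constructor <;> norm_num) (f := fun t => m t ^ 2) (g := Q)
            (hm.pow_const 2).aemeasurable hQm.aemeasurable
          refine this.trans (le_of_eq ?_)
          congr 2
          · refine lintegral_congr fun t => ?_
            rw [← ENNReal.rpow_natCast, ← ENNReal.rpow_mul, ← ENNReal.rpow_natCast]
            norm_num
          · refine lintegral_congr fun t => ?_
            rw [← ENNReal.rpow_natCast]
            norm_num
      _ = _ := by ring
  have hest : ∀ j, ∫⁻ t in J, eLpNorm (diffq (h • unitVec k) (u t j)) 3 volume ^ 2 ≤
      (Λ * (H * K₀ + S)) ^ 2 := fun j => by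
    have hfin : ∀ᵐ s, N s < ⊤ ∧ (fun _ : ℝ => (0 : ℝ≥0∞)) s < ⊤ := by
      filter_upwards [lpNorm_four_lt_top_ae hu] with s hs
      refine ⟨?_, by simp⟩
      have h1 : P s < ⊤ := (hP s).trans_lt (ENNReal.mul_lt_top ENNReal.ofReal_lt_top (hu.1.1 s))
      have h2 : Q s < ⊤ := diffNorm_three_lt_top _ _
      exact ENNReal.mul_lt_top (by simp) (ENNReal.mul_lt_top hs (ENNReal.mul_lt_top
        (ENNReal.rpow_lt_top_of_nonneg (by norm_num) h1.ne)
        (ENNReal.rpow_lt_top_of_nonneg (by norm_num) h2.ne)))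
    have hc : ∀ ψ : 𝓢(R6, ℂ), Continuous fun t => pair ψ (diffTwo k h (u t) j) := fun ψ => by
      simp_rw [fun t => pair_diffTwo k h (hu.1.hasGrad t) hh.le j ψ]
      exact (pair _).continuous.comp (hu.1.continuous_apply j)
    -- The second bound is taken to be zero, so the value of θ is immaterial.
    have h1 := ((hu.duhamelEq_diffTwo k h hh.le j).strichartz_of_enorm (coeff_ne_zero hκ j)
      (θ := 0) le_rfl zero_le_one hNm measurable_const (fun ψ => ?_) (fun s ψ => ?_) hfin hc a b).2
    · rw [hJ] at h1
      simp_rw [← fun t => eLpNorm_congr_ae (p := 3) (diffTwo_coeFn k h (hu.1.hasGrad t) hh.le j)]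
      refine h1.trans ?_
      gcongr
      · exact linConst_le_pairConst κ j
      · rw [Lp.enorm_def, eLpNorm_congr_ae (diffTwo_coeFn k h (hu.1.hasGrad a) hh.le j)]
        exact (le_sum_two (fun j => eLpNorm (diffq (h • unitVec k) (u a j)) 2 volume) j).trans
          (hPK a ⟨le_rfl, hab⟩)
      · simp [S]
    · simp_rw [diffTest_apply]
      exact ((continuous_nonlinTest hu.1.continuous_apply j continuous_const).measurable).const_mul _
    · rw [zero_mul, add_zero]
      exact enorm_diffTest_le k h j s ψ
  have hQY : ∫⁻ t in J, Q t ^ 2 ≤ (2 * (Λ * (H * K₀ + S))) ^ 2 := by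
    have := lintegral_sum_sq_le Finset.univ
      (fun j t => eLpNorm (diffq (h • unitVec k) (u t j)) 3 volume) (fun j _ => by
        simp_rw [← fun t => eLpNorm_congr_ae (p := 3) (diffLp_coeFn (h • unitVec k) (u t j))]
        exact measurable_eLpNorm_of_continuous
          ((continuous_diffLp _).comp (hu.1.continuous_apply j)) 3) J (fun j _ => hest j)
    rw [Finset.card_univ, Fintype.card_fin, Nat.cast_ofNat] at this
    exact this
  have e2 : ∀ x : ℝ≥0∞, (x ^ 2) ^ (1 / 2 : ℝ) = x := fun x => by
    rw [← ENNReal.rpow_natCast_mul]; norm_num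
  have e3 : (∫⁻ t in J, Q t ^ 2) = Y ^ 2 := by
    simp only [Y]
    rw [← ENNReal.rpow_mul_natCast]; norm_num
  have hY : Y ≤ 2 * Λ * (H * K₀) + (64 * Λ ^ 2 * H * K₀ * U ^ (1 / 2 : ℝ) * Y) ^ (1 / 2 : ℝ) := by
    have h1 := ENNReal.rpow_le_rpow hQY (z := 1 / 2) (by norm_num)
    rw [e2] at h1
    refine h1.trans ?_
    rw [← mul_assoc, mul_add]
    gcongr
    calc 2 * Λ * S ≤ 2 * Λ * (4 * H * K₀ * U ^ (1 / 2 : ℝ) * Y) ^ (1 / 2 : ℝ) := by gcongr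
      _ = ((2 * Λ) ^ 2 * (4 * H * K₀ * U ^ (1 / 2 : ℝ) * Y)) ^ (1 / 2 : ℝ) := by
          rw [ENNReal.mul_rpow_of_nonneg ((2 * Λ) ^ 2) _ (by norm_num : (0 : ℝ) ≤ 1 / 2), e2]
      _ ≤ _ := by
          refine ENNReal.rpow_le_rpow ?_ (by norm_num)
          calc _ = 16 * (Λ ^ 2 * H * K₀ * U ^ (1 / 2 : ℝ) * Y) := by ring
            _ ≤ 64 * (Λ ^ 2 * H * K₀ * U ^ (1 / 2 : ℝ) * Y) := by gcongr; norm_num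
            _ = _ := by ring
  have hfinal := le_of_le_add_sqrt_mul hYt hY
  rw [e3]
  refine pow_le_pow_left' (hfinal.trans (le_of_eq ?_)) 2
  simp only [K]
  ring

end Difference

theorem ENNReal_liminf_sq (f : ℕ → ℝ≥0∞) :
    (liminf f atTop) ^ 2 = liminf (fun n => f n ^ 2) atTop :=
  (pow_left_mono 2 : Monotone fun x : ℝ≥0∞ => x ^ 2).map_liminf_of_continuousAt f
    (ENNReal.continuous_pow 2).continuousAt

/-- The difference quotients are bounded in the endpoint norm uniformly in h; lower semicontinuity
in space and Fatou in time pass to the gradient. -/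
theorem IsSolution.lintegral_gradLpNorm_three_lt_top {κ : ℝ} (hκ : 0 < κ) {u : ℝ → State}
    (hu : IsSolution κ u) (a b : ℝ) :
    ∫⁻ t in Set.Icc a b, gradLpNorm 3 (State.toDist (u t)) ^ 2 < ⊤ := by
  obtain ⟨K, hK⟩ := hu.exists_lintegral_diffNorm_le hκ a b
  have hm : ∀ k j, Measurable fun t => eLpNorm (weakGrad k (u t j)) 3 volume := fun k j =>
    measurable_eLpNorm_of_continuous (hu.1.continuous_weakGrad k j) 3
  have h1 : ∀ k j, ∫⁻ t in Set.Icc a b, eLpNorm (weakGrad k (u t j)) 3 volume ^ 2 ≤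
      (K : ℝ≥0∞) ^ 2 := fun k j => by
    set h : ℕ → ℝ := fun n => 1 / ((n : ℝ) + 1)
    have h0 : ∀ n, 0 < h n := fun n => by positivity
    set g : ℕ → ℝ → ℝ≥0∞ := fun n t => (ENNReal.ofReal (h n))⁻¹ *
      diffNorm (h n • unitVec k) 3 (u t)
    have hg : ∀ n, Measurable (g n) := fun n => (hu.1.measurable_diffNorm _ _).const_mul _
    have hb : ∀ t, eLpNorm (weakGrad k (u t j)) 3 volume ≤ liminf (fun n => g n t) atTop :=
      fun t => by
        refine ((hu.1.hasGrad t k j).eLpNorm_three_le_liminf (Lp.memLp _) (Lp.memLp _) h0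
          tendsto_one_div_add_atTop_nhds_zero_nat).trans
          (liminf_le_liminf (Eventually.of_forall fun n => ?_))
        simp only [g]
        gcongr
        exact le_sum_two (fun j => eLpNorm (diffq (h n • unitVec k) (u t j)) 3 volume) j
    calc _ ≤ ∫⁻ t in Set.Icc a b, liminf (fun n => g n t ^ 2) atTop :=
          lintegral_mono fun t => by
            rw [← ENNReal_liminf_sq]
            exact pow_le_pow_left' (hb t) 2
      _ ≤ liminf (fun n => ∫⁻ t in Set.Icc a b, g n t ^ 2) atTop :=
          lintegral_liminf_le fun n => (hg n).pow_const 2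
      _ ≤ liminf (fun _ : ℕ => (K : ℝ≥0∞) ^ 2) atTop := by
          refine liminf_le_liminf (Eventually.of_forall fun n => ?_)
          have hn0 : ENNReal.ofReal (h n) ≠ 0 := by simpa using h0 n
          simp only [g, mul_pow]
          rw [lintegral_const_mul _ ((hu.1.measurable_diffNorm _ _).pow_const 2)]
          refine (mul_le_mul_right (hK k (h n) (h0 n)) _).trans (le_of_eq ?_)
          rw [← mul_pow, ← mul_assoc, ENNReal.inv_mul_cancel hn0 ENNReal.ofReal_ne_top, one_mul]
      _ = _ := liminf_const _
  simp_rw [fun t => gradLpNorm_eq (hu.1.hasGrad t) (p := 3) (by norm_num), ← Finset.sum_product']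
  refine (lintegral_sum_sq_le (Finset.univ ×ˢ Finset.univ) (fun p t =>
    eLpNorm (weakGrad p.1 (u t p.2)) 3 volume) (fun p _ => hm p.1 p.2) (Set.Icc a b)
    (fun p _ => h1 p.1 p.2)).trans_lt ?_
  finiteness

end QuadNLS
end

noncomputable section
namespace QuadNLS

/-! ### From fixed to moving test functions -/

/-- Telescoping over a fine partition bounds the total increment by η (H b - H a) with η arbitrary.
It stands in for differentiation in time, since the paths considered satisfy their equation only
weakly. -/
theorem eq_of_norm_sub_le_mul {Ψ : ℝ → ℂ} {H : ℝ → ℝ} {a b : ℝ} (hab : a ≤ b)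
    (h : ∀ η > 0, ∃ δ > 0, ∀ s t, a ≤ s → s ≤ t → t ≤ b → t ≤ s + δ →
      ‖Ψ t - Ψ s‖ ≤ η * (H t - H s)) : Ψ b = Ψ a := by
  have key : ∀ η > 0, ‖Ψ b - Ψ a‖ ≤ η * (H b - H a) := fun η hη => by
    obtain ⟨δ, hδ, hd⟩ := h η hη
    obtain ⟨N, hN⟩ := exists_nat_gt ((b - a) / δ)
    set p : ℕ → ℝ := fun i => a + i * ((b - a) / (N + 1 : ℝ))
    have hN1 : (0 : ℝ) < (N : ℝ) + 1 := by positivity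
    have hstep0 : 0 ≤ (b - a) / ((N : ℝ) + 1) := div_nonneg (by linarith) hN1.le
    have hstep : (b - a) / ((N : ℝ) + 1) ≤ δ := by
      rw [div_lt_iff₀ hδ] at hN
      rw [div_le_iff₀ hN1]
      nlinarith
    have hp : ∀ i, p (i + 1) = p i + (b - a) / ((N : ℝ) + 1) := fun i => by
      simp only [p]; push_cast; ring
    have hp0 : p 0 = a := by simp [p]
    have hpN : p (N + 1) = b := by
      simp only [p]; push_cast; field_simp; ring
    have e1 := Finset.sum_range_sub (fun i => Ψ (p i)) (N + 1)
    have e2 := Finset.sum_range_sub (fun i => H (p i)) (N + 1)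
    rw [hp0, hpN] at e1 e2
    rw [← e1, ← e2, Finset.mul_sum]
    refine (norm_sum_le _ _).trans (Finset.sum_le_sum fun i hi => ?_)
    have hi' : ((i : ℝ) + 1) ≤ (N : ℝ) + 1 := by
      have := Finset.mem_range.1 hi
      exact_mod_cast this
    have hle : p (i + 1) ≤ b := by
      rw [← hpN]
      simp only [p]
      push_cast
      have := mul_le_mul_of_nonneg_right hi' hstep0
      linarith
    refine hd _ _ ?_ ?_ hle ?_
    · simp only [p]
      have : 0 ≤ (i : ℝ) * ((b - a) / ((N : ℝ) + 1)) := by positivity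
      linarith
    · rw [hp]; linarith
    · rw [hp]; linarith
  have hlim : Tendsto (fun η : ℝ => η * (H b - H a)) (𝓝[>] 0) (𝓝 0) := by
    have : Tendsto (fun η : ℝ => η * (H b - H a)) (𝓝 0) (𝓝 (0 * (H b - H a))) :=
      (continuous_id.mul continuous_const).tendsto 0
    rw [zero_mul] at this
    exact this.mono_left nhdsWithin_le_nhds
  have h0 : ‖Ψ b - Ψ a‖ ≤ 0 := ge_of_tendsto hlim (by
    filter_upwards [self_mem_nhdsWithin] with η hη using key η hη)
  exact sub_eq_zero.1 (norm_le_zero_iff.1 h0)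

/-- The embedding of the Schwartz space in `L² × L³ × L³` by a function and a derivative. -/
def toL233 (v : R6) : 𝓢(R6, ℂ) →L[ℂ] L23 × Lp ℂ 3 (volume : Measure R6) :=
  toL23.prod ((SchwartzMap.toLpCLM ℂ ℂ 3 volume).comp (LineDeriv.lineDerivOpCLM ℂ 𝓢(R6, ℂ) v))

theorem continuous_toL233_sch (c t : ℝ) (v : R6) (φ : 𝓢(R6, ℂ)) :
    Continuous fun s => toL233 v (sch c (t - s) φ) := by
  have h : Continuous fun s : ℝ => t - s := by fun_prop
  refine ((continuous_toL23_sch c φ).comp h).prodMk ?_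
  change Continuous fun s => (∂_{v} (sch c (t - s) φ) : 𝓢(R6, ℂ)).toLp 3 volume
  simp_rw [← sch_lineDeriv]
  exact (continuous_sch_toLp_three c _).comp h

theorem hasDerivAt_pair_sch (c t s : ℝ) (φ : 𝓢(R6, ℂ)) (F : Lp ℂ 2 (volume : Measure R6)) :
    HasDerivAt (fun s => pair (sch c (t - s) φ) F)
      (-(Complex.I * c * pair (Δ (sch c (t - s) φ)) F)) s := by
  simp_rw [pair_eq_inner_star]
  have h1 := (hasDerivAt_sch_toLp_two c (t - s) φ).scomp s ((hasDerivAt_id s).const_sub t)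
  have h2 := (innerSL ℂ (star F)).hasFDerivAt.restrictScalars ℝ |>.comp_hasDerivAt s h1
  refine HasDerivAt.congr_deriv (f := fun s => inner ℂ (star F) ((sch c (t - s) φ).toLp 2 volume))
    h2 ?_
  change inner ℂ (star F) ((-1 : ℝ) • ((Complex.I * c) • _)) = _
  rw [neg_smul, one_smul, inner_neg_right, inner_smul_right]

theorem norm_pair_le (ψ : 𝓢(R6, ℂ)) (F : Lp ℂ 2 (volume : Measure R6)) :
    ‖pair ψ F‖ ≤ ‖F‖ * ‖ψ.toLp 2 volume‖ := by
  rw [pair_eq_inner_star]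
  refine (norm_inner_le_norm _ _).trans (le_of_eq ?_)
  congr 1
  rw [Lp.norm_def, Lp.norm_def]
  congr 1
  exact eLpNorm_congr_norm_ae ((Lp.coeFn_star F).mono fun x hx => by rw [hx]; simp)

theorem pair_sub_left (ψ φ : 𝓢(R6, ℂ)) (F : Lp ℂ 2 (volume : Measure R6)) :
    pair (ψ - φ) F = pair ψ F - pair φ F := by
  rw [pair_eq_inner_star, pair_eq_inner_star, pair_eq_inner_star, toLp_schwartz_sub,
    inner_sub_right]

theorem continuous_pair_comp {ψ : ℝ → 𝓢(R6, ℂ)} {F : ℝ → Lp ℂ 2 (volume : Measure R6)}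
    (hψ : Continuous fun s => (ψ s).toLp 2 (volume : Measure R6)) (hF : Continuous F) :
    Continuous fun s => pair (ψ s) (F s) := by
  refine continuous_iff_continuousAt.2 fun s => ?_
  rw [ContinuousAt, tendsto_iff_norm_sub_tendsto_zero]
  have h1 := tendsto_iff_norm_sub_tendsto_zero.1 (hF.tendsto s)
  have h2 := tendsto_iff_norm_sub_tendsto_zero.1 (hψ.tendsto s)
  have h3 := (h1.mul ((hψ.tendsto s).norm)).add (h2.const_mul ‖F s‖)
  rw [zero_mul, mul_zero, add_zero] at h3
  refine squeeze_zero (fun _ => norm_nonneg _) (fun t => ?_) h3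
  have e : pair (ψ t) (F t) - pair (ψ s) (F s) =
      pair (ψ t) (F t - F s) + pair (ψ t - ψ s) (F s) := by
    rw [map_sub, pair_sub_left]; ring
  rw [e]
  refine (norm_add_le _ _).trans (add_le_add (norm_pair_le _ _) ?_)
  have := norm_pair_le (ψ t - ψ s) (F s)
  rwa [toLp_schwartz_sub] at this

theorem intervalIntegrable_sch_sub {c : ℝ} {ℓ : ℝ → 𝓢(R6, ℂ) →ₗ[ℂ] ℂ}
    (hℓ : ∀ ψ, Measurable fun s => ℓ s ψ) (v : R6) {m : ℝ → ℝ}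
    (hm : ∀ a b, IntervalIntegrable m volume a b)
    (hb : ∀ s ψ, ‖ℓ s ψ‖ ≤ m s * ‖toL233 v ψ‖) (t : ℝ) (φ : 𝓢(R6, ℂ)) (a b : ℝ) :
    IntervalIntegrable (fun s => ℓ s (sch c (t - s) φ)) volume a b := by
  have hLm : Measurable fun s => ℓ s (sch c (t - s) φ) := by
    have h2 := stronglyMeasurable_uncurry_of_continuous_of_stronglyMeasurable
      (u := fun (τ : ℝ) (s : ℝ) => ℓ s (sch c (t - τ) φ)) (fun s => by
        refine continuous_iff_continuousAt.2 fun τ => ?_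
        rw [ContinuousAt, tendsto_iff_norm_sub_tendsto_zero]
        have h1 := (tendsto_iff_norm_sub_tendsto_zero.1
          ((continuous_toL233_sch c t v φ).tendsto τ)).const_mul (m s)
        rw [mul_zero] at h1
        refine squeeze_zero (fun _ => norm_nonneg _) (fun τ' => ?_) h1
        rw [← map_sub, ← map_sub]
        exact hb s _)
      (fun τ => (hℓ (sch c (t - τ) φ)).stronglyMeasurable)
    exact h2.measurable.comp (measurable_id.prodMk measurable_id)
  refine ((hm a b).mul_continuousOn
    (continuous_toL233_sch c t v φ).norm.continuousOn).mono_fun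
    hLm.aestronglyMeasurable (Eventually.of_forall fun s => ?_)
  exact (hb s _).trans (le_abs_self _)

/-- The pairing of D(s) with the test function propagated over T - s, minus the forcing accumulated
up to s, does not depend on s. On a short interval D is frozen at the right end while the test
function moves, and the test function is frozen at the left end while D moves. The two Laplacian
terms then cancel up to the oscillation of D and of the test path, which is uniformly small on a
compact interval. -/
theorem duhamelEq_of_weak {c : ℝ} {D : ℝ → Lp ℂ 2 (volume : Measure R6)} (hD : Continuous D)
    {ℓ : ℝ → 𝓢(R6, ℂ) →ₗ[ℂ] ℂ} (hℓ : ∀ ψ, Measurable fun s => ℓ s ψ) (v : R6) {m : ℝ → ℝ}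
    (hm0 : ∀ s, 0 ≤ m s) (hm : ∀ a b, IntervalIntegrable m volume a b)
    (hb : ∀ s ψ, ‖ℓ s ψ‖ ≤ m s * ‖toL233 v ψ‖)
    (hI : ∀ a b ψ, a ≤ b → pair ψ (D b) - pair ψ (D a) =
      ∫ s in a..b, (Complex.I * c * pair (Δ ψ) (D s) + ℓ s ψ)) : DuhamelEq c ℓ D := by
  have hLi : ∀ t φ a b, IntervalIntegrable (fun s => ℓ s (sch c (t - s) φ)) volume a b :=
    intervalIntegrable_sch_sub hℓ v hm hb
  have hℓi : ∀ ψ a b, IntervalIntegrable (fun s => ℓ s ψ) volume a b := fun ψ a b => by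
    refine ((hm a b).mul_const ‖toL233 v ψ‖).mono_fun (hℓ ψ).aestronglyMeasurable
      (Eventually.of_forall fun s => ?_)
    exact (hb s _).trans (le_abs_self _)
  have forward : ∀ a t φ, a ≤ t → pair φ (D t) =
      pair (sch c (t - a) φ) (D a) + ∫ s in a..t, ℓ s (sch c (t - s) φ) := by
    intro a T φ haT
    set ψ : ℝ → 𝓢(R6, ℂ) := fun s => sch c (T - s) φ with hψdef
    have hT : Continuous fun s : ℝ => T - s := by fun_prop
    have hΔc : Continuous fun s => (Δ (ψ s) : 𝓢(R6, ℂ)).toLp 2 (volume : Measure R6) := by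
      simp only [ψ, ← sch_laplacian]
      exact (continuous_sch_toLp_two c _).comp hT
    set Ψ : ℝ → ℂ := fun s => pair (ψ s) (D s) - ∫ σ in a..s, ℓ σ (ψ σ)
    have hkey : Ψ T = Ψ a := by
      obtain ⟨B, hB⟩ := isCompact_Icc (a := a) (b := T) |>.exists_bound_of_continuousOn
        hD.continuousOn
      obtain ⟨B', hB'⟩ := isCompact_Icc (a := a) (b := T) |>.exists_bound_of_continuousOn
        hΔc.continuousOn
      have hB0 : 0 ≤ B := (norm_nonneg _).trans (hB a ⟨le_rfl, haT⟩)
      have hB0' : 0 ≤ B' := (norm_nonneg _).trans (hB' a ⟨le_rfl, haT⟩)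
      -- The primitive of M is the comparison function H: it collects the Laplacian terms and the
      -- forcing.
      set M : ℝ → ℝ := fun s => |c| * (B + B') + m s
      have hMi : ∀ s t, IntervalIntegrable M volume s t := fun s t =>
        intervalIntegrable_const.add (hm s t)
      refine eq_of_norm_sub_le_mul (H := fun s => ∫ σ in a..s, M σ) haT fun η hη => ?_
      have hu1 := isCompact_Icc.uniformContinuousOn_of_continuous
        (s := Set.Icc a T) hD.continuousOn
      have hu2 := isCompact_Icc.uniformContinuousOn_of_continuous
        (s := Set.Icc a T) hΔc.continuousOn
      have hu3 := isCompact_Icc.uniformContinuousOn_of_continuous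
        (s := Set.Icc a T) (continuous_toL233_sch c T v φ).continuousOn
      rw [Metric.uniformContinuousOn_iff_le] at hu1 hu2 hu3
      obtain ⟨δ₁, hδ₁, h1⟩ := hu1 η hη
      obtain ⟨δ₂, hδ₂, h2⟩ := hu2 η hη
      obtain ⟨δ₃, hδ₃, h3⟩ := hu3 η hη
      refine ⟨min δ₁ (min δ₂ δ₃), by positivity, fun s t has hst htT hδ => ?_⟩
      have hd1 : ∀ σ ∈ Set.Icc s t, dist s σ ≤ min δ₁ (min δ₂ δ₃) := fun σ hσ => by
        rw [Real.dist_eq, abs_sub_comm, abs_of_nonneg (by linarith [hσ.1])]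
        linarith [hσ.2]
      have hd2 : ∀ σ ∈ Set.Icc s t, dist σ t ≤ min δ₁ (min δ₂ δ₃) := fun σ hσ => by
        rw [Real.dist_eq, abs_sub_comm, abs_of_nonneg (by linarith [hσ.2])]
        linarith [hσ.1]
      have hsI : s ∈ Set.Icc a T := ⟨has, hst.trans htT⟩
      have htI : t ∈ Set.Icc a T := ⟨has.trans hst, htT⟩
      have hc1 : Continuous fun σ => pair (Δ (ψ σ)) (D t) :=
        continuous_pair_comp hΔc continuous_const
      have hc2 : Continuous fun σ => pair (Δ (ψ s)) (D σ) :=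
        continuous_pair_comp continuous_const hD
      have e1 : pair (ψ t) (D t) - pair (ψ s) (D t) =
          ∫ σ in s..t, -(Complex.I * c * pair (Δ (ψ σ)) (D t)) :=
        (intervalIntegral.integral_eq_sub_of_hasDerivAt
          (fun σ _ => hasDerivAt_pair_sch c T σ φ (D t))
          ((continuous_const.mul hc1).neg.intervalIntegrable _ _)).symm
      have e2 := hI s t (ψ s) hst
      have e3 : (∫ σ in a..t, ℓ σ (ψ σ)) - ∫ σ in a..s, ℓ σ (ψ σ) = ∫ σ in s..t, ℓ σ (ψ σ) :=
        intervalIntegral.integral_interval_sub_left (hLi T φ _ _) (hLi T φ _ _)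
      have e4 : Ψ t - Ψ s = ∫ σ in s..t,
          (Complex.I * c * (pair (Δ (ψ s)) (D σ) - pair (Δ (ψ σ)) (D t)) +
            (ℓ σ (ψ s) - ℓ σ (ψ σ))) := by
        have e5 : Ψ t - Ψ s = (pair (ψ t) (D t) - pair (ψ s) (D t)) +
            (pair (ψ s) (D t) - pair (ψ s) (D s)) - ∫ σ in s..t, ℓ σ (ψ σ) := by
          rw [← e3]; simp only [Ψ]; ring
        have i1 : IntervalIntegrable (fun σ => -(Complex.I * c * pair (Δ (ψ σ)) (D t))) volume s t :=
          (continuous_const.mul hc1).neg.intervalIntegrable _ _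
        have i2 : IntervalIntegrable (fun σ => Complex.I * c * pair (Δ (ψ s)) (D σ) + ℓ σ (ψ s))
            volume s t :=
          ((continuous_const.mul hc2).intervalIntegrable _ _).add (hℓi _ _ _)
        rw [e5, e1, e2, ← intervalIntegral.integral_add i1 i2,
          ← intervalIntegral.integral_sub (i1.add i2) (hLi T φ _ _)]
        refine intervalIntegral.integral_congr fun σ _ => ?_
        ring
      rw [e4]
      have e6 : (∫ σ in a..t, M σ) - ∫ σ in a..s, M σ = ∫ σ in s..t, M σ :=
        intervalIntegral.integral_interval_sub_left (hMi _ _) (hMi _ _)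
      rw [e6, ← intervalIntegral.integral_const_mul]
      refine intervalIntegral.norm_integral_le_of_norm_le hst
        (Eventually.of_forall fun σ hσ => ?_) ((hMi s t).const_mul η)
      have hσ' : σ ∈ Set.Icc s t := ⟨hσ.1.le, hσ.2⟩
      have hσI : σ ∈ Set.Icc a T := ⟨has.trans hσ'.1, hσ'.2.trans htT⟩
      have b1 : ‖D σ - D t‖ ≤ η := by
        rw [← dist_eq_norm]
        exact h1 σ hσI t htI ((hd2 σ hσ').trans (min_le_left _ _))
      have b2 : ‖(Δ (ψ s) : 𝓢(R6, ℂ)).toLp 2 volume - (Δ (ψ σ) : 𝓢(R6, ℂ)).toLp 2 volume‖ ≤ η := by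
        rw [← dist_eq_norm]
        exact h2 s hsI σ hσI ((hd1 σ hσ').trans ((min_le_right _ _).trans (min_le_left _ _)))
      have b3 : ‖toL233 v (ψ s) - toL233 v (ψ σ)‖ ≤ η := by
        rw [← dist_eq_norm]
        exact h3 s hsI σ hσI ((hd1 σ hσ').trans ((min_le_right _ _).trans (min_le_right _ _)))
      have b4 : ‖pair (Δ (ψ s)) (D σ) - pair (Δ (ψ σ)) (D t)‖ ≤ η * (B + B') := by
        have e7 : pair (Δ (ψ s)) (D σ) - pair (Δ (ψ σ)) (D t) =
            pair (Δ (ψ s)) (D σ - D t) + pair (Δ (ψ s) - Δ (ψ σ)) (D t) := by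
          rw [map_sub, pair_sub_left]; ring
        rw [e7]
        refine (norm_add_le _ _).trans ?_
        have q1 := norm_pair_le (Δ (ψ s)) (D σ - D t)
        have q2 := norm_pair_le (Δ (ψ s) - Δ (ψ σ)) (D t)
        rw [toLp_schwartz_sub] at q2
        have q3 := mul_le_mul b1 (hB' s hsI) (norm_nonneg _) hη.le
        have q4 := mul_le_mul (hB t htI) b2 (norm_nonneg _) hB0
        linarith
      have b5 : ‖ℓ σ (ψ s) - ℓ σ (ψ σ)‖ ≤ m σ * η := by
        rw [← map_sub]
        refine (hb σ _).trans ?_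
        rw [map_sub]
        exact mul_le_mul_of_nonneg_left b3 (hm0 σ)
      refine (norm_add_le _ _).trans ?_
      rw [norm_mul, norm_mul, Complex.norm_I, one_mul, Complex.norm_real, Real.norm_eq_abs]
      have q5 := mul_le_mul_of_nonneg_left b4 (abs_nonneg c)
      simp only [M]
      linarith
    have h1 : ψ T = φ := by simp [ψ, sch_zero]
    simp only [Ψ, intervalIntegral.integral_same, sub_zero, h1] at hkey
    rw [← hkey]
    ring
  intro a t φ
  rcases le_total a t with hat | hat
  · exact forward a t φ hat
  -- Backward in time, the formula is the forward one from t to a, tested with the propagated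
  -- function.
  · have h := forward t a (sch c (t - a) φ) hat
    simp_rw [sch_sch] at h
    simp only [show ∀ s, a - s + (t - a) = t - s from fun s => by ring, sub_self, sch_zero] at h
    rw [h, intervalIntegral.integral_symm t a]
    ring

end QuadNLS
end

noncomputable section
namespace QuadNLS

/-! ### Density of compactly supported functions in the Schwartz space -/

theorem cutoff_hasTemperateGrowth (n : ℕ) : (cutoff n).HasTemperateGrowth :=
  (cutoff_hasCompactSupport n).hasTemperateGrowth (cutoff_contDiff n)

/-- The product of a Schwartz function with a cutoff. -/
def cutoffMul (n : ℕ) (ψ : 𝓢(R6, ℂ)) : 𝓢(R6, ℂ) := SchwartzMap.smulLeftCLM ℂ (cutoff n) ψ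

theorem cutoffMul_apply (n : ℕ) (ψ : 𝓢(R6, ℂ)) (x : R6) :
    cutoffMul n ψ x = cutoff n x • ψ x :=
  SchwartzMap.smulLeftCLM_apply_apply (cutoff_hasTemperateGrowth n) ψ x

theorem cutoffMul_hasCompactSupport (n : ℕ) (ψ : 𝓢(R6, ℂ)) : HasCompactSupport (cutoffMul n ψ) := by
  have h := (cutoff_hasCompactSupport n).smul_right (f' := (ψ : R6 → ℂ))
  have e : (cutoffMul n ψ : R6 → ℂ) = cutoff n • (ψ : R6 → ℂ) :=
    funext fun x => cutoffMul_apply n ψ x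
  rwa [e]

theorem contDiff_cutoff_sub_one (n : ℕ) : ContDiff ℝ ∞ (fun x => cutoff n x - 1) :=
  (cutoff_contDiff n).sub contDiff_const

/-- Where ‖x‖ < n + 1 the cutoff is locally constant and everything vanishes; elsewhere ‖x‖/(n + 1)
≥ 1 is a free factor. One more power of the weight in a Schwartz seminorm thus buys a factor 1/(n +
1). -/
theorem exists_iteratedFDeriv_cutoff_sub_one_le (i : ℕ) : ∃ B : ℝ, 0 ≤ B ∧ ∀ n x,
    ‖iteratedFDeriv ℝ i (fun x => cutoff n x - 1) x‖ ≤ B * (‖x‖ / (n + 1)) := by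
  have hcb : ContDiff ℝ ∞ (cutoffBump : R6 → ℝ) := cutoffBump.contDiff
  have hc : Continuous (iteratedFDeriv ℝ i (cutoffBump : R6 → ℝ)) :=
    hcb.continuous_iteratedFDeriv (by exact_mod_cast le_top)
  obtain ⟨B, hB⟩ := (cutoffBump.hasCompactSupport.iteratedFDeriv (𝕜 := ℝ) i).exists_bound_of_continuous hc
  have hB0 : 0 ≤ B := (norm_nonneg _).trans (hB 0)
  refine ⟨B + 1, by positivity, fun n x => ?_⟩
  have hn : (0 : ℝ) < (n : ℝ) + 1 := by positivity
  rcases lt_or_ge ‖x‖ ((n : ℝ) + 1) with hx | hx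
  · have h0 : (fun x => cutoff n x - 1) =ᶠ[𝓝 x] fun _ => 0 := by
      filter_upwards [(isOpen_lt continuous_norm continuous_const).mem_nhds hx] with y hy
      rw [cutoff_eq_one (le_of_lt hy), sub_self]
    rw [(h0.iteratedFDeriv ℝ i).eq_of_nhds]
    have : iteratedFDeriv ℝ i (fun _ : R6 => (0 : ℝ)) x = 0 := by simp
    rw [this, norm_zero]
    positivity
  · have h1 : (1 : ℝ) ≤ ‖x‖ / (n + 1) := by rwa [le_div_iff₀ hn, one_mul]
    refine le_trans ?_ (le_mul_of_one_le_right (by positivity) h1)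
    have hcn : ContDiff ℝ i (cutoff n) := (cutoff_contDiff n).of_le (by exact_mod_cast le_top)
    rw [show (fun x => cutoff n x - 1) = cutoff n - fun _ => (1 : ℝ) from rfl,
      iteratedFDeriv_sub_apply hcn.contDiffAt contDiffAt_const]
    refine (norm_sub_le _ _).trans (add_le_add ?_ ?_)
    · have e : cutoff n = cutoffBump ∘ (((n : ℝ) + 1)⁻¹ • ContinuousLinearMap.id ℝ R6) := rfl
      rw [e, ContinuousLinearMap.iteratedFDeriv_comp_right _ hcb _ (by exact_mod_cast le_top)]
      refine (ContinuousMultilinearMap.norm_compContinuousLinearMap_le _ _).trans ?_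
      refine (mul_le_of_le_one_right (norm_nonneg _) ?_).trans (hB _)
      refine Finset.prod_le_one (fun _ _ => norm_nonneg _) fun _ _ => ?_
      rw [norm_smul, norm_inv, Real.norm_of_nonneg hn.le]
      refine mul_le_one₀ (inv_le_one_of_one_le₀ (by linarith [(Nat.cast_nonneg n : (0 : ℝ) ≤ n)]))
        (norm_nonneg _) ContinuousLinearMap.norm_id_le
    · rcases Nat.eq_zero_or_pos i with rfl | hi
      · rw [norm_iteratedFDeriv_zero]; simp
      · rw [iteratedFDeriv_const_of_ne hi.ne']; simp

theorem tendsto_cutoffMul (ψ : 𝓢(R6, ℂ)) : Tendsto (fun n => cutoffMul n ψ) atTop (𝓝 ψ) := by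
  rw [(schwartz_withSeminorms ℝ R6 ℂ).tendsto_nhds]
  rintro ⟨k, m⟩ ε hε
  choose B hB0 hB using exists_iteratedFDeriv_cutoff_sub_one_le
  set C : ℝ := ∑ i ∈ Finset.range (m + 1), (m.choose i : ℝ) * B i *
    SchwartzMap.seminorm ℝ (k + 1) (m - i) ψ
  have hC : 0 ≤ C := Finset.sum_nonneg fun i _ =>
    mul_nonneg (mul_nonneg (Nat.cast_nonneg _) (hB0 i)) (apply_nonneg _ _)
  have hle : ∀ n : ℕ, SchwartzMap.seminorm ℝ k m (cutoffMul n ψ - ψ) ≤ C / (n + 1) := fun n => by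
    have hn : (0 : ℝ) < (n : ℝ) + 1 := by positivity
    refine SchwartzMap.seminorm_le_bound ℝ k m _ (by positivity) fun x => ?_
    have e : (⇑(cutoffMul n ψ - ψ) : R6 → ℂ) = fun x => (cutoff n x - 1) • ψ x := by
      funext x
      rw [sub_apply, cutoffMul_apply, sub_smul, one_smul]
    rw [e]
    refine (mul_le_mul_of_nonneg_left (norm_iteratedFDeriv_smul_le (contDiff_cutoff_sub_one n)
      (ψ.smooth ⊤) x (by exact_mod_cast le_top)) (by positivity)).trans ?_
    rw [Finset.mul_sum, Finset.sum_div]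
    refine Finset.sum_le_sum fun i _ => ?_
    have h1 := hB i n x
    have h2 := SchwartzMap.le_seminorm ℝ (k + 1) (m - i) ψ x
    have h3 : 0 ≤ (m.choose i : ℝ) := Nat.cast_nonneg _
    calc ‖x‖ ^ k * ((m.choose i : ℝ) * ‖iteratedFDeriv ℝ i (fun x => cutoff n x - 1) x‖ *
          ‖iteratedFDeriv ℝ (m - i) ψ x‖)
        ≤ ‖x‖ ^ k * ((m.choose i : ℝ) * (B i * (‖x‖ / (n + 1))) *
          ‖iteratedFDeriv ℝ (m - i) ψ x‖) := by gcongr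
      _ = (m.choose i : ℝ) * B i * (‖x‖ ^ (k + 1) * ‖iteratedFDeriv ℝ (m - i) ψ x‖) / (n + 1) := by
          rw [pow_succ]; field_simp
      _ ≤ _ := by
          have := hB0 i
          gcongr
  obtain ⟨N, hN⟩ := exists_nat_gt (C / ε)
  filter_upwards [eventually_ge_atTop N] with n hn
  have hn0 : (0 : ℝ) < (n : ℝ) + 1 := by positivity
  refine (hle n).trans_lt ?_
  rw [div_lt_iff₀ hε] at hN
  rw [div_lt_iff₀ hn0]
  have : (N : ℝ) ≤ n := by exact_mod_cast hn
  nlinarith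

/-! ### From weak to strong derivatives in time -/

/-- A smooth approximation of the indicator function of `[a, b]`. -/
def smoothIndicator (ρ : ContDiffBump (0 : ℝ)) (a b t : ℝ) : ℝ :=
  ∫ s in t - b..t - a, ρ.normed volume s

theorem hasDerivAt_smoothIndicator (ρ : ContDiffBump (0 : ℝ)) (a b t : ℝ) :
    HasDerivAt (smoothIndicator ρ a b) (ρ.normed volume (t - a) - ρ.normed volume (t - b)) t := by
  have hc : Continuous (ρ.normed (volume : Measure ℝ)) := ρ.continuous_normed
  have h : ∀ c t : ℝ, HasDerivAt (fun t => ∫ s in (0 : ℝ)..t - c, ρ.normed volume s)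
      (ρ.normed volume (t - c)) t := fun c t => by
    have h1 := intervalIntegral.integral_hasDerivAt_right (hc.intervalIntegrable 0 (t - c))
      (hc.stronglyMeasurableAtFilter _ _) hc.continuousAt
    simpa using h1.comp_sub_const t c
  have e : smoothIndicator ρ a b = fun t => (∫ s in (0 : ℝ)..t - a, ρ.normed volume s) -
      ∫ s in (0 : ℝ)..t - b, ρ.normed volume s := by
    funext t
    rw [intervalIntegral.integral_interval_sub_left (hc.intervalIntegrable _ _)
      (hc.intervalIntegrable _ _)]
    rfl
  rw [e]
  exact (h a t).sub (h b t)

theorem contDiff_smoothIndicator (ρ : ContDiffBump (0 : ℝ)) (a b : ℝ) :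
    ContDiff ℝ ∞ (smoothIndicator ρ a b) := by
  rw [contDiff_infty_iff_deriv]
  refine ⟨fun t => (hasDerivAt_smoothIndicator ρ a b t).differentiableAt, ?_⟩
  have e : deriv (smoothIndicator ρ a b) =
      fun t => ρ.normed volume (t - a) - ρ.normed volume (t - b) :=
    funext fun t => (hasDerivAt_smoothIndicator ρ a b t).deriv
  rw [e]
  exact (ρ.contDiff_normed.comp (contDiff_id.sub contDiff_const)).sub
    (ρ.contDiff_normed.comp (contDiff_id.sub contDiff_const))

theorem normed_eq_zero (ρ : ContDiffBump (0 : ℝ)) {s : ℝ} (hs : ρ.rOut ≤ |s|) :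
    ρ.normed volume s = 0 := by
  rw [ContDiffBump.normed_def, ρ.zero_of_le_dist (by rwa [Real.dist_eq, sub_zero]), zero_div]

theorem smoothIndicator_eq_zero (ρ : ContDiffBump (0 : ℝ)) {a b t : ℝ} (hab : a ≤ b)
    (h : t ≤ a - ρ.rOut ∨ b + ρ.rOut ≤ t) : smoothIndicator ρ a b t = 0 := by
  refine (intervalIntegral.integral_congr (g := fun _ => 0) fun s hs => ?_).trans (by simp)
  rw [Set.uIcc_of_le (by linarith)] at hs
  refine normed_eq_zero ρ ?_
  rcases h with h | h
  · exact le_trans (by linarith [hs.2]) (neg_le_abs s)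
  · exact le_trans (by linarith [hs.1]) (le_abs_self s)

theorem smoothIndicator_eq_one (ρ : ContDiffBump (0 : ℝ)) {a b t : ℝ}
    (h1 : a + ρ.rOut < t) (h2 : t < b - ρ.rOut) : smoothIndicator ρ a b t = 1 := by
  rw [← ρ.integral_normed (μ := (volume : Measure ℝ)), smoothIndicator]
  refine intervalIntegral.integral_eq_integral_of_support_subset ?_
  rw [ρ.support_normed_eq, Real.ball_eq_Ioo]
  exact fun s hs => ⟨by linarith [hs.1], by linarith [hs.2]⟩

theorem smoothIndicator_mem (ρ : ContDiffBump (0 : ℝ)) {a b : ℝ} (hab : a ≤ b) (t : ℝ) :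
    smoothIndicator ρ a b t ∈ Set.Icc (0 : ℝ) 1 := by
  have hle : t - b ≤ t - a := by linarith
  refine ⟨intervalIntegral.integral_nonneg hle fun s _ => ρ.nonneg_normed s, ?_⟩
  rw [← ρ.integral_normed (μ := (volume : Measure ℝ)), smoothIndicator,
    intervalIntegral.integral_of_le hle]
  exact setIntegral_le_integral ρ.integrable_normed (Eventually.of_forall fun s => ρ.nonneg_normed s)

theorem hasCompactSupport_smoothIndicator (ρ : ContDiffBump (0 : ℝ)) {a b : ℝ} (hab : a ≤ b) :
    HasCompactSupport (smoothIndicator ρ a b) := by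
  refine HasCompactSupport.intro (isCompact_Icc (a := a - ρ.rOut) (b := b + ρ.rOut)) fun t ht => ?_
  refine smoothIndicator_eq_zero ρ hab ?_
  rw [Set.mem_Icc, not_and_or, not_le, not_le] at ht
  exact ht.imp le_of_lt le_of_lt

/-- Smooth approximations of the indicator of [a, b] are admissible tests. Their derivatives are
approximate identities at a minus those at b, which evaluate the continuous y, while dominated
convergence takes care of W. -/
theorem sub_eq_integral_of_weak {y W : ℝ → ℂ} (hy : Continuous y)
    (hW : LocallyIntegrable W volume)
    (h : ∀ χ : ℝ → ℝ, ContDiff ℝ ∞ χ → HasCompactSupport χ →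
      ∫ t, deriv χ t • y t = -∫ t, χ t • W t) {a b : ℝ} (hab : a ≤ b) :
    y b - y a = ∫ t in a..b, W t := by
  -- Only the outer radius 1/(n + 1) is used below; the inner one merely has to be smaller.
  set ρ : ℕ → ContDiffBump (0 : ℝ) := fun n =>
    ⟨((n : ℝ) + 2)⁻¹, ((n : ℝ) + 1)⁻¹, by positivity, by gcongr; linarith⟩
  have hρr : ∀ n, (ρ n).rOut = ((n : ℝ) + 1)⁻¹ := fun n => rfl
  have hρ0 : Tendsto (fun n => (ρ n).rOut) atTop (𝓝 0) := by
    simpa [hρr, one_div] using tendsto_one_div_add_atTop_nhds_zero_nat (𝕜 := ℝ)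
  have hρ1 : ∀ n, (ρ n).rOut ≤ 1 := fun n => by
    rw [hρr]; exact inv_le_one_of_one_le₀ (by linarith [(Nat.cast_nonneg n : (0 : ℝ) ≤ n)])
  have hconv : ∀ c, Tendsto (fun n => ∫ t, (ρ n).normed volume (t - c) • y t) atTop (𝓝 (y c)) :=
    fun c => by
      have h1 := ContDiffBump.convolution_tendsto_right_of_continuous (μ := (volume : Measure ℝ))
        (g := y) hρ0 hy c
      refine h1.congr fun n => ?_
      rw [convolution_def, ← integral_sub_left_eq_self _ volume c]
      refine integral_congr_ae (Eventually.of_forall fun t => ?_)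
      simp only [ContinuousLinearMap.lsmul_apply, sub_sub_cancel]
      rw [← ContDiffBump.normed_neg, neg_sub]
  have hint : ∀ n c, Integrable (fun t => (ρ n).normed volume (t - c) • y t) volume := fun n c => by
    refine Continuous.integrable_of_hasCompactSupport
      (((ρ n).continuous_normed.comp (continuous_id.sub continuous_const)).smul hy) ?_
    have h1 : HasCompactSupport fun t => (ρ n).normed (volume : Measure ℝ) (t - c) :=
      (ρ n).hasCompactSupport_normed.comp_homeomorph (Homeomorph.subRight c)
    exact h1.smul_right
  have hlim1 : Tendsto (fun n => ∫ t, deriv (smoothIndicator (ρ n) a b) t • y t) atTop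
      (𝓝 (y a - y b)) := by
    refine ((hconv a).sub (hconv b)).congr fun n => ?_
    rw [← integral_sub (hint n a) (hint n b)]
    refine integral_congr_ae (Eventually.of_forall fun t => ?_)
    simp only [(hasDerivAt_smoothIndicator (ρ n) a b t).deriv, sub_smul]
  have hlim2 : Tendsto (fun n => ∫ t, smoothIndicator (ρ n) a b t • W t) atTop
      (𝓝 (∫ t, (Set.Ioc a b).indicator W t)) := by
    have hWi : IntegrableOn W (Set.Icc (a - 1) (b + 1)) volume :=
      hW.integrableOn_isCompact isCompact_Icc
    refine tendsto_integral_of_dominated_convergence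
      ((Set.Icc (a - 1) (b + 1)).indicator fun t => ‖W t‖)
      (fun n => (contDiff_smoothIndicator _ _ _).continuous.aestronglyMeasurable.smul
        hW.aestronglyMeasurable) ((integrable_indicator_iff measurableSet_Icc).2 hWi.norm)
      (fun n => Eventually.of_forall fun t => ?_) ?_
    · by_cases ht : t ∈ Set.Icc (a - 1) (b + 1)
      · rw [Set.indicator_of_mem ht, norm_smul, Real.norm_eq_abs,
          abs_of_nonneg (smoothIndicator_mem _ hab t).1]
        exact mul_le_of_le_one_left (norm_nonneg _) (smoothIndicator_mem _ hab t).2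
      · rw [Set.indicator_of_notMem ht, smoothIndicator_eq_zero _ hab, zero_smul, norm_zero]
        rw [Set.mem_Icc, not_and_or, not_le, not_le] at ht
        have := hρ1 n
        exact ht.imp (fun h => by linarith) fun h => by linarith
    · have hne : ∀ c : ℝ, ∀ᵐ t : ℝ ∂volume, t ≠ c := fun c => by
        simp [ae_iff, measure_singleton]
      filter_upwards [hne a, hne b] with t hta htb
      refine tendsto_const_nhds.congr' ?_
      by_cases ht : t ∈ Set.Ioc a b
      · have h1 : a < t := ht.1
        have h2 : t < b := lt_of_le_of_ne ht.2 htb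
        filter_upwards [hρ0.eventually_lt_const (sub_pos.2 h1),
          hρ0.eventually_lt_const (sub_pos.2 h2)] with n hn1 hn2
        rw [Set.indicator_of_mem ht, smoothIndicator_eq_one _ (by linarith) (by linarith), one_smul]
      · have h1 : t < a ∨ b < t := by
          rcases lt_or_ge t a with h | h
          · exact Or.inl h
          · refine Or.inr (not_le.1 fun h' => ht ⟨lt_of_le_of_ne h (Ne.symm hta), h'⟩)
        rcases h1 with h1 | h1
        · filter_upwards [hρ0.eventually_lt_const (sub_pos.2 h1)] with n hn1
          rw [Set.indicator_of_notMem ht, smoothIndicator_eq_zero _ hab (Or.inl (by linarith)),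
            zero_smul]
        · filter_upwards [hρ0.eventually_lt_const (sub_pos.2 h1)] with n hn1
          rw [Set.indicator_of_notMem ht, smoothIndicator_eq_zero _ hab (Or.inr (by linarith)),
            zero_smul]
  have e := tendsto_nhds_unique hlim1 (hlim2.neg.congr fun n =>
    (h _ (contDiff_smoothIndicator (ρ n) a b) (hasCompactSupport_smoothIndicator (ρ n) hab)).symm)
  rw [integral_indicator measurableSet_Ioc, ← intervalIntegral.integral_of_le hab] at e
  rw [← neg_sub, e, neg_neg]

end QuadNLS
end

noncomputable section
namespace QuadNLS

/-! ### The equation with an error term -/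

/-- Tensor products separate time from space: the space integrals become pairings and a scalar
identity in time is left. -/
theorem errorDist_prod (κ : ℝ) (u : ℝ → State) (j : Fin 2) {χ : ℝ → ℝ} (hχ : ContDiff ℝ ∞ χ)
    (Φ : 𝓢(R6, ℂ)) : errorDist κ u j (fun p => χ p.1 • Φ p.2) =
      ∫ t, (deriv χ t • (-Complex.I * pair Φ (u t j)) +
        χ t • ((coeff κ j : ℂ) * pair (Δ Φ) (u t j) + nonlinTest (u t) j Φ)) := by
  refine integral_congr_ae (Eventually.of_forall fun t => ?_)
  have hd : ∀ x, deriv (fun s => χ s • Φ x) t = deriv χ t • Φ x := fun x =>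
    (((hχ.differentiable (by simp)) t).hasDerivAt.smul_const (Φ x)).deriv
  have hl : ∀ x, (Δ (fun y => χ t • Φ y)) x = χ t • (Δ Φ : 𝓢(R6, ℂ)) x := fun x => by
    rw [SchwartzMap.laplacian_apply]
    exact InnerProductSpace.laplacian_smul (χ t) ((Φ.smooth 2).contDiffAt)
  simp only [hd, hl]
  have i1 : Integrable (fun x => u t j x * Φ x) volume :=
    integrable_mul_schwartz (r' := 3 / 2) (Lp.memLp _) Φ
  have i2 : Integrable (fun x => u t j x * (Δ Φ : 𝓢(R6, ℂ)) x) volume :=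
    integrable_mul_schwartz (r' := 3 / 2) (Lp.memLp _) _
  have i3 : Integrable (fun x => nonlinLp (u t) j x * Φ x) volume :=
    integrable_mul_schwartz (r' := 3) (Lp.memLp _) Φ
  rw [pair_apply, pair_apply, nonlinTest_apply, mul_comm (-Complex.I), ← integral_mul_const,
    ← integral_smul, ← integral_const_mul]
  have i12 : Integrable (fun x => deriv χ t • (u t j x * Φ x * -Complex.I)) volume :=
    (i1.mul_const _).smul (deriv χ t)
  refine Eq.trans ?_ (congrArg₂ (· + ·) rfl (congrArg (χ t • ·) (integral_add (i2.const_mul _) i3)))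
  rw [← integral_smul]
  refine Eq.trans ?_ (integral_add i12 (((i2.const_mul _).add i3).smul (χ t)))
  refine integral_congr_ae (Eventually.of_forall fun x => ?_)
  simp only [Complex.real_smul]
  ring

/-- The functional `ψ ↦ ∫ f ψ` given by a function in `L^{r'}`. -/
def testFunctional (r' r : ℝ≥0∞) [r'.HolderConjugate r] (f : R6 → ℂ) : 𝓢(R6, ℂ) →ₗ[ℂ] ℂ :=
  open Classical in
  if h : MemLp f r' volume then
    { toFun := fun ψ => ∫ x, f x * ψ x
      map_add' := fun φ ψ => by
        rw [← integral_add (integrable_mul_schwartz (r' := r) h φ)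
          (integrable_mul_schwartz (r' := r) h ψ)]
        simp only [add_apply, mul_add]
      map_smul' := fun a ψ => by
        rw [RingHom.id_apply, smul_eq_mul, ← integral_const_mul]
        refine integral_congr_ae (Eventually.of_forall fun x => ?_)
        simp only [smul_apply, smul_eq_mul]
        ring }
  else 0

section testFunctional

variable {r' r : ℝ≥0∞} [r'.HolderConjugate r] {f : R6 → ℂ}

theorem testFunctional_apply (h : MemLp f r' volume) (ψ : 𝓢(R6, ℂ)) :
    testFunctional r' r f ψ = ∫ x, f x * ψ x := by
  rw [testFunctional, dif_pos h]; rfl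

theorem testFunctional_of_not (h : ¬ MemLp f r' volume) : testFunctional r' r f = 0 := by
  rw [testFunctional, dif_neg h]

theorem enorm_testFunctional_le (f : R6 → ℂ) (ψ : 𝓢(R6, ℂ)) :
    ‖testFunctional r' r f ψ‖ₑ ≤ eLpNorm f r' volume * eLpNorm ψ r volume := by
  by_cases h : MemLp f r' volume
  · rw [testFunctional_apply h]
    exact enorm_integral_mul_le h.1 (aesm_schwartz ψ)
  · rw [testFunctional_of_not h]; simp

end testFunctional

theorem measurable_eLpNorm_slice {G : ℝ × R6 → ℂ} (hG : StronglyMeasurable G) {ρ : ℝ}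
    (hρ : 0 < ρ) : Measurable fun s => eLpNorm (fun x => G (s, x)) (ENNReal.ofReal ρ) volume := by
  simp_rw [eLpNorm_eq_lintegral_rpow_enorm_toReal (ENNReal.ofReal_pos.2 hρ).ne'
    ENNReal.ofReal_ne_top]
  exact (Measurable.lintegral_prod_right' (f := fun p => ‖G p‖ₑ ^ (ENNReal.ofReal ρ).toReal)
    (hG.measurable.enorm.pow_const _)).pow_const _

/-- At times whose slice is not in L^ρ the functional is zero by definition. The set of these times
is measurable, and off it the functional is an integral depending on a parameter. -/
theorem measurable_testFunctional {G : ℝ × R6 → ℂ} (hG : StronglyMeasurable G) {ρ : ℝ} (hρ : 0 < ρ)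
    (r : ℝ≥0∞) [(ENNReal.ofReal ρ).HolderConjugate r] (ψ : 𝓢(R6, ℂ)) :
    Measurable fun s => testFunctional (ENNReal.ofReal ρ) r (fun x => G (s, x)) ψ := by
  have h1 : StronglyMeasurable fun s => ∫ x, G (s, x) * ψ x :=
    StronglyMeasurable.integral_prod_right' (f := fun p : ℝ × R6 => G p * ψ p.2)
      (hG.mul (ψ.continuous.comp continuous_snd).stronglyMeasurable)
  have hm : ∀ s, MemLp (fun x => G (s, x)) (ENNReal.ofReal ρ) volume ↔
      eLpNorm (fun x => G (s, x)) (ENNReal.ofReal ρ) volume < ⊤ := fun s =>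
    ⟨fun h => h.2, fun h =>
      ⟨(hG.comp_measurable measurable_prodMk_left).aestronglyMeasurable, h⟩⟩
  have e : (fun s => testFunctional (ENNReal.ofReal ρ) r (fun x => G (s, x)) ψ) =
      {s | eLpNorm (fun x => G (s, x)) (ENNReal.ofReal ρ) volume < ⊤}.indicator
        fun s => ∫ x, G (s, x) * ψ x := by
    funext s
    by_cases h : eLpNorm (fun x => G (s, x)) (ENNReal.ofReal ρ) volume < ⊤
    · rw [Set.indicator_of_mem (by exact h), testFunctional_apply ((hm s).2 h)]
    · rw [Set.indicator_of_notMem (by exact h), testFunctional_of_not (fun h' => h ((hm s).1 h'))]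
      rfl
  rw [e]
  exact h1.measurable.indicator (measurable_eLpNorm_slice hG hρ measurableSet_Iio)

/-- For an admissible pair with 2/q = θ the space exponent satisfies 1/r = 1/2 - θ/6 = (1 - θ)/2 +
θ/3. -/
theorem eLpNorm_schwartz_interp {θ : ℝ} (h0 : 0 ≤ θ) (h1 : θ ≤ 1) (ψ : 𝓢(R6, ℂ)) :
    eLpNorm ψ (ENNReal.ofReal (1 / 2 - θ / 6)⁻¹) volume ≤
      eLpNorm ψ 2 volume ^ (1 - θ) * eLpNorm ψ 3 volume ^ θ := by
  have := eLpNorm_le_interp (aesm_schwartz ψ) (p := 2) (q := 3) (r := (1 / 2 - θ / 6)⁻¹) (θ := θ)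
    (by norm_num) (by norm_num) (inv_pos.2 (by linarith)) h0 h1 (by rw [one_div, inv_inv]; ring)
  simpa using this

theorem holderConjugate_admissible {θ : ℝ} (h0 : 0 ≤ θ) (h1 : θ ≤ 1) :
    (ENNReal.ofReal (1 / 2 + θ / 6)⁻¹).HolderConjugate (ENNReal.ofReal (1 / 2 - θ / 6)⁻¹) := ⟨by
  have e1 : (0 : ℝ) < 1 / 2 + θ / 6 := by linarith
  have e2 : (0 : ℝ) < 1 / 2 - θ / 6 := by linarith
  rw [ENNReal.ofReal_inv_of_pos e1, ENNReal.ofReal_inv_of_pos e2, inv_inv, inv_inv, inv_one,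
    ← ENNReal.ofReal_add e1.le e2.le]
  norm_num⟩

theorem norm_toLp_le_toL233 (v : R6) (ψ : 𝓢(R6, ℂ)) :
    ‖ψ.toLp 2 (volume : Measure R6)‖ ≤ ‖toL233 v ψ‖ ∧
      ‖ψ.toLp 3 (volume : Measure R6)‖ ≤ ‖toL233 v ψ‖ ∧
        ‖(∂_{v} ψ : 𝓢(R6, ℂ)).toLp 3 (volume : Measure R6)‖ ≤ ‖toL233 v ψ‖ :=
  ⟨(norm_fst_le (toL23 ψ)).trans (norm_fst_le (toL233 v ψ)),
    (norm_snd_le (toL23 ψ)).trans (norm_fst_le (toL233 v ψ)), norm_snd_le (toL233 v ψ)⟩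

theorem norm_le_toL233 {θ : ℝ} (h0 : 0 ≤ θ) (h1 : θ ≤ 1) (v : R6) {N : ℝ≥0∞} (hN : N ≠ ⊤) {z : ℂ}
    {ψ : 𝓢(R6, ℂ)}
    (h : ‖z‖ₑ ≤ N * (eLpNorm ψ 2 volume ^ (1 - θ) * eLpNorm ψ 3 volume ^ θ)) :
    ‖z‖ ≤ N.toReal * ‖toL233 v ψ‖ := by
  obtain ⟨b2, b3, -⟩ := norm_toLp_le_toL233 v ψ
  have e2 : eLpNorm ψ 2 volume ≤ ‖toL233 v ψ‖ₑ := by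
    rw [← enorm_toLp, ← ofReal_norm, ← ofReal_norm]; exact ENNReal.ofReal_le_ofReal b2
  have e3 : eLpNorm ψ 3 volume ≤ ‖toL233 v ψ‖ₑ := by
    rw [← enorm_toLp, ← ofReal_norm, ← ofReal_norm]; exact ENNReal.ofReal_le_ofReal b3
  have h2 : ‖z‖ₑ ≤ N * ‖toL233 v ψ‖ₑ := by
    refine h.trans ?_
    gcongr
    refine (mul_le_mul' (ENNReal.rpow_le_rpow e2 (by linarith))
      (ENNReal.rpow_le_rpow e3 h0)).trans ?_
    rw [← ENNReal.rpow_add_of_nonneg _ _ (by linarith) h0]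
    simp
  have := ENNReal.toReal_mono (by finiteness) h2
  rwa [ENNReal.toReal_mul, toReal_enorm, toReal_enorm] at this

theorem norm_nonlinTest_le (w : State) (j : Fin 2) (ψ : 𝓢(R6, ℂ)) :
    ‖nonlinTest w j ψ‖ ≤ ‖dualPair‖ * ‖nonlinLp w j‖ * ‖ψ.toLp 3 (volume : Measure R6)‖ := by
  rw [nonlinTest_eq]
  exact dualPair.le_opNorm₂ _ _

/-- The nonlinearity, tested with a partial derivative. -/
def nonlinGradTest (w : State) (k : Fin 6) (j : Fin 2) : 𝓢(R6, ℂ) →ₗ[ℂ] ℂ :=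
  nonlinTest w j ∘ₗ (LineDeriv.lineDerivOpCLM ℂ 𝓢(R6, ℂ) (unitVec k)).toLinearMap

theorem nonlinGradTest_apply (w : State) (k : Fin 6) (j : Fin 2) (ψ : 𝓢(R6, ℂ)) :
    nonlinGradTest w k j ψ = nonlinTest w j (∂_{unitVec k} ψ) := rfl

theorem ContinuousHdot1.continuous_nonlinGradTest {u : ℝ → State} (hu : ContinuousHdot1 u)
    (k : Fin 6) (j : Fin 2) (ψ : 𝓢(R6, ℂ)) : Continuous fun s => nonlinGradTest (u s) k j ψ :=
  continuous_nonlinTest hu.continuous_apply j continuous_const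

/-- The equation is solved for the time derivative, with I² = -1 as the only algebra. The minus
signs before y and d reflect the spatial derivative that was moved off the test function. -/
theorem sub_eq_integral_of_test {c : ℂ} {y d n g : ℝ → ℂ} (hy : Continuous y) (hd : Continuous d)
    (hn : Continuous n) (hg : LocallyIntegrable g volume)
    (h : ∀ χ : ℝ → ℝ, ContDiff ℝ ∞ χ → HasCompactSupport χ → ∫ t, χ t • g t =
      -∫ t, (deriv χ t • (-Complex.I * -y t) + χ t • (c * -d t + n t))) {a b : ℝ} (hab : a ≤ b) :
    y b - y a = ∫ s in a..b, (Complex.I * c * d s + (-Complex.I) • (g s + n s)) := by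
  have hWc : Continuous fun s => Complex.I * c * d s - Complex.I * n s :=
    (continuous_const.mul hd).sub (continuous_const.mul hn)
  have hWl : LocallyIntegrable (fun s => Complex.I * c * d s + (-Complex.I) • (g s + n s))
      volume := by
    refine (hWc.locallyIntegrable.sub (hg.smul Complex.I)).congr (Eventually.of_forall fun s => ?_)
    simp only [Pi.sub_apply, Pi.smul_apply, smul_eq_mul]
    ring
  refine sub_eq_integral_of_weak hy hWl (fun χ hχ hχc => ?_) hab
  have e := h χ hχ hχc
  have j1 : Integrable (fun t => deriv χ t • y t) volume :=
    ((hχ.continuous_deriv (by simp)).smul hy).integrable_of_hasCompactSupport hχc.deriv.smul_right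
  have j2 : Integrable (fun t => χ t • (Complex.I * c * d t - Complex.I * n t)) volume :=
    (hχ.continuous.smul hWc).integrable_of_hasCompactSupport hχc.smul_right
  have j3 : Integrable (fun t => χ t • g t) volume :=
    hg.integrable_smul_left_of_hasCompactSupport hχ.continuous hχc
  have e2 : ∫ t, (deriv χ t • (-Complex.I * -y t) + χ t • (c * -d t + n t)) =
      Complex.I * ((∫ t, deriv χ t • y t) +
        ∫ t, χ t • (Complex.I * c * d t - Complex.I * n t)) := by
    rw [← integral_add j1 j2, ← integral_const_mul]
    refine integral_congr_ae (Eventually.of_forall fun t => ?_)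
    simp only [Complex.real_smul]
    linear_combination (-(χ t : ℂ) * c * d t + (χ t : ℂ) * n t) * Complex.I_sq
  have e3 : ∫ t, χ t • (Complex.I * c * d t + (-Complex.I) • (g t + n t)) =
      (∫ t, χ t • (Complex.I * c * d t - Complex.I * n t)) - Complex.I * ∫ t, χ t • g t := by
    rw [← integral_const_mul, ← integral_sub j2 (j3.const_mul _)]
    refine integral_congr_ae (Eventually.of_forall fun t => ?_)
    simp only [Complex.real_smul, smul_eq_mul]
    ring
  rw [e3, e, e2]
  linear_combination ((∫ t, deriv χ t • y t) +
    ∫ t, χ t • (Complex.I * c * d t - Complex.I * n t)) * Complex.I_sq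

theorem fderiv_prod_apply {χ : ℝ → ℝ} (hχ : ContDiff ℝ ∞ χ) (ψ : 𝓢(R6, ℂ)) (v : R6) (p : ℝ × R6) :
    fderiv ℝ (fun p : ℝ × R6 => χ p.1 • ψ p.2) p (0, v) =
      χ p.1 • (∂_{v} ψ : 𝓢(R6, ℂ)) p.2 := by
  have d1 : HasFDerivAt (fun p : ℝ × R6 => χ p.1)
      ((fderiv ℝ χ p.1).comp (ContinuousLinearMap.fst ℝ ℝ R6)) p :=
    ((hχ.differentiable (by simp)) p.1).hasFDerivAt.comp p hasFDerivAt_fst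
  have d2 : HasFDerivAt (fun p : ℝ × R6 => ψ p.2)
      ((fderiv ℝ ψ p.2).comp (ContinuousLinearMap.snd ℝ ℝ R6)) p :=
    (ψ.differentiable p.2).hasFDerivAt.comp p hasFDerivAt_snd
  have d3 : HasFDerivAt (fun p : ℝ × R6 => χ p.1 • ψ p.2) _ p := d1.smul d2
  rw [d3.fderiv, SchwartzMap.lineDerivOp_apply_eq_fderiv]
  simp

theorem hasCompactSupport_prod {χ : ℝ → ℝ} (hχ : HasCompactSupport χ) {ψ : 𝓢(R6, ℂ)}
    (hψ : HasCompactSupport ψ) : HasCompactSupport fun p : ℝ × R6 => χ p.1 • ψ p.2 := by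
  refine HasCompactSupport.intro (hχ.isCompact.prod hψ.isCompact) fun p hp => ?_
  rw [Set.mem_prod, not_and_or] at hp
  rcases hp with hp | hp
  · rw [image_eq_zero_of_notMem_tsupport hp, zero_smul]
  · rw [image_eq_zero_of_notMem_tsupport hp, smul_zero]

/-- Distributions on space-time accept only compactly supported tests. Cutoffs of ψ converge in the
Schwartz space with uniformly bounded norms, so both sides pass to the limit. -/
theorem sub_eq_integral_of_cutoff {c : ℝ} {v : R6} {D : ℝ → Lp ℂ 2 (volume : Measure R6)}
    (hDc : Continuous D) {ℓ : ℝ → 𝓢(R6, ℂ) →ₗ[ℂ] ℂ} (hℓm : ∀ ψ, Measurable fun s => ℓ s ψ)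
    {m : ℝ → ℝ} (hm0 : ∀ s, 0 ≤ m s) (hmi : ∀ a b, IntervalIntegrable m volume a b)
    (hℓb : ∀ s ψ, ‖ℓ s ψ‖ ≤ m s * ‖toL233 v ψ‖) {a b : ℝ}
    (h : ∀ ψ : 𝓢(R6, ℂ), HasCompactSupport ψ → pair ψ (D b) - pair ψ (D a) =
      ∫ s in a..b, (Complex.I * c * pair (Δ ψ) (D s) + ℓ s ψ)) (ψ : 𝓢(R6, ℂ)) :
    pair ψ (D b) - pair ψ (D a) = ∫ s in a..b, (Complex.I * c * pair (Δ ψ) (D s) + ℓ s ψ) := by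
  have t1 : ∀ t, Tendsto (fun n => pair (cutoffMul n ψ) (D t)) atTop (𝓝 (pair ψ (D t))) := fun t => by
    have hc : Continuous fun φ : 𝓢(R6, ℂ) => pair φ (D t) := by
      simp_rw [pair_eq_inner_star]
      exact continuous_const.inner (SchwartzMap.toLpCLM ℂ ℂ 2 (volume : Measure R6)).continuous
    exact (hc.tendsto ψ).comp (tendsto_cutoffMul ψ)
  have hΔc : Continuous fun φ : 𝓢(R6, ℂ) => (Δ φ : 𝓢(R6, ℂ)).toLp 2 (volume : Measure R6) :=
    (SchwartzMap.toLpCLM ℂ ℂ 2 (volume : Measure R6)).continuous.comp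
      (LineDeriv.laplacianCLM ℝ R6 𝓢(R6, ℂ)).continuous
  obtain ⟨B₁, hB₁⟩ := (hΔc.norm.tendsto ψ |>.comp (tendsto_cutoffMul ψ)).bddAbove_range
  obtain ⟨B₂, hB₂⟩ := ((toL233 v).continuous.norm.tendsto ψ |>.comp
    (tendsto_cutoffMul ψ)).bddAbove_range
  have hB₁' : ∀ n, ‖(Δ (cutoffMul n ψ) : 𝓢(R6, ℂ)).toLp 2 (volume : Measure R6)‖ ≤ B₁ :=
    fun n => hB₁ ⟨n, rfl⟩
  have hB₂' : ∀ n, ‖toL233 v (cutoffMul n ψ)‖ ≤ B₂ := fun n => hB₂ ⟨n, rfl⟩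
  refine tendsto_nhds_unique ((t1 b).sub (t1 a)) ?_
  refine Tendsto.congr (fun n => (h _ (cutoffMul_hasCompactSupport n ψ)).symm) ?_
  have hΔm : ∀ φ : 𝓢(R6, ℂ), Continuous fun s => Complex.I * c * pair (Δ φ) (D s) := fun φ =>
    continuous_const.mul ((pair _).continuous.comp hDc)
  refine intervalIntegral.tendsto_integral_filter_of_dominated_convergence
    (fun s => |c| * (‖D s‖ * B₁) + m s * B₂)
    (Eventually.of_forall fun n => ((hΔm (cutoffMul n ψ)).measurable.add (hℓm _)).aestronglyMeasurable)
    (Eventually.of_forall fun n => Eventually.of_forall fun s _ => ?_)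
    (((continuous_const.mul (hDc.norm.mul continuous_const)).intervalIntegrable _ _).add
      ((hmi a b).mul_const _)) (Eventually.of_forall fun s _ => ?_)
  · refine (norm_add_le _ _).trans (add_le_add ?_ ?_)
    · rw [norm_mul, norm_mul, Complex.norm_I, one_mul, Complex.norm_real, Real.norm_eq_abs]
      gcongr
      refine (norm_pair_le _ _).trans ?_
      gcongr
      exact hB₁' n
    · refine (hℓb s _).trans ?_
      have := hm0 s
      gcongr
      exact hB₂' n
  · refine Tendsto.add ?_ ?_
    · refine tendsto_const_nhds.mul ?_
      have hc : Continuous fun φ : 𝓢(R6, ℂ) => pair (Δ φ) (D s) := by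
        simp_rw [pair_eq_inner_star]
        exact continuous_const.inner hΔc
      exact (hc.tendsto ψ).comp (tendsto_cutoffMul ψ)
    · rw [tendsto_iff_norm_sub_tendsto_zero]
      have h2 := (tendsto_iff_norm_sub_tendsto_zero.1 (((toL233 v).continuous.tendsto
        ψ).comp (tendsto_cutoffMul ψ))).const_mul (m s)
      rw [mul_zero] at h2
      refine squeeze_zero (fun _ => norm_nonneg _) (fun n => ?_) h2
      rw [← map_sub, Function.comp_apply, ← map_sub]
      exact hℓb s _

/-- The distributional identity, tested with products and integrated in time, becomes an identity
for fixed spatial tests and then a Duhamel formula. The forcing is -i(∇e - ∇f), where ∇f acts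
through `nonlinGradTest` with its derivative on the test function. The numbers 1/2 + θ/6 and 1 - θ/2
are 1/r' and 1/q' for the admissible pair with 2/q = θ. -/
theorem exists_duhamelEq_weakGrad {κ : ℝ} {u : ℝ → State} (hu : ContinuousHdot1 u) {k : Fin 6}
    {j : Fin 2} {G : ℝ × R6 → ℂ} (hG : LocallyIntegrable G volume)
    (hw : ∀ φ : ℝ × R6 → ℂ, ContDiff ℝ ∞ φ → HasCompactSupport φ →
      ∫ p, φ p * G p = -errorDist κ u j (fun p => fderiv ℝ φ p (0, unitVec k)))
    {θ : ℝ} (h0 : 0 ≤ θ) (h1 : θ ≤ 1)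
    (hfin : eLpNorm (fun t => eLpNorm (fun x => G (t, x)) (ENNReal.ofReal (1 / 2 + θ / 6)⁻¹) volume)
      (ENNReal.ofReal (1 - θ / 2)⁻¹) volume < ⊤) :
    ∃ (N : ℝ → ℝ≥0∞) (g : ℝ → 𝓢(R6, ℂ) →ₗ[ℂ] ℂ), Measurable N ∧
      (∀ᵐ s, N s < ⊤) ∧ (∫⁻ s, N s ^ (1 - θ / 2)⁻¹) ^ (1 - θ / 2) ≤
        eLpNorm (fun t => eLpNorm (fun x => G (t, x)) (ENNReal.ofReal (1 / 2 + θ / 6)⁻¹) volume)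
          (ENNReal.ofReal (1 - θ / 2)⁻¹) volume ∧
      (∀ ψ, Measurable fun s => g s ψ) ∧
      (∀ s ψ, ‖g s ψ‖ₑ ≤ N s * (eLpNorm ψ 2 volume ^ (1 - θ) * eLpNorm ψ 3 volume ^ θ)) ∧
      (∀ t φ a b, IntervalIntegrable (fun s => ((-Complex.I) • (g s + nonlinGradTest (u s) k j))
        (sch (coeff κ j) (t - s) φ)) volume a b) ∧
      DuhamelEq (coeff κ j) (fun s => (-Complex.I) • (g s + nonlinGradTest (u s) k j))
        (fun t => weakGrad k (u t j)) := by
  set ρ : ℝ := (1 / 2 + θ / 6)⁻¹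
  set r : ℝ≥0∞ := ENNReal.ofReal (1 / 2 - θ / 6)⁻¹
  have hρ : 0 < ρ := inv_pos.2 (by linarith)
  have : (ENNReal.ofReal ρ).HolderConjugate r := holderConjugate_admissible h0 h1
  -- Every slice of the strongly measurable version is measurable, and almost every slice agrees
  -- with that of G.
  obtain ⟨G', hG', hGG'⟩ := hG.aestronglyMeasurable
  have hslice : ∀ᵐ t : ℝ, (fun x => G (t, x)) =ᵐ[volume] fun x => G' (t, x) :=
    Measure.ae_ae_of_ae_prod hGG'
  set N : ℝ → ℝ≥0∞ := fun s => eLpNorm (fun x => G' (s, x)) (ENNReal.ofReal ρ) volume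
  have hN : Measurable N := measurable_eLpNorm_slice hG' hρ
  have hNae : N =ᵐ[volume] fun t => eLpNorm (fun x => G (t, x)) (ENNReal.ofReal ρ) volume := by
    filter_upwards [hslice] with t ht using (eLpNorm_congr_ae ht).symm
  set g : ℝ → 𝓢(R6, ℂ) →ₗ[ℂ] ℂ := fun s => testFunctional (ENNReal.ofReal ρ) r fun x => G' (s, x)
  have hgm : ∀ ψ, Measurable fun s => g s ψ := measurable_testFunctional hG' hρ r
  have hgb : ∀ s ψ, ‖g s ψ‖ₑ ≤ N s * (eLpNorm ψ 2 volume ^ (1 - θ) * eLpNorm ψ 3 volume ^ θ) :=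
    fun s ψ => (enorm_testFunctional_le _ ψ).trans (by gcongr; exact eLpNorm_schwartz_interp h0 h1 ψ)
  have hNfin : eLpNorm N (ENNReal.ofReal (1 - θ / 2)⁻¹) volume < ⊤ := by
    rwa [eLpNorm_congr_ae hNae]
  have hq1 : (1 : ℝ≥0∞) ≤ ENNReal.ofReal (1 - θ / 2)⁻¹ := by
    rw [ENNReal.one_le_ofReal]; exact (one_le_inv₀ (by linarith)).2 (by linarith)
  have hNloc : LocallyIntegrable (fun s => (N s).toReal) volume := by
    refine MemLp.locallyIntegrable (p := ENNReal.ofReal (1 - θ / 2)⁻¹)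
      ⟨hN.ennreal_toReal.aestronglyMeasurable, (eLpNorm_mono_enorm fun s => ?_).trans_lt hNfin⟩ hq1
    rw [Real.enorm_of_nonneg ENNReal.toReal_nonneg]
    exact ENNReal.ofReal_toReal_le
  have hq0 : 0 < (1 - θ / 2)⁻¹ := inv_pos.2 (by linarith)
  have hNe : (∫⁻ s, N s ^ (1 - θ / 2)⁻¹) ^ (1 - θ / 2) =
      eLpNorm N (ENNReal.ofReal (1 - θ / 2)⁻¹) volume := by
    rw [eLpNorm_eq_lintegral_rpow_enorm_toReal (ENNReal.ofReal_pos.2 hq0).ne' ENNReal.ofReal_ne_top,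
      ENNReal.toReal_ofReal hq0.le, one_div, inv_inv]
    rfl
  have hNtop : ∀ᵐ s : ℝ, N s < ⊤ := by
    rw [eLpNorm_eq_lintegral_rpow_enorm_toReal (ENNReal.ofReal_pos.2 hq0).ne' ENNReal.ofReal_ne_top,
      ENNReal.rpow_lt_top_iff_of_pos (by rw [ENNReal.toReal_ofReal hq0.le]; positivity)] at hNfin
    filter_upwards [ae_lt_top (hN.pow_const _) hNfin.ne] with s hs
    rwa [ENNReal.toReal_ofReal hq0.le, ENNReal.rpow_lt_top_iff_of_pos hq0] at hs
  have hgn : ∀ s ψ, ‖g s ψ‖ ≤ (N s).toReal * ‖toL233 (unitVec k) ψ‖ := fun s ψ => by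
    by_cases hs : N s = ⊤
    · have : g s = 0 := testFunctional_of_not fun h => h.2.ne hs
      rw [this, LinearMap.zero_apply, norm_zero]; positivity
    · exact norm_le_toL233 h0 h1 _ hs (hgb s ψ)
  have hnc := continuous_nonlinLp hu.continuous_apply j
  set m : ℝ → ℝ := fun s => (N s).toReal + ‖dualPair‖ * ‖nonlinLp (u s) j‖
  have hmc : Continuous fun s => ‖dualPair‖ * ‖nonlinLp (u s) j‖ := by fun_prop
  have hDc := hu.continuous_weakGrad k j
  set c := coeff κ j
  set D : ℝ → Lp ℂ 2 (volume : Measure R6) := fun t => weakGrad k (u t j)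
  have hpD : ∀ t ψ, pair (∂_{unitVec k} ψ) (u t j) = -pair ψ (D t) := fun t ψ => by
    rw [hasWeakDeriv_iff_pair.1 (hu.hasGrad t k j) ψ, neg_neg]
  have hcont : ∀ ψ : 𝓢(R6, ℂ), Continuous fun t => pair ψ (D t) := fun ψ =>
    (pair ψ).continuous.comp hDc
  have hℓb : ∀ s ψ, ‖((-Complex.I) • (g s + nonlinGradTest (u s) k j)) ψ‖ ≤
      m s * ‖toL233 (unitVec k) ψ‖ := fun s ψ => by
    rw [LinearMap.smul_apply, norm_smul, norm_neg, Complex.norm_I, one_mul, LinearMap.add_apply,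
      add_mul]
    refine (norm_add_le _ _).trans (add_le_add (hgn s ψ) ?_)
    rw [nonlinGradTest_apply]
    refine (norm_nonlinTest_le _ _ _).trans ?_
    gcongr
    exact (norm_toLp_le_toL233 (unitVec k) ψ).2.2
  have hmi : ∀ a b, IntervalIntegrable m volume a b := fun a b =>
    ((hNloc.integrableOn_isCompact isCompact_uIcc).intervalIntegrable).add (hmc.intervalIntegrable a b)
  have hℓm : ∀ ψ, Measurable fun s => ((-Complex.I) • (g s + nonlinGradTest (u s) k j)) ψ :=
    fun ψ => ((hgm ψ).add (hu.continuous_nonlinGradTest k j ψ).measurable).const_smul (-Complex.I)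
  have hgl : ∀ ψ, LocallyIntegrable (fun s => g s ψ) volume := fun ψ =>
    (hNloc.smul ‖toL233 (unitVec k) ψ‖).mono (hgm ψ).aestronglyMeasurable
      (Eventually.of_forall fun s => by
        refine (hgn s ψ).trans (le_trans (le_of_eq ?_) (le_abs_self _))
        simp [mul_comm])
  have hcomp : ∀ a b (ψ : 𝓢(R6, ℂ)), HasCompactSupport ψ → a ≤ b →
      pair ψ (D b) - pair ψ (D a) = ∫ s in a..b, (Complex.I * c * pair (Δ ψ) (D s) +
        ((-Complex.I) • (g s + nonlinGradTest (u s) k j)) ψ) := by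
    intro a b ψ hψ hab
    refine sub_eq_integral_of_test (hcont ψ) (hcont _) (hu.continuous_nonlinGradTest k j ψ) (hgl ψ)
      (fun χ hχ hχc => ?_) hab
    have hφd : ContDiff ℝ ∞ fun p : ℝ × R6 => χ p.1 • ψ p.2 :=
      (hχ.comp contDiff_fst).smul ((ψ.smooth ⊤).comp contDiff_snd)
    have hφc := hasCompactSupport_prod hχc hψ
    have e := hw _ hφd hφc
    simp_rw [fderiv_prod_apply hχ] at e
    rw [errorDist_prod κ u j hχ] at e
    have hint : Integrable (fun p : ℝ × R6 => (χ p.1 • ψ p.2) * G p) volume := by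
      have := hG.integrable_smul_left_of_hasCompactSupport hφd.continuous hφc
      simpa only [smul_eq_mul] using this
    have el : ∫ p : ℝ × R6, (χ p.1 • ψ p.2) * G p = ∫ t, χ t • g t ψ := by
      refine (integral_prod _ hint).trans (integral_congr_ae ?_)
      filter_upwards [hslice, hNtop] with t ht hNt
      have hm : MemLp (fun x => G' (t, x)) (ENNReal.ofReal ρ) volume :=
        ⟨(hG'.comp_measurable measurable_prodMk_left).aestronglyMeasurable, hNt⟩
      rw [testFunctional_apply hm, ← integral_smul]
      refine integral_congr_ae (ht.mono fun x hx => ?_)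
      simp only [Complex.real_smul] at hx ⊢
      rw [hx]; ring
    rw [el] at e
    simp only [hpD, laplacian_lineDeriv] at e
    exact e
  refine ⟨N, g, hN, hNtop, hNe.le.trans (eLpNorm_congr_ae hNae).le, hgm, hgb,
    intervalIntegrable_sch_sub hℓm (unitVec k) hmi hℓb, duhamelEq_of_weak hDc hℓm (unitVec k)
    (fun s => by positivity) hmi hℓb fun a b ψ hab => ?_⟩
  exact sub_eq_integral_of_cutoff hDc hℓm (fun s => by positivity) hmi hℓb
    (fun φ hφ => hcomp a b φ hφ hab) ψ

end QuadNLS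
end

noncomputable section
namespace QuadNLS

/-! ### Estimates for differences of nonlinearities -/

/-- Bounds for difference quotients in `L^p` and for the `L^{p'}` norm. -/
def GradBound (k : Fin 6) (p p' : ℝ≥0∞) (S : ℝ≥0) (A : ℝ≥0∞) (f : R6 → ℂ) : Prop :=
  MemLp f 3 volume ∧
    (∀ h : ℝ, 0 < h → eLpNorm (diffq (h • unitVec k) f) p volume ≤ ENNReal.ofReal h * A) ∧
    eLpNorm f p' volume ≤ S * A

theorem GradBound.conj {k : Fin 6} {p p' : ℝ≥0∞} {S : ℝ≥0} {A : ℝ≥0∞} {f : R6 → ℂ}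
    (h : GradBound k p p' S A f) : GradBound k p p' S A fun x => (starRingEnd ℂ) (f x) := by
  refine ⟨h.1.star, fun t ht => ?_, ?_⟩
  · have e : diffq (t • unitVec k) (fun x => (starRingEnd ℂ) (f x)) =
        fun x => (starRingEnd ℂ) (diffq (t • unitVec k) f x) := by
      funext x; simp [diffq]
    rw [e, eLpNorm_conj]
    exact h.2.1 t ht
  · rw [eLpNorm_conj]
    exact h.2.2

/-- An infinite endpoint norm makes the bounds vacuous, so they may be used at every time and not
only almost everywhere. -/
theorem HasGrad.gradBound_three {w : State} (h : HasGrad w) (k : Fin 6) (j : Fin 2) :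
    GradBound k 3 6 (sobolevConst 3) (gradLpNorm 3 (State.toDist w)) (w j) := by
  refine ⟨Lp.memLp _, fun t ht => ?_, h.sobolev_six j⟩
  have hle : eLpNorm (weakGrad k (w j)) 3 volume ≤ gradLpNorm 3 (State.toDist w) :=
    h.eLpNorm_le k j (by norm_num)
  rcases eq_or_ne (gradLpNorm 3 (State.toDist w)) ⊤ with htop | htop
  · rw [htop, ENNReal.mul_top (ENNReal.ofReal_pos.2 ht).ne']
    exact le_top
  · refine ((h k j).eLpNorm_diffq_three_le (Lp.memLp _)
      ⟨Lp.aestronglyMeasurable _, hle.trans_lt htop.lt_top⟩ ht.le).trans ?_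
    gcongr

theorem HasGrad.gradBound_two {w : State} (h : HasGrad w) (k : Fin 6) (j : Fin 2) :
    GradBound k 2 3 (sobolevConst 2) (gradLpNorm 2 (State.toDist w)) (w j) := by
  refine ⟨Lp.memLp _, fun t ht => ?_, h.sobolev_three j⟩
  refine ((h k j).eLpNorm_diffq_two_le (Lp.memLp _) (Lp.memLp _) ht.le).trans ?_
  gcongr
  exact h.eLpNorm_le k j (by norm_num)

theorem integrable_mul_mul_schwartz {f g : R6 → ℂ} (hf : MemLp f 3 volume) (hg : MemLp g 3 volume)
    (φ : 𝓢(R6, ℂ)) : Integrable (fun x => f x * g x * φ x) volume := by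
  have h : MemLp (fun x => f x * g x) (3 / 2) volume := hg.mul hf
  exact integrable_mul_schwartz (r' := 3) h φ

theorem enorm_integral_mul_le_of_gradBound {k : Fin 6} {f g : R6 → ℂ} {S T : ℝ≥0} {A B : ℝ≥0∞}
    (hf : GradBound k 3 6 S A f) (hg : GradBound k 2 3 T B g) (ψ : 𝓢(R6, ℂ)) :
    ‖∫ x, f x * g x * (∂_{unitVec k} ψ : 𝓢(R6, ℂ)) x‖ₑ ≤
      ((S + T : ℝ≥0) * A * B) * eLpNorm ψ 3 volume := by
  refine (enorm_integral_mul_mul_lineDeriv_le hf.1 hg.1 hf.2.1 hf.2.2 hg.2.2 hg.2.1 ψ).trans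
    (le_of_eq ?_)
  rw [ENNReal.coe_add]
  ring

/-- The constant in the estimate for differences of nonlinearities. -/
def nonlinConst : ℝ≥0 := 2 * (sobolevConst 3 + sobolevConst 2)

/-- The factors f carry endpoint norms (gradient in L³, function in L⁶) and the factors g carry
energy norms (gradient in L², function in L³). -/
theorem enorm_integral_add_three_le {f₁ f₂ f₃ g₁ g₂ g₃ : R6 → ℂ} {k : Fin 6} {A B C : ℝ≥0∞}
    (hf₁ : GradBound k 3 6 (sobolevConst 3) A f₁) (hf₂ : GradBound k 3 6 (sobolevConst 3) A f₂)
    (hf₃ : GradBound k 3 6 (sobolevConst 3) B f₃) (hg₁ : GradBound k 2 3 (sobolevConst 2) C g₁)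
    (hg₂ : GradBound k 2 3 (sobolevConst 2) C g₂) (hg₃ : GradBound k 2 3 (sobolevConst 2) C g₃)
    (ψ : 𝓢(R6, ℂ)) :
    ‖∫ x, (f₁ x * g₁ x * (∂_{unitVec k} ψ : 𝓢(R6, ℂ)) x + f₂ x * g₂ x *
      (∂_{unitVec k} ψ : 𝓢(R6, ℂ)) x + f₃ x * g₃ x * (∂_{unitVec k} ψ : 𝓢(R6, ℂ)) x)‖ₑ ≤
      (nonlinConst * (A + B) * C) * eLpNorm ψ 3 volume := by
  have i1 := integrable_mul_mul_schwartz hf₁.1 hg₁.1 (∂_{unitVec k} ψ)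
  have i2 := integrable_mul_mul_schwartz hf₂.1 hg₂.1 (∂_{unitVec k} ψ)
  have i3 := integrable_mul_mul_schwartz hf₃.1 hg₃.1 (∂_{unitVec k} ψ)
  have e0 := (integral_add (i1.add i2) i3).trans
    (congrArg₂ (· + ·) (integral_add i1 i2) rfl)
  simp only [Pi.add_apply] at e0
  rw [e0]
  refine ((enorm_add_le _ _).trans (add_le_add_left (enorm_add_le _ _) _)).trans ?_
  refine (add_le_add (add_le_add (enorm_integral_mul_le_of_gradBound hf₁ hg₁ ψ)
    (enorm_integral_mul_le_of_gradBound hf₂ hg₂ ψ))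
    (enorm_integral_mul_le_of_gradBound hf₃ hg₃ ψ)).trans ?_
  set K : ℝ≥0∞ := ((sobolevConst 3 + sobolevConst 2 : ℝ≥0) : ℝ≥0∞)
  set L := eLpNorm ψ 3 volume
  have e : (nonlinConst : ℝ≥0∞) = 2 * K := by simp [nonlinConst, K]
  rw [e]
  -- A fourth term is added so that the sum factors through A + B.
  calc K * A * C * L + K * A * C * L + K * B * C * L
      ≤ K * A * C * L + K * A * C * L + K * B * C * L + K * B * C * L := le_self_add
    _ = _ := by ring

/-- With w = u - a, the difference of the quadratic terms consists of three products, each with a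
factor w. That factor is measured in the energy norm and the other one, a component of a or again of
w, in the endpoint norm; conjugation changes no norm. -/
theorem enorm_nonlinGradTest_sub_le {u a : State} (hu : HasGrad u) (ha : HasGrad a) (k : Fin 6)
    (j : Fin 2) (ψ : 𝓢(R6, ℂ)) :
    ‖nonlinGradTest u k j ψ - nonlinGradTest a k j ψ‖ₑ ≤
      (nonlinConst * (gradLpNorm 3 (State.toDist a) + gradLpNorm 3 (State.toDist (u - a))) *
        gradLpNorm 2 (State.toDist (u - a))) * eLpNorm ψ 3 volume := by
  have hw := hu.hasGrad_sub ha
  have hs : ∀ i, ∀ᵐ x, u i x = a i x + (u - a) i x := fun i =>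
    (Lp.coeFn_sub (u i) (a i)).mono fun x hx => by
      change u i x = a i x + (u i - a i : Lp ℂ 3 (volume : Measure R6)) x
      rw [hx, Pi.sub_apply, add_sub_cancel]
  have hi : ∀ w : State, Integrable
      (fun x => nonlin (fun i => w i x) j * (∂_{unitVec k} ψ : 𝓢(R6, ℂ)) x) volume := fun w =>
    integrable_mul_schwartz (r' := 3) (memLp_nonlin w j) _
  rw [nonlinGradTest_apply, nonlinGradTest_apply, nonlinTest_apply', nonlinTest_apply',
    ← integral_sub (hi u) (hi a)]
  fin_cases j
  · refine le_trans (le_of_eq ?_) (enorm_integral_add_three_le (ha.gradBound_three k 1)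
      (ha.gradBound_three k 0).conj (hw.gradBound_three k 1) (hw.gradBound_two k 0).conj
      (hw.gradBound_two k 1) (hw.gradBound_two k 0).conj ψ)
    congr 1
    refine integral_congr_ae ?_
    filter_upwards [hs 0, hs 1] with x h0 h1
    simp only [nonlin, Fin.zero_eta, Matrix.cons_val_zero]
    rw [h0, h1, map_add]
    ring
  · refine le_trans (le_of_eq ?_) (enorm_integral_add_three_le (ha.gradBound_three k 0)
      (ha.gradBound_three k 0) (hw.gradBound_three k 0) (hw.gradBound_two k 0)
      (hw.gradBound_two k 0) (hw.gradBound_two k 0) ψ)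
    congr 1
    refine integral_congr_ae ?_
    filter_upwards [hs 0, hs 1] with x h0 h1
    simp only [nonlin, Fin.mk_one, Matrix.cons_val_one, Matrix.cons_val_fin_one]
    rw [h0]
    ring

theorem IsSolution.duhamelEq_weakGrad {κ : ℝ} {u : ℝ → State} (hu : IsSolution κ u) (k : Fin 6)
    (j : Fin 2) : DuhamelEq (coeff κ j) (fun s => (-Complex.I) • nonlinGradTest (u s) k j)
      (fun t => weakGrad k (u t j)) := by
  intro a t ψ
  rw [hasWeakDeriv_iff_pair.1 (hu.1.hasGrad t k j), hasWeakDeriv_iff_pair.1 (hu.1.hasGrad a k j),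
    hu.duhamel a t j, neg_add, sch_lineDeriv, ← intervalIntegral.integral_neg]
  congr 1
  refine intervalIntegral.integral_congr fun s _ => ?_
  simp only [sch_lineDeriv, LinearMap.smul_apply, smul_eq_mul, nonlinGradTest_apply]
  ring

theorem DuhamelEq.sub {c : ℝ} {ℓ₁ ℓ₂ : ℝ → 𝓢(R6, ℂ) →ₗ[ℂ] ℂ}
    {D₁ D₂ : ℝ → Lp ℂ 2 (volume : Measure R6)} (h₁ : DuhamelEq c ℓ₁ D₁) (h₂ : DuhamelEq c ℓ₂ D₂)
    (i₁ : ∀ t φ a b, IntervalIntegrable (fun s => ℓ₁ s (sch c (t - s) φ)) volume a b)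
    (i₂ : ∀ t φ a b, IntervalIntegrable (fun s => ℓ₂ s (sch c (t - s) φ)) volume a b) :
    DuhamelEq c (fun s => ℓ₁ s - ℓ₂ s) (fun t => D₁ t - D₂ t) := by
  intro a t ψ
  simp only [map_sub, LinearMap.sub_apply]
  rw [intervalIntegral.integral_sub (i₁ t ψ a t) (i₂ t ψ a t), h₁ a t ψ, h₂ a t ψ]
  ring

/-! ### The perturbation estimate on an interval -/

theorem gradLpNorm_le_add {w x y : State} (hw : HasGrad w) (hx : HasGrad x) (hy : HasGrad y)
    {p : ℝ≥0∞} (hp : 1 ≤ p) (h : ∀ k j, eLpNorm (weakGrad k (w j)) p volume ≤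
      eLpNorm (weakGrad k (x j)) p volume + eLpNorm (weakGrad k (y j)) p volume) :
    gradLpNorm p (State.toDist w) ≤ gradLpNorm p (State.toDist x) + gradLpNorm p (State.toDist y) := by
  rw [gradLpNorm_eq hw hp, gradLpNorm_eq hx hp, gradLpNorm_eq hy hp]
  simp_rw [← Finset.sum_add_distrib]
  exact Finset.sum_le_sum fun k _ => Finset.sum_le_sum fun j _ => h k j

theorem HasGrad.gradLpNorm_sub_le {x y : State} (hx : HasGrad x) (hy : HasGrad y) {p : ℝ≥0∞}
    (hp : 1 ≤ p) : gradLpNorm p (State.toDist (x - y)) ≤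
      gradLpNorm p (State.toDist x) + gradLpNorm p (State.toDist y) := by
  refine gradLpNorm_le_add (hx.hasGrad_sub hy) hx hy hp fun k j => ?_
  rw [hx.weakGrad_sub hy, eLpNorm_congr_ae (Lp.coeFn_sub _ _)]
  exact eLpNorm_sub_le (Lp.aestronglyMeasurable _) (Lp.aestronglyMeasurable _) hp

theorem HasGrad.gradLpNorm_le_add_sub {x y : State} (hx : HasGrad x) (hy : HasGrad y) {p : ℝ≥0∞}
    (hp : 1 ≤ p) : gradLpNorm p (State.toDist x) ≤
      gradLpNorm p (State.toDist y) + gradLpNorm p (State.toDist (x - y)) := by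
  refine gradLpNorm_le_add hx hy (hx.hasGrad_sub hy) hp fun k j => ?_
  have e : weakGrad k (x j) = weakGrad k (y j) + weakGrad k ((x - y) j) := by
    rw [hx.weakGrad_sub hy, add_sub_cancel]
  rw [e, eLpNorm_congr_ae (Lp.coeFn_add _ _)]
  exact eLpNorm_add_le (Lp.aestronglyMeasurable _) (Lp.aestronglyMeasurable _) hp

theorem sqrt_lintegral_mul_sq_le {f g α : ℝ → ℝ≥0∞} (hf : Measurable f) (hg : Measurable g)
    {J : Set ℝ} (hJ : MeasurableSet J) {C : ℝ≥0∞} {A : ℝ≥0∞} (hα : ∀ t ∈ J, α t ≤ A) :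
    (∫⁻ s in J, (C * (f s + g s) * α s) ^ 2) ^ (1 / 2 : ℝ) ≤
      C * (A * ((∫⁻ s in J, f s ^ 2) ^ (1 / 2 : ℝ) + (∫⁻ s in J, g s ^ 2) ^ (1 / 2 : ℝ))) := by
  have h1 : ∫⁻ s in J, (C * (f s + g s) * α s) ^ 2 ≤ (C * A) ^ 2 * ∫⁻ s in J, (f s + g s) ^ 2 := by
    refine le_trans ?_ (lintegral_const_mul _ ((hf.add hg).pow_const 2)).le
    refine setLIntegral_mono' hJ fun s hs => ?_
    calc (C * (f s + g s) * α s) ^ 2 ≤ (C * (f s + g s) * A) ^ 2 := by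
          gcongr; exact hα s hs
      _ = _ := by rw [Pi.add_apply]; ring
  have h2 := ENNReal.lintegral_Lp_add_le (μ := volume.restrict J) hf.aemeasurable hg.aemeasurable
    (p := 2) (by norm_num)
  simp only [Pi.add_apply, ENNReal.rpow_two] at h2
  calc _ ≤ ((C * A) ^ 2 * ∫⁻ s in J, (f s + g s) ^ 2) ^ (1 / 2 : ℝ) := by gcongr
    _ = C * A * (∫⁻ s in J, (f s + g s) ^ 2) ^ (1 / 2 : ℝ) := by
        rw [ENNReal.mul_rpow_of_nonneg _ _ (by norm_num), ← ENNReal.rpow_natCast,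
          ← ENNReal.rpow_mul]
        norm_num
    _ ≤ _ := by
        rw [mul_assoc]
        gcongr

/-- The constant in the perturbation estimate. -/
def perturbConst (κ : ℝ) : ℝ≥0∞ := 144 * pairConst κ * (1 + nonlinConst)

theorem perturbConst_ne_top (κ : ℝ) : perturbConst κ ≠ ⊤ := by
  have := pairConst_ne_top κ
  unfold perturbConst
  finiteness

/-- The two Duhamel formulas for the gradients are subtracted. The difference of the nonlinearities
enters through N₁, as an L^{3/2} forcing that is square integrable in time, and the error through
the dual exponents of its own admissible pair. The supremum A of the energy norm is kept explicit so
that its product with the endpoint norms can be absorbed on short intervals. -/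
theorem perturbation_estimate {κ : ℝ} (hκ : 0 < κ) {u ua : ℝ → State} (hu : IsSolution κ u)
    (hua : ContinuousHdot1 ua)
    (hγ : ∫⁻ t, gradLpNorm 3 (State.toDist (ua t)) ^ 2 < ⊤)
    {G : Fin 6 → Fin 2 → ℝ × R6 → ℂ} (hG : IsErrorGradient κ ua G) {θ : ℝ} (h0 : 0 ≤ θ)
    (h1 : θ ≤ 1) {E : ℝ≥0∞} (hE : E < ⊤)
    (hGE : ∀ k j, eLpNorm
      (fun t => eLpNorm (fun x => G k j (t, x)) (ENNReal.ofReal (1 / 2 + θ / 6)⁻¹) volume)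
      (ENNReal.ofReal (1 - θ / 2)⁻¹) volume ≤ E) (a b : ℝ) {A : ℝ≥0∞}
    (hA : ∀ t ∈ Set.uIcc a b, gradLpNorm 2 (State.toDist (u t - ua t)) ≤ A) {R : ℝ≥0∞}
    (hR : R = perturbConst κ * (gradLpNorm 2 (State.toDist (u a - ua a)) + E + A *
      ((∫⁻ t in Set.uIcc a b, gradLpNorm 3 (State.toDist (ua t)) ^ 2) ^ (1 / 2 : ℝ) +
        (∫⁻ t in Set.uIcc a b, gradLpNorm 3 (State.toDist (u t - ua t)) ^ 2) ^ (1 / 2 : ℝ)))) :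
    (∀ t ∈ Set.uIcc a b, gradLpNorm 2 (State.toDist (u t - ua t)) ≤ R) ∧
      (∫⁻ t in Set.uIcc a b, gradLpNorm 3 (State.toDist (u t - ua t)) ^ 2) ≤ R ^ 2 := by
  have hw := hu.1.sub hua
  set α : ℝ → ℝ≥0∞ := fun t => gradLpNorm 2 (State.toDist (u t - ua t))
  set β : ℝ → ℝ≥0∞ := fun t => gradLpNorm 3 (State.toDist (u t - ua t))
  set γ : ℝ → ℝ≥0∞ := fun t => gradLpNorm 3 (State.toDist (ua t))
  have hαm : Measurable α := hw.measurable_gradLpNorm (by norm_num)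
  have hβm : Measurable β := hw.measurable_gradLpNorm (by norm_num)
  have hγm : Measurable γ := hua.measurable_gradLpNorm (by norm_num)
  set Dw : Fin 6 → Fin 2 → ℝ → Lp ℂ 2 (volume : Measure R6) := fun k j t =>
    weakGrad k (u t j) - weakGrad k (ua t j)
  have hDw : ∀ k j t, Dw k j t = weakGrad k ((u t - ua t) j) := fun k j t =>
    ((hu.1.hasGrad t).weakGrad_sub (hua.hasGrad t) k j).symm
  set N₁ : ℝ → ℝ≥0∞ := fun s => nonlinConst * (γ s + β s) * α s
  have hN₁m : Measurable N₁ := (measurable_const.mul (hγm.add hβm)).mul hαm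
  -- Here the local endpoint regularity of the solution is used: it makes the endpoint norm of the
  -- difference finite almost everywhere.
  have hN₁top : ∀ᵐ s, N₁ s < ⊤ := by
    have hγtop : ∀ᵐ s, γ s < ⊤ := by
      filter_upwards [ae_lt_top (hγm.pow_const 2) hγ.ne] with s hs
      exact (ENNReal.pow_lt_top_iff.1 hs).resolve_right (by norm_num)
    have hutop : ∀ᵐ s, gradLpNorm 3 (State.toDist (u s)) < ⊤ := by
      have hm := hu.1.measurable_gradLpNorm (p := 3) (by norm_num)
      have h : ∀ n : ℕ, ∀ᵐ s, s ∈ Set.Icc (-(n : ℝ)) n → gradLpNorm 3 (State.toDist (u s)) < ⊤ :=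
        fun n => by
          rw [← ae_restrict_iff' measurableSet_Icc]
          filter_upwards [ae_lt_top (hm.pow_const 2)
            (hu.lintegral_gradLpNorm_three_lt_top hκ (-(n : ℝ)) n).ne] with s hs
          exact (ENNReal.pow_lt_top_iff.1 hs).resolve_right (by norm_num)
      filter_upwards [ae_all_iff.2 h] with s hs
      obtain ⟨n, hn⟩ := exists_nat_ge |s|
      exact hs n (abs_le.1 hn)
    filter_upwards [hγtop, hutop] with s hs1 hs2
    have hβ : β s < ⊤ := ((hu.1.hasGrad s).gradLpNorm_sub_le (hua.hasGrad s)
      (by norm_num)).trans_lt (ENNReal.add_lt_top.2 ⟨hs2, hs1⟩)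
    exact ENNReal.mul_lt_top (ENNReal.mul_lt_top ENNReal.coe_lt_top
      (ENNReal.add_lt_top.2 ⟨hs1, hβ⟩)) (hw.1 s)
  set J := Set.uIcc a b
  have hJ : MeasurableSet J := measurableSet_uIcc
  set Γ := (∫⁻ t in J, γ t ^ 2) ^ (1 / 2 : ℝ) + (∫⁻ t in J, β t ^ 2) ^ (1 / 2 : ℝ)
  set P := pairConst κ * (α a + (nonlinConst * (A * Γ) + E))
  have hcomp : ∀ k j, (∀ t ∈ J, ‖Dw k j t‖ₑ ≤ P) ∧
      ∫⁻ t in J, eLpNorm (Dw k j t) 3 volume ^ 2 ≤ P ^ 2 := by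
    intro k j
    obtain ⟨N, g, hN, hNtop, hNE, hgm, hgb, hgi, hgD⟩ :=
      exists_duhamelEq_weakGrad hua (hG k j).1 (hG k j).2 h0 h1 ((hGE k j).trans_lt hE)
    have hui : ∀ t φ a b, IntervalIntegrable (fun s => ((-Complex.I) • nonlinGradTest (u s) k j)
        (sch (coeff κ j) (t - s) φ)) volume a b := fun t φ a b => by
      refine Continuous.intervalIntegrable ?_ a b
      have hc : Continuous fun s => (∂_{unitVec k} (sch (coeff κ j) (t - s) φ) : 𝓢(R6, ℂ)).toLp 3
          (volume : Measure R6) := by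
        simp_rw [← sch_lineDeriv]
        exact continuous_sch_sub_toLp_three _ t _
      exact continuous_const.mul (continuous_nonlinTest hu.1.continuous_apply j hc)
    have hD := (hu.duhamelEq_weakGrad k j).sub hgD hui hgi
    have hs := hD.strichartz_of_enorm (coeff_ne_zero hκ j) h0 h1 hN₁m hN (fun ψ => ?_)
      (fun s ψ => ?_) (by filter_upwards [hN₁top, hNtop] with s h h' using ⟨h, h'⟩) (fun ψ => ?_) a b
    · have hle : ENNReal.ofReal (linConst (coeff κ j)) * (‖Dw k j a‖ₑ +
          ((∫⁻ s in J, N₁ s ^ 2) ^ (1 / 2 : ℝ) +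
            (∫⁻ s in J, N s ^ (1 - θ / 2)⁻¹) ^ (1 - θ / 2))) ≤ P := by
        refine mul_le_mul' (linConst_le_pairConst κ j) (add_le_add ?_ (add_le_add
          (sqrt_lintegral_mul_sq_le hγm hβm hJ hA) ?_))
        · rw [hDw, Lp.enorm_def]
          exact (hw.hasGrad a).eLpNorm_le k j (by norm_num)
        · refine le_trans ?_ (hNE.trans (hGE k j))
          refine ENNReal.rpow_le_rpow (setLIntegral_le_lintegral _ _) (by linarith)
      exact ⟨fun t ht => (hs.1 t ht).trans hle, hs.2.trans (by gcongr)⟩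
    · exact ((hu.1.continuous_nonlinGradTest k j ψ).measurable.const_smul _).sub
        (((hgm ψ).add (hua.continuous_nonlinGradTest k j ψ).measurable).const_smul _)
    · have e : ((-Complex.I) • nonlinGradTest (u s) k j -
          (-Complex.I) • (g s + nonlinGradTest (ua s) k j)) ψ =
          (-Complex.I) * (nonlinGradTest (u s) k j ψ - nonlinGradTest (ua s) k j ψ) +
            Complex.I * g s ψ := by
        simp only [LinearMap.sub_apply, LinearMap.smul_apply, LinearMap.add_apply, smul_eq_mul]
        ring
      have hI : ‖Complex.I‖ₑ = 1 := by rw [← ofReal_norm, Complex.norm_I, ENNReal.ofReal_one]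
      rw [e]
      refine (enorm_add_le _ _).trans (add_le_add ?_ ?_)
      · rw [enorm_mul, enorm_neg, hI, one_mul]
        exact enorm_nonlinGradTest_sub_le (hu.1.hasGrad s) (hua.hasGrad s) k j ψ
      · rw [enorm_mul, hI, one_mul]
        exact hgb s ψ
    · exact (pair ψ).continuous.comp
        ((hu.1.continuous_weakGrad k j).sub (hua.continuous_weakGrad k j))
  -- Six derivatives of two functions are summed; the factor 144 in `perturbConst` leaves ample
  -- room.
  have h12 : 12 * P ≤ R := by
    rw [hR, perturbConst]
    have e1 : α a + (nonlinConst * (A * Γ) + E) ≤ (1 + nonlinConst) * (α a + E + A * Γ) := by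
      calc _ ≤ α a + (nonlinConst * (A * Γ) + E) + (A * Γ + nonlinConst * (α a + E)) := le_self_add
        _ = _ := by ring
    calc 12 * P ≤ 144 * (pairConst κ * ((1 + nonlinConst) * (α a + E + A * Γ))) := by
          refine mul_le_mul' (by norm_num) ?_
          simp only [P]
          gcongr
      _ = _ := by ring
  constructor
  · intro t ht
    rw [gradLpNorm_eq (hw.hasGrad t) (by norm_num)]
    calc _ ≤ ∑ k : Fin 6, ∑ j : Fin 2, P := by
          gcongr with k _ j _
          rw [← hDw, ← Lp.enorm_def]
          exact (hcomp k j).1 t ht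
      _ = 12 * P := by simp [← mul_assoc]; norm_num
      _ ≤ R := h12
  · have hDc : ∀ k j, Continuous (Dw k j) := fun k j =>
      (hu.1.continuous_weakGrad k j).sub (hua.continuous_weakGrad k j)
    have hDm : ∀ k j, Measurable fun t => eLpNorm (Dw k j t) 3 volume := fun k j =>
      measurable_eLpNorm_of_continuous (hDc k j) 3
    have e : ∀ t, β t = ∑ i : Fin 6 × Fin 2, eLpNorm (Dw i.1 i.2 t) 3 volume := fun t => by
      change gradLpNorm 3 (State.toDist (u t - ua t)) = _
      rw [gradLpNorm_eq (hw.hasGrad t) (by norm_num), Fintype.sum_prod_type]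
      exact Finset.sum_congr rfl fun k _ => Finset.sum_congr rfl fun j _ => by rw [hDw]
    have hsum := lintegral_sum_sq_le (B := P) Finset.univ
      (fun (i : Fin 6 × Fin 2) t => eLpNorm (Dw i.1 i.2 t) 3 volume) (fun i _ => hDm i.1 i.2) J
      (fun i _ => (hcomp i.1 i.2).2)
    have hcard : ((Finset.univ : Finset (Fin 6 × Fin 2)).card : ℝ≥0∞) = 12 := by
      simp
    rw [hcard] at hsum
    refine le_trans (le_of_eq (lintegral_congr fun t => ?_)) (hsum.trans (by gcongr))
    change β t ^ 2 = _
    rw [e]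

end QuadNLS
end

noncomputable section
namespace QuadNLS

/-! ### The continuity argument -/

/-- The integral from a is continuous in its other end, so the intermediate value theorem applies in
both directions of time. -/
theorem exists_setLIntegral_uIcc_eq {f : ℝ → ℝ≥0∞} (hfm : Measurable f)
    (hf : ∀ a b, ∫⁻ t in Set.uIcc a b, f t < ⊤) {a b : ℝ} {y : ℝ≥0∞}
    (hy : y ≤ ∫⁻ t in Set.uIcc a b, f t) : ∃ T ∈ Set.uIcc a b, ∫⁻ t in Set.uIcc a T, f t = y := by
  have hi : ∀ a b, IntervalIntegrable (fun t => (f t).toReal) volume a b := fun a b => by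
    rw [intervalIntegrable_iff]
    refine integrable_toReal_of_lintegral_ne_top hfm.aemeasurable (ne_of_lt ?_)
    exact (lintegral_mono_set Set.uIoc_subset_uIcc).trans_lt (hf a b)
  have hF : ∀ T, |∫ t in a..T, (f t).toReal| = (∫⁻ t in Set.uIcc a T, f t).toReal := fun T => by
    rw [intervalIntegral.abs_integral_eq_abs_integral_uIoc, setIntegral_congr_set uIoc_ae_eq_interval,
      abs_of_nonneg (integral_nonneg fun t => ENNReal.toReal_nonneg),
      integral_toReal hfm.aemeasurable (ae_lt_top hfm (hf a T).ne)]
  have hc : Continuous fun T => |∫ t in a..T, (f t).toReal| :=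
    (intervalIntegral.continuous_primitive hi a).abs
  have hmem : y.toReal ∈ Set.uIcc |∫ t in a..a, (f t).toReal| |∫ t in a..b, (f t).toReal| := by
    rw [intervalIntegral.integral_same, abs_zero, Set.uIcc_of_le (abs_nonneg _), hF]
    exact ⟨ENNReal.toReal_nonneg, ENNReal.toReal_mono (hf a b).ne hy⟩
  obtain ⟨T, hT, hTy⟩ := intermediate_value_uIcc hc.continuousOn hmem
  refine ⟨T, hT, ?_⟩
  simp only [hF] at hTy
  exact (ENNReal.toReal_eq_toReal_iff' (hf a T).ne (hy.trans_lt (hf a b)).ne).1 hTy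

theorem setLIntegral_uIcc_add {f : ℝ → ℝ≥0∞} {a b c : ℝ} (h : b ∈ Set.uIcc a c) :
    ∫⁻ t in Set.uIcc a c, f t = (∫⁻ t in Set.uIcc a b, f t) + ∫⁻ t in Set.uIcc b c, f t := by
  have hu : Set.uIcc a c = Set.uIcc a b ∪ Set.uIcc b c ∧ Set.uIcc a b ∩ Set.uIcc b c = {b} := by
    rcases le_total a c with hac | hac
    · rw [Set.uIcc_of_le hac] at h ⊢
      rw [Set.uIcc_of_le h.1, Set.uIcc_of_le h.2]
      exact ⟨(Set.Icc_union_Icc_eq_Icc h.1 h.2).symm, Set.Icc_inter_Icc_eq_singleton h.1 h.2⟩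
    · rw [Set.uIcc_of_ge hac] at h ⊢
      rw [Set.uIcc_of_ge h.1, Set.uIcc_of_ge h.2, Set.union_comm, Set.inter_comm]
      exact ⟨(Set.Icc_union_Icc_eq_Icc h.1 h.2).symm, Set.Icc_inter_Icc_eq_singleton h.1 h.2⟩
  have hd : AEDisjoint volume (Set.uIcc a b) (Set.uIcc b c) := by
    rw [AEDisjoint, hu.2, Real.volume_singleton]
  rw [hu.1, Measure.restrict_union₀ hd measurableSet_uIcc.nullMeasurableSet, lintegral_add_measure]

/-- The a priori estimate on intervals for the norms of the difference of two solutions. -/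
def BootstrapBound (α β γ : ℝ → ℝ≥0∞) (C E : ℝ≥0∞) : Prop :=
  ∀ a b A R, (∀ t ∈ Set.uIcc a b, α t ≤ A) →
    R = C * (α a + E + A * ((∫⁻ t in Set.uIcc a b, γ t ^ 2) ^ (1 / 2 : ℝ) +
      (∫⁻ t in Set.uIcc a b, β t ^ 2) ^ (1 / 2 : ℝ))) →
    (∀ t ∈ Set.uIcc a b, α t ≤ R) ∧ ∫⁻ t in Set.uIcc a b, β t ^ 2 ≤ R ^ 2

theorem ENNReal_rpow_half_le {x y : ℝ≥0∞} (h : x ≤ y ^ 2) : x ^ (1 / 2 : ℝ) ≤ y := by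
  refine (ENNReal.rpow_le_rpow h (by norm_num)).trans (le_of_eq ?_)
  rw [← ENNReal.rpow_natCast, ← ENNReal.rpow_mul]
  norm_num

section bootstrap

variable {α β γ : ℝ → ℝ≥0∞} {C : ℝ≥0} {E : ℝ≥0∞} (hα : Continuous α) (hαf : ∀ t, α t ≠ ⊤)
  (hβm : Measurable β) (hβ : ∀ a b, ∫⁻ t in Set.uIcc a b, β t ^ 2 < ⊤) (hC : 1 ≤ C)
  (H : BootstrapBound α β γ C E)

include hα hαf hC H in
-- The supremum A of α over the interval is finite by compactness. Each endpoint norm is at most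
-- 1/(4C), so the product term is at most A/2 and is absorbed.
theorem BootstrapBound.of_small {a b : ℝ}
    (hγ : ∫⁻ t in Set.uIcc a b, γ t ^ 2 ≤ ((4 * C : ℝ≥0)⁻¹ : ℝ≥0) ^ 2)
    (hb : ∫⁻ t in Set.uIcc a b, β t ^ 2 ≤ ((4 * C : ℝ≥0)⁻¹ : ℝ≥0) ^ 2) :
    (∀ t ∈ Set.uIcc a b, α t ≤ 2 * C * (α a + E)) ∧
      ∫⁻ t in Set.uIcc a b, β t ^ 2 ≤ (2 * C * (α a + E)) ^ 2 := by
  set J := Set.uIcc a b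
  set A := ⨆ t ∈ J, α t
  have hA : ∀ t ∈ J, α t ≤ A := fun t ht => le_iSup₂ (f := fun t _ => α t) t ht
  have hAf : A ≠ ⊤ := by
    obtain ⟨K, hK⟩ := exists_bound_of_continuous hα hαf (isCompact_uIcc (a := a) (b := b))
    exact ne_top_of_le_ne_top ENNReal.coe_ne_top (iSup₂_le hK)
  set X := C * (α a + E)
  set Γ := (∫⁻ t in J, γ t ^ 2) ^ (1 / 2 : ℝ) + (∫⁻ t in J, β t ^ 2) ^ (1 / 2 : ℝ)
  have hC0 : (C : ℝ≥0) ≠ 0 := (zero_lt_one.trans_le hC).ne'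
  have hΓ : C * Γ ≤ (2⁻¹ : ℝ≥0) := by
    have h1 : Γ ≤ ((4 * C : ℝ≥0)⁻¹ + (4 * C : ℝ≥0)⁻¹ : ℝ≥0) := by
      rw [ENNReal.coe_add]
      exact add_le_add (ENNReal_rpow_half_le hγ) (ENNReal_rpow_half_le hb)
    refine (mul_le_mul_right h1 (C : ℝ≥0∞)).trans ?_
    rw [← ENNReal.coe_mul, ENNReal.coe_le_coe]
    refine le_of_eq ?_
    field_simp
    norm_num
  have hH := H a b A _ hA rfl
  have hR : ∀ A' : ℝ≥0∞, C * (α a + E + A' * Γ) ≤ X + A' * (2⁻¹ : ℝ≥0) := fun A' => by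
    calc C * (α a + E + A' * Γ) = X + A' * (C * Γ) := by ring
      _ ≤ _ := by gcongr
  have hhalf : A * (2⁻¹ : ℝ≥0) + A * (2⁻¹ : ℝ≥0) = A := by
    rw [← mul_add, ← ENNReal.coe_add, ← two_mul, mul_inv_cancel₀ two_ne_zero, ENNReal.coe_one,
      mul_one]
  have hA2 : A * (2⁻¹ : ℝ≥0) ≤ X := by
    have h1 : A * (2⁻¹ : ℝ≥0) + A * (2⁻¹ : ℝ≥0) ≤ X + A * (2⁻¹ : ℝ≥0) := by
      rw [hhalf]
      exact (iSup₂_le hH.1).trans (hR A)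
    exact (ENNReal.add_le_add_iff_right (by finiteness)).1 h1
  have hfin : C * (α a + E + A * Γ) ≤ 2 * C * (α a + E) := by
    refine (hR A).trans ((add_le_add_right hA2 X).trans (le_of_eq ?_))
    simp only [X]
    ring
  exact ⟨fun t ht => (hH.1 t ht).trans hfin, hH.2.trans (by gcongr)⟩

include hα hαf hβm hβ hC H in
-- Were the endpoint norm of the difference to exceed 1/(4C), it would equal that value on some
-- subinterval, where `of_small` gives a strictly smaller bound.
theorem BootstrapBound.step {a b : ℝ}
    (hγ : ∫⁻ t in Set.uIcc a b, γ t ^ 2 ≤ ((4 * C : ℝ≥0)⁻¹ : ℝ≥0) ^ 2)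
    (hK : 2 * C * (α a + E) < ((4 * C : ℝ≥0)⁻¹ : ℝ≥0)) :
    (∀ t ∈ Set.uIcc a b, α t ≤ 2 * C * (α a + E)) ∧
      ∫⁻ t in Set.uIcc a b, β t ^ 2 ≤ (2 * C * (α a + E)) ^ 2 := by
  refine H.of_small hα hαf hC hγ (not_lt.1 fun hlt => ?_)
  obtain ⟨T, hT, hTe⟩ := exists_setLIntegral_uIcc_eq (hβm.pow_const 2) hβ hlt.le
  have hsub : Set.uIcc a T ⊆ Set.uIcc a b := Set.uIcc_subset_uIcc_left hT
  have h := (H.of_small hα hαf hC ((lintegral_mono_set hsub).trans hγ) hTe.le).2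
  rw [hTe] at h
  exact absurd h (not_le.2 (by gcongr))

include hα hαf hβm hβ hC H in
-- Each portion (4C)⁻² of the mass of γ² multiplies the energy bound by at most 4C, because α and E
-- are both below the current bound and 2C(α + E) is at most 4C times it. Smallness after N
-- multiplications guarantees that no step leaves the range of the continuity argument. In the
-- induction the interval is cut at a time where exactly n portions have been used.
theorem BootstrapBound.iterate (hγm : Measurable γ) {t₀ : ℝ} {e : ℝ≥0∞} (h0 : α t₀ ≤ e)
    (hE : E ≤ e) {N : ℕ} (hN : (4 * C : ℝ≥0∞) ^ N * e < ((4 * C : ℝ≥0)⁻¹ : ℝ≥0))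
    (hγ : ∀ a b, ∫⁻ t in Set.uIcc a b, γ t ^ 2 < ⊤) (n : ℕ) (hn : n < N) (T : ℝ)
    (hT : ∫⁻ t in Set.uIcc t₀ T, γ t ^ 2 ≤ n * ((4 * C : ℝ≥0)⁻¹ : ℝ≥0) ^ 2) :
    α T ≤ (4 * C : ℝ≥0∞) ^ (n + 1) * e ∧
      ∫⁻ t in Set.uIcc t₀ T, β t ^ 2 ≤ (n + 1) * ((4 * C : ℝ≥0∞) ^ N * e) ^ 2 := by
  set d : ℝ≥0 := (4 * C : ℝ≥0)⁻¹
  have h4 : (1 : ℝ≥0∞) ≤ 4 * C :=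
    one_le_mul_of_one_le_of_one_le (by norm_num) (by exact_mod_cast hC)
  have hstep : ∀ m a T, m < N → α a ≤ (4 * C : ℝ≥0∞) ^ m * e →
      ∫⁻ t in Set.uIcc a T, γ t ^ 2 ≤ (d : ℝ≥0∞) ^ 2 → α T ≤ (4 * C : ℝ≥0∞) ^ (m + 1) * e ∧
        ∫⁻ t in Set.uIcc a T, β t ^ 2 ≤ ((4 * C : ℝ≥0∞) ^ N * e) ^ 2 := fun m a T hm ha hg => by
    have hEm : E ≤ (4 * C : ℝ≥0∞) ^ m * e :=
      hE.trans (le_mul_of_one_le_left' (one_le_pow_of_one_le' h4 m))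
    have h1 : 2 * C * (α a + E) ≤ (4 * C : ℝ≥0∞) ^ (m + 1) * e := by
      refine (mul_le_mul_right (add_le_add ha hEm) _).trans (le_of_eq ?_)
      ring
    have h2 : (4 * C : ℝ≥0∞) ^ (m + 1) * e ≤ (4 * C : ℝ≥0∞) ^ N * e := by
      gcongr
      omega
    have hs := H.step hα hαf hβm hβ hC hg ((h1.trans h2).trans_lt hN)
    exact ⟨(hs.1 T Set.right_mem_uIcc).trans h1, hs.2.trans (pow_le_pow_left' (h1.trans h2) 2)⟩
  induction n generalizing T with
  | zero =>
    have h := hstep 0 t₀ T hn (by simpa using h0) (hT.trans (by simp))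
    simpa using h
  | succ n ih =>
    rcases le_or_gt (∫⁻ t in Set.uIcc t₀ T, γ t ^ 2) (n * (d : ℝ≥0∞) ^ 2) with hle | hlt
    · obtain ⟨h1, h2⟩ := ih (by omega) T hle
      refine ⟨h1.trans ?_, h2.trans ?_⟩
      · gcongr
        omega
      · gcongr
        exact_mod_cast Nat.le_succ n
    · obtain ⟨T', hT', he⟩ := exists_setLIntegral_uIcc_eq (hγm.pow_const 2) hγ hlt.le
      obtain ⟨h1, h2⟩ := ih (by omega) T' he.le
      have hm : ∫⁻ t in Set.uIcc T' T, γ t ^ 2 ≤ (d : ℝ≥0∞) ^ 2 := by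
        rw [setLIntegral_uIcc_add hT', he] at hT
        refine (ENNReal.add_le_add_iff_left (a := n * (d : ℝ≥0∞) ^ 2) (by finiteness)).1
          (hT.trans (le_of_eq ?_))
        push_cast
        ring
      obtain ⟨h3, h4'⟩ := hstep (n + 1) T' T hn h1 hm
      refine ⟨h3, ?_⟩
      rw [setLIntegral_uIcc_add hT']
      refine (add_le_add h2 h4').trans (le_of_eq ?_)
      push_cast
      ring

include hα hαf hβm hβ hC H in
-- The line is exhausted by intervals centred at t₀, and the factor 2 counts the two directions of
-- time.
theorem BootstrapBound.bound (hγm : Measurable γ) {t₀ : ℝ} {e : ℝ≥0∞} (h0 : α t₀ ≤ e)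
    (hE : E ≤ e) {N : ℕ} (hN : (4 * C : ℝ≥0∞) ^ (N + 1) * e < ((4 * C : ℝ≥0)⁻¹ : ℝ≥0))
    (hγ : ∫⁻ t, γ t ^ 2 ≤ N * ((4 * C : ℝ≥0)⁻¹ : ℝ≥0) ^ 2) :
    (∀ t, α t ≤ 1) ∧ ∫⁻ t, β t ^ 2 ≤ 2 * (N + 1) := by
  have hd1 : (((4 * C : ℝ≥0)⁻¹ : ℝ≥0) : ℝ≥0∞) ≤ 1 := by
    rw [← ENNReal.coe_one, ENNReal.coe_le_coe]
    exact inv_le_one_of_one_le₀ (one_le_mul_of_one_le_of_one_le (by norm_num) hC)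
  have hK : (4 * C : ℝ≥0∞) ^ (N + 1) * e ≤ 1 := hN.le.trans hd1
  have hT : ∀ T, ∫⁻ t in Set.uIcc t₀ T, γ t ^ 2 ≤ N * ((4 * C : ℝ≥0)⁻¹ : ℝ≥0) ^ 2 := fun T =>
    (setLIntegral_le_lintegral _ _).trans hγ
  have hmain := fun T => H.iterate hα hαf hβm hβ hC hγm h0 hE hN
    (fun a b => ((setLIntegral_le_lintegral _ _).trans hγ).trans_lt (by finiteness)) N
    (Nat.lt_succ_self N) T (hT T)
  refine ⟨fun t => (hmain t).1.trans hK, ?_⟩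
  have hb : ∀ T, ∫⁻ t in Set.uIcc t₀ T, β t ^ 2 ≤ N + 1 := fun T =>
    (hmain T).2.trans (mul_le_of_le_one_right' (pow_le_one' hK 2))
  have hu : (⋃ n : ℕ, Set.Icc (t₀ - n) (t₀ + n)) = Set.univ := by
    refine Set.eq_univ_of_forall fun t => Set.mem_iUnion.2 ?_
    obtain ⟨n, hn⟩ := exists_nat_ge |t - t₀|
    obtain ⟨h1, h2⟩ := abs_le.1 hn
    exact ⟨n, by linarith, by linarith⟩
  have hdir : Directed (· ⊆ ·) fun n : ℕ => Set.Icc (t₀ - n) (t₀ + n) := by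
    refine directed_of_isDirected_le fun m n hmn => Set.Icc_subset_Icc ?_ ?_
    · have : (m : ℝ) ≤ n := by exact_mod_cast hmn
      linarith
    · have : (m : ℝ) ≤ n := by exact_mod_cast hmn
      linarith
  rw [← setLIntegral_univ, ← hu, setLIntegral_iUnion_of_directed _ hdir]
  refine iSup_le fun n => ?_
  have hn : (0 : ℝ) ≤ n := Nat.cast_nonneg n
  have hsub : Set.Icc (t₀ - n) (t₀ + n) ⊆ Set.uIcc t₀ (t₀ - n) ∪ Set.uIcc t₀ (t₀ + n) := by
    rw [Set.uIcc_of_ge (by linarith), Set.uIcc_of_le (by linarith)]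
    exact fun t ht => (le_total t t₀).imp (fun h => ⟨ht.1, h⟩) fun h => ⟨h, ht.2⟩
  refine (lintegral_mono_set hsub).trans ((lintegral_union_le _ _ _).trans ?_)
  rw [two_mul]
  exact add_le_add (hb _) (hb _)

end bootstrap

/-! ### Admissible pairs -/

theorem toReal_inv_eq {r : ℝ≥0∞} {x : ℝ} (hx : 0 < x) (h : (r⁻¹).toReal = x) :
    r = ENNReal.ofReal x⁻¹ := by
  have h1 : r⁻¹ ≠ ⊤ := fun h' => by rw [h', ENNReal.toReal_top] at h; exact hx.ne h
  rw [ENNReal.ofReal_inv_of_pos hx, ← h, ENNReal.ofReal_toReal h1, inv_inv]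

/-- The parameter is θ = 2/q, which q ≥ 2 confines to [0, 1]; it runs over the segment from the
energy pair with q = ∞ to the endpoint pair with q = 2. -/
theorem Admissible.exists_param {s : ℝ} {q r : ℝ≥0∞} (h : Admissible s q r) (hs : s ≤ 1) :
    ∃ θ : ℝ, 0 ≤ θ ∧ θ ≤ 1 ∧ q⁻¹ = ENNReal.ofReal (θ / 2) ∧
      (r⁻¹).toReal = 1 / 2 - s / 6 - θ / 6 ∧ r = ENNReal.ofReal (1 / 2 - s / 6 - θ / 6)⁻¹ := by
  have hq : q⁻¹ ≤ 2⁻¹ := ENNReal.inv_le_inv.2 h.1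
  have hqf : q⁻¹ ≠ ⊤ := ne_top_of_le_ne_top (by simp) hq
  have hq2 : (q⁻¹).toReal ≤ 1 / 2 := by
    have := ENNReal.toReal_mono (by simp) hq
    simpa using this
  have hr : (r⁻¹).toReal = 1 / 2 - s / 6 - 2 * (q⁻¹).toReal / 6 := by linarith [h.2]
  refine ⟨2 * (q⁻¹).toReal, by positivity, by linarith, ?_, hr, toReal_inv_eq (by linarith) hr⟩
  rw [mul_div_cancel_left₀ _ two_ne_zero, ENNReal.ofReal_toReal hqf]

theorem conjExp_eq {q : ℝ≥0∞} {x : ℝ} (h0 : 0 ≤ x) (h1 : x < 1) (h : q⁻¹ = ENNReal.ofReal x) :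
    conjExp q = ENNReal.ofReal (1 - x)⁻¹ := by
  rw [conjExp, h, ENNReal.ofReal_inv_of_pos (by linarith), ENNReal.ofReal_sub _ h0,
    ENNReal.ofReal_one]

theorem admissible_two_three : Admissible 0 2 3 := by
  refine ⟨le_rfl, ?_⟩
  simp only [ENNReal.toReal_inv, ENNReal.toReal_ofNat]
  norm_num

theorem admissible_top_two : Admissible 0 ⊤ 2 := by
  refine ⟨le_top, ?_⟩
  simp

theorem strichartzNorm_grad_le (U : ℝ → Fin 2 → 𝓢'(R6, ℂ)) {q r : ℝ≥0∞} (h : Admissible 0 q r) :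
    eLpNorm (fun t => gradLpNorm r (U t)) q volume ≤ strichartzNorm U :=
  le_trans (le_iSup₂_of_le (f := fun (q r : ℝ≥0∞) => ⨆ (_ : Admissible 0 q r),
    eLpNorm (fun t => gradLpNorm r (U t)) q volume) q r
    (le_iSup (fun _ : Admissible 0 q r => eLpNorm (fun t => gradLpNorm r (U t)) q volume) h))
    (le_max_right _ _)

/-- Interpolation in time between an essential bound and a square integral; θ = 0 is treated apart
because q is then infinite. -/
theorem eLpNorm_time_interp_le {f α β : ℝ → ℝ≥0∞} {θ : ℝ} (h0 : 0 ≤ θ) (h1 : θ ≤ 1) {c P : ℝ≥0}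
    (hf : ∀ t, f t ≤ c * (α t ^ (1 - θ) * β t ^ θ)) (hα : ∀ᵐ t, α t ≤ P)
    (hβ : ∫⁻ t, β t ^ 2 ≤ (P : ℝ≥0∞) ^ 2) {q : ℝ≥0∞} (hq : q⁻¹ = ENNReal.ofReal (θ / 2)) :
    eLpNorm f q volume ≤ c * P := by
  rcases h0.eq_or_lt with rfl | hθ
  · have hq' : q = ⊤ := by simpa using hq
    rw [hq', eLpNorm_exponent_top]
    refine eLpNormEssSup_le_of_ae_enorm_bound (hα.mono fun t ht => ?_)
    refine (hf t).trans ?_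
    simpa using mul_le_mul_right ht (c : ℝ≥0∞)
  · have hq' : q = ENNReal.ofReal (θ / 2)⁻¹ := by
      rw [ENNReal.ofReal_inv_of_pos (by positivity), ← hq, inv_inv]
    have hp : (0 : ℝ) < (θ / 2)⁻¹ := by positivity
    rw [hq', eLpNorm_eq_lintegral_rpow_enorm_toReal (ENNReal.ofReal_pos.2 hp).ne'
      ENNReal.ofReal_ne_top, ENNReal.toReal_ofReal hp.le, one_div, inv_inv]
    have hle : ∫⁻ t, ‖f t‖ₑ ^ (θ / 2)⁻¹ ≤
        ∫⁻ t, ((c : ℝ≥0∞) * (P : ℝ≥0∞) ^ (1 - θ)) ^ (θ / 2)⁻¹ * β t ^ 2 := by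
      refine lintegral_mono_ae (hα.mono fun t ht => ?_)
      have h2 : f t ≤ (c * (P : ℝ≥0∞) ^ (1 - θ)) * β t ^ θ := by
        refine (hf t).trans ?_
        rw [mul_assoc]
        gcongr
      rw [enorm_eq_self]
      refine (ENNReal.rpow_le_rpow h2 hp.le).trans (le_of_eq ?_)
      rw [ENNReal.mul_rpow_of_nonneg _ _ hp.le, ← ENNReal.rpow_mul, ← ENNReal.rpow_natCast]
      congr 2
      push_cast
      field_simp
    rw [lintegral_const_mul' _ _ (by
      refine ENNReal.rpow_ne_top_of_nonneg hp.le (ENNReal.mul_ne_top ENNReal.coe_ne_top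
        (ENNReal.rpow_ne_top_of_nonneg (by linarith) ENNReal.coe_ne_top)))] at hle
    refine (ENNReal.rpow_le_rpow (hle.trans (mul_le_mul_right hβ _)) (by positivity)).trans ?_
    rw [ENNReal.mul_rpow_of_nonneg _ _ (by positivity), ← ENNReal.rpow_mul,
      inv_mul_cancel₀ (by positivity), ENNReal.rpow_one, ← ENNReal.rpow_natCast,
      ← ENNReal.rpow_mul, mul_assoc, ← ENNReal.rpow_add_of_nonneg _ _ (by linarith) (by positivity)]
    refine le_of_eq ?_
    have e : 1 - θ + ((2 : ℕ) : ℝ) * (θ / 2) = 1 := by push_cast; ring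
    rw [e, ENNReal.rpow_one]

/-- Propagating the test function by -t undoes the flow, at no cost in L². -/
theorem eLpNorm_weakGrad_le_flow {w : State} (hw : HasGrad w) (κ t : ℝ) (k : Fin 6) (j : Fin 2) :
    eLpNorm (weakGrad k (w j)) 2 volume ≤
      scalarLpNorm 2 (∂_{unitVec k} (flow κ t (State.toDist w) j)) := by
  refine le_iInf fun g => le_iInf fun hg => le_iInf fun h => ?_
  refine eLpNorm_two_le_of_forall_schwartz (Lp.memLp _) fun φ => ?_
  set c := coeff κ j
  have h1 := h (sch c (-t) φ)
  have h2 : (∂_{unitVec k} (flow κ t (State.toDist w) j)) (sch c (-t) φ) =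
      pair φ (weakGrad k (w j)) := by
    change flow κ t (State.toDist w) j (-∂_{unitVec k} (sch c (-t) φ)) = _
    rw [map_neg, flow_apply, toDist_apply, sch_lineDeriv, sch_sch, add_neg_cancel, sch_zero,
      hasWeakDeriv_iff_pair.1 (hw k j)]
  rw [h2, pair_apply] at h1
  rw [h1]
  have h3 := enorm_integral_mul_le (p := 2) (q := 2) (aesm_schwartz (sch c (-t) φ)) hg.1
  refine h3.trans ?_
  rw [mul_comm, ← enorm_toLp, ← enorm_toLp, ← ofReal_norm, ← ofReal_norm, norm_sch_toLp_two]

theorem HasGrad.gradLpNorm_le_flow {w : State} (hw : HasGrad w) (κ t : ℝ) :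
    gradLpNorm 2 (State.toDist w) ≤ gradLpNorm 2 (flow κ t (State.toDist w)) := by
  rw [gradLpNorm_eq hw (by norm_num)]
  exact Finset.sum_le_sum fun k _ => Finset.sum_le_sum fun j _ =>
    eLpNorm_weakGrad_le_flow hw κ t k j

end QuadNLS
end

noncomputable section
namespace QuadNLS

/-! ### Long time perturbation theory -/

theorem ENNReal_sum_mul_rpow_le {ι : Type*} (s : Finset ι) {f a b : ι → ℝ≥0∞} {A B : ℝ≥0∞} {θ : ℝ}
    (h0 : 0 ≤ θ) (h1 : θ ≤ 1) (hf : ∀ i ∈ s, f i ≤ a i ^ (1 - θ) * b i ^ θ)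
    (ha : ∀ i ∈ s, a i ≤ A) (hb : ∀ i ∈ s, b i ≤ B) :
    ∑ i ∈ s, f i ≤ s.card * (A ^ (1 - θ) * B ^ θ) := by
  rw [← nsmul_eq_mul]
  refine Finset.sum_le_card_nsmul _ _ _ fun i hi => (hf i hi).trans (mul_le_mul' ?_ ?_)
  · exact ENNReal.rpow_le_rpow (ha i hi) (by linarith)
  · exact ENNReal.rpow_le_rpow (hb i hi) h0

/-- Every norm in the supremum interpolates between the energy and endpoint norms; those without a
gradient pass through the Sobolev embeddings into L³ and L⁶. The factors 2 and 12 count components.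
-/
theorem strichartzNorm_le {u : ℝ → State} (hu : ContinuousHdot1 u) {P : ℝ≥0}
    (hα : ∀ᵐ t, gradLpNorm 2 (State.toDist (u t)) ≤ P)
    (hβ : ∫⁻ t, gradLpNorm 3 (State.toDist (u t)) ^ 2 ≤ (P : ℝ≥0∞) ^ 2) :
    strichartzNorm (fun t => State.toDist (u t)) ≤
      ((2 * ((sobolevConst 2 + sobolevConst 3) * P) + 12 * P : ℝ≥0) : ℝ≥0∞) := by
  set S : ℝ≥0 := sobolevConst 2 + sobolevConst 3
  refine max_le (iSup_le fun q => iSup_le fun r => iSup_le fun h => ?_)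
    (iSup_le fun q => iSup_le fun r => iSup_le fun h => ?_)
  · obtain ⟨θ, h0, h1, hq, -, hr⟩ := h.exists_param le_rfl
    have hx : (0 : ℝ) < 1 / 2 - 1 / 6 - θ / 6 := by linarith
    have hr1 : 1 ≤ r := by
      rw [hr, ENNReal.one_le_ofReal]; exact (one_le_inv₀ hx).2 (by linarith)
    refine (eLpNorm_time_interp_le (α := fun t => S * gradLpNorm 2 (State.toDist (u t)))
      (β := fun t => S * gradLpNorm 3 (State.toDist (u t))) (c := 2) (P := S * P) h0 h1
      (fun t => ?_) ?_ ?_ hq).trans ?_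
    · rw [lpNorm_toDist _ hr1]
      refine (ENNReal_sum_mul_rpow_le Finset.univ (a := fun j => eLpNorm (u t j) 3 volume)
        (b := fun j => eLpNorm (u t j) 6 volume) (A := S * gradLpNorm 2 (State.toDist (u t)))
        (B := S * gradLpNorm 3 (State.toDist (u t))) h0 h1 (fun j _ => ?_)
        (fun j _ => ((hu.hasGrad t).sobolev_three j).trans ?_)
        (fun j _ => ((hu.hasGrad t).sobolev_six j).trans ?_)).trans (le_of_eq ?_)
      · have := eLpNorm_le_interp (Lp.aestronglyMeasurable (u t j)) (p := 3) (q := 6)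
          (r := (1 / 2 - 1 / 6 - θ / 6)⁻¹) (θ := θ) (by norm_num) (by norm_num) (inv_pos.2 hx) h0 h1
          (by rw [one_div, inv_inv]; ring)
        rw [hr]
        simpa using this
      · gcongr
        exact le_self_add
      · gcongr
        exact le_add_self
      · simp
    · filter_upwards [hα] with t ht
      rw [ENNReal.coe_mul]
      gcongr
    · have e : ∀ t, (S * gradLpNorm 3 (State.toDist (u t))) ^ 2 =
          (S : ℝ≥0∞) ^ 2 * gradLpNorm 3 (State.toDist (u t)) ^ 2 := fun t => mul_pow _ _ _
      simp_rw [e]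
      rw [lintegral_const_mul' _ _ (by finiteness), ENNReal.coe_mul, mul_pow]
      gcongr
    · rw [← ENNReal.coe_mul, ENNReal.coe_le_coe]
      exact le_self_add
  · obtain ⟨θ, h0, h1, hq, -, hr⟩ := h.exists_param zero_le_one
    have hx : (0 : ℝ) < 1 / 2 - 0 / 6 - θ / 6 := by linarith
    have hr1 : 1 ≤ r := by
      rw [hr, ENNReal.one_le_ofReal]; exact (one_le_inv₀ hx).2 (by linarith)
    refine (eLpNorm_time_interp_le (α := fun t => gradLpNorm 2 (State.toDist (u t)))
      (β := fun t => gradLpNorm 3 (State.toDist (u t))) (c := 12) (P := P) h0 h1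
      (fun t => ?_) hα hβ hq).trans ?_
    · rw [gradLpNorm_eq (hu.hasGrad t) hr1,
        ← Fintype.sum_prod_type' (fun k j => eLpNorm (weakGrad k (u t j)) r volume)]
      refine (ENNReal_sum_mul_rpow_le _
        (a := fun i : Fin 6 × Fin 2 => eLpNorm (weakGrad i.1 (u t i.2)) 2 volume)
        (b := fun i => eLpNorm (weakGrad i.1 (u t i.2)) 3 volume) h0 h1 (fun i _ => ?_)
        (fun i _ => (hu.hasGrad t).eLpNorm_le i.1 i.2 (by norm_num))
        (fun i _ => (hu.hasGrad t).eLpNorm_le i.1 i.2 (by norm_num))).trans (le_of_eq ?_)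
      · have := eLpNorm_le_interp (Lp.aestronglyMeasurable (weakGrad i.1 (u t i.2))) (p := 2) (q := 3)
          (r := (1 / 2 - 0 / 6 - θ / 6)⁻¹) (θ := θ) (by norm_num) (by norm_num) (inv_pos.2 hx) h0 h1
          (by rw [one_div, inv_inv]; ring)
        rw [hr]
        simpa using this
      · simp
    · rw [← ENNReal.coe_mul, ENNReal.coe_le_coe]
      exact le_add_self

/-- The error norm is an infimum that may not be attained, hence the strict inequality. -/
theorem exists_errorGradient {κ : ℝ} {u : ℝ → State} {E : ℝ≥0∞} (h : gradErrorNorm κ u < E) :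
    ∃ (G : Fin 6 → Fin 2 → ℝ × R6 → ℂ) (θ : ℝ), IsErrorGradient κ u G ∧ 0 ≤ θ ∧ θ ≤ 1 ∧
      ∀ k j, eLpNorm (fun t => eLpNorm (fun x => G k j (t, x))
        (ENNReal.ofReal (1 / 2 + θ / 6)⁻¹) volume) (ENNReal.ofReal (1 - θ / 2)⁻¹) volume ≤ E := by
  simp only [gradErrorNorm, iInf_lt_iff] at h
  obtain ⟨q, r, hqr, G, hG, hlt⟩ := h
  obtain ⟨θ, h0, h1, hq, hr, hr'⟩ := hqr.exists_param zero_le_one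
  refine ⟨G, θ, hG, h0, h1, fun k j => le_trans ?_ hlt.le⟩
  have hx : (0 : ℝ) < 1 / 2 - 0 / 6 - θ / 6 := by linarith
  have e1 : conjExp r = ENNReal.ofReal (1 / 2 + θ / 6)⁻¹ := by
    rw [conjExp_eq hx.le (by linarith) (by rw [hr', ENNReal.ofReal_inv_of_pos hx, inv_inv])]
    congr 2
    ring
  rw [conjExp_eq (by positivity) (by linarith) hq, e1]
  refine eLpNorm_mono_enorm fun t => ?_
  simp only [enorm_eq_self]
  refine le_trans ?_ (Finset.single_le_sum (f := fun k => ∑ j, eLpNorm (fun x => G k j (t, x))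
    (ENNReal.ofReal (1 / 2 + θ / 6)⁻¹) volume) (fun _ _ => zero_le) (Finset.mem_univ k))
  exact Finset.single_le_sum (f := fun j => eLpNorm (fun x => G k j (t, x))
    (ENNReal.ofReal (1 / 2 + θ / 6)⁻¹) volume) (fun _ _ => zero_le) (Finset.mem_univ j)

theorem lintegral_sq_le_of_eLpNorm_two_le {f : ℝ → ℝ≥0∞} {M : ℝ≥0∞} (h : eLpNorm f 2 volume ≤ M) :
    ∫⁻ t, f t ^ 2 ≤ M ^ 2 := by
  have h1 := pow_le_pow_left' h 2
  rw [eLpNorm_eq_lintegral_rpow_enorm_toReal (by norm_num) (by norm_num),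
    ← ENNReal.rpow_mul_natCast] at h1
  simpa using h1

theorem one_le_perturbConst (κ : ℝ) : 1 ≤ perturbConst κ := by
  have h1 : 1 ≤ pairConst κ := by
    refine le_trans ?_ (le_self_add (b := ENNReal.ofReal (linConst κ)))
    rw [ENNReal.one_le_ofReal]
    exact one_le_linConst 1
  exact one_le_mul_of_one_le_of_one_le (one_le_mul_of_one_le_of_one_le (by norm_num) h1) le_self_add

theorem ae_le_of_strichartzNorm_le {U : ℝ → Fin 2 → 𝓢'(R6, ℂ)} {M : ℝ≥0∞}
    (h : strichartzNorm U ≤ M) : ∀ᵐ t, gradLpNorm 2 (U t) ≤ M := by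
  have h1 := (strichartzNorm_grad_le U admissible_top_two).trans h
  rw [eLpNorm_exponent_top] at h1
  filter_upwards [ae_le_eLpNormEssSup (f := fun t => gradLpNorm 2 (U t)) (μ := volume)] with t ht
  exact ht.trans h1

theorem bootstrapBound_sub {κ : ℝ} (hκ : 0 < κ) {u ua : ℝ → State} (hu : IsSolution κ u)
    (hua : ContinuousHdot1 ua) (hγ : ∫⁻ t, gradLpNorm 3 (State.toDist (ua t)) ^ 2 < ⊤)
    {E : ℝ≥0∞} (hE : E < ⊤) (he : gradErrorNorm κ ua < E) {C : ℝ≥0} (hC : (C : ℝ≥0∞) = perturbConst κ) :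
    BootstrapBound (fun t => gradLpNorm 2 (State.toDist (u t - ua t)))
      (fun t => gradLpNorm 3 (State.toDist (u t - ua t)))
      (fun t => gradLpNorm 3 (State.toDist (ua t))) C E := by
  obtain ⟨G, θ, hG, h0, h1, hGE⟩ := exists_errorGradient he
  intro a b A R hA hR
  rw [hC] at hR
  exact perturbation_estimate hκ hu hua hγ hG h0 h1 hE hGE a b hA hR

theorem lintegral_sq_add_le {f g h : ℝ → ℝ≥0∞} (hf : Measurable f) (hg : Measurable g)
    {J : Set ℝ} (hh : ∀ t, h t ≤ f t + g t) {A B : ℝ≥0∞} (hA : ∫⁻ t in J, f t ^ 2 ≤ A ^ 2)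
    (hB : ∫⁻ t in J, g t ^ 2 ≤ B ^ 2) : ∫⁻ t in J, h t ^ 2 ≤ (A + B) ^ 2 := by
  have h2 := ENNReal.lintegral_Lp_add_le (μ := volume.restrict J) hf.aemeasurable hg.aemeasurable
    (p := 2) (by norm_num)
  simp only [Pi.add_apply, ENNReal.rpow_two] at h2
  have h3 := h2.trans (add_le_add (ENNReal_rpow_half_le hA) (ENNReal_rpow_half_le hB))
  refine (lintegral_mono fun t => pow_le_pow_left' (hh t) 2).trans ?_
  refine le_trans (le_of_eq ?_) (pow_le_pow_left' h3 2)
  rw [← ENNReal.rpow_mul_natCast]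
  norm_num

theorem long_time_perturbation (κ : ℝ) (hκ : 0 < κ) (M : ℝ≥0) :
    ∃ ε L : ℝ≥0, 0 < ε ∧ ε < 1 ∧ 1 < L ∧ ∀ (u ua : ℝ → State) (t₀ : ℝ), IsSolution κ u →
      ContinuousHdot1 ua → strichartzNorm (fun t => State.toDist (ua t)) ≤ M →
      gradErrorNorm κ ua ≤ ε →
      strichartzNorm (fun t => flow κ (t - t₀) (State.toDist (u t₀ - ua t₀))) ≤ ε →
      strichartzNorm (fun t => State.toDist (u t)) ≤ L := by
  obtain ⟨C, hCe, hC⟩ : ∃ C : ℝ≥0, (C : ℝ≥0∞) = perturbConst κ ∧ 1 ≤ C := by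
    have h := ENNReal.coe_toNNReal (perturbConst_ne_top κ)
    refine ⟨_, h, ?_⟩
    rw [← ENNReal.coe_le_coe, h, ENNReal.coe_one]
    exact one_le_perturbConst κ
  have hC4 : 0 < 4 * C := mul_pos (by norm_num) (zero_lt_one.trans_le hC)
  have hd : 0 < (4 * C)⁻¹ := inv_pos.2 hC4
  -- The number of portions (4C)⁻² that exhaust the mass M² of the approximate solution.
  obtain ⟨N, hN⟩ := exists_nat_ge (M ^ 2 / (4 * C)⁻¹ ^ 2)
  -- The data and the error must remain below 1/(4C) after N + 1 multiplications by 4C. They enter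
  -- as 2ε because the error is required to lie strictly below its bound.
  obtain ⟨ε, hε, hε1, hKε⟩ : ∃ ε : ℝ≥0, 0 < ε ∧ ε < 1 ∧
      (4 * C : ℝ≥0∞) ^ (N + 1) * ((2 * ε : ℝ≥0) : ℝ≥0∞) < ((4 * C)⁻¹ : ℝ≥0) := by
    set K : ℝ≥0 := (4 * C) ^ (N + 1)
    have hK : 0 < K := pow_pos hC4 _
    refine ⟨min (1 / 2) ((4 * C)⁻¹ / (4 * K)), lt_min (by norm_num) (by positivity),
      (min_le_left _ _).trans_lt (by norm_num), ?_⟩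
    have h1 : K * (2 * min (1 / 2) ((4 * C)⁻¹ / (4 * K))) ≤ (4 * C)⁻¹ / 2 := by
      calc _ ≤ K * (2 * ((4 * C)⁻¹ / (4 * K))) := by gcongr; exact min_le_right _ _
        _ = (4 * C)⁻¹ / 2 := by field_simp; norm_num
    have h2 := ENNReal.coe_lt_coe.2 (h1.trans_lt (NNReal.half_lt_self hd.ne'))
    rw [ENNReal.coe_mul, ENNReal.coe_pow, ENNReal.coe_mul] at h2
    exact h2
  -- Large enough for both norms of u: M + 1 for the energy, and M plus the square root of 2(N + 1)
  -- for the endpoint.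
  set P : ℝ≥0 := M + (2 * (N + 1))
  have hP : (P : ℝ≥0∞) = M + 2 * (N + 1) := by
    simp only [P, ENNReal.coe_add, ENNReal.coe_mul, ENNReal.coe_natCast, ENNReal.coe_one,
      ENNReal.coe_ofNat]
  refine ⟨ε, 2 * ((sobolevConst 2 + sobolevConst 3) * P) + 12 * P, hε, hε1, ?_, ?_⟩
  · have h1 : (1 : ℝ≥0) ≤ P := by
      refine le_trans ?_ (le_add_self (a := 2 * ((N : ℝ≥0) + 1)))
      exact one_le_mul_of_one_le_of_one_le (by norm_num) le_add_self
    calc (1 : ℝ≥0) < 12 * 1 := by norm_num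
      _ ≤ 12 * P := by gcongr
      _ ≤ _ := le_add_self
  · intro u ua t₀ hu hua hM he hw
    have hsub := hu.1.sub hua
    have hγ : ∫⁻ t, gradLpNorm 3 (State.toDist (ua t)) ^ 2 ≤ (M : ℝ≥0∞) ^ 2 :=
      lintegral_sq_le_of_eLpNorm_two_le ((strichartzNorm_grad_le _ admissible_two_three).trans hM)
    have hγf : ∫⁻ t, gradLpNorm 3 (State.toDist (ua t)) ^ 2 < ⊤ := hγ.trans_lt (by finiteness)
    have hγm := hua.measurable_gradLpNorm (p := 3) (by norm_num)
    have hβm := hsub.measurable_gradLpNorm (p := 3) (by norm_num)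
    have hE : gradErrorNorm κ ua < ((2 * ε : ℝ≥0) : ℝ≥0∞) := by
      refine he.trans_lt (ENNReal.coe_lt_coe.2 ?_)
      rw [two_mul]
      exact lt_add_of_pos_left ε hε
    have hB := bootstrapBound_sub hκ hu hua hγf ENNReal.coe_lt_top hE hCe
    have hβ : ∀ a b, ∫⁻ t in Set.uIcc a b, gradLpNorm 3 (State.toDist (u t - ua t)) ^ 2 < ⊤ :=
      fun a b => by
        have h1 := hu.lintegral_gradLpNorm_three_lt_top hκ (min a b) (max a b)
        set Y := ∫⁻ t in Set.Icc (min a b) (max a b), gradLpNorm 3 (State.toDist (u t)) ^ 2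
        have h2 : Y ≤ (1 + Y) ^ 2 := by
          calc Y ≤ Y + (1 + Y + Y ^ 2) := le_self_add
            _ = _ := by ring
        refine (lintegral_sq_add_le (hu.1.measurable_gradLpNorm (p := 3) (by norm_num)) hγm
          (fun t => (hu.1.hasGrad t).gradLpNorm_sub_le (hua.hasGrad t) (by norm_num)) h2
          ((setLIntegral_le_lintegral _ _).trans hγ)).trans_lt ?_
        finiteness
    have h0 : gradLpNorm 2 (State.toDist (u t₀ - ua t₀)) ≤ ((2 * ε : ℝ≥0) : ℝ≥0∞) := by
      -- The energy pair bounds the evolved gradient at almost every time; one time is enough, as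
      -- the flow can be undone in L².
      obtain ⟨t, ht⟩ := (ae_le_of_strichartzNorm_le hw).exists
      refine ((hsub.hasGrad t₀).gradLpNorm_le_flow κ (t - t₀)).trans (ht.trans ?_)
      rw [ENNReal.coe_le_coe, two_mul]
      exact le_self_add
    have hmass : ∫⁻ t, gradLpNorm 3 (State.toDist (ua t)) ^ 2 ≤ N * (((4 * C)⁻¹ : ℝ≥0) : ℝ≥0∞) ^ 2 := by
      refine hγ.trans ?_
      rw [div_le_iff₀ (by positivity)] at hN
      exact_mod_cast hN
    obtain ⟨hα1, hβ1⟩ := hB.bound hsub.continuous_gradLpNorm_two (fun t => (hsub.1 t).ne) hβm hβ hC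
      hγm h0 le_rfl hKε hmass
    have hP1 : ∫⁻ t, gradLpNorm 3 (State.toDist (u t)) ^ 2 ≤ (P : ℝ≥0∞) ^ 2 := by
      have h1 : ∫⁻ t, gradLpNorm 3 (State.toDist (u t - ua t)) ^ 2 ≤
          (2 * ((N : ℝ≥0∞) + 1)) ^ 2 := by
        refine hβ1.trans (le_self_pow₀ ?_ two_ne_zero)
        exact one_le_mul_of_one_le_of_one_le (by norm_num) le_add_self
      have h3 : ∀ t, gradLpNorm 3 (State.toDist (u t)) ≤ gradLpNorm 3 (State.toDist (ua t)) +
          gradLpNorm 3 (State.toDist (u t - ua t)) := fun t =>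
        (hu.1.hasGrad t).gradLpNorm_le_add_sub (hua.hasGrad t) (by norm_num)
      rw [← setLIntegral_univ] at h1 hγ
      have h2 := lintegral_sq_add_le hγm hβm h3 hγ h1
      rw [setLIntegral_univ] at h2
      rwa [hP]
    refine strichartzNorm_le hu.1 ?_ hP1
    filter_upwards [ae_le_of_strichartzNorm_le hM] with t ht
    refine ((hu.1.hasGrad t).gradLpNorm_le_add_sub (hua.hasGrad t) (by norm_num)).trans
      ((add_le_add ht (hα1 t)).trans ?_)
    rw [hP]
    exact add_le_add_right (one_le_mul_of_one_le_of_one_le (by norm_num) le_add_self) _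

end QuadNLS
end

theorem proposition2p1 (κ : ℝ) (hκ : 0 < κ) (M : ℝ≥0) :
    ∃ ε L : ℝ≥0, 0 < ε ∧ ε < 1 ∧ 1 < L ∧
      ∀ (u ua : ℝ → QuadNLS.State) (t₀ : ℝ),
        QuadNLS.IsSolution κ u →
        QuadNLS.ContinuousHdot1 ua →
        QuadNLS.strichartzNorm (fun t => QuadNLS.State.toDist (ua t)) ≤ M →
        QuadNLS.gradErrorNorm κ ua ≤ ε →
        QuadNLS.strichartzNorm
          (fun t => QuadNLS.flow κ (t - t₀) (QuadNLS.State.toDist (u t₀ - ua t₀))) ≤ ε →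
        QuadNLS.strichartzNorm (fun t => QuadNLS.State.toDist (u t)) ≤ L :=
  QuadNLS.long_time_perturbation κ hκ M
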